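/- Let $\mathbb M^2$ be a compact connected oriented smooth surface, $r\ge 5$ an integer, and $\mathcal I^r$ the set of $C^r$ immersions $\mathbb M^2\to\mathbb R^3$, an open subset of the Banach space $C^r(\mathbb M^2,\mathbb R^3)$ with the $C^r$ topology. For an immersion $\alpha$ with unit normal $N_\alpha$ and $D\alpha\,\omega_\alpha=DN_\alpha$, let $\mathcal H,\mathcal K$ be half the trace and the determinant of $-\omega_\alpha$; umbilics are the points with $\mathcal H^2=\mathcal K$, and away from them the minimal and maximal principal foliations $\mathcal F_1,\mathcal F_2$ are tangent to the eigenlines of $-\omega_\alpha$ for the smaller and the larger eigenvalue. In a chart $(u,v)$ put $\mathcal T(u,v,p)=(Fg-Gf)p^2+(Eg-Ge)p+(Ef-Fe)$, $p=dv/du$, where $E,F,G$ and $e,f,g$ are the coefficients of the first and second fundamental forms. The surface $\mathbb L_\alpha=\{\mathcal T=0\}$ in the projective tangent bundle carries the line field (with singularities) generated by the vector field $\dot u=\mathcal T_p,\ \dot v=p\,\mathcal T_p,\ \dot p=-(\mathcal T_u+p\,\mathcal T_v)$; near $p=\infty$ use the analogous expressions in $q=du/dv$. An umbilic satisfies condition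 $T$ if the derivative of $\mathcal T$ (respectively of its analogue in $q$) vanishes at no point of the projective line over it. An umbilic satisfying $T$ is of type * $D_1$, if the only singularity of the line field over it is a hyperbolic saddle; * $D_2$, if the singularities over it are exactly one hyperbolic node and two hyperbolic saddles; * $D^1_2$, if the singularities over it are exactly one hyperbolic saddle and one (quadratic) saddle-node whose central manifold lies along the projective line over the umbilic. (Saddles, nodes and saddle-nodes refer to the restriction of the vector field to $\mathbb L_\alpha$.) **Proposition.** Suppose that $\alpha\in\mathcal I^r$ has an umbilic point $p$ of type $D^1_2$. Then there are a neighborhood $\mathcal V\subset\mathcal I^r$ of $\alpha$, a neighborhood $V$ of $p$, and a function $\mathcal B:\mathcal V\to\mathbb R$ of class $C^{r-3}$ such that every $\beta\in\mathcal V$ has a unique umbilic point $p_\beta$ in $V$, and 1. $d\mathcal B(\alpha)\neq0$; 2. $\mathcal B(\beta)>0$ if and only if $p_\beta$ is of type $D_1$; 3. $\mathcal B(\beta)<0$ if and only if $p_\beta$ is of type $D_2$; 4. $\mathcal B(\beta)=0$ if and only if $p_\beta$ is of type $D^1_2$. Moreover the local principal configuration of $\beta$ at $p_\beta$ is the following.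 In arbitrarily small neighborhoods of $p_\beta$ there is an open neighborhood $U$ of $p_\beta$, containing no other umbilic of $\beta$, and a homeomorphism of $U$ onto the open unit disc which sends $p_\beta$ to $0$ and the leaves of $\mathcal F_i|_{U\setminus p_\beta}$, $i=1,2$ simultaneously, onto the leaves in the punctured disc of the foliations tangent to the eigenlines of $\begin{pmatrix}a u&b v\\ b v&-a u\end{pmatrix}$ for the negative ($i=1$) and positive ($i=2$) eigenvalue, where * if $\mathcal B(\beta)>0$, then $(a,b)=(1,1)$: each foliation has exactly one leaf tending to $p_\beta$ (a separatrix), and this leaf has a tangent ray at $p_\beta$; * if $\mathcal B(\beta)<0$, then $(a,b)=(3,8)$: each foliation has two separatrices, corresponding to the rays spanned by $(2,\pm1)$ for $i=2$ and $(-2,\pm1)$ for $i=1$, which bound a parabolic and a hyperbolic sector. They have tangent rays at $p_\beta$ which form an acute nonzero angle, and all other leaves tending to $p_\beta$ are tangent there to one third ray strictly between these two; * if $\mathcal B(\beta)=0$, then $(a,b)=(3,8)$: each foliation has two separatrices as before, with tangent rays at $p_\beta$ which form an acute nonzero angle; one separatrix (the isolated one) corresponds to the ray spanned by $(2,1)$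 for $i=2$ and by $(-2,-1)$ for $i=1$, and all leaves tending to $p_\beta$ other than the isolated separatrix are tangent there to the tangent ray of the other, non-isolated one. -/

import Mathlib

open scoped Manifold ContDiff Topology
open Set Filter

noncomputable section

namespace Umbilic

/-- The Euclidean plane, on which surfaces are modelled. -/
abbrev E2 := EuclideanSpace ℝ (Fin 2)

/-- Euclidean 3-space. -/
abbrev E3 := EuclideanSpace ℝ (Fin 3)

/-- First vector of the canonical basis of the plane. -/
def e₁ : E2 := EuclideanSpace.single 0 1

/-- Second vector of the canonical basis of the plane. -/
def e₂ : E2 := EuclideanSpace.single 1 1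

/-- The vector product of oriented Euclidean 3-space. -/
def cross (a b : E3) : E3 := WithLp.toLp 2 (crossProduct a.ofLp b.ofLp)

/-! ### Oriented surfaces and the Banach space of maps of class `C^r` -/

section Space

variable (M : Type*) [TopologicalSpace M] [ChartedSpace E2 M]

/-- The atlas of `M` is oriented: all its coordinate changes have positive Jacobian. Thus the
charts of the atlas are positive charts of the oriented surface `M`. -/
def OrientedAtlas : Prop :=
  ∀ c ∈ atlas E2 M, ∀ c' ∈ atlas E2 M, ∀ x ∈ (c.symm.trans c').source,
    0 < (fderiv ℝ (c.symm.trans c') x).det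

/-- A finite cover of `M` by compact subsets of domains of charts. It is used only to write
down a norm of the `C^r` topology; any two such covers give equivalent norms. -/
structure ChartCover where
  /-- The points whose preferred charts are used. -/
  centers : Finset M
  /-- The compact pieces. -/
  piece : centers → Set M
  isCompact_piece : ∀ c, IsCompact (piece c)
  piece_subset : ∀ c, piece c ⊆ (chartAt E2 (c : M)).source
  covers : ∀ x, ∃ c, x ∈ piece c

variable {M}

instance (D : ChartCover M) (c : D.centers) : CompactSpace (D.piece c) :=
  isCompact_iff_compactSpace.mp (D.isCompact_piece c)

/-- Such covers exist on every compact surface. -/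
theorem nonempty_chartCover [T2Space M] [CompactSpace M] : Nonempty (ChartCover M) := by
  have h : ∀ x : M, ∃ K : Set M, K ∈ 𝓝 x ∧ K ⊆ (chartAt E2 x).source ∧ IsCompact K := fun x =>
    local_compact_nhds ((chartAt E2 x).open_source.mem_nhds (mem_chart_source E2 x))
  choose K hK hsub hcomp using h
  obtain ⟨t, -, ht⟩ := isCompact_univ.elim_nhds_subcover K fun x _ => hK x
  refine ⟨⟨t, fun c => K c, fun c => hcomp c, fun c => hsub c, fun x => ?_⟩⟩
  obtain ⟨c, hc, hx⟩ := mem_iUnion₂.mp (ht (mem_univ x))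
  exact ⟨⟨c, hc⟩, hx⟩

/-- The coordinate expression, in the preferred chart at `c`, of a map from `M` to space. -/
def inChart (α : M → E3) (c : M) : E2 → E3 := fun x => α ((chartAt E2 c).symm x)

/-- The vector space of maps of class `C^r` from `M` to Euclidean 3-space. It is normed below by
the suprema of the derivatives of orders `0, …, r` in the charts of the cover `D`. -/
def CrMap (_ : ChartCover M) (r : ℕ) : Type _ :=
  C^(r : WithTop ℕ∞)⟮𝓡 2, M; 𝓘(ℝ, E3), E3⟯

namespace CrMap

variable {D : ChartCover M} {r : ℕ}

instance : AddCommGroup (CrMap D r) :=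
  inferInstanceAs (AddCommGroup C^(r : WithTop ℕ∞)⟮𝓡 2, M; 𝓘(ℝ, E3), E3⟯)

instance : Module ℝ (CrMap D r) :=
  inferInstanceAs (Module ℝ C^(r : WithTop ℕ∞)⟮𝓡 2, M; 𝓘(ℝ, E3), E3⟯)

instance : FunLike (CrMap D r) M E3 :=
  inferInstanceAs (FunLike C^(r : WithTop ℕ∞)⟮𝓡 2, M; 𝓘(ℝ, E3), E3⟯ M E3)

theorem contMDiff (f : CrMap D r) : ContMDiff (𝓡 2) 𝓘(ℝ, E3) r (f : M → E3) :=
  ContMDiffMap.contMDiff (show C^(r : WithTop ℕ∞)⟮𝓡 2, M; 𝓘(ℝ, E3), E3⟯ from f)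

theorem ext {f g : CrMap D r} (h : ∀ x, f x = g x) : f = g := DFunLike.ext f g h

theorem add_apply (f g : CrMap D r) (x : M) : (f + g) x = f x + g x := rfl

theorem smul_apply (t : ℝ) (f : CrMap D r) (x : M) : (t • f) x = t • f x := rfl

variable [IsManifold (𝓡 2) ∞ M]

theorem contDiffOn_inChart (f : CrMap D r) (c : M) :
    ContDiffOn ℝ r (inChart f c) (chartAt E2 c).target := by
  have : IsManifold (𝓡 2) (r : WithTop ℕ∞) M :=
    IsManifold.of_le (n := ∞) (by exact_mod_cast le_top)
  have h := f.contMDiff.comp_contMDiffOn (contMDiffOn_chart_symm (I := 𝓡 2) (n := r) (x := c))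
  exact contMDiffOn_iff_contDiffOn.mp h

theorem contDiffAt_inChart (f : CrMap D r) (c : M) {x : E2} (hx : x ∈ (chartAt E2 c).target)
    {j : ℕ} (hj : j ≤ r) : ContDiffAt ℝ j (inChart f c) x :=
  ((f.contDiffOn_inChart c).contDiffAt ((chartAt E2 c).open_target.mem_nhds hx)).of_le
    (by exact_mod_cast hj)

/-- The normed space of families of continuous fields of `j`-linear maps, `j = 0, …, r`, on the
pieces of the cover. -/
def JetSpace (D : ChartCover M) (r : ℕ) : Type _ :=
  (c : D.centers) → (j : Fin (r + 1)) → C(D.piece c, E2 [×(j : ℕ)]→L[ℝ] E3)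

instance : NormedAddCommGroup (JetSpace D r) :=
  inferInstanceAs (NormedAddCommGroup
    ((c : D.centers) → (j : Fin (r + 1)) → C(D.piece c, E2 [×(j : ℕ)]→L[ℝ] E3)))

instance : NormedSpace ℝ (JetSpace D r) :=
  letI (c : D.centers) : NormedSpace ℝ
      ((j : Fin (r + 1)) → C(D.piece c, E2 [×(j : ℕ)]→L[ℝ] E3)) := Pi.normedSpace
  inferInstanceAs (NormedSpace ℝ
    ((c : D.centers) → (j : Fin (r + 1)) → C(D.piece c, E2 [×(j : ℕ)]→L[ℝ] E3)))

/-- The derivatives of orders `0, …, r` of a `C^r` map in the charts of the cover. -/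
def jet (D : ChartCover M) (r : ℕ) :
    CrMap D r →ₗ[ℝ] JetSpace D r where
  toFun f c j :=
    ⟨fun x => iteratedFDeriv ℝ j (inChart f c) (chartAt E2 (c : M) x), by
      have h1 : ContinuousOn (iteratedFDeriv ℝ j (inChart f c)) (chartAt E2 (c : M)).target := by
        intro y hy
        exact ((f.contDiffAt_inChart c hy (Nat.lt_succ_iff.mp j.2)).continuousAt_iteratedFDeriv
          le_rfl).continuousWithinAt
      have h2 : Continuous fun x : D.piece c => chartAt E2 (c : M) (x : M) :=
        ((chartAt E2 (c : M)).continuousOn.mono (D.piece_subset c)).domRestrict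
      exact h1.comp_continuous h2 fun x =>
        (chartAt E2 (c : M)).map_source (D.piece_subset c x.2)⟩
  map_add' f g := by
    funext c j
    ext1 x
    have hx := (chartAt E2 (c : M)).map_source (D.piece_subset c x.2)
    have hj := Nat.lt_succ_iff.mp j.2
    exact iteratedFDeriv_add_apply (f.contDiffAt_inChart c hx hj) (g.contDiffAt_inChart c hx hj)
  map_smul' t f := by
    funext c j
    ext1 x
    have hx := (chartAt E2 (c : M)).map_source (D.piece_subset c x.2)
    have hj := Nat.lt_succ_iff.mp j.2
    exact iteratedFDeriv_const_smul_apply (f.contDiffAt_inChart c hx hj)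

theorem jet_injective (D : ChartCover M) (r : ℕ) : Function.Injective (jet D r) := by
  intro f g hfg
  refine CrMap.ext fun x => ?_
  obtain ⟨c, hc⟩ := D.covers x
  have h := congrArg (fun F => F c 0 ⟨x, hc⟩ 0) hfg
  have h' : inChart f c (chartAt E2 (c : M) x) = inChart g c (chartAt E2 (c : M) x) := h
  simpa [inChart, (chartAt E2 (c : M)).left_inv (D.piece_subset c hc)] using h'

/-- The `C^r` norm: the supremum over the pieces of the cover, and over the orders `0, …, r`, of
the norms of the derivatives in the charts. -/
instance : NormedAddCommGroup (CrMap D r) :=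
  NormedAddCommGroup.induced _ _ (jet D r) (jet_injective D r)

instance : NormedSpace ℝ (CrMap D r) :=
  NormedSpace.induced ℝ _ _ (jet D r)

end CrMap

end Space

/-! ### Principal configurations -/

section Geometry

variable {M : Type*} [TopologicalSpace M] [ChartedSpace E2 M]

/-- The differential at `q` of a map from `M` to space. The tangent space of `M` at `q` is the
plane, through the preferred chart at `q`. -/
def differential (α : M → E3) (q : M) : E2 →L[ℝ] E3 := mfderiv (𝓡 2) 𝓘(ℝ, E3) α q

/-- `α` is an immersion: its differential is one to one at every point. -/
def IsImmersion (α : M → E3) : Prop := ∀ q, Function.Injective (differential α q)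

/-- The Gaussian normal map of `α`, computed at each point in a positive chart. -/
def gaussMap (α : M → E3) (q : M) : E3 :=
  ‖cross (differential α q e₁) (differential α q e₂)‖⁻¹ •
    cross (differential α q e₁) (differential α q e₂)

/-- The Weingarten endomorphism of the tangent space at `q`: for an immersion of class `C^2`, the
unique linear map `A` with `Dα ∘ A = DN`. -/
def weingarten (α : M → E3) (q : M) : E2 →ₗ[ℝ] E2 :=
  Classical.epsilon fun A : E2 →ₗ[ℝ] E2 =>
    ∀ v, differential α q (A v) = differential (gaussMap α) q v

/-- Mean curvature. -/
def meanCurvature (α : M → E3) (q : M) : ℝ := 1 / 2 * LinearMap.trace ℝ E2 (-weingarten α q)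

/-- Gaussian curvature. -/
def gaussCurvature (α : M → E3) (q : M) : ℝ := LinearMap.det (-weingarten α q)

/-- Umbilic points. -/
def IsUmbilic (α : M → E3) (q : M) : Prop := meanCurvature α q ^ 2 - gaussCurvature α q = 0

/-- The sign `-1` for the minimal (`i = 0`) and `1` for the maximal (`i = 1`) foliation. -/
def sign (i : Fin 2) : ℝ := if i = 0 then -1 else 1

/-- The minimal (`i = 0`) and maximal (`i = 1`) principal curvatures. -/
def principalCurvature (α : M → E3) (i : Fin 2) (q : M) : ℝ :=
  meanCurvature α q + sign i * √(meanCurvature α q ^ 2 - gaussCurvature α q)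

/-- The minimal (`i = 0`) and maximal (`i = 1`) principal line fields, by the equation of
Rodrigues. -/
def principalLine (α : M → E3) (i : Fin 2) (q : M) : Set (TangentSpace (𝓡 2) q) :=
  {v : E2 | weingarten α q v + principalCurvature α i q • v = 0}

/-- The leaf through `x` of the foliation of `W` integrating the line field `l`: the set of the
points which are joined to `x` by a curve of class `C^1` in `W` that is everywhere tangent
to `l`. -/
def leaf (l : (q : M) → Set (TangentSpace (𝓡 2) q)) (W : Set M) (x : M) : Set M :=
  {y | ∃ γ : ℝ → M, ContMDiff 𝓘(ℝ, ℝ) (𝓡 2) 1 γ ∧ γ 0 = x ∧ γ 1 = y ∧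
    ∀ t, γ t ∈ W ∧ mfderiv 𝓘(ℝ, ℝ) (𝓡 2) γ t (1 : ℝ) ∈ l (γ t)}

/-! ### The equation of principal lines, its surface and its Lie-Cartan line field

Here `f` is the expression of an immersion in coordinates `(u, v)`. -/

section Local

variable (f : E2 → E3)

/-- The partial derivative in `u`. -/
def du (x : E2) : E3 := fderiv ℝ f x e₁

/-- The partial derivative in `v`. -/
def dv (x : E2) : E3 := fderiv ℝ f x e₂

/-- The unit normal in coordinates. -/
def normal (x : E2) : E3 := ‖cross (du f x) (dv f x)‖⁻¹ • cross (du f x) (dv f x)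

/-- Coefficient `E` of the first fundamental form. -/
def coeffE (x : E2) : ℝ := inner ℝ (du f x) (du f x)

/-- Coefficient `F` of the first fundamental form. -/
def coeffF (x : E2) : ℝ := inner ℝ (du f x) (dv f x)

/-- Coefficient `G` of the first fundamental form. -/
def coeffG (x : E2) : ℝ := inner ℝ (dv f x) (dv f x)

/-- Coefficient `e` of the second fundamental form. -/
def coeffe (x : E2) : ℝ := inner ℝ (normal f x) (du (du f) x)

/-- Coefficient `f` of the second fundamental form. -/
def coefff (x : E2) : ℝ := inner ℝ (normal f x) (dv (du f) x)

/-- Coefficient `g` of the second fundamental form. -/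
def coeffg (x : E2) : ℝ := inner ℝ (normal f x) (dv (dv f) x)

/-- The quadratic form
`(F g - G f) dv ^ 2 + (E g - G e) du dv + (E f - F e) du ^ 2`, evaluated on the
vector `w = (du, dv)` at the point `x`; its zeros are the principal directions at `x`. -/
def principalForm (x w : E2) : ℝ :=
  (coeffF f x * coeffg f x - coeffG f x * coefff f x) * w 1 ^ 2 +
    (coeffE f x * coeffg f x - coeffG f x * coeffe f x) * (w 0 * w 1) +
    (coeffE f x * coefff f x - coeffF f x * coeffe f x) * w 0 ^ 2

/-- The function `T(x, s)` whose zero set is, in the chart `(x, s) ↦ (x, [a + s b])` of the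
projective tangent bundle, the surface of principal directions. For `(a, b) = (e₁, e₂)` this
is the chart `(u, v; p = dv/du)`, and for `(a, b) = (e₂, e₁)` the chart `(u, v; q = du/dv)`. -/
def surfaceFun (a b : E2) (z : E2 × ℝ) : ℝ := principalForm f z.1 (a + z.2 • b)

/-- The Lie-Cartan vector field in the same chart, which generates the lifted line field on the
surface. In the chart `(u, v; p)` it is `(T_p, p T_p, -(T_u + p T_v))`, and in the chart
`(u, v; q)` it is `(q T_q, T_q, -(q T_u + T_v))`. -/
def lieCartan (a b : E2) (z : E2 × ℝ) : E2 × ℝ :=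
  (fderiv ℝ (surfaceFun f a b) z (0, 1) • (a + z.2 • b),
    -fderiv ℝ (surfaceFun f a b) z (a + z.2 • b, 0))

end Local

/-- At a zero `z` of the vector field `X`, which is tangent to the level surfaces of `T`, the
linear part of `X` on the tangent plane of the surface at `z` (the kernel of the derivative
of `T`) has the eigenvalues `l` and `m`, with multiplicity, and `v` is an eigenvector for `l`. -/
def HasEigenvaluesOn (T : E2 × ℝ → ℝ) (X : E2 × ℝ → E2 × ℝ) (z v : E2 × ℝ) (l m : ℝ) : Prop :=
  ∃ (w : E2 × ℝ) (k : ℝ), LinearIndependent ℝ ![v, w] ∧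
    fderiv ℝ T z v = 0 ∧ fderiv ℝ T z w = 0 ∧
    fderiv ℝ X z v = l • v ∧ fderiv ℝ X z w = k • v + m • w

/-- A hyperbolic saddle of `X` on the surface `T = 0`. -/
def IsSaddleOn (T : E2 × ℝ → ℝ) (X : E2 × ℝ → E2 × ℝ) (z : E2 × ℝ) : Prop :=
  X z = 0 ∧ ∃ v l m, l < 0 ∧ 0 < m ∧ HasEigenvaluesOn T X z v l m

/-- A hyperbolic node of `X` on the surface `T = 0`: real nonzero eigenvalues of the same sign. -/
def IsNodeOn (T : E2 × ℝ → ℝ) (X : E2 × ℝ → E2 × ℝ) (z : E2 × ℝ) : Prop :=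
  X z = 0 ∧ ∃ v l m, 0 < l * m ∧ HasEigenvaluesOn T X z v l m

/-- A (quadratic) saddle-node of `X` on the surface `T = 0` whose central manifold is along the
fibre through `z`: one eigenvalue is zero, with the direction of the fibre as eigenspace, the
other one is not, and the restriction of `X` to the fibre, which is invariant if it lies over
an umbilic point, vanishes to order exactly two. -/
def IsFibreSaddleNodeOn (T : E2 × ℝ → ℝ) (X : E2 × ℝ → E2 × ℝ) (z : E2 × ℝ) : Prop :=
  X z = 0 ∧ (∃ m, m ≠ 0 ∧ HasEigenvaluesOn T X z (0, 1) 0 m) ∧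
    iteratedDeriv 2 (fun s => (X (z.1, s)).2) z.2 ≠ 0

/-- The charts of the projective line of directions: the slope `dv/du = ξ` is read in the chart
`p = dv/du` if it is finite, and in the chart `q = du/dv`, at `q = 0`, if `ξ = ∞`. The first
two components are the vectors `a`, `b` of the chart `s ↦ [a + s b]`, the third one is `s`. -/
def slopeChart (ξ : OnePoint ℝ) : E2 × E2 × ℝ := ξ.elim (e₂, e₁, 0) fun p => (e₁, e₂, p)

/-- The function defining the surface of principal directions over a neighbourhood of `q`, near
the direction of slope `ξ`. -/
def surfaceAt (α : M → E3) (q : M) (ξ : OnePoint ℝ) : E2 × ℝ → ℝ :=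
  surfaceFun (inChart α q) (slopeChart ξ).1 (slopeChart ξ).2.1

/-- The Lie-Cartan vector field over a neighbourhood of `q`, near the direction of slope `ξ`. -/
def fieldAt (α : M → E3) (q : M) (ξ : OnePoint ℝ) : E2 × ℝ → E2 × ℝ :=
  lieCartan (inChart α q) (slopeChart ξ).1 (slopeChart ξ).2.1

/-- The coordinates of the point of slope `ξ` on the projective line over `q`. -/
def pointAt (q : M) (ξ : OnePoint ℝ) : E2 × ℝ := (chartAt E2 q q, (slopeChart ξ).2.2)

/-- Condition `T`: the surface of principal directions is regular along the projective line
over `q`. -/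
def CondT (α : M → E3) (q : M) : Prop :=
  ∀ ξ, fderiv ℝ (surfaceAt α q ξ) (pointAt q ξ) ≠ 0

/-- The lifted line field has a singularity at the slope `ξ` over `q`. -/
def IsSing (α : M → E3) (q : M) (ξ : OnePoint ℝ) : Prop := fieldAt α q ξ (pointAt q ξ) = 0

/-- The singularity at the slope `ξ` over `q` is a hyperbolic saddle. -/
def IsSaddle (α : M → E3) (q : M) (ξ : OnePoint ℝ) : Prop :=
  IsSaddleOn (surfaceAt α q ξ) (fieldAt α q ξ) (pointAt q ξ)

/-- The singularity at the slope `ξ` over `q` is a hyperbolic node. -/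
def IsNode (α : M → E3) (q : M) (ξ : OnePoint ℝ) : Prop :=
  IsNodeOn (surfaceAt α q ξ) (fieldAt α q ξ) (pointAt q ξ)

/-- The singularity at the slope `ξ` over `q` is a saddle-node with its central manifold along
the projective line over `q`. -/
def IsFibreSaddleNode (α : M → E3) (q : M) (ξ : OnePoint ℝ) : Prop :=
  IsFibreSaddleNodeOn (surfaceAt α q ξ) (fieldAt α q ξ) (pointAt q ξ)

/-- Darbouxian umbilic of type `D_1`: the only singularity over `q` is a saddle. -/
def IsD1 (α : M → E3) (q : M) : Prop :=
  IsUmbilic α q ∧ CondT α q ∧ ∃ ξ, IsSaddle α q ξ ∧ ∀ η, IsSing α q η → η = ξ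

/-- Darbouxian umbilic of type `D_2`: the singularities over `q` are a node and two saddles. -/
def IsD2 (α : M → E3) (q : M) : Prop :=
  IsUmbilic α q ∧ CondT α q ∧ ∃ ξ₀ ξ₁ ξ₂, ξ₁ ≠ ξ₂ ∧ IsNode α q ξ₀ ∧ IsSaddle α q ξ₁ ∧
    IsSaddle α q ξ₂ ∧ ∀ η, IsSing α q η → η = ξ₀ ∨ η = ξ₁ ∨ η = ξ₂

/-- Umbilic of type `D^1_2`: the singularities over `q` are a hyperbolic saddle and a saddle-node
with its central manifold along the projective line over `q`. -/
def IsD12 (α : M → E3) (q : M) : Prop :=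
  IsUmbilic α q ∧ CondT α q ∧ ∃ ξ₀ ξ₁, IsFibreSaddleNode α q ξ₀ ∧ IsSaddle α q ξ₁ ∧
    ∀ η, IsSing α q η → η = ξ₀ ∨ η = ξ₁

/-! ### Local principal configurations -/

/-- The model line fields on the punctured plane: the eigenlines of the symmetric matrix with
rows `(a u, b v)` and `(b v, -a u)`, for the negative (`i = 0`) and positive (`i = 1`)
eigenvalue. For `(a, b) = (1, 1)` the leaves are confocal parabolas, with one ray for each
foliation. For `(a, b) = (3, 8)` each foliation has two separatrix rays, bounding a parabolic
sector of angle less than `π / 2`, filled by leaves tending to `0`, and a hyperbolic sector. -/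
def modelLine (a b : ℝ) (i : Fin 2) (z : E2) : Set (TangentSpace (𝓡 2) z) :=
  {w : E2 | a * z 0 * w 0 + b * z 1 * w 1 = sign i * √((a * z 0) ^ 2 + (b * z 1) ^ 2) * w 0 ∧
    b * z 1 * w 0 - a * z 0 * w 1 = sign i * √((a * z 0) ^ 2 + (b * z 1) ^ 2) * w 1}

/-- The homeomorphism `h` from a neighbourhood of `q` onto the unit disc maps `q`, the only umbilic
point of `β` there, to `0`, and maps the leaves of the minimal and maximal principal foliations
of `β` onto those of the model with parameters `a`, `b`. -/
def IsModelChart (β : M → E3) (q : M) (a b : ℝ) (h : OpenPartialHomeomorph M E2) : Prop :=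
  q ∈ h.source ∧ h.target = Metric.ball 0 1 ∧ h q = 0 ∧
    (∀ x ∈ h.source, IsUmbilic β x ↔ x = q) ∧
    ∀ i, ∀ x ∈ h.source \ {q},
      h '' leaf (principalLine β i) (h.source \ {q}) x =
        leaf (modelLine a b i) (Metric.ball 0 1 \ {0}) (h x)

/-- The set `S` approaches `q` tangentially to the ray spanned by the tangent vector `d`, a unit
vector in the coordinates of the preferred chart at `q`. -/
def IsTangentRay (S : Set M) (q : M) (d : E2) : Prop :=
  Tendsto (fun y => ‖chartAt E2 q y - chartAt E2 q q‖⁻¹ • (chartAt E2 q y - chartAt E2 q q))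
    (𝓝[S \ {q}] q) (𝓝 d)

/-- The angle of the tangent vectors `d`, `d'` at `q`, in the first fundamental form of `β`, is
acute and not zero. -/
def AcuteAt (β : M → E3) (q : M) (d d' : E2) : Prop :=
  LinearIndependent ℝ ![d, d'] ∧ 0 < inner ℝ (differential β q d) (differential β q d')

/-- The leaf through `x` of a principal foliation of `β` in the punctured domain of `h`. -/
def localLeaf (β : M → E3) (q : M) (h : OpenPartialHomeomorph M E2) (i : Fin 2) (x : M) : Set M :=
  leaf (principalLine β i) (h.source \ {q}) x

/-- The two separatrices (`s = 1` and `s = -1`) of a foliation modelled on that with parameters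
`(a, b) = (3, 8)`: the inverse images of the rays of the model spanned by `(2, s)` for the
maximal foliation, and by `(-2, -s)` for the minimal one. -/
def separatrix (h : OpenPartialHomeomorph M E2) (i : Fin 2) (s : ℝ) : Set M :=
  {x ∈ h.source | ∃ t : ℝ, 0 < t ∧ h x 0 = t * sign i * 2 ∧ h x 1 = t * sign i * s}

/-- The local principal configuration of a point `D_1`: each foliation has one leaf tending to
`q`, with a tangent ray there, and a hyperbolic sector. -/
def HasConfigD1 (β : M → E3) (q : M) : Prop :=
  ∀ V ∈ 𝓝 q, ∃ h : OpenPartialHomeomorph M E2, h.source ⊆ V ∧ IsModelChart β q 1 1 h ∧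
    ∀ i, ∃ d, ∀ x ∈ h.source \ {q}, q ∈ closure (localLeaf β q h i x) →
      IsTangentRay (localLeaf β q h i x) q d

/-- The local principal configuration of a point `D_2`: each foliation has two separatrices, which
bound a parabolic and a hyperbolic sector, and are tangent at `q` to rays forming an acute
angle; all the other leaves which tend to `q` are tangent there to one third ray, strictly
between these two. -/
def HasConfigD2 (β : M → E3) (q : M) : Prop :=
  ∀ V ∈ 𝓝 q, ∃ h : OpenPartialHomeomorph M E2, h.source ⊆ V ∧ IsModelChart β q 3 8 h ∧
    ∀ i, ∃ d₀ d₁ d₂, AcuteAt β q d₁ d₂ ∧ (∃ s t : ℝ, 0 < s ∧ 0 < t ∧ d₀ = s • d₁ + t • d₂) ∧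
      IsTangentRay (separatrix h i 1) q d₁ ∧ IsTangentRay (separatrix h i (-1)) q d₂ ∧
      ∀ x ∈ h.source \ {q}, q ∈ closure (localLeaf β q h i x) →
        x ∉ separatrix h i 1 → x ∉ separatrix h i (-1) → IsTangentRay (localLeaf β q h i x) q d₀

/-- The local principal configuration of a point `D^1_2`: each foliation has two separatrices,
which bound a parabolic and a hyperbolic sector, and are tangent at `q` to rays forming an
acute angle; one of them is isolated, and all the other leaves which tend to `q` are tangent
there to the other, non-isolated one. -/
def HasConfigD12 (β : M → E3) (q : M) : Prop :=
  ∀ V ∈ 𝓝 q, ∃ h : OpenPartialHomeomorph M E2, h.source ⊆ V ∧ IsModelChart β q 3 8 h ∧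
    ∀ i, ∃ d₀ d₁, AcuteAt β q d₀ d₁ ∧
      IsTangentRay (separatrix h i 1) q d₁ ∧ IsTangentRay (separatrix h i (-1)) q d₀ ∧
      ∀ x ∈ h.source \ {q}, q ∈ closure (localLeaf β q h i x) →
        x ∉ separatrix h i 1 → IsTangentRay (localLeaf β q h i x) q d₀

end Geometry

end Umbilic

end

open scoped Manifold ContDiff Topology

noncomputable section
namespace Umbilic
open Complex Metric ComplexConjugate

local notation "ch" => chartAt E2
local notation "CM" => ContMDiff (𝓡 2) 𝓘(ℝ, E3)

/-! ### Scalar differential equations with one singular point -/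

/-- A bounded, centrally symmetric right-hand side of a scalar differential equation, of class
`C^1` outside of the origin. -/
structure SlopeField (g : ℝ → ℝ → ℝ) (L : ℝ) : Prop where
  contDiffOn : ContDiffOn ℝ 1 (Function.uncurry g) {0}ᶜ
  bound : ∀ x y, |g x y| ≤ L
  even : ∀ x y, g (-x) (-y) = g x y

/-- Solutions on the positive half-line. -/
def IsSol (g : ℝ → ℝ → ℝ) (f : ℝ → ℝ) : Prop := ∀ x, 0 < x → HasDerivAt f (g x (f x)) x

namespace SlopeField

variable {g : ℝ → ℝ → ℝ} {L : ℝ}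

variable (hg : SlopeField g L)
include hg

lemma nonneg : 0 ≤ L := (abs_nonneg _).trans (hg.bound 0 0)

lemma lipschitzOnWith_box {a b c d : ℝ}
    (h : (0 : ℝ × ℝ) ∉ Icc a b ×ˢ Icc c d) :
    ∃ K, ∀ t ∈ Icc a b, LipschitzOnWith K (g t) (Icc c d) := by
  have hsub : Icc a b ×ˢ Icc c d ⊆ ({0}ᶜ : Set (ℝ × ℝ)) := fun z hz h0 => by
    rw [mem_singleton_iff.mp h0] at hz; exact h hz
  obtain ⟨K, hK⟩ := (hg.contDiffOn.mono hsub).exists_lipschitzOnWith (by norm_num)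
    ((convex_Icc a b).prod (convex_Icc c d)) (isCompact_Icc.prod isCompact_Icc)
  refine ⟨K, fun t ht y hy y' hy' => ?_⟩; have := hK (x := (t, y)) ⟨ht, hy⟩ (y := (t, y')) ⟨ht, hy'⟩
  simpa [Function.uncurry, Prod.edist_eq] using this

lemma continuousAt {z : ℝ × ℝ} (hz : z ≠ 0) :
    ContinuousAt (Function.uncurry g) z :=
  (hg.contDiffOn.contDiffAt (isOpen_compl_singleton.mem_nhds hz)).continuousAt

lemma eqOn_Icc {a b t0 : ℝ} {f h : ℝ → ℝ} (ha : 0 < a)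
    (ht0 : t0 ∈ Ioo a b) (hfc : ContinuousOn f (Icc a b)) (hhc : ContinuousOn h (Icc a b))
    (hf : ∀ t ∈ Ioo a b, HasDerivAt f (g t (f t)) t)
    (hh : ∀ t ∈ Ioo a b, HasDerivAt h (g t (h t)) t) (h0 : f t0 = h t0) :
    EqOn f h (Icc a b) := by
  obtain ⟨R, hR⟩ := isCompact_Icc.exists_bound_of_continuousOn hfc
  obtain ⟨R', hR'⟩ := isCompact_Icc.exists_bound_of_continuousOn hhc
  obtain ⟨K, hK⟩ := hg.lipschitzOnWith_box (a := a) (b := b) (c := -max R R') (d := max R R')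
    (fun h => absurd h.1.1 (not_le.mpr ha))
  refine ODE_solution_unique_of_mem_Icc (s := fun _ => Icc (-max R R') (max R R'))
    (fun t ht => hK t (Ioo_subset_Icc_self ht)) ht0 hfc hf (fun t ht => ?_) hhc hh (fun t ht => ?_) h0
  · exact abs_le.mp ((hR t (Ioo_subset_Icc_self ht)).trans (le_max_left _ _))
  · exact abs_le.mp ((hR' t (Ioo_subset_Icc_self ht)).trans (le_max_right _ _))

lemma sol_unique {f h : ℝ → ℝ} (hf : IsSol g f) (hh : IsSol g h) {x1 : ℝ}
    (hx1 : 0 < x1) (h1 : f x1 = h x1) {x : ℝ} (hx : 0 < x) : f x = h x := by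
  have hp : ∀ t ∈ Icc (min x x1 / 2) (max x x1 + 1), 0 < t := fun t ht =>
    lt_of_lt_of_le (by have := lt_min hx hx1; linarith) ht.1
  have hm := lt_min hx hx1; have := min_le_left x x1; have := min_le_right x x1
  have := le_max_left x x1; have := le_max_right x x1
  refine hg.eqOn_Icc (a := min x x1 / 2) (b := max x x1 + 1) (t0 := x1) (by linarith) ⟨by linarith,
    by linarith⟩ (fun t ht => (hf t (hp t ht)).continuousAt.continuousWithinAt) (fun t ht => (hh t
    (hp t ht)).continuousAt.continuousWithinAt) (fun t ht => hf t (hp t (Ioo_subset_Icc_self ht)))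
    (fun t ht => hh t (hp t (Ioo_subset_Icc_self ht))) h1 ⟨by linarith, by linarith⟩

lemma exists_sol_Icc {a b x0 : ℝ} (ha : 0 < a) (h : x0 ∈ Icc a b) (y0 : ℝ) :
    ∃ f : ℝ → ℝ, f x0 = y0 ∧ ContinuousOn f (Icc a b) ∧
      ∀ t ∈ Ioo a b, HasDerivAt f (g t (f t)) t := by
  set R := L * max (b - x0) (x0 - a)
  have hR : 0 ≤ R := mul_nonneg hg.nonneg (le_max_of_le_left (by linarith [h.2]))
  obtain ⟨K, hK⟩ := hg.lipschitzOnWith_box (a := a) (b := b) (c := y0 - R) (d := y0 + R)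
    (fun h => absurd h.1.1 (not_le.mpr ha))
  have hp : IsPicardLindelof g (⟨x0, h⟩ : Icc a b) y0 R.toNNReal 0 L.toNNReal K := by
    refine ⟨fun t ht => ?_, fun y _ => ?_, fun t _ y _ => ?_, ?_⟩
    · rw [Real.coe_toNNReal _ hR, Real.closedBall_eq_Icc]; exact hK t ht
    · intro t ht
      have h0 : ((t, y) : ℝ × ℝ) ≠ 0 := fun h => by
        have : t = 0 := congrArg Prod.fst h; linarith [ht.1]
      exact (ContinuousAt.comp (f := fun s : ℝ => (s, y)) (hg.continuousAt h0)
        (by fun_prop)).continuousWithinAt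
    · rw [Real.coe_toNNReal _ hg.nonneg]; exact hg.bound t y
    · simp [Real.coe_toNNReal _ hR, Real.coe_toNNReal _ hg.nonneg, R]
  obtain ⟨f, hf0, hf⟩ := hp.exists_eq_forall_mem_Icc_hasDerivWithinAt₀
  exact ⟨f, hf0, fun t ht => (hf t ht).continuousWithinAt, fun t ht =>
    (hf t (Ioo_subset_Icc_self ht)).hasDerivAt (Icc_mem_nhds ht.1 ht.2)⟩

lemma exists_sol {x0 : ℝ} (h0 : 0 < x0) (y0 : ℝ) :
    ∃ f, f x0 = y0 ∧ IsSol g f := by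
  have hn : ∀ n : ℕ, (1 : ℝ) < n + 2 := fun n => by have := n.cast_nonneg (α := ℝ); linarith
  have hp : ∀ n : ℕ, 0 < x0 / (n + 2) := fun n => div_pos h0 (by linarith [hn n])
  have hm : ∀ n : ℕ, x0 ∈ Ioo (x0 / (n + 2)) (x0 * (n + 2)) := fun n =>
    ⟨div_lt_self h0 (hn n), lt_mul_of_one_lt_right h0 (hn n)⟩
  choose α hα0 hαc hα using fun n : ℕ => hg.exists_sol_Icc (hp n) (Ioo_subset_Icc_self (hm n)) y0
  have hsub : ∀ {n m : ℕ}, n ≤ m →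
      Icc (x0 / (n + 2)) (x0 * (n + 2)) ⊆ Icc (x0 / (m + 2)) (x0 * (m + 2)) := by
    intro n m hnm; have : (n : ℝ) ≤ m := by exact_mod_cast hnm
    have := hn n; exact Icc_subset_Icc (by gcongr) (by gcongr)
  have hsub' : ∀ {n m : ℕ}, n ≤ m →
      Ioo (x0 / (n + 2)) (x0 * (n + 2)) ⊆ Ioo (x0 / (m + 2)) (x0 * (m + 2)) := by
    intro n m hnm; have : (n : ℝ) ≤ m := by exact_mod_cast hnm
    have := hn n; exact Ioo_subset_Ioo (by gcongr) (by gcongr)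
  have heq : ∀ {n m : ℕ}, n ≤ m → EqOn (α n) (α m) (Icc (x0 / (n + 2)) (x0 * (n + 2))) :=
    fun {n m} hnm => hg.eqOn_Icc (hp n) (hm n) (hαc n) ((hαc m).mono (hsub hnm)) (hα n)
      (fun t ht => hα m t (hsub' hnm ht)) (by rw [hα0, hα0])
  have hex : ∀ x : ℝ, 0 < x → ∃ n : ℕ, x ∈ Ioo (x0 / (n + 2)) (x0 * (n + 2)) := by
    intro x hx; obtain ⟨n, hn'⟩ := exists_nat_gt (max (x0 / x) (x / x0))
    have h1 : x0 / x < n + 2 := by linarith [le_max_left (x0 / x) (x / x0)]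
    have h2 : x / x0 < n + 2 := by linarith [le_max_right (x0 / x) (x / x0)]
    refine ⟨n, ?_, ?_⟩
    · rw [div_lt_iff₀ (by linarith [hn n])]; rwa [div_lt_iff₀ hx, mul_comm] at h1
    · rwa [div_lt_iff₀ h0, mul_comm] at h2
  classical
  let f : ℝ → ℝ := fun x => if hx : 0 < x then α (hex x hx).choose x else 0
  have hf : ∀ n, EqOn f (α n) (Ioo (x0 / (n + 2)) (x0 * (n + 2))) := by
    intro n x hx; have hx0 : 0 < x := (hp n).trans hx.1; simp only [f, dif_pos hx0]
    have h1 := (hex x hx0).choose_spec; rcases le_total (hex x hx0).choose n with h | h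
    · exact heq h (Ioo_subset_Icc_self h1)
    · exact (heq h (Ioo_subset_Icc_self hx)).symm
  refine ⟨f, (hf 0 (hm 0)).trans (hα0 0), fun x hx => ?_⟩; obtain ⟨n, hn⟩ := hex x hx
  have := hα n x hn; rw [← hf n hn] at this
  exact this.congr_of_eventuallyEq ((hf n).eventuallyEq_of_mem (Ioo_mem_nhds hn.1 hn.2))

end SlopeField

/-- The value at `x` of the solution through `(x0, y0)`. -/
def sol (g : ℝ → ℝ → ℝ) (x0 y0 : ℝ) : ℝ → ℝ :=
  Classical.epsilon fun f => f x0 = y0 ∧ IsSol g f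

namespace SlopeField

variable {g : ℝ → ℝ → ℝ} {L : ℝ}

variable (hg : SlopeField g L)
include hg

lemma sol_self {x0 : ℝ} (h : 0 < x0) (y0 : ℝ) : sol g x0 y0 x0 = y0 :=
  (Classical.epsilon_spec (hg.exists_sol h y0)).1

lemma isSol {x0 : ℝ} (h : 0 < x0) (y0 : ℝ) : IsSol g (sol g x0 y0) :=
  (Classical.epsilon_spec (hg.exists_sol h y0)).2

lemma sol_eq {f : ℝ → ℝ} (hf : IsSol g f) {x0 x : ℝ} (h : 0 < x0)
    (hx : 0 < x) : sol g x0 (f x0) x = f x :=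
  hg.sol_unique (hg.isSol h _) hf h (hg.sol_self h _) hx

lemma sol_sol {x0 x1 x : ℝ} (h : 0 < x0) (h1 : 0 < x1) (hx : 0 < x)
    (y0 : ℝ) : sol g x1 (sol g x0 y0 x1) x = sol g x0 y0 x :=
  hg.sol_eq (hg.isSol h y0) h1 hx

lemma abs_sub_le {f : ℝ → ℝ} (hf : IsSol g f) {x x' : ℝ} (hx : 0 < x)
    (hx' : 0 < x') : |f x - f x'| ≤ L * |x - x'| :=
  (convex_Ioi (0 : ℝ)).norm_image_sub_le_of_norm_hasDerivWithin_le
    (fun t ht => (hf t ht).hasDerivWithinAt) (fun t _ => hg.bound t _) hx' hx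

lemma sol_lt {f h : ℝ → ℝ} (hf : IsSol g f) (hh : IsSol g h) {x0 x : ℝ}
    (h0 : 0 < x0) (hx : 0 < x) (hlt : f x0 < h x0) : f x < h x := by
  by_contra hle; push Not at hle
  have hc : ContinuousOn (fun t => h t - f t) (Ioi 0) := fun t ht =>
    ((hh t ht).continuousAt.sub (hf t ht).continuousAt).continuousWithinAt
  obtain ⟨t, ht, hte⟩ := (isPreconnected_Ioi (a := (0 : ℝ))).intermediate_value hx h0 hc
    (show (0 : ℝ) ∈ Icc (h x - f x) (h x0 - f x0) from ⟨by linarith, by linarith⟩)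
  have : f x0 = h x0 := hg.sol_unique hf hh ht (by simp only at hte; linarith) h0; linarith

lemma sol_le {f h : ℝ → ℝ} (hf : IsSol g f) (hh : IsSol g h) {x0 x : ℝ}
    (h0 : 0 < x0) (hx : 0 < x) (hlt : f x0 ≤ h x0) : f x ≤ h x := by
  rcases hlt.lt_or_eq with h1 | h1
  · exact (hg.sol_lt hf hh h0 hx h1).le
  · exact (hg.sol_unique hf hh h0 h1 hx).le

lemma strictMono_sol {x0 x : ℝ} (h : 0 < x0) (hx : 0 < x) :
    StrictMono fun y => sol g x0 y x := fun y y' hy =>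
  hg.sol_lt (hg.isSol h y) (hg.isSol h y') h hx (by simpa only [hg.sol_self h])

lemma continuous_sol_right {x0 x : ℝ} (h : 0 < x0) (hx : 0 < x) :
    Continuous fun y => sol g x0 y x :=
  (hg.strictMono_sol h hx).monotone.continuous_of_surjective fun y =>
    ⟨sol g x y x0, by simp only [hg.sol_sol hx h hx, hg.sol_self hx]⟩

lemma continuousAt_sol {x0 y0 x : ℝ} (h : 0 < x0) (hx : 0 < x) :
    ContinuousAt (fun z : ℝ × ℝ => sol g z.1 z.2 x) (x0, y0) := by
  have h1 : ContinuousAt (fun z : ℝ × ℝ => sol g z.1 z.2 x0) (x0, y0) := by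
    have hb : ∀ᶠ z : ℝ × ℝ in 𝓝 (x0, y0),
        |sol g z.1 z.2 x0 - y0| ≤ L * |x0 - z.1| + |z.2 - y0| := by
      filter_upwards [(continuous_fst (X := ℝ) (Y := ℝ)).continuousAt.eventually
        (lt_mem_nhds (a := 0) (b := ((x0, y0) : ℝ × ℝ).1) h)] with z hz
      have := hg.abs_sub_le (hg.isSol hz z.2) h hz; rw [hg.sol_self hz] at this
      exact (_root_.abs_sub_le _ z.2 _).trans (by gcongr)
    rw [ContinuousAt, hg.sol_self h, tendsto_iff_norm_sub_tendsto_zero]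
    refine squeeze_zero' (Eventually.of_forall fun z => norm_nonneg _) hb ?_
    have : Continuous fun z : ℝ × ℝ => L * |x0 - z.1| + |z.2 - y0| := by fun_prop
    simpa using this.tendsto (x0, y0)
  have h2 := ContinuousAt.comp (f := fun z : ℝ × ℝ => sol g z.1 z.2 x0) (x := (x0, y0))
    (hg.continuous_sol_right h hx).continuousAt h1
  refine h2.congr ?_
  filter_upwards [(continuous_fst (X := ℝ) (Y := ℝ)).continuousAt.eventually
    (lt_mem_nhds (a := 0) (b := ((x0, y0) : ℝ × ℝ).1) h)] with z hz
  exact hg.sol_sol hz h hx z.2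

lemma exists_tendsto {f : ℝ → ℝ} (hf : IsSol g f) :
    ∃ c, Tendsto f (𝓝[>] 0) (𝓝 c) ∧ ∀ x, 0 < x → |f x - c| ≤ L * x := by
  have hl : LipschitzOnWith L.toNNReal f (Ioi 0) :=
    LipschitzOnWith.of_dist_le_mul fun x hx y hy => by
      rw [Real.coe_toNNReal _ hg.nonneg]; exact hg.abs_sub_le hf hx hy
  obtain ⟨F, hF, hFe⟩ := hl.extend_real
  have ht : Tendsto f (𝓝[>] 0) (𝓝 (F 0)) := by
    refine ((hF.continuous.tendsto 0).mono_left nhdsWithin_le_nhds).congr' ?_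
    filter_upwards [self_mem_nhdsWithin] with x hx using (hFe hx).symm
  refine ⟨F 0, ht, fun x hx => ?_⟩; have := hF.dist_le_mul x 0; rw [← hFe hx] at this
  simpa [Real.dist_eq, abs_of_pos hx, hg.nonneg] using this

end SlopeField

/-- The limit at the singular abscissa of the solution through `(x, y)`, for positive `x`. -/
def axisValuePos (g : ℝ → ℝ → ℝ) (x y : ℝ) : ℝ := limUnder (𝓝[>] 0) (sol g x y)

/-- The ordinate at which the solution through `(x, y)` meets the singular abscissa. -/
def axisValue (g : ℝ → ℝ → ℝ) (x y : ℝ) : ℝ :=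
  if 0 < x then axisValuePos g x y else if x < 0 then -axisValuePos g (-x) (-y) else y

namespace SlopeField

variable {g : ℝ → ℝ → ℝ} {L : ℝ}

lemma axisValue_of_pos {x : ℝ} (hx : 0 < x) (y : ℝ) : axisValue g x y = axisValuePos g x y :=
  if_pos hx

lemma axisValue_zero (y : ℝ) : axisValue g 0 y = y := by simp [axisValue]

lemma axisValue_neg (x y : ℝ) : axisValue g (-x) (-y) = -axisValue g x y := by
  rcases lt_trichotomy x 0 with h | rfl | h
  · simp [axisValue, h, h.not_gt]
  · simp [axisValue]
  · simp [axisValue, h, h.not_gt]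

variable (hg : SlopeField g L)
include hg

lemma tendsto_axisValue {f : ℝ → ℝ} (hf : IsSol g f) {x : ℝ} (hx : 0 < x) :
    Tendsto f (𝓝[>] 0) (𝓝 (axisValue g x (f x))) := by
  obtain ⟨c, hc, -⟩ := hg.exists_tendsto hf
  have h : Tendsto (sol g x (f x)) (𝓝[>] 0) (𝓝 c) := hc.congr' (by
    filter_upwards [self_mem_nhdsWithin] with t ht using (hg.sol_eq hf hx ht).symm)
  rwa [axisValue_of_pos hx, axisValuePos, h.limUnder_eq]

lemma axisValue_eq {f : ℝ → ℝ} (hf : IsSol g f) {x x' : ℝ} (hx : 0 < x)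
    (hx' : 0 < x') : axisValue g x (f x) = axisValue g x' (f x') :=
  tendsto_nhds_unique (hg.tendsto_axisValue hf hx) (hg.tendsto_axisValue hf hx')

lemma abs_sub_axisValue_le (x y : ℝ) :
    |y - axisValue g x y| ≤ L * |x| := by
  have key : ∀ {x} (y : ℝ), 0 < x → |y - axisValue g x y| ≤ L * |x| := by
    intro x y hx; obtain ⟨c, hc, hc'⟩ := hg.exists_tendsto (hg.isSol hx y)
    have h1 := hg.tendsto_axisValue (hg.isSol hx y) hx; rw [hg.sol_self hx] at h1
    rw [tendsto_nhds_unique h1 hc, abs_of_pos hx]; simpa [hg.sol_self hx] using hc' x hx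
  rcases lt_trichotomy x 0 with h | rfl | h
  · have := key (-y) (neg_pos.mpr h); rw [axisValue_neg, abs_neg] at this; rw [← abs_neg]
    convert this using 2
    ring
  · simp [axisValue_zero]
  · exact key y h

lemma axisValue_le (x : ℝ) : Monotone (axisValue g x) := by
  have key : ∀ {x : ℝ}, 0 < x → Monotone (axisValue g x) := by
    intro x hx y y' hy; have h1 := hg.tendsto_axisValue (hg.isSol hx y) hx
    have h2 := hg.tendsto_axisValue (hg.isSol hx y') hx; rw [hg.sol_self hx] at h1 h2
    refine le_of_tendsto_of_tendsto h1 h2 ?_; filter_upwards [self_mem_nhdsWithin] with t ht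
    exact hg.sol_le (hg.isSol hx y) (hg.isSol hx y') hx ht (by simpa only [hg.sol_self hx])
  rcases lt_trichotomy x 0 with h | rfl | h
  · intro y y' hy; have := key (neg_pos.mpr h) (neg_le_neg hy)
    rw [axisValue_neg, axisValue_neg] at this; linarith
  · intro y y' hy; simpa only [axisValue_zero]
  · exact key h

lemma continuous_axisValue : Continuous (Function.uncurry (axisValue g)) := by
  have key : ∀ {x : ℝ} (y : ℝ), 0 < x → ContinuousAt (Function.uncurry (axisValue g)) (x, y) := by
    intro x y hx; rw [Metric.continuousAt_iff']; intro ε hε; have hL := hg.nonneg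
    set t := ε / (4 * (L + 1)) with ht; have ht0 : 0 < t := by positivity
    have hLt : L * t < ε / 3 := by
      rw [ht, mul_div_assoc', div_lt_div_iff₀ (by positivity) (by norm_num)]; nlinarith
    have hb : ∀ z : ℝ × ℝ, 0 < z.1 → |sol g z.1 z.2 t - axisValue g z.1 z.2| ≤ L * t := by
      intro z hz; have := hg.abs_sub_axisValue_le t (sol g z.1 z.2 t)
      rwa [abs_of_pos ht0, hg.axisValue_eq (hg.isSol hz z.2) ht0 hz, hg.sol_self hz] at this
    filter_upwards [Metric.continuousAt_iff'.mp (hg.continuousAt_sol (y0 := y) hx ht0) (ε / 3)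
      (by positivity), (continuous_fst (X := ℝ) (Y := ℝ)).continuousAt.eventually
        (lt_mem_nhds (a := 0) (b := ((x, y) : ℝ × ℝ).1) hx)] with z hz hz0
    have h1 := abs_le.mp (hb z hz0); have h2 := abs_le.mp (hb (x, y) hx)
    rw [Real.dist_eq, abs_lt] at hz ⊢; simp only [Function.uncurry] at *; constructor <;> linarith
  rw [continuous_iff_continuousAt]; rintro ⟨x, y⟩; rcases lt_trichotomy x 0 with h | rfl | h
  · have h1 := key (-y) (neg_pos.mpr h)
    have h2 : ContinuousAt (fun z : ℝ × ℝ => -Function.uncurry (axisValue g) (-z.1, -z.2)) (x, y) :=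
      (ContinuousAt.comp (f := fun z : ℝ × ℝ => (-z.1, -z.2)) (x := (x, y)) h1 (by fun_prop)).neg
    refine h2.congr (Eventually.of_forall fun z => ?_); simp [Function.uncurry, axisValue_neg]
  · rw [ContinuousAt, tendsto_iff_norm_sub_tendsto_zero]
    refine squeeze_zero (g := fun z : ℝ × ℝ => L * |z.1| + |z.2 - y|) (fun _ => norm_nonneg _)
      (fun z => ?_) ?_
    · have := hg.abs_sub_axisValue_le z.1 z.2
      simp only [Function.uncurry, axisValue_zero, Real.norm_eq_abs]; rw [abs_sub_comm] at this
      exact (_root_.abs_sub_le _ z.2 _).trans (by gcongr)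
    · have : Continuous fun z : ℝ × ℝ => L * |z.1| + |z.2 - y| := by fun_prop
      simpa using this.tendsto (0, y)
  · exact key y h

/-- Outside of the solutions which tend to the singular point, the solutions are determined by
their ordinate on the singular axis. -/
lemma eq_of_axisValue_eq {f h : ℝ → ℝ} (hf : IsSol g f) (hh : IsSol g h)
    {x : ℝ} (hx : 0 < x) (h1 : axisValue g x (f x) = axisValue g x (h x))
    (h0 : axisValue g x (f x) ≠ 0) : f x = h x := by
  set c := axisValue g x (f x) with hc; have hfc := hg.tendsto_axisValue hf hx
  have hhc := hg.tendsto_axisValue hh hx; rw [← h1] at hhc; rw [← hc] at hfc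
  have hcp : 0 < |c| := abs_pos.mpr h0
  obtain ⟨K, hK⟩ := hg.lipschitzOnWith_box (a := 0) (b := 1) (c := c - |c| / 2) (d := c + |c| / 2)
    (fun h => by
      have := h.2; simp only [Prod.snd_zero, mem_Icc] at this
      rcases abs_cases c with ⟨h, -⟩ | ⟨h, -⟩ <;> rw [h] at this hcp <;> linarith)
  have hI : Icc (c - |c| / 2) (c + |c| / 2) ∈ 𝓝 c := Icc_mem_nhds (by linarith) (by linarith)
  have hev : ∀ᶠ t in 𝓝[>] (0 : ℝ), f t ∈ Icc (c - |c| / 2) (c + |c| / 2) ∧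
      h t ∈ Icc (c - |c| / 2) (c + |c| / 2) := (hfc.eventually hI).and (hhc.eventually hI)
  obtain ⟨δ, hδ0, hδ⟩ := mem_nhdsGT_iff_exists_Ioo_subset.mp hev; have hδ0 : 0 < δ := hδ0
  set b := min (δ / 2) (1 / 2) with hb; have hb0 : 0 < b := by positivity
  have hbδ : b < δ := (min_le_left _ _).trans_lt (by linarith)
  have hb1 : b < 1 := (min_le_right _ _).trans_lt (by norm_num)
  have hdist : ∀ t ∈ Ioo 0 b, dist (f b) (h b) ≤ dist (f t) (h t) * Real.exp (K * b) := by
    intro t ht; have hpos : ∀ s ∈ Icc t b, 0 < s := fun s hs => ht.1.trans_le hs.1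
    have := dist_le_of_trajectories_ODE_of_mem (v := g) (K := K) (a := t) (b := b)
      (s := fun _ => Icc (c - |c| / 2) (c + |c| / 2)) (f := f) (g := h) (δ := dist (f t) (h t))
      (fun s hs => hK s ⟨(hpos s (Ico_subset_Icc_self hs)).le, by linarith [hs.2]⟩)
      (fun s hs => (hf s (hpos s hs)).continuousAt.continuousWithinAt)
      (fun s hs => (hf s (hpos s (Ico_subset_Icc_self hs))).hasDerivWithinAt)
      (fun s hs => (hδ ⟨hpos s (Ico_subset_Icc_self hs), hs.2.trans hbδ⟩).1)
      (fun s hs => (hh s (hpos s hs)).continuousAt.continuousWithinAt)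
      (fun s hs => (hh s (hpos s (Ico_subset_Icc_self hs))).hasDerivWithinAt)
      (fun s hs => (hδ ⟨hpos s (Ico_subset_Icc_self hs), hs.2.trans hbδ⟩).2) le_rfl b
      ⟨ht.2.le, le_rfl⟩
    refine this.trans ?_; gcongr; linarith [ht.1]
  have hlim : Tendsto (fun t => dist (f t) (h t) * Real.exp (K * b)) (𝓝[>] 0) (𝓝 0) := by
    have := (hfc.dist hhc).mul_const (Real.exp (K * b)); simpa using this
  have : dist (f b) (h b) ≤ 0 := ge_of_tendsto hlim (by
    filter_upwards [Ioo_mem_nhdsGT hb0] with t ht using hdist t ht)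
  exact hg.sol_unique hf hh hb0 (dist_le_zero.mp this) hx

lemma exists_sol_axisValue (c : ℝ) :
    ∃ f, IsSol g f ∧ ∀ x, 0 < x → axisValue g x (f x) = c := by
  have hc : Continuous (axisValue g 1) := hg.continuous_axisValue.comp (by fun_prop : Continuous
    fun y : ℝ => ((1 : ℝ), y))
  have h1 := fun y => abs_le.mp (hg.abs_sub_axisValue_le 1 y); simp only [abs_one, mul_one] at h1
  obtain ⟨y, -, hy⟩ := intermediate_value_Icc (a := c - L) (b := c + L) (by linarith [hg.nonneg])
    hc.continuousOn (show c ∈ Icc _ _ from ⟨by linarith [(h1 (c - L)).1], by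
      linarith [(h1 (c + L)).2]⟩)
  refine ⟨sol g 1 y, hg.isSol one_pos y, fun x hx => ?_⟩
  rw [hg.axisValue_eq (hg.isSol one_pos y) hx one_pos, hg.sol_self one_pos, hy]

end SlopeField

/-- A complete leaf of the equation with ordinate `c` on the singular axis. -/
structure IsLeafFun (g : ℝ → ℝ → ℝ) (c : ℝ) (f : ℝ → ℝ) : Prop where
  continuous : Continuous f
  zero : f 0 = c
  hasDerivAt : ∀ x, (x ≠ 0 ∨ c ≠ 0) → HasDerivAt f (g x (f x)) x
  axisValue : ∀ x, axisValue g x (f x) = c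

namespace SlopeField

variable {g : ℝ → ℝ → ℝ} {L : ℝ}

variable (hg : SlopeField g L)
include hg

lemma isLeafFun_glue {c : ℝ} {f h : ℝ → ℝ} (hf : IsSol g f)
    (hh : IsSol g h) (hfc : ∀ x, 0 < x → axisValue g x (f x) = c)
    (hhc : ∀ x, 0 < x → axisValue g x (h x) = -c) :
    IsLeafFun g c fun x => if 0 < x then f x else if x < 0 then -h (-x) else c := by
  set F : ℝ → ℝ := fun x => if 0 < x then f x else if x < 0 then -h (-x) else c
  have hF1 : ∀ x, 0 < x → F x = f x := fun x hx => if_pos hx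
  have hF2 : ∀ x, x < 0 → F x = -h (-x) := fun x hx => by simp [F, hx, hx.not_gt]
  have hF0 : F 0 = c := by simp [F]
  have hd : ∀ x, x ≠ 0 → HasDerivAt F (g x (F x)) x := by
    intro x hx; rcases hx.lt_or_gt with h' | h'
    · have h1 := (hh (-x) (neg_pos.mpr h')).scomp x (hasDerivAt_neg x)
      have h2 : HasDerivAt (fun x => -h (-x)) (g x (-h (-x))) x := by
        have h3 := h1.neg; rw [← hg.even, neg_neg] at h3
        convert! h3 using 1
        simp
      rw [hF2 x h']
      exact h2.congr_of_eventuallyEq (by filter_upwards [gt_mem_nhds h'] with t ht using hF2 t ht)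
    · rw [hF1 x h']
      exact (hf x h').congr_of_eventuallyEq
        (by filter_upwards [lt_mem_nhds h'] with t ht using hF1 t ht)
  have hA : ∀ x, axisValue g x (F x) = c := by
    intro x; rcases lt_trichotomy x 0 with h | rfl | h
    · have := hhc (-x) (neg_pos.mpr h); rw [hF2 x h]
      conv_lhs => rw [← neg_neg x]
      rw [axisValue_neg, neg_neg, this, neg_neg]
    · rw [hF0, axisValue_zero]
    · rw [hF1 x h, hfc x h]
  have hc0 : ContinuousAt F 0 := by
    rw [ContinuousAt, tendsto_iff_norm_sub_tendsto_zero, hF0]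
    refine squeeze_zero (g := fun x => L * |x|) (fun _ => norm_nonneg _) (fun x => ?_) ?_
    · have := hg.abs_sub_axisValue_le x (F x); rwa [hA] at this
    · have : Continuous fun x : ℝ => L * |x| := by fun_prop
      simpa using this.tendsto 0
  have hc : Continuous F := by
    rw [continuous_iff_continuousAt]; intro x; rcases eq_or_ne x 0 with rfl | hx
    · exact hc0
    · exact (hd x hx).continuousAt
  refine ⟨hc, hF0, fun x hx => ?_, hA⟩; rcases eq_or_ne x 0 with rfl | h0
  · have hcn : c ≠ 0 := hx.resolve_left (by simp)
    have hgc : ContinuousAt (fun x => g x (F x)) 0 :=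
      ContinuousAt.comp (f := fun x => (x, F x)) (g := Function.uncurry g) (x := 0)
        (hg.continuousAt (by rw [hF0]; exact fun h => hcn (congrArg Prod.snd h)))
        (by exact continuousAt_id.prodMk hc0)
    exact hasDerivAt_of_hasDerivAt_of_ne hd hc0 hgc
  · exact hd x h0

lemma exists_isLeafFun_of_isSol {f : ℝ → ℝ} (hf : IsSol g f) :
    ∃ F, IsLeafFun g (axisValue g 1 (f 1)) F ∧ ∀ x, 0 < x → F x = f x := by
  obtain ⟨h, hh, hhc⟩ := hg.exists_sol_axisValue (-axisValue g 1 (f 1))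
  refine ⟨_, hg.isLeafFun_glue hf hh (fun x hx => hg.axisValue_eq hf hx one_pos) hhc, ?_⟩
  intro x hx; simp [hx]

/-- The centrally symmetric leaf with a given half which tends to the origin. -/
lemma exists_odd_isLeafFun {f : ℝ → ℝ} (hf : IsSol g f)
    (h0 : axisValue g 1 (f 1) = 0) :
    ∃ F, IsLeafFun g 0 F ∧ (∀ x, 0 < x → F x = f x) ∧ ∀ x, F (-x) = -F x := by
  have h0' : ∀ x, 0 < x → axisValue g x (f x) = 0 := fun x hx => by
    rw [hg.axisValue_eq hf hx one_pos, h0]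
  refine ⟨_, hg.isLeafFun_glue (c := 0) hf hf h0' (by simpa using h0'), ?_, ?_⟩
  · intro x hx; simp [hx]
  · intro x; rcases lt_trichotomy x 0 with h | rfl | h
    · simp [h, h.not_gt]
    · simp
    · simp [h, h.not_gt]

lemma _root_.Umbilic.IsLeafFun.neg {c : ℝ} {f : ℝ → ℝ}
    (hf : IsLeafFun g c f) : IsLeafFun g (-c) fun x => -f (-x) := by
  refine ⟨(hf.continuous.comp continuous_neg).neg, by simp [hf.zero], fun x hx => ?_, fun x => ?_⟩
  · have h1 := ((hf.hasDerivAt (-x) (by simpa using hx)).scomp x (hasDerivAt_neg x)).neg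
    rw [← hg.even, neg_neg] at h1
    convert! h1 using 1
    simp
  · conv_lhs => rw [← neg_neg x]
    rw [axisValue_neg, neg_neg, hf.axisValue]

lemma exists_isLeafFun (x y : ℝ) :
    ∃ f, IsLeafFun g (axisValue g x y) f ∧ f x = y := by
  have key : ∀ {x : ℝ} (y : ℝ), 0 < x → ∃ f, IsLeafFun g (axisValue g x y) f ∧ f x = y := by
    intro x y hx; obtain ⟨F, hF, hFe⟩ := hg.exists_isLeafFun_of_isSol (hg.isSol hx y)
    rw [← hg.axisValue_eq (hg.isSol hx y) hx one_pos, hg.sol_self hx] at hF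
    exact ⟨F, hF, by rw [hFe x hx, hg.sol_self hx]⟩
  rcases lt_trichotomy x 0 with h | rfl | h
  · obtain ⟨f, hf, hfx⟩ := key (-y) (neg_pos.mpr h); refine ⟨fun x => -f (-x), ?_, by simp [hfx]⟩
    have := IsLeafFun.neg hg hf; rwa [axisValue_neg, neg_neg] at this
  · obtain ⟨f, hf, hf'⟩ := hg.exists_sol_axisValue y
    obtain ⟨F, hF, hFe⟩ := hg.exists_isLeafFun_of_isSol hf; rw [hf' 1 one_pos] at hF
    exact ⟨F, by rwa [axisValue_zero], hF.zero⟩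
  · exact key y h

omit hg in
lemma _root_.Umbilic.IsLeafFun.isSol {c : ℝ} {f : ℝ → ℝ} (hf : IsLeafFun g c f) : IsSol g f :=
  fun x hx => hf.hasDerivAt x (Or.inl hx.ne')

/-- Leaves which do not tend to the origin are determined by their ordinate on the axis. -/
lemma _root_.Umbilic.IsLeafFun.eq_of_axisValue {c : ℝ} {f : ℝ → ℝ}
    (hf : IsLeafFun g c f) (hc : c ≠ 0) {x y : ℝ} (h : axisValue g x y = c) : f x = y := by
  have key : ∀ {c : ℝ} {f : ℝ → ℝ} {x y : ℝ}, IsLeafFun g c f → c ≠ 0 → axisValue g x y = c →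
      0 < x → f x = y := by
    intro c f x y hf hc h hx
    have := hg.eq_of_axisValue_eq hf.isSol (hg.isSol hx y) hx
      (by rw [hf.axisValue, hg.sol_self hx, h]) (by rwa [hf.axisValue])
    rwa [hg.sol_self hx] at this
  rcases lt_trichotomy x 0 with hx | rfl | hx
  · have := key (x := -x) (y := -y) (IsLeafFun.neg hg hf) (neg_ne_zero.mpr hc)
      (by rw [axisValue_neg, h]) (neg_pos.mpr hx)
    simpa using this
  · rw [hf.zero, ← h, axisValue_zero]
  · exact key hf hc h hx

/-- Leaves which tend to the origin are determined, on either side, by any of their points. -/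
lemma _root_.Umbilic.IsLeafFun.eq_of_eq {c c' : ℝ} {f h : ℝ → ℝ}
    (hf : IsLeafFun g c f) (hh : IsLeafFun g c' h) {x x' : ℝ} (hx : 0 < x * x') (h1 : f x = h x) :
    f x' = h x' := by
  rcases pos_and_pos_or_neg_and_neg_of_mul_pos hx with ⟨h2, h3⟩ | ⟨h2, h3⟩
  · exact hg.sol_unique hf.isSol hh.isSol h2 h1 h3
  · have := hg.sol_unique (IsLeafFun.neg hg hf).isSol (IsLeafFun.neg hg hh).isSol
      (neg_pos.mpr h2) (by simp [h1]) (neg_pos.mpr h3)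
    simpa using this

/-- A curve tangent to the slope field stays locally on a leaf. -/
lemma eventually_eq_of_tangent {c : ℝ} {f : ℝ → ℝ} (hf : IsLeafFun g c f)
    {x y x' : ℝ → ℝ} {t0 : ℝ} (hx : ∀ᶠ t in 𝓝 t0, HasDerivAt x (x' t) t)
    (hy : ∀ᶠ t in 𝓝 t0, HasDerivAt y (x' t * g (x t) (y t)) t) (hx' : ContinuousAt x' t0)
    (h0 : y t0 = f (x t0)) (hne : (x t0, y t0) ≠ (0 : ℝ × ℝ)) :
    ∀ᶠ t in 𝓝 t0, y t = f (x t) := by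
  have hxc : ContinuousAt x t0 := hx.self_of_nhds.continuousAt
  have hyc : ContinuousAt y t0 := hy.self_of_nhds.continuousAt
  obtain ⟨K, U, hU, hK⟩ := (hg.contDiffOn.contDiffAt
    (isOpen_compl_singleton.mem_nhds hne)).exists_lipschitzOnWith
  have hfc : ContinuousAt (fun t => f (x t)) t0 := hf.continuous.continuousAt.comp hxc
  have e1 : ∀ᶠ t in 𝓝 t0, (x t, y t) ∈ U := (hxc.prodMk hyc).eventually hU
  have e2 : ∀ᶠ t in 𝓝 t0, (x t, f (x t)) ∈ U :=
    (hxc.prodMk hfc).eventually (by rw [h0] at hU; exact hU)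
  have e3 : ∀ᶠ t in 𝓝 t0, |x' t| < |x' t0| + 1 := hx'.abs.eventually (gt_mem_nhds (by linarith))
  have e4 : ∀ᶠ t in 𝓝 t0, x t ≠ 0 ∨ c ≠ 0 := by
    by_cases hc : c = 0
    · have : x t0 ≠ 0 := by intro h; exact hne (by rw [h0, h, hf.zero, hc]; rfl)
      filter_upwards [hxc.eventually_ne this] with t ht using Or.inl ht
    · exact Eventually.of_forall fun _ => Or.inr hc
  set M : NNReal := K * (|x' t0| + 1).toNNReal
  have h := ODE_solution_unique_of_eventually (v := fun t (d : ℝ) =>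
      if d = y t - f (x t) then x' t * (g (x t) (y t) - g (x t) (f (x t))) else 0)
    (K := M) (s := fun t => {d | d = y t - f (x t) ∨ d = 0}) (f := fun t => y t - f (x t))
    (g := fun _ => 0) (t₀ := t0) ?_ ?_ ?_ (by simp [h0])
  · filter_upwards [h] with t ht; simpa [sub_eq_zero] using ht
  · filter_upwards [e1, e2, e3] with t h1 h2 h3
    have hb : |g (x t) (y t) - g (x t) (f (x t))| ≤ K * |y t - f (x t)| := by
      have := hK.dist_le_mul _ h1 _ h2
      simpa [Function.uncurry, Prod.dist_eq, Real.dist_eq] using this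
    have hb' : |x' t * (g (x t) (y t) - g (x t) (f (x t)))| ≤ M * |y t - f (x t)| := by
      rw [abs_mul]
      calc _ ≤ (|x' t0| + 1) * (K * |y t - f (x t)|) := by gcongr
        _ = _ := by rw [NNReal.coe_mul, Real.coe_toNNReal _ (by positivity)]; ring
    refine LipschitzOnWith.of_dist_le_mul ?_; rintro a (rfl | rfl) b (rfl | rfl)
    · simp
    · by_cases hd : 0 = y t - f (x t)
      · simp [← hd]
      · simpa [Real.dist_eq, hd, abs_sub_comm] using hb'
    · by_cases hd : 0 = y t - f (x t)
      · simp [← hd]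
      · simpa [Real.dist_eq, hd, abs_sub_comm] using hb'
    · simp
  · filter_upwards [hx, hy, e4] with t h1 h2 h3; refine ⟨?_, Or.inl rfl⟩; rw [if_pos rfl]
    have := h2.sub ((hf.hasDerivAt _ h3).comp t h1)
    convert! this using 1
    ring
  · refine Eventually.of_forall fun t => ⟨?_, Or.inr rfl⟩
    have : (if (0 : ℝ) = y t - f (x t) then x' t * (g (x t) (y t) - g (x t) (f (x t))) else 0) = 0 := by
      split_ifs with h
      · rw [← sub_eq_zero.mp h.symm]; ring
      · rfl
    rw [this]; exact hasDerivAt_const _ _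

end SlopeField

/-! ### The position of a point in the funnel of the leaves which tend to the origin -/

/-- The ordinates at abscissa `1` of the leaves which tend to the origin. -/
def funnel (g : ℝ → ℝ → ℝ) : Set ℝ := {y | axisValue g 1 y = 0}

/-- The upper edge of the funnel. -/
def funnelTop (g : ℝ → ℝ → ℝ) : ℝ := sSup (funnel g)

/-- The lower edge of the funnel. -/
def funnelBot (g : ℝ → ℝ → ℝ) : ℝ := sInf (funnel g)

/-- The relative position in the funnel of the leaf through `(x, y)`, for positive `x`. -/
def funnelPos (g : ℝ → ℝ → ℝ) (x y : ℝ) : ℝ :=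
  max (-1) (min 1 ((2 * sol g x y 1 - funnelTop g - funnelBot g) / (funnelTop g - funnelBot g)))

/-- `0` if there is a unique leaf which tends to the origin from the right, and `1` otherwise. -/
def fanFlag (g : ℝ → ℝ → ℝ) : ℝ := if funnelTop g = funnelBot g then 0 else 1

namespace SlopeField

variable {g : ℝ → ℝ → ℝ} {L : ℝ}

lemma fanFlag_nonneg : 0 ≤ fanFlag g := by unfold fanFlag; split_ifs <;> norm_num

variable (hg : SlopeField g L)
include hg

lemma continuous_axisValue_right (x : ℝ) : Continuous (axisValue g x) :=
  hg.continuous_axisValue.comp (by fun_prop : Continuous fun y : ℝ => (x, y))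

lemma funnel_spec : IsCompact (funnel g) ∧ (funnel g).Nonempty := by
  refine ⟨isCompact_of_isClosed_isBounded (isClosed_eq (hg.continuous_axisValue_right 1)
    continuous_const) ((isBounded_closedBall (x := (0 : ℝ)) (r := L)).subset fun y hy => ?_), ?_⟩
  · have := hg.abs_sub_axisValue_le 1 y; rw [show axisValue g 1 y = 0 from hy] at this
    simpa using this
  · obtain ⟨f, hf, hf'⟩ := hg.exists_sol_axisValue 0; exact ⟨f 1, hf' 1 one_pos⟩

lemma funnelTop_mem : axisValue g 1 (funnelTop g) = 0 :=
  hg.funnel_spec.1.sSup_mem hg.funnel_spec.2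

lemma funnelBot_mem : axisValue g 1 (funnelBot g) = 0 :=
  hg.funnel_spec.1.sInf_mem hg.funnel_spec.2

lemma funnelBot_le : funnelBot g ≤ funnelTop g :=
  csInf_le hg.funnel_spec.1.bddBelow hg.funnelTop_mem

lemma mem_funnel_iff {y : ℝ} :
    axisValue g 1 y = 0 ↔ funnelBot g ≤ y ∧ y ≤ funnelTop g := by
  refine ⟨fun h => ⟨csInf_le hg.funnel_spec.1.bddBelow h, le_csSup hg.funnel_spec.1.bddAbove h⟩,
    fun h => le_antisymm ?_ ?_⟩
  · rw [← hg.funnelTop_mem]; exact hg.axisValue_le 1 h.2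
  · rw [← hg.funnelBot_mem]; exact hg.axisValue_le 1 h.1

omit hg in
lemma abs_funnelPos_le (x y : ℝ) : |funnelPos g x y| ≤ fanFlag g := by
  unfold fanFlag funnelPos; split_ifs with h
  · simp [h]
  · exact abs_le.mpr ⟨le_max_left _ _, max_le (by norm_num) (min_le_left _ _)⟩

lemma axisValue_sol_one {x : ℝ} (hx : 0 < x) (y : ℝ) :
    axisValue g 1 (sol g x y 1) = axisValue g x y := by
  rw [hg.axisValue_eq (hg.isSol hx y) one_pos hx, hg.sol_self hx]

lemma funnelPos_of_pos {x y : ℝ} (hx : 0 < x) (h : 0 < axisValue g x y) :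
    funnelPos g x y = fanFlag g := by
  unfold fanFlag funnelPos; split_ifs with h1
  · simp [h1]
  · have h2 : funnelTop g ≤ sol g x y 1 := by
      by_contra hlt; have := hg.axisValue_le 1 (not_le.mp hlt).le
      rw [hg.axisValue_sol_one hx, hg.funnelTop_mem] at this; linarith
    have h3 : 0 < funnelTop g - funnelBot g :=
      sub_pos.mpr (lt_of_le_of_ne hg.funnelBot_le (Ne.symm h1))
    rw [min_eq_left ((one_le_div h3).mpr (by linarith)), max_eq_right (by norm_num)]

lemma funnelPos_of_neg {x y : ℝ} (hx : 0 < x) (h : axisValue g x y < 0) :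
    funnelPos g x y = -fanFlag g := by
  unfold fanFlag funnelPos; split_ifs with h1
  · simp [h1]
  · have h2 : sol g x y 1 ≤ funnelBot g := by
      by_contra hlt; have := hg.axisValue_le 1 (not_le.mp hlt).le
      rw [hg.axisValue_sol_one hx, hg.funnelBot_mem] at this; linarith
    have h3 : 0 < funnelTop g - funnelBot g :=
      sub_pos.mpr (lt_of_le_of_ne hg.funnelBot_le (Ne.symm h1))
    have h4 : (2 * sol g x y 1 - funnelTop g - funnelBot g) / (funnelTop g - funnelBot g) ≤ -1 := by
      rw [div_le_iff₀ h3]; linarith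
    rw [min_eq_right (h4.trans (by norm_num)), max_eq_left h4]

/-- Within the funnel, the position determines the leaf. -/
lemma sol_one_of_axisValue {x y : ℝ} (hx : 0 < x)
    (h : axisValue g x y = 0) :
    2 * sol g x y 1 = funnelTop g + funnelBot g + funnelPos g x y * (funnelTop g - funnelBot g) := by
  rw [← hg.axisValue_sol_one hx, hg.mem_funnel_iff] at h; unfold funnelPos
  rcases eq_or_ne (funnelTop g) (funnelBot g) with h1 | h1
  · rw [h1] at h ⊢; linarith [h.1, h.2]
  · have h3 : 0 < funnelTop g - funnelBot g := sub_pos.mpr (lt_of_le_of_ne hg.funnelBot_le h1.symm)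
    rw [min_eq_right ((div_le_one h3).mpr (by linarith)),
      max_eq_right ((le_div_iff₀ h3).mpr (by linarith))]
    field_simp; ring

lemma continuousAt_funnelPos {x y : ℝ} (hx : 0 < x) :
    ContinuousAt (fun z : ℝ × ℝ => funnelPos g z.1 z.2) (x, y) := by
  have h1 := hg.continuousAt_sol (y0 := y) hx one_pos
  exact continuousAt_const.max (continuousAt_const.min
    ((((continuousAt_const.mul h1).sub continuousAt_const).sub continuousAt_const).div_const _))

lemma funnelPos_eq_of_isSol {f : ℝ → ℝ} (hf : IsSol g f) {x x' : ℝ}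
    (hx : 0 < x) (hx' : 0 < x') : funnelPos g x (f x) = funnelPos g x' (f x') := by
  unfold funnelPos; rw [hg.sol_eq hf hx one_pos, hg.sol_eq hf hx' one_pos]

end SlopeField

/-! ### Pairs of transverse foliations -/

lemma pos_of_hasDerivAt_pos_of_zero {D : ℝ → ℝ} {a b : ℝ} (hD : ContinuousOn D (Icc a b))
    (ha : D a = 0) (h : ∀ x ∈ Icc a b, D x = 0 → ∃ d, 0 < d ∧ HasDerivAt D d x) :
    ∀ x ∈ Ioc a b, 0 < D x := by
  intro x2 hx2; by_contra hle; push Not at hle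
  obtain ⟨d, hd, hda⟩ := h a ⟨le_rfl, hx2.1.le.trans hx2.2⟩ ha
  have h1 := (hasDerivAt_iff_tendsto_slope_left_right.mp hda).2.eventually (lt_mem_nhds hd)
  obtain ⟨a', ha', h1a⟩ := (h1.and (Ioo_mem_nhdsGT hx2.1)).exists
  have hDa' : 0 < D a' := by
    rw [slope_def_field, ha, sub_zero] at ha'
    exact (div_pos_iff_of_pos_right (sub_pos.mpr h1a.1)).mp ha'
  set S := Icc a' x2 ∩ D ⁻¹' Iic 0 with hS
  have hsub : Icc a' x2 ⊆ Icc a b := Icc_subset_Icc h1a.1.le hx2.2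
  have hScomp : IsCompact S := by
    rw [hS]
    exact isCompact_Icc.of_isClosed_subset ((hD.mono hsub).preimage_isClosed_of_isClosed
      isClosed_Icc isClosed_Iic) inter_subset_left
  have hSne : S.Nonempty := ⟨x2, ⟨h1a.2.le, le_rfl⟩, hle⟩; set z := sInf S with hz
  have hzS : z ∈ S := hScomp.sInf_mem hSne
  have haz : a' < z := lt_of_le_of_ne hzS.1.1 (by rintro h; rw [← h] at hzS; exact absurd hzS.2 (not_le.mpr hDa'))
  have hlt : ∀ t ∈ Ico a' z, 0 < D t := by
    intro t ht; by_contra hn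
    exact absurd (csInf_le hScomp.bddBelow (show t ∈ S from
      ⟨⟨ht.1, ht.2.le.trans hzS.1.2⟩, not_lt.mp hn⟩)) (not_le.mpr ht.2)
  have hDz : D z = 0 := by
    refine le_antisymm hzS.2 ?_
    have hc : Tendsto D (𝓝[<] z) (𝓝 (D z)) :=
      ((hD z (hsub hzS.1)).mono_left (nhdsWithin_le_of_mem (mem_of_superset
        (Ioo_mem_nhdsLT haz) fun t ht => hsub ⟨ht.1.le, ht.2.le.trans hzS.1.2⟩)))
    exact ge_of_tendsto hc (by
      filter_upwards [Ioo_mem_nhdsLT haz] with t ht using (hlt t ⟨ht.1.le, ht.2⟩).le)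
  obtain ⟨d', hd', hdz⟩ := h z (hsub hzS.1) hDz
  have h2 := (hasDerivAt_iff_tendsto_slope_left_right.mp hdz).1.eventually (lt_mem_nhds hd')
  obtain ⟨t, ht, hta⟩ := (h2.and (Ioo_mem_nhdsLT haz)).exists
  rw [slope_def_field, hDz, sub_zero] at ht; have := hlt t ⟨hta.1.le, hta.2⟩
  have h3 : D t / (t - z) < 0 := div_neg_of_pos_of_neg this (by linarith [hta.2]); linarith

/-- Two transverse foliations of the plane with a common singularity at the origin: the leaves of
the first one are graphs `y = f(x)`, where `f' = g(x, f)`, and those of the second one graphs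
`-x = k(y)`, where `k' = g'(y, k)`. -/
structure SlopePair (g g' : ℝ → ℝ → ℝ) (L : ℝ) : Prop where
  fst : SlopeField g L
  snd : SlopeField g' L
  trans : ∀ x y, (x, y) ≠ (0 : ℝ × ℝ) → 0 < 1 + g x y * g' y (-x)
  acute : ∀ f k, IsSol g f → IsSol g' k → axisValue g 1 (f 1) = 0 → axisValue g' 1 (k 1) = 0 →
    ∃ s s', Tendsto (fun x => f x / x) (𝓝[>] 0) (𝓝 s) ∧
      Tendsto (fun x => k x / x) (𝓝[>] 0) (𝓝 s') ∧ 0 < 1 + s * s'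

/-- The label of a leaf of the first foliation. -/
def ord (g : ℝ → ℝ → ℝ) (w : ℂ) : ℝ := axisValue g w.re w.im

/-- The labels of the leaves of the first foliation in the fan of leaves which tend to the
origin, weighted by the label of the leaf of the second one. -/
def fan (g g' : ℝ → ℝ → ℝ) (w : ℂ) : ℝ :=
  (if 0 < w.re then funnelPos g w.re w.im else if w.re < 0 then -funnelPos g (-w.re) (-w.im)
    else if 0 < w.im then fanFlag g else -fanFlag g) * |ord g' (-I * w)|

/-- The labels of both leaves through a point. -/
def leafLabels (g g' : ℝ → ℝ → ℝ) (w : ℂ) : (ℝ × ℝ) × (ℝ × ℝ) :=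
  ((ord g w, fan g g' w), (ord g' (-I * w), fan g' g (-I * w)))

/-- The conditions on the labels `y`, `z` in terms of a label `u` of the other foliation. -/
def IsLabel (c y z u : ℝ) : Prop :=
  (0 < y → z = c * |u|) ∧ (y < 0 → z = -(c * |u|)) ∧ |z| ≤ c * |u|

lemma IsLabel.neg {c y z u : ℝ} (h : IsLabel c y z u) : IsLabel c (-y) (-z) (-u) := by
  obtain ⟨h1, h2, h3⟩ := h; refine ⟨fun h => ?_, fun h => ?_, by simpa using h3⟩
  · rw [h2 (by linarith)]; simp
  · rw [h1 (by linarith)]; simp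

lemma IsLabel.neg_third {c y z u : ℝ} (h : IsLabel c y z u) : IsLabel c y z (-u) := by
  simpa [IsLabel] using h

/-- For a given label `y ≠ 0` of the other leaf, the two labels of a leaf are determined by one
combination of them. -/
lemma IsLabel.ext {c y u v u' v' : ℝ} (hy : y ≠ 0) (h : IsLabel c u v y)
    (h' : IsLabel c u' v' y) (he : u + v / |y| = u' + v' / |y|) : u = u' ∧ v = v' := by
  have hp : 0 < |y| := abs_pos.mpr hy
  have hb : ∀ {u v}, IsLabel c u v y → (0 < u → v / |y| = c) ∧ (u < 0 → v / |y| = -c) ∧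
      |(v / |y|)| ≤ c := by
    rintro u v ⟨h1, h2, h3⟩
    refine ⟨fun h => by rw [h1 h]; field_simp, fun h => by rw [h2 h]; field_simp, ?_⟩
    rw [abs_div, abs_abs, div_le_iff₀ hp]; exact h3
  obtain ⟨a1, a2, a3⟩ := hb h; obtain ⟨b1, b2, b3⟩ := hb h'; rw [abs_le] at a3 b3
  have hu : u = u' := by
    rcases lt_trichotomy u 0 with hu | hu | hu <;> rcases lt_trichotomy u' 0 with hu' | hu' | hu'
    · rw [a2 hu, b2 hu'] at he; linarith
    · have := a2 hu; linarith
    · have := a2 hu; linarith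
    · have := b2 hu'; linarith
    · rw [hu, hu']
    · have := b1 hu'; linarith
    · have := a1 hu; linarith
    · have := a1 hu; linarith
    · rw [a1 hu, b1 hu'] at he; linarith
  refine ⟨hu, ?_⟩; rw [hu] at he; have : v / |y| = v' / |y| := by linarith
  exact (div_left_inj' hp.ne').mp this

lemma ord_neg (g : ℝ → ℝ → ℝ) (w : ℂ) : ord g (-w) = -ord g w := by
  simp [ord, SlopeField.axisValue_neg]

lemma ord_zero (g : ℝ → ℝ → ℝ) : ord g 0 = 0 := by simp [ord, SlopeField.axisValue_zero]

lemma SlopeField.continuous_ord {g : ℝ → ℝ → ℝ} {L : ℝ} (hg : SlopeField g L) :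
    Continuous (ord g) :=
  hg.continuous_axisValue.comp (continuous_re.prodMk continuous_im)

lemma fan_neg (g g' : ℝ → ℝ → ℝ) (w : ℂ)
    (h0 : w.re = 0 → w.im = 0 → ord g' (-I * w) = 0) :
    fan g g' (-w) = -fan g g' w := by
  unfold fan; rw [mul_neg, ord_neg, abs_neg, ← neg_mul]; rcases lt_trichotomy w.re 0 with h | h | h
  · simp [h, h.not_gt]
  · rcases lt_trichotomy w.im 0 with h1 | h1 | h1
    · simp [h, h1, h1.not_gt]
    · rw [h0 h h1]; simp
    · simp [h, h1, h1.not_gt]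
  · simp [h, h.not_gt]

lemma ord_of_re_eq_zero (g : ℝ → ℝ → ℝ) {w : ℂ} (h : w.re = 0) : ord g w = w.im := by
  simp [ord, h, SlopeField.axisValue_zero]

lemma rot_zero {w : ℂ} (h : w.re = 0) (h1 : w.im = 0) (g' : ℝ → ℝ → ℝ) :
    ord g' (-I * w) = 0 := by rw [show w = 0 from ext h h1, mul_zero, ord_zero]

lemma SlopeField.fan_of_pos {g : ℝ → ℝ → ℝ} {L : ℝ} (hg : SlopeField g L) (g' : ℝ → ℝ → ℝ) {w : ℂ}
    (h : 0 < ord g w) : fan g g' w = fanFlag g * |ord g' (-I * w)| := by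
  unfold fan; congr 1; rcases lt_trichotomy w.re 0 with h1 | h1 | h1
  · rw [if_neg h1.not_gt, if_pos h1, hg.funnelPos_of_neg (neg_pos.mpr h1), neg_neg]
    rw [SlopeField.axisValue_neg]; exact neg_neg_iff_pos.mpr h
  · rw [ord_of_re_eq_zero g h1] at h; simp [h1, h]
  · rw [if_pos h1, hg.funnelPos_of_pos h1 h]

lemma SlopeField.isLabel {g : ℝ → ℝ → ℝ} {L : ℝ} (hg : SlopeField g L) (g' : ℝ → ℝ → ℝ) (w : ℂ) :
    IsLabel (fanFlag g) (ord g w) (fan g g' w) (ord g' (-I * w)) := by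
  refine ⟨fun h => hg.fan_of_pos g' h, fun h => ?_, ?_⟩
  · have := hg.fan_of_pos g' (w := -w) (by rw [ord_neg]; linarith)
    rw [fan_neg g g' w fun a b => rot_zero a b g', mul_neg, ord_neg, abs_neg] at this; linarith
  · unfold fan; rw [abs_mul, abs_abs]; refine mul_le_mul_of_nonneg_right ?_ (abs_nonneg _)
    have := fanFlag_nonneg (g := g); split_ifs
    · exact abs_funnelPos_le _ _
    · rw [abs_neg]; exact abs_funnelPos_le _ _
    · rw [abs_of_nonneg this]
    · rw [abs_neg, abs_of_nonneg this]

lemma leafLabels_neg (g g' : ℝ → ℝ → ℝ) (w : ℂ) : leafLabels g g' (-w) = -leafLabels g g' w := by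
  have h : -I * -w = -(-I * w) := by ring
  simp only [leafLabels, h, ord_neg, fan_neg g g' w fun a b => rot_zero a b g',
    fan_neg g' g (-I * w) fun a b => rot_zero a b g]
  rfl

lemma SlopeField.continuous_fan {g g' : ℝ → ℝ → ℝ} {L : ℝ} (hg : SlopeField g L)
    (hg' : SlopeField g' L) : Continuous (fan g g') := by
  have hU : Continuous fun w => ord g' (-I * w) :=
    hg'.continuous_ord.comp (continuous_const.mul continuous_id)
  have hY := hg.continuous_ord
  have hpos : ∀ w : ℂ, 0 < w.re → ContinuousAt (fan g g') w := by
    intro w hw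
    have h1 : ContinuousAt (fun w : ℂ => funnelPos g w.re w.im) w :=
      ContinuousAt.comp (f := fun w : ℂ => (w.re, w.im)) (hg.continuousAt_funnelPos hw)
        (continuous_re.prodMk continuous_im).continuousAt
    refine (h1.mul hU.abs.continuousAt).congr ?_
    filter_upwards [continuous_re.continuousAt.eventually (lt_mem_nhds hw)] with z hz
    simp [fan, hz]
  have hYpos : ∀ w, 0 < ord g w → ContinuousAt (fan g g') w := by
    intro w hw
    refine (continuousAt_const.mul hU.abs.continuousAt : ContinuousAt
      (fun w => fanFlag g * |ord g' (-I * w)|) w).congr ?_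
    filter_upwards [hY.continuousAt.eventually (lt_mem_nhds hw)] with z hz
    exact (hg.fan_of_pos g' hz).symm
  have hneg : ∀ w, ContinuousAt (fan g g') (-w) → ContinuousAt (fan g g') w := by
    intro w hw
    have h1 : ContinuousAt (fun z => -fan g g' (-z)) w :=
      (ContinuousAt.comp (f := fun z : ℂ => -z) hw continuous_neg.continuousAt).neg
    refine h1.congr (Eventually.of_forall fun z => ?_)
    simp only [fan_neg g g' z fun a b => rot_zero a b g', neg_neg]
  rw [continuous_iff_continuousAt]; intro w; rcases lt_trichotomy w.re 0 with h | h | h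
  · exact hneg w (hpos _ (by simpa using h))
  · rcases lt_trichotomy w.im 0 with h1 | h1 | h1
    · refine hneg w (hYpos _ ?_); rw [ord_neg, ord_of_re_eq_zero g h]; linarith
    · rw [show w = 0 from ext h h1]; have hz : fan g g' 0 = 0 := by simp [fan, ord_zero]
      rw [ContinuousAt, hz]
      refine squeeze_zero_norm (a := fun w => fanFlag g * |ord g' (-I * w)|)
        (fun w => (hg.isLabel g' w).2.2) ?_
      have h2 : Continuous (fun w => fanFlag g * |ord g' (-I * w)|) :=
        continuous_const.mul hU.abs
      simpa [ord_zero] using h2.tendsto 0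
    · exact hYpos w (by rwa [ord_of_re_eq_zero g h])
  · exact hpos w h

namespace SlopePair

variable {g g' : ℝ → ℝ → ℝ} {L : ℝ}

variable (h : SlopePair g g' L)
include h

lemma swap : SlopePair g' g L := by
  refine ⟨h.snd, h.fst, fun x y hxy => ?_, fun f k hf hk h1 h2 => ?_⟩
  · have := h.trans y (-x) (fun h0 => hxy (by
      have h1 : y = 0 := congrArg Prod.fst h0; have h2 : -x = 0 := congrArg Prod.snd h0
      rw [h1, neg_eq_zero.mp h2]; rfl))
    rw [h.snd.even] at this; linarith
  · obtain ⟨s, s', a, b, c⟩ := h.acute k f hk hf h2 h1; exact ⟨s', s, b, a, by linarith⟩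

lemma continuous_leafLabels : Continuous (leafLabels g g') := by
  have hr : Continuous fun w : ℂ => -I * w := continuous_const.mul continuous_id
  exact (h.fst.continuous_ord.prodMk (h.fst.continuous_fan h.snd)).prodMk
    ((h.snd.continuous_ord.comp hr).prodMk ((h.snd.continuous_fan h.fst).comp hr))

omit h in
lemma leafLabels_swap (g g' : ℝ → ℝ → ℝ) (w : ℂ) :
    leafLabels g' g (-I * w) = ((leafLabels g g' w).2, -(leafLabels g g' w).1) := by
  have hr : -I * (-I * w) = -w := by rw [← mul_assoc, neg_mul_neg, I_mul_I, neg_one_mul]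
  simp only [leafLabels, hr, ord_neg, fan_neg g g' w fun a b => rot_zero a b g']; rfl

/-- The leaves of the two foliations cross positively. -/
lemma cross_hasDerivAt {c c' : ℝ} {f k : ℝ → ℝ} (hf : IsLeafFun g c f)
    (hk : IsLeafFun g' c' k) {x : ℝ} (hx : x + k (f x) = 0) (hne : (x, f x) ≠ (0 : ℝ × ℝ)) :
    ∃ d, 0 < d ∧ HasDerivAt (fun x => x + k (f x)) d x := by
  have h1 : x ≠ 0 ∨ c ≠ 0 := by
    by_contra hn; push Not at hn; exact hne (by rw [hn.1, hf.zero, hn.2]; rfl)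
  have h2 : f x ≠ 0 ∨ c' ≠ 0 := by
    by_contra hn; push Not at hn; rw [hn.1, hk.zero, hn.2, add_zero] at hx
    exact hne (by rw [hn.1, hx]; rfl)
  refine ⟨1 + g' (f x) (k (f x)) * g x (f x), ?_,
    (hasDerivAt_id x).add ((hk.hasDerivAt _ h2).comp x (hf.hasDerivAt x h1))⟩
  have := h.trans x (f x) hne; rw [show k (f x) = -x by linarith]; linarith

lemma cross_pos {c c' : ℝ} {f k : ℝ → ℝ} (hf : IsLeafFun g c f)
    (hk : IsLeafFun g' c' k) {x1 x2 : ℝ} (h12 : x1 < x2) (hx : x1 + k (f x1) = 0)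
    (hne : ∀ x ∈ Icc x1 x2, (x, f x) ≠ (0 : ℝ × ℝ)) : 0 < x2 + k (f x2) :=
  pos_of_hasDerivAt_pos_of_zero (D := fun x => x + k (f x))
    (continuous_id.add (hk.continuous.comp hf.continuous)).continuousOn hx
    (fun x hx h0 => h.cross_hasDerivAt hf hk h0 (hne x hx)) x2 ⟨h12, le_rfl⟩

omit h in
lemma hasDerivAt_of_odd {f : ℝ → ℝ} {s : ℝ} (ho : ∀ x, f (-x) = -f x) (h0 : f 0 = 0)
    (h : Tendsto (fun x => f x / x) (𝓝[>] 0) (𝓝 s)) : HasDerivAt f s 0 := by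
  rw [hasDerivAt_iff_tendsto_slope_left_right]
  have hs : slope f 0 = fun x => f x / x := by
    funext x; rw [slope_def_field, h0, sub_zero, sub_zero]
  rw [hs]; refine ⟨?_, h⟩
  have h1 : Tendsto (fun x : ℝ => -x) (𝓝[<] 0) (𝓝[>] 0) := by
    have := tendsto_neg_nhdsLT (a := (0 : ℝ)); simpa using this
  refine (h.comp h1).congr fun x => ?_; simp [ho]

/-- Only the origin is on a leaf tending to the origin of either foliation. -/
lemma eq_zero_of_ord {w : ℂ} (h1 : ord g w = 0)
    (h2 : ord g' (-I * w) = 0) : w = 0 := by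
  have key : ∀ {w : ℂ}, 0 < w.re → ord g w = 0 → ord g' (-I * w) = 0 → False := by
    intro w hw h1 h2; have h1' : axisValue g w.re w.im = 0 := h1
    have h2' : axisValue g' w.im (-w.re) = 0 := by simpa [ord] using h2
    obtain ⟨F, hF, hFe⟩ := h.fst.exists_isLeafFun w.re w.im; rw [h1'] at hF
    obtain ⟨f, hf, hfF, hfo⟩ := h.fst.exists_odd_isLeafFun hF.isSol (hF.axisValue 1)
    obtain ⟨G, hG, hGe⟩ := h.snd.exists_isLeafFun w.im (-w.re); rw [h2'] at hG
    obtain ⟨k, hk, hkG, hko⟩ : ∃ k, IsLeafFun g' 0 k ∧ k w.im = -w.re ∧ ∀ x, k (-x) = -k x := by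
      rcases lt_trichotomy w.im 0 with hi | hi | hi
      · obtain ⟨k, hk, hkG, hko⟩ := h.snd.exists_odd_isLeafFun (IsLeafFun.neg h.snd hG).isSol
          (by simpa using (IsLeafFun.neg h.snd hG).axisValue 1)
        refine ⟨k, hk, ?_, hko⟩; have := hkG (-w.im) (by linarith); rw [hko, neg_neg] at this
        linarith
      · rw [hi, SlopeField.axisValue_zero] at h2'; linarith
      · obtain ⟨k, hk, hkG, hko⟩ := h.snd.exists_odd_isLeafFun hG.isSol (hG.axisValue 1)
        exact ⟨k, hk, by rw [hkG _ hi, hGe], hko⟩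
    obtain ⟨s, s', ha, hb, hc⟩ := h.acute f k hf.isSol hk.isSol (hf.axisValue 1) (hk.axisValue 1)
    have hfd := hasDerivAt_of_odd hfo hf.zero ha; have hkd := hasDerivAt_of_odd hko hk.zero hb
    have := pos_of_hasDerivAt_pos_of_zero (D := fun x => x + k (f x)) (a := 0) (b := w.re)
      (continuous_id.add (hk.continuous.comp hf.continuous)).continuousOn
      (by simp [hf.zero, hk.zero]) (fun x hx h0 => by
        rcases hx.1.eq_or_lt with rfl | hx0
        · refine ⟨1 + s' * s, by linarith, (hasDerivAt_id (0 : ℝ)).add ?_⟩; rw [← hf.zero] at hkd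
          exact hkd.comp (0 : ℝ) hfd
        · exact h.cross_hasDerivAt hf hk h0 fun h => hx0.ne' (congrArg Prod.fst h))
      w.re ⟨hw, le_rfl⟩
    simp only [hfF _ hw, hFe, hkG] at this; linarith
  rcases lt_trichotomy w.re 0 with hw | hw | hw
  · refine (key (w := -w) (by simpa using hw) (by rw [ord_neg, h1, neg_zero]) ?_).elim
    rw [mul_neg, ord_neg, h2, neg_zero]
  · rw [ord_of_re_eq_zero g hw] at h1; exact ext hw h1
  · exact (key hw h1 h2).elim

/-- Along a leaf of the first foliation, the label of the second one is monotone. -/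
lemma ord_le_of_leaf {c : ℝ} {f : ℝ → ℝ} (hf : IsLeafFun g c f)
    {x1 x2 : ℝ} (h12 : x1 ≤ x2) (hne : ∀ x ∈ Icc x1 x2, (x, f x) ≠ (0 : ℝ × ℝ)) :
    axisValue g' (f x2) (-x2) ≤ axisValue g' (f x1) (-x1) := by
  rcases h12.eq_or_lt with rfl | h12
  · exact le_rfl
  obtain ⟨k, hk, hke⟩ := h.snd.exists_isLeafFun (f x1) (-x1)
  have := h.cross_pos hf hk h12 (by rw [hke]; ring) hne; rw [← hk.axisValue (f x2)]
  exact h.snd.axisValue_le _ (by linarith)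

lemma ord_neg_of_ord_eq_zero {w : ℂ} (hw : 0 < w.re) (h0 : ord g w = 0) :
    ord g' (-I * w) < 0 := by
  refine lt_of_le_of_ne ?_ fun h1 => by rw [h.eq_zero_of_ord h0 h1] at hw; simp at hw
  have h0' : axisValue g w.re w.im = 0 := h0
  obtain ⟨f, hf, hfe⟩ := h.fst.exists_isLeafFun w.re w.im; rw [h0'] at hf
  have hc : Tendsto (fun x => axisValue g' (f x) (-x)) (𝓝[>] 0) (𝓝 0) := by
    have h1 : Continuous fun x => axisValue g' (f x) (-x) :=
      h.snd.continuous_axisValue.comp (hf.continuous.prodMk continuous_neg)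
    have := (h1.tendsto 0).mono_left (nhdsWithin_le_nhds (s := Ioi 0))
    simpa [hf.zero, SlopeField.axisValue_zero] using this
  have : ord g' (-I * w) = axisValue g' (f w.re) (-w.re) := by simp [ord, hfe]
  rw [this]; refine ge_of_tendsto hc ?_; filter_upwards [Ioo_mem_nhdsGT hw] with x hx
  exact h.ord_le_of_leaf hf hx.2.le fun t ht h0 => by
    have h1 : t = 0 := congrArg Prod.fst h0; linarith [ht.1, hx.1]

end SlopePair

/-- Two points are on the same leaf (in the complement of the origin) of the first foliation. -/
def SameLeaf (g : ℝ → ℝ → ℝ) (w w' : ℂ) : Prop :=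
  ∃ c f, IsLeafFun g c f ∧ f w.re = w.im ∧ f w'.re = w'.im ∧ (c ≠ 0 ∨ 0 < w.re * w'.re)

/-- The expression of `SameLeaf` in terms of labels. -/
def SameLabel (p p' : (ℝ × ℝ) × (ℝ × ℝ)) : Prop :=
  p.1.1 = p'.1.1 ∧ (p.1.1 ≠ 0 ∨ (0 < p.2.1 * p'.2.1 ∧ p.1.2 * |p'.2.1| = p'.1.2 * |p.2.1|))

lemma SameLeaf.neg {g : ℝ → ℝ → ℝ} {L : ℝ} (hg : SlopeField g L) {w w' : ℂ}
    (h : SameLeaf g w w') : SameLeaf g (-w) (-w') := by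
  obtain ⟨c, f, hf, h1, h2, h3⟩ := h
  exact ⟨-c, _, IsLeafFun.neg hg hf, by simp [h1], by simp [h2], by simpa using h3⟩

lemma SameLeaf.symm {g : ℝ → ℝ → ℝ} {w w' : ℂ} (h : SameLeaf g w w') : SameLeaf g w' w := by
  obtain ⟨c, f, hf, h1, h2, h3⟩ := h; exact ⟨c, f, hf, h2, h1, by rwa [mul_comm]⟩

namespace SlopePair

variable {g g' : ℝ → ℝ → ℝ} {L : ℝ}

variable (h : SlopePair g g' L)
include h

lemma ord_pos_of_ord_eq_zero {w : ℂ} (hw : w.re < 0) (h0 : ord g w = 0) :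
    0 < ord g' (-I * w) := by
  have := h.ord_neg_of_ord_eq_zero (w := -w) (by simpa using hw) (by rw [ord_neg, h0, neg_zero])
  rw [mul_neg, ord_neg] at this; linarith

omit h in
lemma _root_.Umbilic.re_ne_zero {g : ℝ → ℝ → ℝ} {w : ℂ} (hw : w ≠ 0) (h0 : ord g w = 0) : w.re ≠ 0 := by
  intro h1; rw [ord_of_re_eq_zero g h1] at h0; exact hw (ext h1 h0)

/-- On the leaves which tend to the origin, the abscissa has the sign of the label of the other
foliation. -/
lemma re_mul_ord_neg {w : ℂ} (hw : w ≠ 0) (h0 : ord g w = 0) :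
    w.re * ord g' (-I * w) < 0 := by
  rcases (re_ne_zero hw h0).lt_or_gt with h1 | h1
  · exact mul_neg_of_neg_of_pos h1 (h.ord_pos_of_ord_eq_zero h1 h0)
  · exact mul_neg_of_pos_of_neg h1 (h.ord_neg_of_ord_eq_zero h1 h0)

lemma sameLabel_of_sameLeaf {w w' : ℂ} (hw : w ≠ 0) (hw' : w' ≠ 0)
    (hs : SameLeaf g w w') : SameLabel (leafLabels g g' w) (leafLabels g g' w') := by
  have key : ∀ {w w' : ℂ}, 0 < w.re → 0 < w'.re → SameLeaf g w w' → ord g w = 0 →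
      fan g g' w * |ord g' (-I * w')| = fan g g' w' * |ord g' (-I * w)| := by
    rintro w w' hw hw' ⟨c, f, hf, h1, h2, -⟩ -; unfold fan
    rw [if_pos hw, if_pos hw', ← h1, ← h2, h.fst.funnelPos_eq_of_isSol hf.isSol hw hw']; ring
  have hs' := hs; obtain ⟨c, f, hf, h1, h2, h3⟩ := hs'
  have e1 : ord g w = c := by rw [ord, ← h1, hf.axisValue]
  have e2 : ord g w' = c := by rw [ord, ← h2, hf.axisValue]
  refine ⟨e1.trans e2.symm, ?_⟩
  by_cases hc : c = 0
  · right; rw [hc] at e1 e2; have h3 := h3.resolve_left (by simpa using hc)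
    have a1 := h.re_mul_ord_neg hw e1; have a2 := h.re_mul_ord_neg hw' e2; refine ⟨?_, ?_⟩
    · show 0 < ord g' (-I * w) * ord g' (-I * w')
      have : 0 < (w.re * ord g' (-I * w)) * (w'.re * ord g' (-I * w')) :=
        mul_pos_of_neg_of_neg a1 a2
      have e : (w.re * ord g' (-I * w)) * (w'.re * ord g' (-I * w')) =
        (w.re * w'.re) * (ord g' (-I * w) * ord g' (-I * w')) := by ring
      rw [e] at this; exact (pos_iff_pos_of_mul_pos this).mp h3
    · show fan g g' w * |ord g' (-I * w')| = fan g g' w' * |ord g' (-I * w)|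
      rcases pos_and_pos_or_neg_and_neg_of_mul_pos h3 with ⟨b1, b2⟩ | ⟨b1, b2⟩
      · exact key b1 b2 hs e1
      · have := key (w := -w) (w' := -w') (by simpa using b1) (by simpa using b2)
          (hs.neg h.fst) (by rw [ord_neg, e1, neg_zero])
        rw [fan_neg g g' w fun a b => rot_zero a b g', fan_neg g g' w' fun a b => rot_zero a b g',
          mul_neg, mul_neg, ord_neg, ord_neg, abs_neg, abs_neg] at this
        linarith
  · left; show ord g w ≠ 0; rwa [e1]

lemma sameLeaf_of_sameLabel {w w' : ℂ} (hw : w ≠ 0) (hw' : w' ≠ 0)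
    (hs : SameLabel (leafLabels g g' w) (leafLabels g g' w')) : SameLeaf g w w' := by
  have hs1 : ord g w = ord g w' := hs.1
  have hs2 : ord g w ≠ 0 ∨ (0 < ord g' (-I * w) * ord g' (-I * w') ∧
    fan g g' w * |ord g' (-I * w')| = fan g g' w' * |ord g' (-I * w)|) := hs.2
  by_cases h0 : ord g w = 0
  · have hs3 := hs2.resolve_left (by simpa using h0)
    have key : ∀ {w w' : ℂ}, 0 < w.re → 0 < w'.re → ord g w = 0 → ord g w' = 0 →
        fan g g' w * |ord g' (-I * w')| = fan g g' w' * |ord g' (-I * w)| →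
        SameLeaf g w w' := by
      intro w w' b1 b2 e1 e2 e3; have u1 := h.ord_neg_of_ord_eq_zero b1 e1
      have u2 := h.ord_neg_of_ord_eq_zero b2 e2
      have e4 : funnelPos g w.re w.im = funnelPos g w'.re w'.im := by
        unfold fan at e3; rw [if_pos b1, if_pos b2] at e3
        have : 0 < |ord g' (-I * w)| * |ord g' (-I * w')| :=
          mul_pos (abs_pos.mpr u1.ne) (abs_pos.mpr u2.ne)
        refine mul_right_cancel₀ this.ne' ?_; linarith
      have p1 := h.fst.sol_one_of_axisValue b1 e1; have p2 := h.fst.sol_one_of_axisValue b2 e2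
      rw [e4, ← p2] at p1; obtain ⟨f, hf, hfe⟩ := h.fst.exists_isLeafFun w.re w.im
      refine ⟨_, f, hf, hfe, ?_, Or.inr (mul_pos b1 b2)⟩
      have q1 : f 1 = sol g w.re w.im 1 := by
        rw [← hfe]; exact (h.fst.sol_eq hf.isSol b1 one_pos).symm
      have := h.fst.sol_unique hf.isSol (h.fst.isSol b2 w'.im) one_pos (by linarith) b2
      rwa [h.fst.sol_self b2] at this
    have a1 := h.re_mul_ord_neg hw h0; have a2 := h.re_mul_ord_neg hw' (hs1 ▸ h0)
    have hre : 0 < w.re * w'.re := by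
      have : 0 < (w.re * ord g' (-I * w)) * (w'.re * ord g' (-I * w')) :=
        mul_pos_of_neg_of_neg a1 a2
      have e : (w.re * ord g' (-I * w)) * (w'.re * ord g' (-I * w')) =
        (w.re * w'.re) * (ord g' (-I * w) * ord g' (-I * w')) := by ring
      rw [e] at this; exact (pos_iff_pos_of_mul_pos this).mpr hs3.1
    rcases pos_and_pos_or_neg_and_neg_of_mul_pos hre with ⟨b1, b2⟩ | ⟨b1, b2⟩
    · exact key b1 b2 h0 (hs1 ▸ h0) hs3.2
    · have := key (w := -w) (w' := -w') (by simpa using b1) (by simpa using b2)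
        (by rw [ord_neg, h0, neg_zero]) (by rw [ord_neg, ← hs1, h0, neg_zero])
        (by
          rw [fan_neg g g' w fun a b => rot_zero a b g', fan_neg g g' w' fun a b => rot_zero a b g',
            mul_neg, mul_neg, ord_neg, ord_neg, abs_neg, abs_neg]
          linarith [hs3.2])
      simpa using this.neg h.fst
  · obtain ⟨f, hf, hfe⟩ := h.fst.exists_isLeafFun w.re w.im
    exact ⟨_, f, hf, hfe, hf.eq_of_axisValue h.fst h0 hs1.symm, Or.inl h0⟩

omit h in
lemma leafLabels_zero (g g' : ℝ → ℝ → ℝ) : leafLabels g g' 0 = 0 := by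
  have h : fan g g' 0 = 0 := by simp [fan, ord_zero]
  have h' : fan g' g 0 = 0 := by simp [fan, ord_zero]
  simp only [leafLabels, mul_zero, ord_zero, h, h']; rfl

lemma leafLabels_eq_zero {w : ℂ} (h0 : leafLabels g g' w = 0) : w = 0 :=
  h.eq_zero_of_ord (congrArg (fun p => p.1.1) h0) (congrArg (fun p => p.2.1) h0)

lemma leafLabels_injective : Function.Injective (leafLabels g g') := by
  intro w1 w2 he
  by_cases h1 : w1 = 0
  · rw [h1, leafLabels_zero] at he; rw [h1, h.leafLabels_eq_zero he.symm]
  by_cases h2 : w2 = 0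
  · rw [h2, leafLabels_zero] at he; rw [h2, h.leafLabels_eq_zero he]
  have hr1 : -I * w1 ≠ 0 := mul_ne_zero (by simp) h1
  have hr2 : -I * w2 ≠ 0 := mul_ne_zero (by simp) h2
  have hself : ∀ {g g' : ℝ → ℝ → ℝ} {w : ℂ}, SlopePair g g' L → w ≠ 0 →
      SameLabel (leafLabels g g' w) (leafLabels g g' w) := by
    intro g g' w h hw; refine ⟨rfl, ?_⟩
    by_cases h0 : ord g w = 0
    · exact Or.inr ⟨mul_self_pos.mpr fun h1 => hw (h.eq_zero_of_ord h0 h1), rfl⟩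
    · exact Or.inl h0
  have hsw : leafLabels g' g (-I * w1) = leafLabels g' g (-I * w2) := by
    rw [leafLabels_swap, leafLabels_swap, he]
  obtain ⟨c, f, hf, f1, f2, f3⟩ := h.sameLeaf_of_sameLabel h1 h2 (by
    have := hself h h1; rwa [← he])
  obtain ⟨c', k, hk, k1, k2, k3⟩ := h.swap.sameLeaf_of_sameLabel hr1 hr2 (by
    have := hself h.swap hr1; rwa [← hsw])
  have k1 : k w1.im = -w1.re := by simpa using k1
  have k2 : k w2.im = -w2.re := by simpa using k2
  have hne : ∀ x, (0 < x * w1.re ∨ c ≠ 0) → (x, f x) ≠ (0 : ℝ × ℝ) := by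
    intro x hx h0; have e1 : x = 0 := congrArg Prod.fst h0
    have e2 : f x = 0 := congrArg Prod.snd h0; rw [e1, zero_mul] at hx; rw [e1, hf.zero] at e2
    exact hx.elim (lt_irrefl _) fun h => h e2
  have key : ∀ {w w' : ℂ}, f w.re = w.im → f w'.re = w'.im → k w.im = -w.re → k w'.im = -w'.re →
      w.re < w'.re → (∀ x ∈ Icc w.re w'.re, (x, f x) ≠ (0 : ℝ × ℝ)) → False := by
    intro w w' a1 a2 b1 b2 hlt hn; have := h.cross_pos hf hk hlt (by rw [a1, b1]; ring) hn
    rw [a2, b2] at this; linarith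
  have hmem : ∀ x, (x ∈ Icc w1.re w2.re ∨ x ∈ Icc w2.re w1.re) → (0 < x * w1.re ∨ c ≠ 0) := by
    intro x hx; rcases f3 with hc | hp
    · exact Or.inr hc
    · left; rcases pos_and_pos_or_neg_and_neg_of_mul_pos hp with ⟨b1, b2⟩ | ⟨b1, b2⟩
      · refine mul_pos ?_ b1; rcases hx with hx | hx <;> linarith [hx.1]
      · refine mul_pos_of_neg_of_neg ?_ b1; rcases hx with hx | hx <;> linarith [hx.2]
  rcases lt_trichotomy w1.re w2.re with hlt | heq | hlt
  · exact (key f1 f2 k1 k2 hlt fun x hx => hne x (hmem x (Or.inl hx))).elim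
  · refine ext heq ?_; rw [← f1, ← f2, heq]
  · exact (key f2 f1 k2 k1 hlt fun x hx => hne x (hmem x (Or.inr hx))).elim

/-- The possible labels of points. -/
def _root_.Umbilic.labelSet (c c' : ℝ) : Set ((ℝ × ℝ) × (ℝ × ℝ)) :=
  {p | IsLabel c p.1.1 p.1.2 p.2.1 ∧ IsLabel c' p.2.1 p.2.2 p.1.1}

omit h in
lemma _root_.Umbilic.neg_mem_labelSet {c c' : ℝ} {p : (ℝ × ℝ) × (ℝ × ℝ)}
    (h : p ∈ labelSet c c') : -p ∈ labelSet c c' := ⟨h.1.neg, h.2.neg⟩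

lemma leafLabels_mem (w : ℂ) :
    leafLabels g g' w ∈ labelSet (fanFlag g) (fanFlag g') := by
  refine ⟨h.fst.isLabel g' w, ?_⟩; have h1 := h.snd.isLabel g (-I * w)
  have hr : -I * (-I * w) = -w := by rw [← mul_assoc, neg_mul_neg, I_mul_I, neg_one_mul]
  rw [hr, ord_neg] at h1; simpa [leafLabels] using h1.neg_third

lemma exists_exit {r : ℝ} (hr : 0 < r) :
    ∃ η, 0 < η ∧ ∀ y, |axisValue g r y| ≤ η → axisValue g' y (-r) ≤ -η := by
  set S : Set ℝ := closedBall 0 (L * r + 1)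
  have hc : Continuous fun y => max |axisValue g r y| (-axisValue g' y (-r)) :=
    (h.fst.continuous_axisValue_right r).abs.max
      (h.snd.continuous_axisValue.comp (by fun_prop : Continuous fun y : ℝ => (y, -r))).neg
  have hL := h.fst.nonneg
  obtain ⟨y0, -, hy0⟩ := (isCompact_closedBall (0 : ℝ) (L * r + 1)).exists_isMinOn
    ⟨0, mem_closedBall_self (by positivity)⟩ hc.continuousOn
  set m := max |axisValue g r y0| (-axisValue g' y0 (-r)) with hm
  have hm0 : 0 < m := by
    by_cases h0 : axisValue g r y0 = 0
    · have := h.ord_neg_of_ord_eq_zero (w := ⟨r, y0⟩) hr h0; simp only [ord] at this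
      refine lt_max_of_lt_right ?_; simpa using this
    · exact lt_max_of_lt_left (abs_pos.mpr h0)
  refine ⟨min (m / 2) 1, by positivity, fun y hy => ?_⟩
  have hyS : y ∈ closedBall (0 : ℝ) (L * r + 1) := by
    have h1 := h.fst.abs_sub_axisValue_le r y; rw [abs_of_pos hr] at h1
    rw [mem_closedBall_zero_iff, Real.norm_eq_abs]
    have := abs_sub_abs_le_abs_sub y (axisValue g r y); linarith [min_le_right (m / 2) 1]
  have h2 : m ≤ max |axisValue g r y| (-axisValue g' y (-r)) := hy0 hyS
  have h3 : |axisValue g r y| < m := by linarith [min_le_left (m / 2) 1]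
  rcases le_max_iff.mp h2 with h4 | h4
  · linarith
  · linarith [min_le_left (m / 2) 1]

lemma exists_leafLabels_eq_of_ne {r : ℝ} (hr : 0 < r) :
    ∃ η, 0 < η ∧ ∀ p ∈ labelSet (fanFlag g) (fanFlag g'), |p.1.1| < η → |p.2.1| < η → p.1.1 ≠ 0 →
      ∃ w : ℂ, ‖w‖ ≤ r ∧ leafLabels g g' w = p := by
  have hL := h.fst.nonneg; set ρ := r / (L + 2) with hρ; have hρ0 : 0 < ρ := by positivity
  obtain ⟨η, hη, hexit⟩ := h.exists_exit hρ0; refine ⟨min η ρ, by positivity, ?_⟩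
  have key : ∀ p ∈ labelSet (fanFlag g) (fanFlag g'), |p.1.1| < min η ρ → |p.2.1| < min η ρ →
      0 < p.1.1 → ∃ w : ℂ, ‖w‖ ≤ r ∧ leafLabels g g' w = p := by
    rintro ⟨⟨c, z⟩, ⟨u, v⟩⟩ ⟨hp1, hp2⟩ hc hu hc0; simp only at hp1 hp2 hc hu hc0
    obtain ⟨f, hf, hfe⟩ := h.fst.exists_isLeafFun 0 c; rw [SlopeField.axisValue_zero] at hf
    rw [abs_of_pos hc0] at hc; have hfl : ∀ x, ord g ⟨x, f x⟩ = c := fun x => hf.axisValue x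
    set φ : ℝ → ℝ := fun x => ord g' (-Complex.I * ⟨x, f x⟩) + fan g' g (-Complex.I * ⟨x, f x⟩) / |c|
    have hw : Continuous fun x : ℝ => -Complex.I * Complex.mk x (f x) := by
      refine continuous_const.mul ?_
      have : (fun x : ℝ => Complex.mk x (f x)) = fun x : ℝ => (x : ℂ) + (f x : ℂ) * Complex.I := by
        funext x; exact (Complex.re_add_im ⟨x, f x⟩).symm
      rw [this]
      exact (Complex.continuous_ofReal).add ((Complex.continuous_ofReal.comp hf.continuous).mul
        continuous_const)
    have hφ : Continuous φ := (h.snd.continuous_ord.comp hw).add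
      (((h.snd.continuous_fan h.fst).comp hw).div_const _)
    have hlab : ∀ x, IsLabel (fanFlag g') (ord g' (-Complex.I * ⟨x, f x⟩))
        (fan g' g (-Complex.I * ⟨x, f x⟩)) c := fun x => by
      have := (h.leafLabels_mem ⟨x, f x⟩).2; simp only [leafLabels, hfl] at this; exact this
    have hF := SlopeField.fanFlag_nonneg (g := g'); have habs : |c| = c := abs_of_pos hc0
    have hr1 : φ ρ ≤ -η - fanFlag g' := by
      have h1 : ord g' (-Complex.I * ⟨ρ, f ρ⟩) ≤ -η := by
        have := hexit (f ρ) (by rw [hf.axisValue, habs]; linarith [min_le_left η ρ])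
        simpa [ord] using this
      simp only [φ]; rw [(hlab ρ).2.1 (by linarith), habs, neg_div, mul_div_cancel_right₀ _ hc0.ne']
      linarith
    have hr2 : η + fanFlag g' ≤ φ (-ρ) := by
      have h1 : η ≤ ord g' (-Complex.I * ⟨-ρ, f (-ρ)⟩) := by
        have h2 := hf.axisValue (-ρ); rw [← neg_neg (f (-ρ)), SlopeField.axisValue_neg] at h2
        have := hexit (-f (-ρ)) (by
          rw [show axisValue g ρ (-f (-ρ)) = -c by linarith, abs_neg, habs]
          linarith [min_le_left η ρ])
        rw [SlopeField.axisValue_neg] at this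
        have e : ord g' (-Complex.I * ⟨-ρ, f (-ρ)⟩) = axisValue g' (f (-ρ)) ρ := by simp [ord]
        rw [e]; linarith
      simp only [φ]; rw [(hlab (-ρ)).1 (by linarith), habs, mul_div_cancel_right₀ _ hc0.ne']
      linarith
    have hv : |v / c| ≤ fanFlag g' := by
      rw [abs_div, habs, div_le_iff₀ hc0]; have := hp2.2.2; rwa [habs] at this
    have hu' := abs_lt.mp (hu.trans_le (min_le_left η ρ)); have hv' := abs_le.mp hv
    obtain ⟨x, hx, hxe⟩ := intermediate_value_Icc' (a := -ρ) (b := ρ) (by linarith) hφ.continuousOn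
      (show u + v / |c| ∈ Icc (φ ρ) (φ (-ρ)) by
        rw [habs]; constructor <;> linarith [hu'.1, hu'.2, hv'.1, hv'.2])
    obtain ⟨e1, e2⟩ := (hlab x).ext hc0.ne' hp2 hxe; refine ⟨⟨x, f x⟩, ?_, ?_⟩
    · refine (Complex.norm_le_abs_re_add_abs_im _).trans ?_; have h1 : |x| ≤ ρ := abs_le.mpr hx
      have h2 := h.fst.abs_sub_axisValue_le x (f x); rw [hf.axisValue] at h2
      have h3 := abs_sub_abs_le_abs_sub (f x) c; rw [habs] at h3
      have h4 : (L + 2) * ρ = r := by rw [hρ]; field_simp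
      have h5 : L * |x| ≤ L * ρ := mul_le_mul_of_nonneg_left h1 hL; simp only
      linarith [min_le_right η ρ]
    · have e3 := (h.leafLabels_mem ⟨x, f x⟩).1.1; simp only [leafLabels, hfl] at e3 ⊢
      rw [e3 hc0, e1, e2, hp1.1 hc0]
  intro p hp h1 h2 h0; rcases h0.lt_or_gt with h3 | h3
  · obtain ⟨w, hw, hwe⟩ := key (-p) (neg_mem_labelSet hp) (by simpa using h1) (by simpa using h2)
      (by simpa using h3)
    exact ⟨-w, by simpa using hw, by rw [leafLabels_neg, hwe, neg_neg]⟩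
  · exact key p hp h1 h2 h3

lemma exists_leafLabels_eq {r : ℝ} (hr : 0 < r) :
    ∃ η, 0 < η ∧ ∀ p ∈ labelSet (fanFlag g) (fanFlag g'), |p.1.1| < η → |p.2.1| < η →
      ∃ w : ℂ, ‖w‖ ≤ r ∧ leafLabels g g' w = p := by
  obtain ⟨η1, h1, H1⟩ := h.exists_leafLabels_eq_of_ne hr
  obtain ⟨η2, h2, H2⟩ := h.swap.exists_leafLabels_eq_of_ne hr
  refine ⟨min η1 η2, by positivity, fun p hp ha hb => ?_⟩
  by_cases h0 : p.1.1 = 0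
  · by_cases h0' : p.2.1 = 0
    · refine ⟨0, by simpa using hr.le, ?_⟩; have a1 := hp.1.2.2; have a2 := hp.2.2.2
      rw [h0', abs_zero, mul_zero, abs_nonpos_iff] at a1
      rw [h0, abs_zero, mul_zero, abs_nonpos_iff] at a2; rw [leafLabels_zero]
      exact (Prod.ext (Prod.ext h0 a1) (Prod.ext h0' a2)).symm
    · have hp' : ((p.2, -p.1) : (ℝ × ℝ) × (ℝ × ℝ)) ∈ labelSet (fanFlag g') (fanFlag g) :=
        ⟨hp.2.neg_third, by simpa using hp.1.neg.neg_third⟩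
      obtain ⟨w, hw, hwe⟩ := H2 (p.2, -p.1) hp' (hb.trans_le (min_le_right _ _))
        (by simpa using ha.trans_le (min_le_right _ _)) h0'
      refine ⟨I * w, by simpa using hw, ?_⟩; have := leafLabels_swap g g' (I * w)
      rw [← mul_assoc, neg_mul, I_mul_I, neg_neg, one_mul, hwe] at this
      have e1 : p.2 = (leafLabels g g' (I * w)).2 := congrArg Prod.fst this
      have e2 : p.1 = (leafLabels g g' (I * w)).1 := neg_injective (congrArg Prod.snd this)
      exact (Prod.ext e2 e1).symm
  · exact H1 p hp (ha.trans_le (min_le_left _ _)) (hb.trans_le (min_le_left _ _)) h0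

end SlopePair

/-- The points with labels less than `η`. -/
def labelBox (g g' : ℝ → ℝ → ℝ) (η : ℝ) : Set ℂ :=
  {w | |ord g w| < η ∧ |ord g' (-I * w)| < η}

namespace SlopePair

variable {g g' m m' : ℝ → ℝ → ℝ} {L L' : ℝ}

lemma isOpen_labelBox (h : SlopePair g g' L) (η : ℝ) : IsOpen (labelBox g g' η) :=
  (isOpen_lt h.fst.continuous_ord.abs continuous_const).inter
    (isOpen_lt (h.snd.continuous_ord.comp (continuous_const.mul continuous_id)).abs continuous_const)

lemma zero_mem_labelBox (g g' : ℝ → ℝ → ℝ) {η : ℝ} (hη : 0 < η) : 0 ∈ labelBox g g' η := by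
  simp [labelBox, ord_zero, hη]

lemma exists_labelBox_subset (h : SlopePair g g' L) {r : ℝ} (hr : 0 < r) :
    ∃ η, 0 < η ∧ (labelBox g g' η ⊆ closedBall 0 r) ∧ ∀ p ∈ labelSet (fanFlag g) (fanFlag g'),
      |p.1.1| < η → |p.2.1| < η → ∃ w : ℂ, ‖w‖ ≤ r ∧ leafLabels g g' w = p := by
  obtain ⟨η, hη, H⟩ := h.exists_leafLabels_eq hr; refine ⟨η, hη, fun w hw => ?_, H⟩
  obtain ⟨w', hw', he⟩ := H _ (h.leafLabels_mem w) hw.1 hw.2; rw [← h.leafLabels_injective he]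
  simpa using hw'

/-- Two pairs of foliations with the same flags are conjugate near the origin. -/
lemma exists_conj (h : SlopePair g g' L) (k : SlopePair m m' L') (h1 : fanFlag g = fanFlag m)
    (h2 : fanFlag g' = fanFlag m') {r : ℝ} (hr : 0 < r) :
    ∃ (η : ℝ) (e : OpenPartialHomeomorph ℂ ℂ), 0 < η ∧ e.source = labelBox g g' η ∧ e.target =
      labelBox m m' η ∧ labelBox g g' η ⊆ closedBall 0 r ∧ labelBox m m' η ⊆ closedBall 0 r ∧ (∀ w ∈
      labelBox g g' η, leafLabels m m' (e w) = leafLabels g g' w) := by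
  obtain ⟨η1, hη1, hs1, H1⟩ := h.exists_labelBox_subset hr
  obtain ⟨η2, hη2, hs2, H2⟩ := k.exists_labelBox_subset hr; set η := min η1 η2
  have hη : 0 < η := lt_min hη1 hη2; have hl : η ≤ η1 := min_le_left _ _
  have hl' : η ≤ η2 := min_le_right _ _
  have ht1 : labelBox g g' η ⊆ closedBall 0 r := fun w hw =>
    hs1 ⟨hw.1.trans_le hl, hw.2.trans_le hl⟩
  have ht2 : labelBox m m' η ⊆ closedBall 0 r := fun w hw =>
    hs2 ⟨hw.1.trans_le hl', hw.2.trans_le hl'⟩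
  have ex1 : ∀ w : ℂ, ∃ w', w ∈ labelBox g g' η → leafLabels m m' w' = leafLabels g g' w := by
    intro w
    by_cases hw : w ∈ labelBox g g' η
    · obtain ⟨w', -, he⟩ := H2 (leafLabels g g' w) (by rw [← h1, ← h2]; exact h.leafLabels_mem w)
        (hw.1.trans_le hl') (hw.2.trans_le hl')
      exact ⟨w', fun _ => he⟩
    · exact ⟨0, fun h => (hw h).elim⟩
  have ex2 : ∀ w : ℂ, ∃ w', w ∈ labelBox m m' η → leafLabels g g' w' = leafLabels m m' w := by
    intro w
    by_cases hw : w ∈ labelBox m m' η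
    · obtain ⟨w', -, he⟩ := H1 (leafLabels m m' w) (by rw [h1, h2]; exact k.leafLabels_mem w)
        (hw.1.trans_le hl) (hw.2.trans_le hl)
      exact ⟨w', fun _ => he⟩
    · exact ⟨0, fun h => (hw h).elim⟩
  choose F hF using ex1; choose G hG using ex2
  have hFm : ∀ w ∈ labelBox g g' η, F w ∈ labelBox m m' η := by
    intro w hw; have := hF w hw; have e1 : ord m (F w) = ord g w := congrArg (fun p => p.1.1) this
    have e2 : ord m' (-I * F w) = ord g' (-I * w) := congrArg (fun p => p.2.1) this
    exact ⟨by rw [e1]; exact hw.1, by rw [e2]; exact hw.2⟩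
  have hGm : ∀ w ∈ labelBox m m' η, G w ∈ labelBox g g' η := by
    intro w hw; have := hG w hw; have e1 : ord g (G w) = ord m w := congrArg (fun p => p.1.1) this
    have e2 : ord g' (-I * G w) = ord m' (-I * w) := congrArg (fun p => p.2.1) this
    exact ⟨by rw [e1]; exact hw.1, by rw [e2]; exact hw.2⟩
  have cont : ∀ {g g' m m' : ℝ → ℝ → ℝ} {L L' : ℝ} {F : ℂ → ℂ}, SlopePair g g' L →
      SlopePair m m' L' → (∀ w ∈ labelBox g g' η, leafLabels m m' (F w) = leafLabels g g' w) →
      (∀ w ∈ labelBox g g' η, F w ∈ closedBall (0 : ℂ) r) →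
      ContinuousOn F (labelBox g g' η) := by
    intro g g' m m' L L' F h k hF hb w hw
    refine (isCompact_closedBall (0 : ℂ) r).tendsto_nhds_of_unique_mapClusterPt ?_ ?_
    · filter_upwards [self_mem_nhdsWithin] with z hz using hb z hz
    · intro y _ hy; refine k.leafLabels_injective ?_; rw [hF w hw]
      have c1 : MapClusterPt (leafLabels m m' y) (𝓝[labelBox g g' η] w)
          (leafLabels m m' ∘ F) := hy.tendsto_comp k.continuous_leafLabels.continuousAt
      have c2 : Tendsto (leafLabels m m' ∘ F) (𝓝[labelBox g g' η] w)
          (𝓝 (leafLabels g g' w)) := by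
        refine ((h.continuous_leafLabels.tendsto w).mono_left nhdsWithin_le_nhds).congr' ?_
        filter_upwards [self_mem_nhdsWithin] with z hz using (hF z hz).symm
      exact eq_of_nhds_neBot (c1.neBot.mono (inf_le_inf_left _ c2))
  exact ⟨η, {
    toFun := F
    invFun := G
    source := labelBox g g' η
    target := labelBox m m' η
    map_source' := hFm
    map_target' := hGm
    left_inv' := fun w hw => h.leafLabels_injective ((hG _ (hFm w hw)).trans (hF w hw))
    right_inv' := fun w hw => k.leafLabels_injective ((hF _ (hGm w hw)).trans (hG w hw))
    open_source := h.isOpen_labelBox η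
    open_target := k.isOpen_labelBox η
    continuousOn_toFun := cont h k hF fun w hw => ht2 (hFm w hw)
    continuousOn_invFun := cont k h hG fun w hw => ht1 (hGm w hw) }, hη, rfl, rfl, ht1, ht2, hF⟩

end SlopePair

/-! ### Singular scalar equations `x s' = k(x, s)` -/

/-- Solutions on the positive half-line of the equation `x s' = k(x, s)`. -/
def IsSlopeSol (k : ℝ → ℝ → ℝ) (s : ℝ → ℝ) : Prop := ∀ x, 0 < x → HasDerivAt s (k x (s x) / x) x

section SlopeSol

variable {k : ℝ → ℝ → ℝ} {s : ℝ → ℝ}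

lemma IsSlopeSol.neg (hs : IsSlopeSol k s) : IsSlopeSol (fun x y => -k x (-y)) (-s) := by
  intro x hx; have := (hs x hx).neg; simpa [neg_div] using this

lemma IsSlopeSol.barrier_le (hs : IsSlopeSol k s) {σ σ' : ℝ → ℝ} {x0 : ℝ}
    (hσ : ∀ x ∈ Ioc 0 x0, HasDerivAt σ (σ' x) x) (hk : ∀ x ∈ Ioc 0 x0, k x (σ x) < x * σ' x)
    (h0 : σ x0 ≤ s x0) : ∀ x ∈ Ioc 0 x0, σ x ≤ s x := by
  have key : ∀ z ∈ Ioc 0 x0, s z = σ z → ∀ x ∈ Ioo 0 z, σ x < s x := by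
    intro z hz hze x hx
    have hmem : ∀ t ∈ Icc (-z) (-x), -t ∈ Ioc 0 x0 := fun t ht =>
      ⟨by linarith [ht.2, hx.1], by linarith [ht.1, hz.2]⟩
    have hd : ∀ t ∈ Icc (-z) (-x), HasDerivAt (fun t => s (-t) - σ (-t))
        (-(k (-t) (s (-t)) / (-t) - σ' (-t))) t := fun t ht => by
      have h1 := (hs (-t) (hmem t ht).1).scomp t (hasDerivAt_neg t)
      have h2 := (hσ (-t) (hmem t ht)).scomp t (hasDerivAt_neg t)
      convert! h1.sub h2 using 1
      simp only [smul_eq_mul]; ring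
    have := pos_of_hasDerivAt_pos_of_zero (D := fun t => s (-t) - σ (-t)) (a := -z) (b := -x)
      (fun t ht => (hd t ht).continuousAt.continuousWithinAt) (by simp [hze])
      (fun t ht h0 => ⟨_, ?_, hd t ht⟩) (-x) ⟨by linarith [hx.2], le_rfl⟩
    · simp only [neg_neg] at this; linarith
    · have h3 := hk _ (hmem t ht); have h4 := (hmem t ht).1
      rw [sub_eq_zero.mp h0, neg_pos, sub_neg, div_lt_iff₀ h4]; linarith
  intro x hx; rcases hx.2.eq_or_lt with rfl | hlt
  · exact h0
  by_contra hn; push Not at hn; have hx0 : x0 ∈ Ioc 0 x0 := ⟨hx.1.trans_le hx.2, le_rfl⟩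
  have hc : ContinuousOn (fun t => s t - σ t) (Icc x x0) := fun t ht =>
    ((hs t (hx.1.trans_le ht.1)).continuousAt.sub
      (hσ t ⟨hx.1.trans_le ht.1, ht.2⟩).continuousAt).continuousWithinAt
  obtain ⟨z, hz, hze⟩ := intermediate_value_Icc hx.2 hc
    (show (0 : ℝ) ∈ Icc (s x - σ x) (s x0 - σ x0) from ⟨by linarith, by linarith⟩)
  rcases hz.1.eq_or_lt with rfl | hxz
  · simp only at hze; linarith
  · exact absurd (key z ⟨hx.1.trans_le hz.1, hz.2⟩ (sub_eq_zero.mp hze) x ⟨hx.1, hxz⟩) (by linarith)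

lemma IsSlopeSol.le_barrier (hs : IsSlopeSol k s) {c x0 : ℝ}
    (hk : ∀ x ∈ Ioc 0 x0, 0 < k x c) (h0 : s x0 ≤ c) : ∀ x ∈ Ioc 0 x0, s x ≤ c := by
  intro x hx
  have := hs.neg.barrier_le (σ := fun _ => -c) (σ' := fun _ => 0) (fun _ _ => hasDerivAt_const _ _)
    (fun x hx => by simpa using hk x hx) (neg_le_neg h0) x hx
  simpa using this

lemma IsSlopeSol.const_le (hs : IsSlopeSol k s) {c x0 : ℝ}
    (hk : ∀ x ∈ Ioc 0 x0, k x c < 0) (h0 : c ≤ s x0) : ∀ x ∈ Ioc 0 x0, c ≤ s x :=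
  hs.barrier_le (σ' := fun _ => 0) (fun _ _ => hasDerivAt_const _ _)
    (fun x hx => by simpa using hk x hx) h0

lemma exists_pos_of_pos (hk : Continuous (Function.uncurry k)) {c : ℝ} (h : 0 < k 0 c) :
    ∃ x1, 0 < x1 ∧ ∀ x ∈ Ioc 0 x1, 0 < k x c := by
  have h1 : Continuous fun x => k x c := hk.comp (by fun_prop : Continuous fun x : ℝ => (x, c))
  obtain ⟨δ, hδ, hδ'⟩ := Metric.eventually_nhds_iff.mp
    (h1.continuousAt.eventually (lt_mem_nhds (a := 0) (b := k 0 c) h))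
  refine ⟨δ / 2, by positivity, fun x hx => hδ' ?_⟩; rw [Real.dist_eq, sub_zero, abs_of_pos hx.1]
  linarith [hx.2]

lemma exists_neg_of_neg (hk : Continuous (Function.uncurry k)) {c : ℝ} (h : k 0 c < 0) :
    ∃ x1, 0 < x1 ∧ ∀ x ∈ Ioc 0 x1, k x c < 0 := by
  obtain ⟨x1, h1, h2⟩ := exists_pos_of_pos (k := fun x y => -k x y) hk.neg (c := c) (by simpa)
  exact ⟨x1, h1, fun x hx => by simpa using h2 x hx⟩

/-- Bounded solutions do not tend to points where `k` is positive. -/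
lemma IsSlopeSol.not_pos_of_tendsto (hk : Continuous (Function.uncurry k)) (hs : IsSlopeSol k s)
    {l : ℝ} (hl : Tendsto s (𝓝[>] 0) (𝓝 l)) : ¬0 < k 0 l := by
  intro hpos
  have h1 : Tendsto (fun x => k x (s x)) (𝓝[>] 0) (𝓝 (k 0 l)) :=
    (hk.tendsto (0, l)).comp ((tendsto_id.mono_left nhdsWithin_le_nhds).prodMk_nhds hl)
  obtain ⟨δ, hδ0, hδ⟩ := mem_nhdsGT_iff_exists_Ioo_subset.mp
    (h1.eventually (lt_mem_nhds (show k 0 l / 2 < k 0 l by linarith)))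
  have hδ0 : 0 < δ := hδ0; set m := k 0 l / 2; have hm : 0 < m := by positivity
  have hd : ∀ x ∈ Ioo 0 δ, HasDerivAt (fun x => s x - m * Real.log x) (k x (s x) / x - m * x⁻¹) x :=
    fun x hx => (hs x hx.1).sub ((Real.hasDerivAt_log hx.1.ne').const_mul m)
  have hmono : MonotoneOn (fun x => s x - m * Real.log x) (Ioo 0 δ) := by
    refine monotoneOn_of_deriv_nonneg (convex_Ioo _ _) (fun x hx => (hd x
      hx).continuousAt.continuousWithinAt) (fun x hx => (hd x (interior_subset
      hx)).differentiableAt.differentiableWithinAt) (fun x hx => ?_)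
    have hx' := interior_subset hx; rw [(hd x hx').deriv, div_eq_mul_inv, ← sub_mul]
    exact mul_nonneg (by have := hδ hx'; simp only [mem_ofPred_eq] at this; linarith)
      (inv_nonneg.mpr hx'.1.le)
  have h2 : Tendsto (fun x => s x - m * Real.log x) (𝓝[>] 0) atTop := by
    have h3 : Tendsto (fun x => -(m * Real.log x)) (𝓝[>] 0) atTop :=
      tendsto_neg_atBot_atTop.comp (Real.tendsto_log_nhdsGT_zero.const_mul_atBot hm)
    simpa [sub_eq_add_neg] using hl.add_atTop h3
  have h3 := h2.eventually (eventually_gt_atTop (s (δ / 2) - m * Real.log (δ / 2)))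
  obtain ⟨x, hx1, hx2⟩ := (h3.and (Ioo_mem_nhdsGT (show (0 : ℝ) < δ / 2 by positivity))).exists
  have := hmono ⟨hx2.1, by linarith [hx2.2]⟩ ⟨by positivity, by linarith⟩ hx2.2.le
  simp only at this; linarith

/-- Bounded solutions tend to zeros of `k(0, ·)`. -/
lemma IsSlopeSol.exists_tendsto (hk : Continuous (Function.uncurry k)) (hs : IsSlopeSol k s)
    {R : ℝ} (hR : ∀ᶠ x in 𝓝[>] 0, |s x| ≤ R) (h0 : ∀ u v, u < v → ∃ c ∈ Ioo u v, k 0 c ≠ 0) :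
    ∃ l, k 0 l = 0 ∧ Tendsto s (𝓝[>] 0) (𝓝 l) := by
  have hcross : ∀ c, k 0 c ≠ 0 → (∀ᶠ x in 𝓝[>] 0, s x ≤ c) ∨ ∀ᶠ x in 𝓝[>] 0, c ≤ s x := by
    intro c hc; rcases hc.lt_or_gt with h | h
    · obtain ⟨x1, hx1, hneg⟩ := exists_neg_of_neg hk h
      by_cases hex : ∃ x ∈ Ioc 0 x1, c ≤ s x
      · obtain ⟨x, hx, hcx⟩ := hex; right; filter_upwards [Ioc_mem_nhdsGT hx.1] with t ht
        exact hs.const_le (fun y hy => hneg y ⟨hy.1, hy.2.trans hx.2⟩) hcx t ht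
      · push Not at hex; left; filter_upwards [Ioc_mem_nhdsGT hx1] with t ht using (hex t ht).le
    · obtain ⟨x1, hx1, hpos⟩ := exists_pos_of_pos hk h
      by_cases hex : ∃ x ∈ Ioc 0 x1, s x ≤ c
      · obtain ⟨x, hx, hcx⟩ := hex; left; filter_upwards [Ioc_mem_nhdsGT hx.1] with t ht
        exact hs.le_barrier (fun y hy => hpos y ⟨hy.1, hy.2.trans hx.2⟩) hcx t ht
      · push Not at hex; right; filter_upwards [Ioc_mem_nhdsGT hx1] with t ht using (hex t ht).le
  obtain ⟨l, hl⟩ := tendsto_of_no_upcrossings (f := 𝓝[>] (0 : ℝ)) (u := s) dense_univ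
    (fun a _ b _ hab => by
      rintro ⟨ha, hb⟩; obtain ⟨c, hc, hc0⟩ := h0 a b hab; rcases hcross c hc0 with h | h
      · obtain ⟨x, h1, h2⟩ := (hb.and_eventually h).exists; linarith [hc.2]
      · obtain ⟨x, h1, h2⟩ := (ha.and_eventually h).exists; linarith [hc.1])
    ⟨R, by simpa using hR.mono fun x hx => (abs_le.mp hx).2⟩
    ⟨-R, by simpa using hR.mono fun x hx => (abs_le.mp hx).1⟩
  refine ⟨l, le_antisymm (not_lt.mp (hs.not_pos_of_tendsto hk hl)) (not_lt.mp fun hneg => ?_), hl⟩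
  refine hs.neg.not_pos_of_tendsto (k := fun x y => -k x (-y)) (l := -l) ?_ hl.neg (by simpa)
  exact (hk.comp (by fun_prop : Continuous fun p : ℝ × ℝ => (p.1, -p.2))).neg

/-- At most one solution tends to a zero where `k(0, ·)` is decreasing. -/
lemma IsSlopeSol.false_of_lt {s1 s2 : ℝ → ℝ} (hs₁ : IsSlopeSol k s1) (hs2 : IsSlopeSol k s2)
    (hlt : ∀ x, 0 < x → s1 x < s2 x) {l : ℝ} (h1 : Tendsto s1 (𝓝[>] 0) (𝓝 l))
    (h2 : Tendsto s2 (𝓝[>] 0) (𝓝 l)) (hk : ContDiff ℝ 1 (Function.uncurry k)) {d : ℝ}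
    (hd : HasDerivAt (k 0) d l) (hd0 : d < 0) : False := by
  have hst := (hk.contDiffAt (x := ((0 : ℝ), l))).hasStrictFDerivAt (by norm_num)
  set D := fderiv ℝ (Function.uncurry k) ((0 : ℝ), l)
  have hD : D (0, 1) = d := by
    have h3 : HasDerivAt (fun y : ℝ => ((0 : ℝ), y)) (0, 1) l :=
      (hasDerivAt_const l (0 : ℝ)).prodMk (hasDerivAt_id l)
    exact (hst.hasFDerivAt.comp_hasDerivAt l h3).unique hd
  have hs1 : Tendsto (fun x => ((x, s2 x), (x, s1 x))) (𝓝[>] 0)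
      (𝓝 (((0 : ℝ), l), ((0 : ℝ), l))) :=
    ((tendsto_id.mono_left nhdsWithin_le_nhds).prodMk_nhds h2).prodMk_nhds
      ((tendsto_id.mono_left nhdsWithin_le_nhds).prodMk_nhds h1)
  have hb := hs1.eventually (hst.isLittleO.def (c := -d / 2) (by linarith))
  obtain ⟨δ, hδ0, hδ⟩ := mem_nhdsGT_iff_exists_Ioo_subset.mp hb; have hδ0 : 0 < δ := hδ0
  have hanti : ∀ x ∈ Ioo 0 δ, k x (s2 x) - k x (s1 x) ≤ 0 := by
    intro x hx; have h4 := hδ hx; have h5 := hlt x hx.1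
    have h6 : D ((x, s2 x) - (x, s1 x)) = (s2 x - s1 x) * d := by
      rw [← hD, show ((x, s2 x) - (x, s1 x) : ℝ × ℝ) = (s2 x - s1 x) • ((0 : ℝ), (1 : ℝ)) by
        ext <;> simp, map_smul, smul_eq_mul]
    simp only [mem_ofPred_eq, h6, Function.uncurry] at h4
    have h7 : ‖((x, s2 x) - (x, s1 x) : ℝ × ℝ)‖ = s2 x - s1 x := by
      rw [Prod.mk_sub_mk, sub_self, Prod.norm_mk, norm_zero, Real.norm_eq_abs,
        abs_of_pos (by linarith)]
      exact max_eq_right (by linarith)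
    rw [h7] at h4; have := (abs_le.mp h4).2; nlinarith
  have hdd : ∀ x ∈ Ioo 0 δ, HasDerivAt (fun x => s2 x - s1 x)
      (k x (s2 x) / x - k x (s1 x) / x) x := fun x hx => (hs2 x hx.1).sub (hs₁ x hx.1)
  have hant : AntitoneOn (fun x => s2 x - s1 x) (Ioo 0 δ) := by
    refine antitoneOn_of_deriv_nonpos (convex_Ioo _ _) (fun x hx => (hdd x
      hx).continuousAt.continuousWithinAt) (fun x hx => (hdd x (interior_subset
      hx)).differentiableAt.differentiableWithinAt) (fun x hx => ?_)
    have hx' := interior_subset hx; rw [(hdd x hx').deriv, ← sub_div]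
    exact div_nonpos_of_nonpos_of_nonneg (hanti x hx') hx'.1.le
  have h8 : Tendsto (fun x => s2 x - s1 x) (𝓝[>] 0) (𝓝 0) := by simpa using h2.sub h1
  have h9 := hlt (δ / 2) (by positivity)
  obtain ⟨x, hx1, hx2⟩ := ((h8.eventually (gt_mem_nhds (sub_pos.mpr h9))).and
    (Ioo_mem_nhdsGT (show (0 : ℝ) < δ / 2 by positivity))).exists
  have := hant ⟨hx2.1, by linarith [hx2.2]⟩ ⟨by positivity, by linarith⟩ hx2.2.le; simp only at this
  linarith

end SlopeSol

/-- The slope field extends, in polar coordinates, to the singular point: `k(x, s) + s` is the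
value of `g` at `(x, x s)`. -/
structure IsBlowup (g k : ℝ → ℝ → ℝ) : Prop where
  contDiff : ContDiff ℝ 1 (Function.uncurry k)
  eq : ∀ x s, 0 < x → g x (x * s) = k x s + s

namespace IsBlowup

variable {g k : ℝ → ℝ → ℝ} {L : ℝ}

lemma isSlopeSol (h : IsBlowup g k) {f : ℝ → ℝ} (hf : IsSol g f) :
    IsSlopeSol k fun x => f x / x := by
  intro x hx; have h1 := (hf x hx).div (hasDerivAt_id x) hx.ne'
  convert! h1 using 1
  have h2 := h.eq x (f x / x) hx; rw [mul_div_cancel₀ _ hx.ne'] at h2; rw [h2]; simp only [id]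
  field_simp; ring

lemma axisValue_eq_zero (hg : SlopeField g L) {f : ℝ → ℝ} (hf : IsSol g f) {R : ℝ}
    (hR : ∀ᶠ x in 𝓝[>] 0, |f x / x| ≤ R) : axisValue g 1 (f 1) = 0 := by
  have h1 := hg.tendsto_axisValue hf one_pos
  refine tendsto_nhds_unique h1 (squeeze_zero_norm' (a := fun x => R * x) ?_ ?_)
  · filter_upwards [hR, self_mem_nhdsWithin] with x hx hx0; have hx0 : 0 < x := hx0
    rwa [abs_div, abs_of_pos hx0, div_le_iff₀ hx0] at hx
  · have : Tendsto (fun x : ℝ => R * x) (𝓝 0) (𝓝 (R * 0)) := (continuous_const_mul R).tendsto 0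
    rw [mul_zero] at this; exact this.mono_left nhdsWithin_le_nhds

lemma exists_tendsto (hg : SlopeField g L) (h : IsBlowup g k)
    (h0 : ∀ u v, u < v → ∃ c ∈ Ioo u v, k 0 c ≠ 0) {f : ℝ → ℝ} (hf : IsSol g f)
    (hf0 : axisValue g 1 (f 1) = 0) :
    ∃ l, k 0 l = 0 ∧ Tendsto (fun x => f x / x) (𝓝[>] 0) (𝓝 l) := by
  refine (h.isSlopeSol hf).exists_tendsto h.contDiff.continuous (R := L) ?_ h0
  filter_upwards [self_mem_nhdsWithin] with x hx; have hx : 0 < x := hx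
  have := hg.abs_sub_axisValue_le x (f x)
  rwa [hg.axisValue_eq hf hx one_pos, hf0, sub_zero, abs_of_pos hx, ← div_le_iff₀ hx,
    ← abs_of_pos hx, ← abs_div, abs_of_pos hx] at this

/-- At most one leaf tends to the origin with a slope where `k(0, ·)` decreases. -/
lemma eq_of_tendsto (hg : SlopeField g L) (h : IsBlowup g k) {f1 f2 : ℝ → ℝ}
    (hf1 : IsSol g f1) (hf2 : IsSol g f2) {l d : ℝ}
    (h1 : Tendsto (fun x => f1 x / x) (𝓝[>] 0) (𝓝 l))
    (h2 : Tendsto (fun x => f2 x / x) (𝓝[>] 0) (𝓝 l)) (hd : HasDerivAt (k 0) d l) (hd0 : d < 0) :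
    f1 1 = f2 1 := by
  have key : ∀ {f1 f2 : ℝ → ℝ}, IsSol g f1 → IsSol g f2 →
      Tendsto (fun x => f1 x / x) (𝓝[>] 0) (𝓝 l) → Tendsto (fun x => f2 x / x) (𝓝[>] 0) (𝓝 l) →
      ¬f1 1 < f2 1 := fun hf1 hf2 h1 h2 hlt =>
    (h.isSlopeSol hf1).false_of_lt (h.isSlopeSol hf2) (fun x hx => (div_lt_div_iff_of_pos_right
      hx).mpr (hg.sol_lt hf1 hf2 one_pos hx hlt)) h1 h2 h.contDiff hd hd0
  exact le_antisymm (not_lt.mp (key hf2 hf1 h2 h1)) (not_lt.mp (key hf1 hf2 h1 h2))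

/-- If solutions cannot leave a neighbourhood of `μ` for decreasing `x`, then the edges of the
funnel lie on either side of it. -/
lemma edge_le (hg : SlopeField g L) (h : IsBlowup g k) {μ x1 : ℝ}
    (hstay : ∀ s, IsSlopeSol k s → ∀ x ∈ Ioc 0 x1, s x = μ →
      ∃ R, ∀ᶠ t in 𝓝[>] 0, |s t| ≤ R) {ft fb : ℝ → ℝ} (hft : IsSol g ft) (hfb : IsSol g fb)
    (ht : ft 1 = funnelTop g) (hb : fb 1 = funnelBot g) :
    ∀ x ∈ Ioc 0 x1, fb x / x ≤ μ ∧ μ ≤ ft x / x := by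
  intro x hx; have hf := hg.isSol hx.1 (x * μ); have hfx := hg.sol_self hx.1 (x * μ)
  obtain ⟨R, hR⟩ := hstay _ (h.isSlopeSol hf) x hx (by rw [hfx]; field_simp [hx.1.ne'])
  have h0 := axisValue_eq_zero hg hf hR; rw [hg.mem_funnel_iff, ← ht, ← hb] at h0
  have h1 := hg.sol_le hfb hf one_pos hx.1 h0.1; have h2 := hg.sol_le hf hft one_pos hx.1 h0.2
  rw [hfx] at h1 h2
  exact ⟨(div_le_iff₀ hx.1).mpr (by linarith), (le_div_iff₀ hx.1).mpr (by linarith)⟩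

end IsBlowup

/-- A pair of coefficients of class `C^1` on the plane, uniformly close to `1` and `b`. -/
structure CoeffPair (a c : ℂ → ℂ) (b : ℂ) (ε : ℝ) : Prop where
  contDiff_fst : ContDiff ℝ 1 a
  contDiff_snd : ContDiff ℝ 1 c
  norm_fst_sub : ∀ z, ‖a z - 1‖ ≤ ε
  norm_snd_sub : ∀ z, ‖c z - b‖ ≤ ε
  norm_lt : ‖b‖ + 2 * ε < 1
  fst_zero : a 0 = 1
  snd_zero : c 0 = b

/-- A vector tangent, at `w`, to the first foliation on the double cover `w ↦ w ^ 2`. -/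
def coverVec (a c : ℂ → ℂ) (w : ℂ) : ℂ := conj w * (a (w ^ 2) * w + c (w ^ 2) * conj w)

/-- Its slope. -/
def slopeOf (a c : ℂ → ℂ) (x y : ℝ) : ℝ :=
  (coverVec a c (mk x y)).im / (coverVec a c (mk x y)).re

/-- The vector `coverVec` at `x (1 + i s)`, divided by `x ^ 2`. -/
def blowupVec (a c : ℂ → ℂ) (x s : ℝ) : ℂ :=
  a (((x : ℂ) * mk 1 s) ^ 2) * ((1 + s ^ 2 : ℝ) : ℂ) + c (((x : ℂ) * mk 1 s) ^ 2) * (mk 1 (-s)) ^ 2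

/-- The cubic polynomial whose roots are the slopes of the leaves tending to the origin. -/
def slopeCubic (b : ℂ) (s : ℝ) : ℝ :=
  (b.re - 1) * s ^ 3 - 3 * b.im * s ^ 2 - (1 + 3 * b.re) * s + b.im

namespace CoeffPair

variable {a c : ℂ → ℂ} {b : ℂ} {ε : ℝ}

variable (h : CoeffPair a c b ε)
include h

lemma neg : CoeffPair (fun z => a (-z)) (fun z => c (-z)) b ε where
  contDiff_fst := h.contDiff_fst.comp contDiff_neg
  contDiff_snd := h.contDiff_snd.comp contDiff_neg
  norm_fst_sub z := h.norm_fst_sub _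
  norm_snd_sub z := h.norm_snd_sub _
  norm_lt := h.norm_lt
  fst_zero := by simp [h.fst_zero]
  snd_zero := by simp [h.snd_zero]

lemma norm_snd_le (z : ℂ) : ‖c z‖ ≤ ‖b‖ + ε := by
  have := norm_add_le (c z - b) b; rw [sub_add_cancel] at this; linarith [h.norm_snd_sub z]

lemma norm_lt_norm (z : ℂ) : ‖c z‖ < ‖a z‖ := by
  have h1 := norm_sub_norm_le (1 : ℂ) (1 - a z); rw [sub_sub_cancel, norm_one, norm_sub_rev] at h1
  linarith [h.norm_fst_sub z, h.norm_snd_le z, h.norm_lt]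

lemma bounds {z u v : ℂ} {ρ : ℝ} (hρ : 0 ≤ ρ) (hu : u = ρ) (hv : ‖v‖ = ρ)
    : (1 - ‖b‖ - 2 * ε) * ρ ≤ (a z * u + c z * v).re ∧
      |(a z * u + c z * v).im| ≤ (‖b‖ + 2 * ε) * ρ := by
  have e : a z * u + c z * v = (ρ : ℂ) + ((a z - 1) * u + c z * v) := by rw [hu]; ring
  have hn : ‖(a z - 1) * u + c z * v‖ ≤ (‖b‖ + 2 * ε) * ρ := by
    refine (norm_add_le _ _).trans ?_
    rw [norm_mul, norm_mul, hv, hu, norm_real, Real.norm_of_nonneg hρ]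
    nlinarith [h.norm_fst_sub z, h.norm_snd_le z]
  rw [e, add_re, add_im, ofReal_re, ofReal_im, zero_add]
  have h1 := (abs_le.mp ((abs_re_le_norm _).trans hn)).1
  exact ⟨by nlinarith, (abs_im_le_norm _).trans hn⟩

omit h in
lemma coverVec_eq (a c : ℂ → ℂ) (w : ℂ) :
    coverVec a c w = a (w ^ 2) * (w * conj w) + c (w ^ 2) * conj w ^ 2 := by rw [coverVec]; ring

lemma coverVec_bounds (w : ℂ) : (1 - ‖b‖ - 2 * ε) * ‖w‖ ^ 2 ≤ (coverVec a c w).re ∧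
      |(coverVec a c w).im| ≤ (‖b‖ + 2 * ε) * ‖w‖ ^ 2 := by
  rw [coverVec_eq]; refine h.bounds (sq_nonneg _) ?_ ?_
  · rw [mul_conj, normSq_eq_norm_sq]
  · rw [norm_pow, norm_conj]

lemma coverVec_re_pos {w : ℂ} (hw : w ≠ 0) : 0 < (coverVec a c w).re :=
  (mul_pos (by linarith [h.norm_lt]) (pow_pos (norm_pos_iff.mpr hw) 2)).trans_le
    (h.coverVec_bounds w).1

omit h in
lemma coverVec_neg (a c : ℂ → ℂ) (w : ℂ) : coverVec a c (-w) = coverVec a c w := by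
  simp only [coverVec, map_neg, neg_sq]; ring

omit h in
lemma contDiff_mk {E : Type*} [NormedAddCommGroup E] [NormedSpace ℝ E] {n : WithTop ℕ∞}
    {f g : E → ℝ} (hf : ContDiff ℝ n f) (hg : ContDiff ℝ n g) :
    ContDiff ℝ n fun x => Complex.mk (f x) (g x) := by
  have : (fun x => Complex.mk (f x) (g x)) = fun x => (f x : ℂ) + (g x : ℂ) * Complex.I := by
    ext x; exact Complex.mk_eq_add_mul_I _ _
  rw [this]
  exact (Complex.ofRealCLM.contDiff.comp hf).add ((Complex.ofRealCLM.contDiff.comp hg).mul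
    contDiff_const)

omit h in
lemma contDiff_conj {n : WithTop ℕ∞} : ContDiff ℝ n (fun z : ℂ => conj z) :=
  conjCLE.contDiff

lemma contDiff_coverVec : ContDiff ℝ 1 (coverVec a c) := by
  have h2 : ContDiff ℝ 1 fun w : ℂ => w ^ 2 := contDiff_id.pow 2
  exact contDiff_conj.mul (((h.contDiff_fst.comp h2).mul contDiff_id).add
    ((h.contDiff_snd.comp h2).mul contDiff_conj))

lemma slopeField : SlopeField (slopeOf a c) ((‖b‖ + 2 * ε) / (1 - ‖b‖ - 2 * ε)) where
  contDiffOn := by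
    have h1 : ContDiff ℝ 1 fun p : ℝ × ℝ => coverVec a c (Complex.mk p.1 p.2) :=
      h.contDiff_coverVec.comp (contDiff_mk _root_.contDiff_fst _root_.contDiff_snd)
    refine ContDiffOn.div (Complex.imCLM.contDiff.comp h1).contDiffOn
      (Complex.reCLM.contDiff.comp h1).contDiffOn fun p hp => ?_
    refine (h.coverVec_re_pos fun h0 => hp ?_).ne'
    exact Prod.ext (congrArg Complex.re h0) (congrArg Complex.im h0)
  bound x y := by
    have h0 : (0 : ℝ) < 1 - ‖b‖ - 2 * ε := by linarith [h.norm_lt]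
    have hε : 0 ≤ ε := (norm_nonneg _).trans (h.norm_fst_sub 0)
    obtain ⟨h1, h2⟩ := h.coverVec_bounds (Complex.mk x y); set V := coverVec a c (Complex.mk x y)
    rcases eq_or_ne (Complex.mk x y) 0 with hw | hw
    · have : V = 0 := by simp only [V, hw, coverVec, map_zero, zero_mul]
      simp only [slopeOf]; rw [show coverVec a c (Complex.mk x y) = 0 from this]
      simpa using div_nonneg (by positivity) h0.le
    · have h3 : 0 < V.re := h.coverVec_re_pos hw
      rw [slopeOf, abs_div, abs_of_pos h3, div_le_div_iff₀ h3 h0]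
      have h4 : 0 ≤ ‖b‖ + 2 * ε := by positivity
      nlinarith [norm_nonneg b]
  even x y := by
    have : Complex.mk (-x) (-y) = -Complex.mk x y := rfl; rw [slopeOf, this, coverVec_neg]; rfl

lemma trans_pos {x y : ℝ} (hxy : (x, y) ≠ (0 : ℝ × ℝ)) :
    0 < 1 + slopeOf a c x y * slopeOf (fun z => a (-z)) (fun z => c (-z)) y (-x) := by
  set w := Complex.mk x y with hw
  have hw0 : w ≠ 0 := fun h0 => hxy (Prod.ext (congrArg Complex.re h0) (congrArg Complex.im h0))
  have hw' : Complex.mk y (-x) = -Complex.I * w := by apply Complex.ext <;> simp [hw]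
  have hw0' : -Complex.I * w ≠ 0 := mul_ne_zero (neg_ne_zero.mpr Complex.I_ne_zero) hw0
  have p1 := h.coverVec_re_pos hw0; have p2 := h.neg.coverVec_re_pos hw0'
  have e : coverVec (fun z => a (-z)) (fun z => c (-z)) (-Complex.I * w) =
      a (w ^ 2) * (w * conj w) - c (w ^ 2) * conj w ^ 2 := by
    have : -((-Complex.I * w) ^ 2) = w ^ 2 := by rw [mul_pow, neg_sq, Complex.I_sq]; ring
    simp only [coverVec, this, map_mul, map_neg, Complex.conj_I, neg_neg]
    linear_combination (-a (w ^ 2) * (w * conj w) + c (w ^ 2) * conj w ^ 2) * Complex.I_sq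
  have hn := h.norm_lt_norm (w ^ 2)
  have key : (coverVec a c w).re * (coverVec (fun z => a (-z)) (fun z => c (-z)) (-Complex.I * w)).re +
      (coverVec a c w).im * (coverVec (fun z => a (-z)) (fun z => c (-z)) (-Complex.I * w)).im =
      (‖w‖ ^ 2) ^ 2 * (‖a (w ^ 2)‖ ^ 2 - ‖c (w ^ 2)‖ ^ 2) := by
    rw [e, coverVec_eq]
    simp only [← Complex.normSq_eq_norm_sq, Complex.normSq_apply, pow_two (conj w), Complex.add_re,
      Complex.sub_re, Complex.add_im, Complex.sub_im, Complex.mul_re, Complex.mul_im,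
      Complex.conj_re, Complex.conj_im]
    ring
  have hpos : 0 < (‖w‖ ^ 2) ^ 2 * (‖a (w ^ 2)‖ ^ 2 - ‖c (w ^ 2)‖ ^ 2) := by
    have := norm_pos_iff.mpr hw0; have h2 := norm_nonneg (c (w ^ 2))
    exact mul_pos (by positivity) (by nlinarith)
  rw [slopeOf, slopeOf, hw', ← hw]
  have : 1 + (coverVec a c w).im / (coverVec a c w).re *
      ((coverVec (fun z => a (-z)) (fun z => c (-z)) (-Complex.I * w)).im /
        (coverVec (fun z => a (-z)) (fun z => c (-z)) (-Complex.I * w)).re) =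
      ((‖w‖ ^ 2) ^ 2 * (‖a (w ^ 2)‖ ^ 2 - ‖c (w ^ 2)‖ ^ 2)) / ((coverVec a c w).re *
        (coverVec (fun z => a (-z)) (fun z => c (-z)) (-Complex.I * w)).re) := by
    rw [← key]
    generalize (coverVec (fun z => a (-z)) (fun z => c (-z)) (-Complex.I * w)) = V at p2
    field_simp
  rw [this]; positivity

lemma blowupVec_re_pos (x s : ℝ) : 0 < (blowupVec a c x s).re := by
  have h1 : (0 : ℝ) < 1 + s ^ 2 := by positivity
  refine lt_of_lt_of_le ?_ (h.bounds h1.le rfl ?_).1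
  · exact mul_pos (by linarith [h.norm_lt]) h1
  · rw [norm_pow, ← normSq_eq_norm_sq, normSq_apply]; simp; ring

omit h in
lemma coverVec_mul (a c : ℂ → ℂ) (x s : ℝ) :
    coverVec a c (Complex.mk x (x * s)) = ((x ^ 2 : ℝ) : ℂ) * blowupVec a c x s := by
  have h1 : Complex.mk x (x * s) = (x : ℂ) * Complex.mk 1 s := by apply Complex.ext <;> simp
  have h2 : conj (Complex.mk 1 s) = Complex.mk 1 (-s) := rfl
  have h3 : Complex.mk 1 s * Complex.mk 1 (-s) = ((1 + s ^ 2 : ℝ) : ℂ) := by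
    apply Complex.ext
    · rw [Complex.mul_re, Complex.ofReal_re]; simp only; ring
    · rw [Complex.mul_im, Complex.ofReal_im]; simp only; ring
  rw [coverVec_eq, blowupVec, h1, ← h3, map_mul, Complex.conj_ofReal, h2]; push_cast; ring

/-- The polar form of the slope field. -/
def blowup (a c : ℂ → ℂ) (x s : ℝ) : ℝ := (blowupVec a c x s).im / (blowupVec a c x s).re - s

lemma isBlowup : IsBlowup (slopeOf a c) (blowup a c) where
  contDiff := by
    have h2 : ContDiff ℝ 1 fun p : ℝ × ℝ => ((p.1 : ℂ) * Complex.mk 1 p.2) ^ 2 :=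
      ((Complex.ofRealCLM.contDiff.comp _root_.contDiff_fst).mul
        (contDiff_mk contDiff_const _root_.contDiff_snd)).pow 2
    have h1 : ContDiff ℝ 1 fun p : ℝ × ℝ => blowupVec a c p.1 p.2 := by
      refine ((h.contDiff_fst.comp h2).mul ?_).add ((h.contDiff_snd.comp h2).mul ?_)
      · exact Complex.ofRealCLM.contDiff.comp (contDiff_const.add (_root_.contDiff_snd.pow 2))
      · exact (contDiff_mk contDiff_const _root_.contDiff_snd.neg).pow 2
    exact ((Complex.imCLM.contDiff.comp h1).div (Complex.reCLM.contDiff.comp h1)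
      fun p => (h.blowupVec_re_pos p.1 p.2).ne').sub _root_.contDiff_snd
  eq x s hx := by
    have hx2 : x ^ 2 ≠ 0 := by positivity
    rw [slopeOf, coverVec_mul, blowup, Complex.re_ofReal_mul, Complex.im_ofReal_mul,
      mul_div_mul_left _ _ hx2]
    ring

lemma blowupVec_zero (s : ℝ) :
    blowupVec a c 0 s = Complex.mk (1 + s ^ 2 + b.re * (1 - s ^ 2) + 2 * b.im * s)
      (b.im * (1 - s ^ 2) - 2 * b.re * s) := by
  rw [blowupVec]
  simp only [Complex.ofReal_zero, zero_mul, ne_eq, OfNat.ofNat_ne_zero, not_false_eq_true, zero_pow,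
    h.fst_zero, h.snd_zero, pow_two (Complex.mk 1 (-s))]
  apply Complex.ext
  · rw [Complex.add_re, one_mul, Complex.ofReal_re, Complex.mul_re, Complex.mul_re, Complex.mul_im]
    simp only; ring
  · rw [Complex.add_im, one_mul, Complex.ofReal_im, Complex.mul_im, Complex.mul_re, Complex.mul_im]
    simp only; ring

lemma blowup_zero (s : ℝ) :
    blowup a c 0 s = slopeCubic b s / (1 + s ^ 2 + b.re * (1 - s ^ 2) + 2 * b.im * s) := by
  have h1 := h.blowupVec_re_pos 0 s; rw [h.blowupVec_zero] at h1
  rw [blowup, h.blowupVec_zero, slopeCubic]; rw [sub_eq_iff_eq_add, div_add' _ _ _ h1.ne']; congr 1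
  ring

lemma denom_pos (s : ℝ) :
    0 < 1 + s ^ 2 + b.re * (1 - s ^ 2) + 2 * b.im * s := by
  have h1 := h.blowupVec_re_pos 0 s; rwa [h.blowupVec_zero] at h1

lemma blowup_zero_eq_zero {s : ℝ} :
    blowup a c 0 s = 0 ↔ slopeCubic b s = 0 := by
  rw [h.blowup_zero, div_eq_zero_iff]; simp [(h.denom_pos s).ne']

lemma norm_lt_one : ‖b‖ < 1 := by
  have hε : 0 ≤ ε := (norm_nonneg _).trans (h.norm_fst_sub 0); linarith [h.norm_lt]

end CoeffPair

lemma one_sub_sq_pos {b : ℂ} (hb : ‖b‖ < 1) : 0 < 1 - b.re ^ 2 - b.im ^ 2 := by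
  have h1 := normSq_eq_norm_sq b; rw [normSq_apply] at h1; nlinarith [norm_nonneg b]

lemma re_lt_one {b : ℂ} (hb : ‖b‖ < 1) : b.re < 1 := (re_le_norm b).trans_lt hb

lemma slopeDenom_pos {b : ℂ} (hb : ‖b‖ < 1) (s : ℝ) :
    0 < 1 + s ^ 2 + b.re * (1 - s ^ 2) + 2 * b.im * s := by
  have h := one_sub_sq_pos hb; have h1 := re_lt_one hb
  have : 0 < (1 - b.re) * (1 + s ^ 2 + b.re * (1 - s ^ 2) + 2 * b.im * s) := by
    have e : (1 - b.re) * (1 + s ^ 2 + b.re * (1 - s ^ 2) + 2 * b.im * s) =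
      ((1 - b.re) * s + b.im) ^ 2 + (1 - b.re ^ 2 - b.im ^ 2) := by ring
    rw [e]; positivity
  exact pos_of_mul_pos_right this (by linarith)

lemma one_add_mul_pos {b : ℂ} (hb : ‖b‖ < 1) {s s' : ℝ} (hs : slopeCubic b s = 0)
    (hs' : slopeCubic b s' = 0) : 0 < 1 + s * s' := by
  rcases eq_or_ne s s' with rfl | hne
  · nlinarith [mul_self_nonneg s]
  have hU := slopeDenom_pos hb s; have hU' := slopeDenom_pos hb s'; have h1 := one_sub_sq_pos hb
  set R := 1 + s ^ 2 + b.re * (1 - s ^ 2) + 2 * b.im * s with hR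
  set R' := 1 + s' ^ 2 + b.re * (1 - s' ^ 2) + 2 * b.im * s' with hR'
  simp only [slopeCubic] at hs hs'
  have e1 : (1 + b.re + b.im * s) * (1 + s ^ 2) = R * (1 - s ^ 2) := by
    rw [hR]; linear_combination -s * hs
  have e2 : (s + b.im - b.re * s) * (1 + s ^ 2) = R * (2 * s) := by rw [hR]; linear_combination hs
  have e1' : (1 + b.re + b.im * s') * (1 + s' ^ 2) = R' * (1 - s' ^ 2) := by
    rw [hR']; linear_combination -s' * hs'
  have e2' : (s' + b.im - b.re * s') * (1 + s' ^ 2) = R' * (2 * s') := by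
    rw [hR']; linear_combination hs'
  have e : (1 - b.re ^ 2 - b.im ^ 2) * (s' - s) * ((1 + s ^ 2) * (1 + s' ^ 2)) =
      2 * (R * R') * (1 + s * s') * (s' - s) := by
    have l : (1 - b.re ^ 2 - b.im ^ 2) * (s' - s) * ((1 + s ^ 2) * (1 + s' ^ 2)) =
      ((1 + b.re + b.im * s) * (1 + s ^ 2)) * ((s' + b.im - b.re * s') * (1 + s' ^ 2)) -
        ((s + b.im - b.re * s) * (1 + s ^ 2)) * ((1 + b.re + b.im * s') * (1 + s' ^ 2)) := by ring
    rw [l, e1, e2, e1', e2']; ring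
  have e3 : (1 - b.re ^ 2 - b.im ^ 2) * ((1 + s ^ 2) * (1 + s' ^ 2)) =
      2 * (R * R') * (1 + s * s') := by
    refine mul_right_cancel₀ (sub_ne_zero.mpr hne.symm) ?_
    linear_combination e
  have h5 : 0 < 2 * (R * R') * (1 + s * s') := by rw [← e3]; positivity
  exact pos_of_mul_pos_right h5 (by positivity)

lemma exists_slopeCubic_ne_zero {b : ℂ} (hb : ‖b‖ < 1) {u v : ℝ} (huv : u < v) :
    ∃ s ∈ Ioo u v, slopeCubic b s ≠ 0 := by
  by_contra hcon; push Not at hcon; set d := (v - u) / 5 with hd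
  have hd0 : 0 < d := by rw [hd]; linarith
  have h1 := hcon (u + d) ⟨by linarith, by linarith⟩
  have h2 := hcon (u + 2 * d) ⟨by linarith, by linarith⟩
  have h3 := hcon (u + 3 * d) ⟨by linarith, by linarith⟩
  have h4 := hcon (u + 4 * d) ⟨by linarith, by linarith⟩; simp only [slopeCubic] at h1 h2 h3 h4
  have h5 : (b.re - 1) * (6 * d ^ 3) = 0 := by linear_combination h4 - 3 * h3 + 3 * h2 - h1
  have := re_lt_one hb; rcases mul_eq_zero.mp h5 with h | h
  · linarith
  · have : 0 < 6 * d ^ 3 := by positivity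
    linarith

namespace CoeffPair

variable {a c : ℂ → ℂ} {b : ℂ} {ε : ℝ}

lemma exists_tendsto (h : CoeffPair a c b ε) {f : ℝ → ℝ} (hf : IsSol (slopeOf a c) f)
    (hf0 : axisValue (slopeOf a c) 1 (f 1) = 0) :
    ∃ l, slopeCubic b l = 0 ∧ Tendsto (fun x => f x / x) (𝓝[>] 0) (𝓝 l) := by
  obtain ⟨l, hl, ht⟩ := h.isBlowup.exists_tendsto h.slopeField (fun u v huv => by
    obtain ⟨s, hs, h0⟩ := exists_slopeCubic_ne_zero h.norm_lt_one huv
    exact ⟨s, hs, fun h1 => h0 (h.blowup_zero_eq_zero.mp h1)⟩) hf hf0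
  exact ⟨l, h.blowup_zero_eq_zero.mp hl, ht⟩

lemma slopePair (h : CoeffPair a c b ε) :
    SlopePair (slopeOf a c) (slopeOf (fun z => a (-z)) (fun z => c (-z)))
      ((‖b‖ + 2 * ε) / (1 - ‖b‖ - 2 * ε)) where
  fst := h.slopeField
  snd := h.neg.slopeField
  trans x y hxy := h.trans_pos hxy
  acute f k hf hk hf0 hk0 := by
    obtain ⟨s, hs, h1⟩ := h.exists_tendsto hf hf0
    obtain ⟨s', hs', h2⟩ := h.neg.exists_tendsto hk hk0
    exact ⟨s, s', h1, h2, one_add_mul_pos h.norm_lt_one hs hs'⟩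

end CoeffPair

/-- A fan of leaves tending to the origin: its upper and lower edges, and the leaves in its
interior, have the given slopes there. -/
structure HasFan (g : ℝ → ℝ → ℝ) (σt σb σm : ℝ) : Prop where
  flag : fanFlag g = 1
  top : ∀ f, IsSol g f → f 1 = funnelTop g → Tendsto (fun x => f x / x) (𝓝[>] 0) (𝓝 σt)
  bot : ∀ f, IsSol g f → f 1 = funnelBot g → Tendsto (fun x => f x / x) (𝓝[>] 0) (𝓝 σb)
  mid : ∀ f, IsSol g f → axisValue g 1 (f 1) = 0 → f 1 ≠ funnelTop g → f 1 ≠ funnelBot g →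
    Tendsto (fun x => f x / x) (𝓝[>] 0) (𝓝 σm)

lemma hasDerivAt_slopeCubic (b : ℂ) (s : ℝ) : HasDerivAt (slopeCubic b)
    (3 * (b.re - 1) * s ^ 2 - 6 * b.im * s - (1 + 3 * b.re)) s := by
  have h := ((((hasDerivAt_id s).pow 3).const_mul (b.re - 1)).sub
    (((hasDerivAt_id s).pow 2).const_mul (3 * b.im))).sub ((hasDerivAt_id s).const_mul (1 + 3 * b.re))
  convert! h.add_const b.im using 1
  simp; ring

namespace CoeffPair

variable {a c : ℂ → ℂ} {b : ℂ} {ε : ℝ}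

variable (h : CoeffPair a c b ε)
include h

lemma eq_of_tendsto {f1 f2 : ℝ → ℝ} (hf1 : IsSol (slopeOf a c) f1)
    (hf2 : IsSol (slopeOf a c) f2) {l : ℝ} (h1 : Tendsto (fun x => f1 x / x) (𝓝[>] 0) (𝓝 l))
    (h2 : Tendsto (fun x => f2 x / x) (𝓝[>] 0) (𝓝 l)) (hl : slopeCubic b l = 0)
    (hd : 3 * (b.re - 1) * l ^ 2 - 6 * b.im * l - (1 + 3 * b.re) < 0) : f1 1 = f2 1 := by
  have hR : HasDerivAt (fun s : ℝ => 1 + s ^ 2 + b.re * (1 - s ^ 2) + 2 * b.im * s)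
      (2 * l - b.re * (2 * l) + 2 * b.im) l := by
    have := ((((hasDerivAt_id l).pow 2).const_add 1).add
      ((((hasDerivAt_id l).pow 2).const_sub 1).const_mul b.re)).add
      ((hasDerivAt_id l).const_mul (2 * b.im))
    convert! this using 1
    simp; ring
  have hp := h.denom_pos l
  have hk : HasDerivAt (blowup a c 0)
      ((3 * (b.re - 1) * l ^ 2 - 6 * b.im * l - (1 + 3 * b.re)) /
        (1 + l ^ 2 + b.re * (1 - l ^ 2) + 2 * b.im * l)) l := by
    have h3 := (hasDerivAt_slopeCubic b l).div hR hp.ne'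
    rw [hl, zero_mul, sub_zero, pow_two (1 + l ^ 2 + _ + _), mul_div_mul_right _ _ hp.ne'] at h3
    convert! h3 using 1
    funext s; exact h.blowup_zero s
  exact h.isBlowup.eq_of_tendsto h.slopeField hf1 hf2 h1 h2 hk (div_neg_of_neg_of_pos hd hp)

lemma isSol_funnelTop : ∃ f, IsSol (slopeOf a c) f ∧ f 1 = funnelTop (slopeOf a c) :=
  ⟨_, h.slopeField.isSol one_pos _, h.slopeField.sol_self one_pos _⟩

lemma isSol_funnelBot : ∃ f, IsSol (slopeOf a c) f ∧ f 1 = funnelBot (slopeOf a c) :=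
  ⟨_, h.slopeField.isSol one_pos _, h.slopeField.sol_self one_pos _⟩

/-- If the only root of the cubic is a hyperbolic saddle, then there is only one leaf tending to
the origin. -/
lemma fanFlag_eq_zero {s0 : ℝ} (hu : ∀ s, slopeCubic b s = 0 → s = s0)
    (h0 : slopeCubic b s0 = 0)
    (hd : 3 * (b.re - 1) * s0 ^ 2 - 6 * b.im * s0 - (1 + 3 * b.re) < 0) :
    fanFlag (slopeOf a c) = 0 := by
  obtain ⟨f, hf, hf1⟩ := h.isSol_funnelTop; obtain ⟨k, hk, hk1⟩ := h.isSol_funnelBot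
  obtain ⟨l, hl, ht⟩ := h.exists_tendsto hf (by rw [hf1, h.slopeField.funnelTop_mem])
  obtain ⟨l', hl', ht'⟩ := h.exists_tendsto hk (by rw [hk1, h.slopeField.funnelBot_mem])
  rw [hu l hl] at ht; rw [hu l' hl'] at ht'; rw [fanFlag, if_pos]; rw [← hf1, ← hk1]
  exact h.eq_of_tendsto hf hk ht ht' h0 hd

lemma blowup_zero_pos {s : ℝ} (hs : 0 < slopeCubic b s) :
    0 < blowup a c 0 s := by rw [h.blowup_zero]; exact div_pos hs (h.denom_pos s)

lemma blowup_zero_neg {s : ℝ} (hs : slopeCubic b s < 0) :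
    blowup a c 0 s < 0 := by rw [h.blowup_zero]; exact div_neg_of_neg_of_pos hs (h.denom_pos s)

lemma fanFlag_eq_one {σt σb : ℝ}
    (htop : ∀ f, IsSol (slopeOf a c) f → f 1 = funnelTop (slopeOf a c) →
      Tendsto (fun x => f x / x) (𝓝[>] 0) (𝓝 σt))
    (hbot : ∀ f, IsSol (slopeOf a c) f → f 1 = funnelBot (slopeOf a c) →
      Tendsto (fun x => f x / x) (𝓝[>] 0) (𝓝 σb)) (hne : σt ≠ σb) : fanFlag (slopeOf a c) = 1 := by
  rw [fanFlag, if_neg]; intro he; obtain ⟨f, hf, hf1⟩ := h.isSol_funnelTop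
  exact hne (tendsto_nhds_unique (htop f hf hf1) (hbot f hf (hf1.trans he)))

/-- The limits of the slopes of the edges of the funnel lie on either side of `μ`. -/
lemma edge_limits {μ x1 : ℝ} (hx1 : 0 < x1)
    (hstay : ∀ s, IsSlopeSol (blowup a c) s → ∀ x ∈ Ioc 0 x1, s x = μ →
      ∃ R, ∀ᶠ t in 𝓝[>] 0, |s t| ≤ R) {f k : ℝ → ℝ} (hf : IsSol (slopeOf a c) f)
    (hk : IsSol (slopeOf a c) k) (hf1 : f 1 = funnelTop (slopeOf a c))
    (hk1 : k 1 = funnelBot (slopeOf a c)) {lt lb : ℝ}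
    (ht : Tendsto (fun x => f x / x) (𝓝[>] 0) (𝓝 lt))
    (hb : Tendsto (fun x => k x / x) (𝓝[>] 0) (𝓝 lb)) : lb ≤ μ ∧ μ ≤ lt := by
  have := h.isBlowup.edge_le h.slopeField hstay hf hk hf1 hk1; have hI := Ioc_mem_nhdsGT hx1
  exact ⟨le_of_tendsto hb (by filter_upwards [hI] with x hx using (this x hx).1),
    ge_of_tendsto ht (by filter_upwards [hI] with x hx using (this x hx).2)⟩

omit h in
lemma _root_.Umbilic.deriv_slopeCubic_of_factor {b : ℂ} {l : ℝ} {q : ℝ → ℝ}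
    (hfac : ∀ s, slopeCubic b s = (b.re - 1) * ((s - l) * q s)) (hq : DifferentiableAt ℝ q l) :
    3 * (b.re - 1) * l ^ 2 - 6 * b.im * l - (1 + 3 * b.re) = (b.re - 1) * q l := by
  have h1 := (((hasDerivAt_id l).sub_const l).mul hq.hasDerivAt).const_mul (b.re - 1)
  have h2 := hasDerivAt_slopeCubic b l; rw [funext hfac] at h2; rw [h2.unique h1]; simp

/-- Two saddles bound a fan of leaves tending to a node. -/
lemma hasFan_node {s1 s2 s3 : ℝ} (h12 : s1 < s2) (h23 : s2 < s3)
    (hfac : ∀ s, slopeCubic b s = (b.re - 1) * ((s - s1) * (s - s2) * (s - s3))) :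
    HasFan (slopeOf a c) s3 s1 s2 := by
  have hb1 : 0 < 1 - b.re := sub_pos.mpr (re_lt_one h.norm_lt_one)
  have hroot : ∀ s, slopeCubic b s = 0 → s = s1 ∨ s = s2 ∨ s = s3 := by
    intro s hs
    rw [hfac, mul_eq_zero, mul_eq_zero, mul_eq_zero, sub_eq_zero (a := s), sub_eq_zero (a := s),
      sub_eq_zero (a := s)] at hs
    rcases hs with hs | (hs | hs) | hs
    · linarith
    · exact .inl hs
    · exact .inr (.inl hs)
    · exact .inr (.inr hs)
  have hz1 : slopeCubic b s1 = 0 := by rw [hfac]; ring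
  have hz3 : slopeCubic b s3 = 0 := by rw [hfac]; ring
  have hd1 : 3 * (b.re - 1) * s1 ^ 2 - 6 * b.im * s1 - (1 + 3 * b.re) < 0 := by
    rw [deriv_slopeCubic_of_factor (q := fun s => (s - s2) * (s - s3))
      (fun s => by rw [hfac]; ring) (by fun_prop)]
    nlinarith [mul_pos hb1 (mul_pos (sub_pos.mpr h12) (sub_pos.mpr (h12.trans h23)))]
  have hd3 : 3 * (b.re - 1) * s3 ^ 2 - 6 * b.im * s3 - (1 + 3 * b.re) < 0 := by
    rw [deriv_slopeCubic_of_factor (q := fun s => (s - s1) * (s - s2))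
      (fun s => by rw [hfac]; ring) (by fun_prop)]
    nlinarith [mul_pos hb1 (mul_pos (sub_pos.mpr h23) (sub_pos.mpr (h12.trans h23)))]
  obtain ⟨μ, h1μ, hμ2⟩ := exists_between h12; obtain ⟨μ', h2μ, hμ3⟩ := exists_between h23
  have hc := h.isBlowup.contDiff.continuous
  obtain ⟨x1, hx1, hneg⟩ := exists_neg_of_neg hc (c := μ) (h.blowup_zero_neg (by
    rw [hfac]
    nlinarith [mul_pos hb1 (mul_pos (mul_pos (sub_pos.mpr h1μ) (sub_pos.mpr hμ2))
      (sub_pos.mpr (hμ2.trans h23)))]))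
  obtain ⟨x2, hx2, hpos⟩ := exists_pos_of_pos hc (c := μ') (h.blowup_zero_pos (by
    rw [hfac]
    nlinarith [mul_pos hb1 (mul_pos (mul_pos (sub_pos.mpr (h12.trans h2μ)) (sub_pos.mpr h2μ))
      (sub_pos.mpr hμ3))]))
  have hstay : ∀ ν ∈ Icc μ μ', ∀ s, IsSlopeSol (blowup a c) s → ∀ x ∈ Ioc 0 (min x1 x2), s x = ν →
      ∃ R, ∀ᶠ t in 𝓝[>] 0, |s t| ≤ R := by
    intro ν hν s hs x hx he; refine ⟨max |μ| |μ'|, ?_⟩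
    filter_upwards [Ioc_mem_nhdsGT hx.1] with t ht
    have l1 := hs.const_le (fun y hy => hneg y ⟨hy.1, hy.2.trans (hx.2.trans (min_le_left _ _))⟩)
      (he ▸ hν.1) t ht
    have l2 := hs.le_barrier (fun y hy => hpos y ⟨hy.1, hy.2.trans (hx.2.trans (min_le_right _ _))⟩)
      (he ▸ hν.2) t ht
    exact abs_le_max_abs_abs l1 l2
  have hmm : μ ≤ μ' := (hμ2.trans h2μ).le
  have htop : ∀ f, IsSol (slopeOf a c) f → f 1 = funnelTop (slopeOf a c) →
      Tendsto (fun x => f x / x) (𝓝[>] 0) (𝓝 s3) := by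
    intro f hf hf1; obtain ⟨k, hk, hk1⟩ := h.isSol_funnelBot
    obtain ⟨l, hl, ht⟩ := h.exists_tendsto hf (by rw [hf1, h.slopeField.funnelTop_mem])
    obtain ⟨l', hl', ht'⟩ := h.exists_tendsto hk (by rw [hk1, h.slopeField.funnelBot_mem])
    have := (h.edge_limits (lt_min hx1 hx2) (hstay μ' ⟨hmm, le_rfl⟩) hf hk hf1 hk1 ht ht').2
    rcases hroot l hl with rfl | rfl | rfl
    · linarith
    · linarith
    · exact ht
  have hbot : ∀ f, IsSol (slopeOf a c) f → f 1 = funnelBot (slopeOf a c) →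
      Tendsto (fun x => f x / x) (𝓝[>] 0) (𝓝 s1) := by
    intro k hk hk1; obtain ⟨f, hf, hf1⟩ := h.isSol_funnelTop
    obtain ⟨l, hl, ht⟩ := h.exists_tendsto hf (by rw [hf1, h.slopeField.funnelTop_mem])
    obtain ⟨l', hl', ht'⟩ := h.exists_tendsto hk (by rw [hk1, h.slopeField.funnelBot_mem])
    have := (h.edge_limits (lt_min hx1 hx2) (hstay μ ⟨le_rfl, hmm⟩) hf hk hf1 hk1 ht ht').1
    rcases hroot l' hl' with rfl | rfl | rfl
    · exact ht'
    · linarith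
    · linarith
  refine ⟨h.fanFlag_eq_one htop hbot (h12.trans h23).ne', htop, hbot, fun f hf h0 hft hfb => ?_⟩
  obtain ⟨l, hl, ht⟩ := h.exists_tendsto hf h0; rcases hroot l hl with rfl | rfl | rfl
  · obtain ⟨k, hk, hk1⟩ := h.isSol_funnelBot
    exact absurd ((h.eq_of_tendsto hf hk ht (hbot k hk hk1) hz1 hd1).trans hk1) hfb
  · exact ht
  · obtain ⟨k, hk, hk1⟩ := h.isSol_funnelTop
    exact absurd ((h.eq_of_tendsto hf hk ht (htop k hk hk1) hz3 hd3).trans hk1) hft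

/-- A saddle and a double root below it bound a fan of leaves. -/
lemma hasFan_saddleNode {s1 s2 : ℝ} (h12 : s1 < s2)
    (hfac : ∀ s, slopeCubic b s = (b.re - 1) * ((s - s1) ^ 2 * (s - s2))) :
    HasFan (slopeOf a c) s2 s1 s1 := by
  have hb1 : 0 < 1 - b.re := sub_pos.mpr (re_lt_one h.norm_lt_one)
  have hroot : ∀ s, slopeCubic b s = 0 → s = s1 ∨ s = s2 := by
    intro s hs
    rw [hfac, mul_eq_zero, mul_eq_zero, pow_eq_zero_iff two_ne_zero, sub_eq_zero (a := s),
      sub_eq_zero (a := s)] at hs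
    rcases hs with hs | hs | hs
    · linarith
    · exact .inl hs
    · exact .inr hs
  have hz1 : slopeCubic b s1 = 0 := by rw [hfac]; ring
  have hz2 : slopeCubic b s2 = 0 := by rw [hfac]; ring
  have hd2 : 3 * (b.re - 1) * s2 ^ 2 - 6 * b.im * s2 - (1 + 3 * b.re) < 0 := by
    rw [deriv_slopeCubic_of_factor (q := fun s => (s - s1) ^ 2)
      (fun s => by rw [hfac]; ring) (by fun_prop)]
    nlinarith [mul_pos hb1 (pow_pos (sub_pos.mpr h12) 2)]
  obtain ⟨μ, h1μ, hμ2⟩ := exists_between h12; have hc := h.isBlowup.contDiff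
  obtain ⟨x2, hx2, hpos⟩ := exists_pos_of_pos hc.continuous (c := μ) (h.blowup_zero_pos (by
    rw [hfac]; nlinarith [mul_pos hb1 (mul_pos (pow_pos (sub_pos.mpr h1μ) 2) (sub_pos.mpr hμ2))]))
  obtain ⟨K, x1, hx₁, hlow⟩ : ∃ K x1 : ℝ, 0 < x1 ∧ ∀ x ∈ Ioc 0 x1, s1 + K * x ≤ μ ∧
      s1 - 1 ≤ s1 + K * x ∧ blowup a c x (s1 + K * x) < x * K := by
    set Dk := fderiv ℝ (Function.uncurry (blowup a c)) (0, s1) with hDk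
    set K := Dk (1, 0) + 1 with hK
    have hγ : HasDerivAt (fun x : ℝ => (x, s1 + K * x)) (1, K) 0 := by
      have := (hasDerivAt_id (0 : ℝ)).prodMk (((hasDerivAt_id (0 : ℝ)).const_mul K).const_add s1)
      simpa using this
    have hkd : HasFDerivAt (Function.uncurry (blowup a c)) Dk ((fun x : ℝ => (x, s1 + K * x)) 0) := by
      simp only [mul_zero, add_zero]; exact (hc.differentiable one_ne_zero _).hasFDerivAt
    have h1 := hkd.comp_hasDerivAt 0 hγ
    have hD0 : Dk (0, 1) = 0 := by
      have h2 : HasDerivAt (fun y : ℝ => ((0 : ℝ), y)) (0, 1) s1 :=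
        (hasDerivAt_const s1 (0 : ℝ)).prodMk (hasDerivAt_id s1)
      have h3 : HasDerivAt (blowup a c 0) (Dk (0, 1)) s1 :=
        (hc.differentiable one_ne_zero (0, s1)).hasFDerivAt.comp_hasDerivAt s1 h2
      have h4 : HasDerivAt (fun s => blowup a c 0 s *
          (1 + s ^ 2 + b.re * (1 - s ^ 2) + 2 * b.im * s)) (Dk (0, 1) *
          (1 + s1 ^ 2 + b.re * (1 - s1 ^ 2) + 2 * b.im * s1) + blowup a c 0 s1 *
          deriv (fun s : ℝ => 1 + s ^ 2 + b.re * (1 - s ^ 2) + 2 * b.im * s) s1) s1 :=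
        h3.mul (by fun_prop : DifferentiableAt ℝ
          (fun s : ℝ => 1 + s ^ 2 + b.re * (1 - s ^ 2) + 2 * b.im * s) s1).hasDerivAt
      have h5 : (fun s => blowup a c 0 s * (1 + s ^ 2 + b.re * (1 - s ^ 2) + 2 * b.im * s)) =
          slopeCubic b := by funext s; rw [h.blowup_zero, div_mul_cancel₀ _ (h.denom_pos s).ne']
      rw [h5, h.blowup_zero_eq_zero.mpr hz1, zero_mul, add_zero] at h4
      have h6 := h4.unique (hasDerivAt_slopeCubic b s1)
      rw [deriv_slopeCubic_of_factor (q := fun s => (s - s1) * (s - s2))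
        (fun s => by rw [hfac]; ring) (by fun_prop), sub_self, zero_mul, mul_zero] at h6
      exact (mul_eq_zero.mp h6).resolve_right (h.denom_pos s1).ne'
    have hDK : Dk (1, K) = K - 1 := by
      rw [show ((1, K) : ℝ × ℝ) = (1, 0) + K • (0, 1) by ext <;> simp, map_add, map_smul, hD0,
        smul_zero, add_zero]
      ring
    rw [hDK] at h1
    have h2 := (hasDerivAt_iff_tendsto_slope_zero.mp h1).mono_left
      (nhdsWithin_mono 0 (fun x hx => (ne_of_gt hx : x ≠ 0) : Ioi (0 : ℝ) ⊆ {0}ᶜ))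
    have h3 := h2.eventually (gt_mem_nhds (show K - 1 < K by linarith))
    have h4 : Tendsto (fun x : ℝ => s1 + K * x) (𝓝[>] 0) (𝓝 s1) := by
      have : Tendsto (fun x : ℝ => s1 + K * x) (𝓝 0) (𝓝 (s1 + K * 0)) :=
        (by fun_prop : Continuous fun x : ℝ => s1 + K * x).tendsto 0
      rw [mul_zero, add_zero] at this; exact this.mono_left nhdsWithin_le_nhds
    have h5 := (h3.and (h4.eventually (gt_mem_nhds h1μ))).and
      (h4.eventually (lt_mem_nhds (show s1 - 1 < s1 by linarith)))
    obtain ⟨δ, hδ0, hδ⟩ := mem_nhdsGT_iff_exists_Ioo_subset.mp h5; have hδ0 : 0 < δ := hδ0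
    refine ⟨K, δ / 2, by positivity, fun x hx => ?_⟩
    obtain ⟨⟨h6, h7⟩, h8⟩ := hδ (show x ∈ Ioo 0 δ from ⟨hx.1, by linarith [hx.2]⟩)
    refine ⟨h7.le, h8.le, ?_⟩
    simp only [Function.comp, zero_add, mul_zero, add_zero, Function.uncurry,
      h.blowup_zero_eq_zero.mpr hz1, sub_zero, smul_eq_mul] at h6
    rwa [inv_mul_lt_iff₀ hx.1] at h6
  have hstay : ∀ s, IsSlopeSol (blowup a c) s → ∀ x ∈ Ioc 0 (min x1 x2), s x = μ →
      ∃ R, ∀ᶠ t in 𝓝[>] 0, |s t| ≤ R := by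
    intro s hs x hx he; refine ⟨max |s1 - 1| |μ|, ?_⟩; have hx1 := hx.2.trans (min_le_left _ _)
    filter_upwards [Ioc_mem_nhdsGT hx.1] with t ht
    have l1 := hs.barrier_le (σ := fun x => s1 + K * x) (σ' := fun _ => K) (x0 := x) (fun y _ => by
      simpa using ((hasDerivAt_id y).const_mul K).const_add s1) (fun y hy => (hlow y ⟨hy.1,
      hy.2.trans hx1⟩).2.2) (he ▸ (hlow x ⟨hx.1, hx1⟩).1) t ht
    have l2 := hs.le_barrier (fun y hy => hpos y ⟨hy.1, hy.2.trans (hx.2.trans (min_le_right _ _))⟩)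
      he.le t ht
    exact abs_le_max_abs_abs ((hlow t ⟨ht.1, ht.2.trans hx1⟩).2.1.trans l1) l2
  have htop : ∀ f, IsSol (slopeOf a c) f → f 1 = funnelTop (slopeOf a c) →
      Tendsto (fun x => f x / x) (𝓝[>] 0) (𝓝 s2) := by
    intro f hf hf1; obtain ⟨k, hk, hk1⟩ := h.isSol_funnelBot
    obtain ⟨l, hl, ht⟩ := h.exists_tendsto hf (by rw [hf1, h.slopeField.funnelTop_mem])
    obtain ⟨l', hl', ht'⟩ := h.exists_tendsto hk (by rw [hk1, h.slopeField.funnelBot_mem])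
    have := (h.edge_limits (lt_min hx₁ hx2) hstay hf hk hf1 hk1 ht ht').2
    rcases hroot l hl with rfl | rfl
    · linarith
    · exact ht
  have hbot : ∀ f, IsSol (slopeOf a c) f → f 1 = funnelBot (slopeOf a c) →
      Tendsto (fun x => f x / x) (𝓝[>] 0) (𝓝 s1) := by
    intro k hk hk1; obtain ⟨f, hf, hf1⟩ := h.isSol_funnelTop
    obtain ⟨l, hl, ht⟩ := h.exists_tendsto hf (by rw [hf1, h.slopeField.funnelTop_mem])
    obtain ⟨l', hl', ht'⟩ := h.exists_tendsto hk (by rw [hk1, h.slopeField.funnelBot_mem])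
    have := (h.edge_limits (lt_min hx₁ hx2) hstay hf hk hf1 hk1 ht ht').1
    rcases hroot l' hl' with rfl | rfl
    · exact ht'
    · linarith
  refine ⟨h.fanFlag_eq_one htop hbot h12.ne', htop, hbot, fun f hf h0 hft hfb => ?_⟩
  obtain ⟨l, hl, ht⟩ := h.exists_tendsto hf h0; rcases hroot l hl with rfl | rfl
  · exact ht
  · obtain ⟨k, hk, hk1⟩ := h.isSol_funnelTop
    exact absurd ((h.eq_of_tendsto hf hk ht (htop k hk hk1) hz2 hd2).trans hk1) hft

omit h in
/-- Given coefficients can be modified outside of a neighbourhood of the origin. -/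
lemma _root_.Umbilic.exists_coeffPair {a0 c0 : ℂ → ℂ} (ha : ContDiffAt ℝ 1 a0 0)
    (hc : ContDiffAt ℝ 1 c0 0) (ha0 : a0 0 = 1) (hb : ‖c0 0‖ < 1) :
    ∃ a c ε, CoeffPair a c (c0 0) ε ∧ ∀ᶠ z in 𝓝 0, a z = a0 z ∧ c z = c0 z := by
  set ε := (1 - ‖c0 0‖) / 4 with hε; have hε0 : 0 < ε := by rw [hε]; linarith
  obtain ⟨δ, hδ, H⟩ := eventually_nhds_iff_ball.mp (((ha.eventually (by simp)).and (hc.eventually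
    (by simp))).and ((tendsto_nhds.mp ha.continuousAt ε hε0).and (tendsto_nhds.mp hc.continuousAt ε
    hε0)))
  let χ : ContDiffBump (0 : ℂ) := ⟨δ / 4, δ / 2, by positivity, by linarith⟩
  have key : ∀ f : ℂ → ℂ, (∀ y ∈ ball (0 : ℂ) δ, ContDiffAt ℝ 1 f y) →
      (∀ y ∈ ball (0 : ℂ) δ, dist (f y) (f 0) < ε) →
      ContDiff ℝ 1 (fun z => f 0 + (χ z : ℂ) * (f z - f 0)) ∧
      (∀ z, ‖f 0 + (χ z : ℂ) * (f z - f 0) - f 0‖ ≤ ε) ∧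
      (∀ᶠ z in 𝓝 0, f 0 + (χ z : ℂ) * (f z - f 0) = f z) := by
    intro f hf hd; refine ⟨contDiff_iff_contDiffAt.mpr fun z => ?_, fun z => ?_, ?_⟩
    · by_cases hz : z ∈ ball (0 : ℂ) δ
      · exact contDiffAt_const.add ((ofRealCLM.contDiff.contDiffAt.comp z
          χ.contDiff.contDiffAt).mul ((hf z hz).sub contDiffAt_const))
      · refine (contDiffAt_const (c := f 0)).congr_of_eventuallyEq ?_
        have hz' : z ∈ (closedBall (0 : ℂ) (δ / 2))ᶜ := by
          simp only [mem_ball, not_lt] at hz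
          simp only [mem_compl_iff, mem_closedBall, not_le]; linarith
        filter_upwards [isClosed_closedBall.isOpen_compl.mem_nhds hz'] with y hy
        rw [χ.zero_of_le_dist (by
          simp only [mem_compl_iff, mem_closedBall, not_le] at hy; exact hy.le)]
        simp
    · rw [add_sub_cancel_left, norm_mul, norm_real, Real.norm_of_nonneg χ.nonneg]
      by_cases hz : z ∈ ball (0 : ℂ) δ
      · have h1 := hd z hz; rw [dist_eq_norm] at h1
        nlinarith [χ.nonneg (x := z), χ.le_one (x := z), norm_nonneg (f z - f 0)]
      · rw [χ.zero_of_le_dist (by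
          simp only [mem_ball, not_lt] at hz; show δ / 2 ≤ dist z 0; linarith), zero_mul]
        exact hε0.le
    · filter_upwards [χ.eventuallyEq_one] with z hz; rw [hz]; simp
  obtain ⟨p1, p2, p3⟩ := key a0 (fun y hy => (H y hy).1.1) (fun y hy => (H y hy).2.1)
  obtain ⟨q1, q2, q3⟩ := key c0 (fun y hy => (H y hy).1.2) (fun y hy => (H y hy).2.2)
  refine ⟨_, _, ε, ⟨p1, q1, fun z => ?_, q2, ?_, ?_, ?_⟩, p3.and q3⟩
  · rw [← ha0]; exact p2 z
  · rw [hε]; linarith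
  · simp [ha0]
  · simp

end CoeffPair

/-- The principal line fields in the coordinate `ζ`, the value at each point of the trace-free part
of the shape operator: the images by `η ↦ a η + c η̄` of the eigenlines of `η ↦ ζ η̄`. -/
def coneLine (a c : ℂ → ℂ) (i : Fin 2) (ζ : ℂ) : Set ℂ :=
  {v | ∃ η : ℂ, v = a ζ * η + c ζ * conj η ∧ ζ * conj η = (sign i * ‖ζ‖ : ℝ) * η}

/-- The leaves of a line field on a subset of the complex plane. -/
def planeLeaf (l : ℂ → Set ℂ) (W : Set ℂ) (z : ℂ) : Set ℂ :=
  {z' | ∃ γ : ℝ → ℂ, ContDiff ℝ 1 γ ∧ γ 0 = z ∧ γ 1 = z' ∧ ∀ t, γ t ∈ W ∧ deriv γ t ∈ l (γ t)}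

/-- The coefficients read through the reflection which exchanges the two foliations. -/
def twist (i : Fin 2) (a : ℂ → ℂ) (z : ℂ) : ℂ := a ((sign i : ℂ) * z)

lemma sign_sq (i : Fin 2) : sign i ^ 2 = 1 := by unfold sign; split_ifs <;> norm_num

lemma sign_mul_sign (i : Fin 2) : (sign i : ℂ) * (sign i : ℂ) = 1 := by
  rw [← ofReal_mul, ← pow_two, sign_sq, ofReal_one]

lemma sign_ne_zero (i : Fin 2) : (sign i : ℂ) ≠ 0 := left_ne_zero_of_mul_eq_one (sign_mul_sign i)

lemma norm_sign (i : Fin 2) : ‖(sign i : ℂ)‖ = 1 := by unfold sign; split_ifs <;> simp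

lemma twist_one (a : ℂ → ℂ) : twist 1 a = a := by funext z; simp [twist, sign]

lemma twist_zero (a : ℂ → ℂ) : twist 0 a = fun z => a (-z) := by funext z; simp [twist, sign]

lemma CoeffPair.twist {a c : ℂ → ℂ} {b : ℂ} {ε : ℝ} (h : CoeffPair a c b ε) (i : Fin 2) :
    CoeffPair (twist i a) (twist i c) b ε := by
  fin_cases i
  · exact (twist_zero a).symm ▸ (twist_zero c).symm ▸ h.neg
  · exact (twist_one a).symm ▸ (twist_one c).symm ▸ h

/-- Two points of the plane are on the same leaf of the foliation tangent to `coneLine a c i`. -/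
def SameConeLeaf (a c : ℂ → ℂ) (i : Fin 2) (z z' : ℂ) : Prop :=
  ∃ w w' : ℂ, (sign i : ℂ) * w ^ 2 = z ∧ (sign i : ℂ) * w' ^ 2 = z' ∧
    SameLeaf (slopeOf (twist i a) (twist i c)) w w'

/-- The branch of the square root with value `w` at `w ^ 2`. -/
def sqrtAt (w z : ℂ) : ℂ := w * (z / w ^ 2) ^ (((2 : ℕ) : ℂ)⁻¹)

lemma sqrtAt_sq {w : ℂ} (hw : w ≠ 0) (z : ℂ) : sqrtAt w z ^ 2 = z := by
  rw [sqrtAt, mul_pow, cpow_nat_inv_pow _ two_ne_zero]; field_simp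

lemma sqrtAt_self {w : ℂ} (hw : w ≠ 0) : sqrtAt w (w ^ 2) = w := by
  rw [sqrtAt, div_self (pow_ne_zero 2 hw), one_cpow, mul_one]

lemma eventually_differentiableAt_sqrtAt {w : ℂ} (hw : w ≠ 0) :
    ∀ᶠ z in 𝓝 (w ^ 2), DifferentiableAt ℂ (sqrtAt w) z := by
  have h1 : ContinuousAt (fun z : ℂ => z / w ^ 2) (w ^ 2) := by fun_prop
  have h2 : (fun z : ℂ => z / w ^ 2) (w ^ 2) ∈ slitPlane := by simp [div_self (pow_ne_zero 2 hw)]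
  filter_upwards [h1.eventually (isOpen_slitPlane.mem_nhds h2)] with z hz
  exact ((differentiableAt_id.div_const _).cpow_const hz).const_mul w

section Leaves

variable {a c : ℂ → ℂ} {b : ℂ} {ε : ℝ} {i : Fin 2}

lemma SlopePair.sameLeaf_trans {g g' : ℝ → ℝ → ℝ} {L : ℝ} (h : SlopePair g g' L) {w w' w'' : ℂ}
    (hw : w ≠ 0) (hw' : w' ≠ 0) (h1 : SameLeaf g w w') (h2 : SameLeaf g w' w'') :
    SameLeaf g w w'' := by
  have l1 := h.sameLabel_of_sameLeaf hw hw' h1; obtain ⟨c, f, hf, a1, a2, a3⟩ := h1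
  obtain ⟨k, m, hm, b1, b2, b3⟩ := h2
  have e1 : axisValue g w'.re w'.im = c := by rw [← a2, hf.axisValue]
  have e2 : axisValue g w'.re w'.im = k := by rw [← b1, hm.axisValue]
  obtain rfl : c = k := e1.symm.trans e2
  by_cases hc : c = 0
  · have a3 := a3.resolve_left (by simpa using hc); have b3 := b3.resolve_left (by simpa using hc)
    refine ⟨c, f, hf, a1, ?_, .inr ?_⟩
    · rw [IsLeafFun.eq_of_eq h.fst hf hm b3 (a2.trans b1.symm), b2]
    · exact (pos_iff_pos_of_mul_pos (by
        rw [show w.re * w''.re * (w'.re * w'.re) = (w.re * w'.re) * (w'.re * w''.re) by ring]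
        exact mul_pos a3 b3)).mpr (mul_self_pos.mpr (right_ne_zero_of_mul a3.ne'))
  · refine ⟨c, f, hf, a1, ?_, .inl hc⟩
    exact IsLeafFun.eq_of_axisValue h.fst hf hc (by rw [← b2, hm.axisValue])

lemma sameConeLeaf_trans (h : CoeffPair a c b ε) {z z' z'' : ℂ} (hz : z ≠ 0) (hz' : z' ≠ 0)
    (h1 : SameConeLeaf a c i z z') (h2 : SameConeLeaf a c i z' z'') :
    SameConeLeaf a c i z z'' := by
  have hp := (h.twist i).slopePair; obtain ⟨w, w', rfl, rfl, h1⟩ := h1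
  obtain ⟨v, v', hv, rfl, h2⟩ := h2; have hw : w ≠ 0 := by rintro rfl; simp at hz
  have hw' : w' ≠ 0 := by rintro rfl; simp at hz'
  rcases sq_eq_sq_iff_eq_or_eq_neg.mp (mul_left_cancel₀ (sign_ne_zero i) hv) with rfl | rfl
  · exact ⟨w, v', rfl, rfl, hp.sameLeaf_trans hw hw' h1 h2⟩
  · refine ⟨w, -v', rfl, by rw [neg_sq], hp.sameLeaf_trans hw hw' h1 ?_⟩; simpa using h2.neg hp.fst

lemma sameConeLeaf_symm {z z' : ℂ} (h1 : SameConeLeaf a c i z z') : SameConeLeaf a c i z' z := by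
  obtain ⟨w, w', h, h', hs⟩ := h1; exact ⟨w', w, h', h, hs.symm⟩

lemma exists_sign_mul_sq (i : Fin 2) (z : ℂ) : ∃ w : ℂ, (sign i : ℂ) * w ^ 2 = z := by
  refine ⟨((sign i : ℂ) * z) ^ (((2 : ℕ) : ℂ)⁻¹), ?_⟩
  rw [cpow_nat_inv_pow _ two_ne_zero, ← mul_assoc, sign_mul_sign, one_mul]

/-- The eigenvectors of `η ↦ ζ η̄` in terms of a square root of `ζ`. -/
lemma eigen_iff {w η : ℂ} (hw : w ≠ 0) :
    ((sign i : ℂ) * w ^ 2) * conj η = (sign i * ‖(sign i : ℂ) * w ^ 2‖ : ℝ) * η ↔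
      ∃ ρ : ℝ, η = ρ * w := by
  have hn : (((sign i * ‖(sign i : ℂ) * w ^ 2‖ : ℝ)) : ℂ) = (sign i : ℂ) * (w * conj w) := by
    rw [norm_mul, norm_sign, one_mul, norm_pow, mul_conj, normSq_eq_norm_sq]; push_cast; rfl
  rw [hn]; have hcw : conj w ≠ 0 := (map_ne_zero _).mpr hw; constructor
  · intro h
    have h1 : w * conj η = conj w * η := by
      refine mul_left_cancel₀ (mul_ne_zero (sign_ne_zero i) hw) ?_
      linear_combination h
    refine ⟨(η / w).re, ?_⟩
    have h2 : conj (η / w) = η / w := by rw [map_div₀, div_eq_div_iff hcw hw]; linear_combination h1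
    rw [conj_eq_iff_re.mp h2, div_mul_cancel₀ _ hw]
  · rintro ⟨ρ, rfl⟩; rw [map_mul, conj_ofReal]; ring

lemma mem_coneLine_iff {w v : ℂ} (hw : w ≠ 0) : v ∈ coneLine a c i ((sign i : ℂ) * w ^ 2) ↔
    ∃ ρ : ℝ, v = ρ * (twist i a (w ^ 2) * w + twist i c (w ^ 2) * conj w) := by
  constructor
  · rintro ⟨η, rfl, h⟩; obtain ⟨ρ, rfl⟩ := (eigen_iff hw).mp h; refine ⟨ρ, ?_⟩
    rw [map_mul, conj_ofReal, twist, twist]; ring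
  · rintro ⟨ρ, rfl⟩; refine ⟨ρ * w, ?_, (eigen_iff hw).mpr ⟨ρ, rfl⟩⟩
    rw [map_mul, conj_ofReal, twist, twist]; ring

/-- A curve tangent to the line field stays locally on a leaf. -/
lemma eventually_sameConeLeaf (h : CoeffPair a c b ε) {γ : ℝ → ℂ} (hγ : ContDiff ℝ 1 γ)
    (h0 : ∀ t, γ t ≠ 0) (ht : ∀ t, deriv γ t ∈ coneLine a c i (γ t)) (t0 : ℝ) :
    ∀ᶠ t in 𝓝 t0, SameConeLeaf a c i (γ t0) (γ t) := by
  have hp := (h.twist i).slopePair; set g := slopeOf (twist i a) (twist i c) with hg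
  obtain ⟨w0, hw₀⟩ := exists_sign_mul_sq i (γ t0)
  have hw0 : w0 ≠ 0 := by rintro rfl; exact h0 t0 (by rw [← hw₀]; simp)
  have hw0' : (sign i : ℂ) * γ t0 = w0 ^ 2 := by rw [← hw₀, ← mul_assoc, sign_mul_sign, one_mul]
  set w : ℝ → ℂ := fun t => sqrtAt w0 ((sign i : ℂ) * γ t) with hwdef
  have hwt0 : w t0 = w0 := by simp only [hwdef, hw0', sqrtAt_self hw0]
  have hsq : ∀ t, (sign i : ℂ) * w t ^ 2 = γ t := fun t => by
    simp only [hwdef, sqrtAt_sq hw0]; rw [← mul_assoc, sign_mul_sign, one_mul]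
  have hne : ∀ t, w t ≠ 0 := fun t h1 => h0 t (by rw [← hsq, h1]; simp)
  have hγd : ∀ t, HasDerivAt γ (deriv γ t) t := fun t =>
    (hγ.differentiable one_ne_zero t).hasDerivAt
  have hwd : ∀ᶠ t in 𝓝 t0, HasDerivAt w ((sign i : ℂ) * deriv γ t / (2 * w t)) t := by
    have h1 : ContinuousAt (fun t => (sign i : ℂ) * γ t) t0 :=
      continuousAt_const.mul hγ.continuous.continuousAt
    have h2 := eventually_differentiableAt_sqrtAt hw0; rw [← hw0'] at h2
    filter_upwards [h1.eventually h2] with t ht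
    have h3 := HasDerivAt.scomp (g₁ := sqrtAt w0) (h := fun t => (sign i : ℂ) * γ t) t ht.hasDerivAt
      ((hγd t).const_mul (sign i : ℂ))
    change HasDerivAt w _ t at h3; have h4 := (h3.pow 2).const_mul (sign i : ℂ)
    have h5 := h4.unique (show HasDerivAt (fun y => (sign i : ℂ) * (w ^ 2) y) (deriv γ t) t by
      rw [show (fun y => (sign i : ℂ) * (w ^ 2) y) = γ from funext hsq]; exact hγd t)
    convert! h3 using 1
    simp only [Nat.cast_ofNat, Nat.add_one_sub_one, pow_one] at h5
    rw [div_eq_iff (mul_ne_zero two_ne_zero (hne t))]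
    generalize ((sign i : ℂ) * deriv γ t) • deriv (sqrtAt w0) ((sign i : ℂ) * γ t) = E at h5 ⊢
    linear_combination (-sign i : ℂ) * h5 + 2 * w t * E * sign_mul_sign i
  have hwc : ContinuousAt w t0 := hwd.self_of_nhds.continuousAt
  have hV : ∀ t, ∃ κ : ℝ, (sign i : ℂ) * deriv γ t / (2 * w t) =
      κ * coverVec (twist i a) (twist i c) (w t) := by
    intro t; have h1 := ht t; rw [← hsq t, mem_coneLine_iff (hne t)] at h1; obtain ⟨ρ, hρ⟩ := h1
    refine ⟨sign i * ρ / (2 * ‖w t‖ ^ 2), ?_⟩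
    have hcw : conj (w t) ≠ 0 := (map_ne_zero _).mpr (hne t)
    have hn : ((‖w t‖ : ℝ) : ℂ) ^ 2 = w t * conj (w t) := by
      rw [mul_conj, normSq_eq_norm_sq]; push_cast; rfl
    rw [hρ, coverVec]; push_cast; rw [hn]; have := hne t; field_simp
  obtain ⟨f, hf, hf0⟩ := hp.fst.exists_isLeafFun w0.re w0.im
  have hev := hp.fst.eventually_eq_of_tangent hf (x := fun t => (w t).re) (y := fun t => (w t).im)
    (x' := fun t => ((sign i : ℂ) * deriv γ t / (2 * w t)).re) (t0 := t0) (hwd.mono fun t h1 =>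
    reCLM.hasFDerivAt.comp_hasDerivAt t h1) (hwd.mono fun t h1 => by
      have h2 := imCLM.hasFDerivAt.comp_hasDerivAt t h1
      convert! h2 using 1
      obtain ⟨κ, hκ⟩ := hV t; have h3 := (h.twist i).coverVec_re_pos (hne t); rw [hκ]
      simp only [hg, slopeOf, eta, imCLM_apply, re_ofReal_mul, im_ofReal_mul]; field_simp)
    (continuous_re.continuousAt.comp ((continuousAt_const.mul (hγ.continuous_deriv
      le_rfl).continuousAt).div (continuousAt_const.mul hwc) (mul_ne_zero two_ne_zero (hne t0))))
    (by simp only [hwt0, hf0])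
    (fun h1 => hne t0 (ext (congrArg Prod.fst h1) (congrArg Prod.snd h1)))
  have hre : ∀ᶠ t in 𝓝 t0, axisValue g w0.re w0.im ≠ 0 ∨ 0 < w0.re * (w t).re := by
    by_cases hc : axisValue g w0.re w0.im = 0
    · have h1 : 0 < w0.re * (w t0).re := by rw [hwt0]; exact mul_self_pos.mpr (re_ne_zero hw0 hc)
      have h2 : ContinuousAt (fun t => w0.re * (w t).re) t0 :=
        continuousAt_const.mul (continuous_re.continuousAt.comp hwc)
      exact (h2.eventually (lt_mem_nhds h1)).mono fun t h3 => .inr h3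
    · exact .of_forall fun t => .inl hc
  filter_upwards [hev, hre] with t h1 h2; exact ⟨w0, w t, hw₀, hsq t, _, f, hf, hf0, h1.symm, h2⟩

lemma sameConeLeaf_of_tangent (h : CoeffPair a c b ε) {γ : ℝ → ℂ} (hγ : ContDiff ℝ 1 γ)
    (h0 : ∀ t, γ t ≠ 0) (ht : ∀ t, deriv γ t ∈ coneLine a c i (γ t)) (t t' : ℝ) :
    SameConeLeaf a c i (γ t) (γ t') :=
  isPreconnected_univ.induction₂ (fun t t' => SameConeLeaf a c i (γ t) (γ t'))
    (fun t _ => (eventually_sameConeLeaf h hγ h0 ht t).filter_mono nhdsWithin_le_nhds)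
    (fun _ _ _ _ _ _ h1 h2 => sameConeLeaf_trans h (h0 _) (h0 _) h1 h2)
    (fun _ _ _ _ h1 => sameConeLeaf_symm h1) (mem_univ t) (mem_univ t')

/-- A point which can be reached by a continuous path inside a leaf can be reached along it. -/
lemma mem_planeLeaf_of_path (h : CoeffPair a c b ε) {W : Set ℂ} (hW : ∀ z ∈ W, z ≠ 0)
    {σ : ℝ → ℂ} (hσ : Continuous σ) (hmem : ∀ t, σ t ∈ W)
    (hs : ∀ t, SameConeLeaf a c i (σ 0) (σ t)) : σ 1 ∈ planeLeaf (coneLine a c i) W (σ 0) := by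
  have hp := (h.twist i).slopePair; set g := slopeOf (twist i a) (twist i c) with hg
  obtain ⟨w0, hw₀⟩ := exists_sign_mul_sq i (σ 0)
  have hw0 : w0 ≠ 0 := by rintro rfl; exact hW _ (hmem 0) (by rw [← hw₀]; simp)
  obtain ⟨f, hf, hf0⟩ := hp.fst.exists_isLeafFun w0.re w0.im
  set k := axisValue g w0.re w0.im with hk
  have hlift : ∀ t, ∃ w : ℂ, (sign i : ℂ) * w ^ 2 = σ t ∧ f w.re = w.im ∧
      (k ≠ 0 ∨ 0 < w0.re * w.re) := by
    intro t; obtain ⟨v, v', hv, hv', hl⟩ := hs t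
    obtain ⟨u, hu, hl⟩ : ∃ u, (sign i : ℂ) * u ^ 2 = σ t ∧ SameLeaf g w0 u := by
      rcases sq_eq_sq_iff_eq_or_eq_neg.mp
        (mul_left_cancel₀ (sign_ne_zero i) (hw₀.trans hv.symm)) with rfl | rfl
      · exact ⟨v', hv', hl⟩
      · exact ⟨-v', by rw [neg_sq, hv'], hl.neg hp.fst⟩
    refine ⟨u, hu, ?_⟩; obtain ⟨c', m, hm, h1, h2, h3⟩ := hl
    obtain rfl : k = c' := by rw [hk, ← h1, hm.axisValue]
    refine ⟨?_, h3⟩; rcases h3 with h3 | h3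
    · exact IsLeafFun.eq_of_axisValue hp.fst hf h3 (by rw [← h2, hm.axisValue])
    · rw [IsLeafFun.eq_of_eq hp.fst hf hm h3 (hf0.trans h1.symm), h2]
  choose w hw hwf hws using hlift
  have hne : ∀ t, w t ≠ 0 := fun t h1 => hW _ (hmem t) (by rw [← hw, h1]; simp)
  have hord : ∀ t, ord g (w t) = k := fun t => by rw [ord, ← hwf, hf.axisValue]
  have hcont : Continuous w := by
    refine continuous_iff_continuousAt.mpr fun t0 => ?_
    have e0 : (sign i : ℂ) * σ t0 = w t0 ^ 2 := by rw [← hw, ← mul_assoc, sign_mul_sign, one_mul]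
    have hr : ContinuousAt (fun t => sqrtAt (w t0) ((sign i : ℂ) * σ t)) t0 := by
      have h1 := (eventually_differentiableAt_sqrtAt (hne t0)).self_of_nhds.continuousAt
      rw [← e0] at h1
      exact h1.comp (f := fun t => (sign i : ℂ) * σ t) (continuous_const.mul hσ).continuousAt
    have hr0 : sqrtAt (w t0) ((sign i : ℂ) * σ t0) = w t0 := by rw [e0, sqrtAt_self (hne t0)]
    have hsgn : ∀ t, w t = sqrtAt (w t0) ((sign i : ℂ) * σ t) ∨
        w t = -sqrtAt (w t0) ((sign i : ℂ) * σ t) := fun t => by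
      rw [← sq_eq_sq_iff_eq_or_eq_neg, sqrtAt_sq (hne t0), ← hw, ← mul_assoc, sign_mul_sign,
        one_mul]
    have hev : ∀ᶠ t in 𝓝 t0, w t = sqrtAt (w t0) ((sign i : ℂ) * σ t) := by
      by_cases hk0 : k = 0
      · have p0 : 0 < w0.re * (w t0).re := (hws t0).resolve_left (by simpa using hk0)
        have h2 : ContinuousAt (fun t => w0.re * (sqrtAt (w t0) ((sign i : ℂ) * σ t)).re) t0 :=
          continuousAt_const.mul (Complex.continuous_re.continuousAt.comp hr)
        filter_upwards [h2.eventually (lt_mem_nhds (a := 0) (by simpa only [hr0] using p0))] with t ht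
        refine (hsgn t).resolve_right fun h3 => ?_
        have p1 : 0 < w0.re * (w t).re := (hws t).resolve_left (by simpa using hk0)
        rw [h3, Complex.neg_re] at p1; linarith
      · have h2 : ContinuousAt (fun t => ord g (sqrtAt (w t0) ((sign i : ℂ) * σ t))) t0 :=
          hp.fst.continuous_ord.continuousAt.comp hr
        have h3 : (fun t => ord g (sqrtAt (w t0) ((sign i : ℂ) * σ t))) t0 ≠ -k := by
          simp only [hr0, hord]; intro h4; exact hk0 (by linarith)
        filter_upwards [h2.eventually_ne h3] with t ht
        refine (hsgn t).resolve_right fun h4 => ht ?_; rw [← hord t, h4, ord_neg, neg_neg]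
    exact (hr.congr (hev.mono fun t ht => ht.symm))
  set x0 := (w 0).re; set x1 := (w 1).re
  have hseg : ∀ x ∈ uIcc x0 x1, (x ≠ 0 ∨ k ≠ 0) ∧
      (sign i : ℂ) * Complex.mk x (f x) ^ 2 ∈ W := by
    intro x hx
    obtain ⟨t, -, ht⟩ := intermediate_value_uIcc (a := 0) (b := 1)
      (f := fun t => (w t).re) (Complex.continuous_re.comp hcont).continuousOn hx
    simp only at ht; constructor
    · rcases hws t with h1 | h1
      · exact .inr h1
      · exact .inl (ht ▸ right_ne_zero_of_mul h1.ne')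
    · have : Complex.mk x (f x) = w t := Complex.ext ht.symm (by rw [← hwf, ht]); rw [this, hw]
      exact hmem t
  set φ : ℝ → ℝ := fun s => x0 + Real.smoothTransition s * (x1 - x0) with hφ
  have hφm : ∀ s, φ s ∈ uIcc x0 x1 := fun s => by
    rw [← segment_eq_uIcc]
    refine ⟨1 - Real.smoothTransition s, Real.smoothTransition s,
      sub_nonneg.mpr (Real.smoothTransition.le_one s), Real.smoothTransition.nonneg s, by ring, ?_⟩
    simp only [hφ, smul_eq_mul]; ring
  have hφ1 : ContDiff ℝ 1 φ :=
    contDiff_const.add ((Real.smoothTransition.contDiff (n := 1)).mul contDiff_const)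
  have hφd : ∀ s, HasDerivAt φ (deriv φ s) s := fun s =>
    (hφ1.differentiable one_ne_zero s).hasDerivAt
  set z : ℝ → ℂ := fun s => Complex.mk (φ s) (f (φ s)) with hz
  have hz0 : ∀ s, z s ≠ 0 := fun s h1 => hW _ (hseg _ (hφm s)).2 (by
    rw [show Complex.mk (φ s) (f (φ s)) = 0 from h1]; simp)
  have hzc : Continuous z := Complex.equivRealProdCLM.symm.continuous.comp
    (hφ1.continuous.prodMk (hf.continuous.comp hφ1.continuous))
  have hg1 : ∀ s, g (φ s) (f (φ s)) =
      (coverVec (twist i a) (twist i c) (z s)).im / (coverVec (twist i a) (twist i c) (z s)).re :=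
    fun s => rfl
  set κ : ℝ → ℝ := fun s => deriv φ s / (coverVec (twist i a) (twist i c) (z s)).re with hκ
  have hVc : Continuous fun s => coverVec (twist i a) (twist i c) (z s) :=
    (h.twist i).contDiff_coverVec.continuous.comp hzc
  have hVp : ∀ s, 0 < (coverVec (twist i a) (twist i c) (z s)).re := fun s =>
    (h.twist i).coverVec_re_pos (hz0 s)
  have hzd : ∀ s, HasDerivAt z (κ s * coverVec (twist i a) (twist i c) (z s)) s := by
    intro s; have h1 := (hf.hasDerivAt _ (hseg _ (hφm s)).1).comp s (hφd s)
    have h2 := (Complex.equivRealProdCLM.symm.hasFDerivAt (x := (φ s, f (φ s)))).comp_hasDerivAt s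
      ((hφd s).prodMk h1)
    convert! h2 using 1
    rw [hg1]; have := (hVp s).ne'; apply Complex.ext
    · simp [hκ]; field_simp
    · simp [hκ]; field_simp
  have hγd : ∀ s, HasDerivAt (fun s => (sign i : ℂ) * z s ^ 2)
      ((2 * sign i * κ s * ‖z s‖ ^ 2 : ℝ) *
        (twist i a (z s ^ 2) * z s + twist i c (z s ^ 2) * conj (z s))) s := by
    intro s; have h1 := ((hzd s).pow 2).const_mul (sign i : ℂ)
    convert! h1 using 1
    have hn : ((‖z s‖ : ℝ) : ℂ) ^ 2 = z s * conj (z s) := by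
      rw [Complex.mul_conj, Complex.normSq_eq_norm_sq]; push_cast; rfl
    rw [coverVec]; push_cast; rw [hn]; ring
  have e0 : z 0 = w 0 := by
    have : φ 0 = x0 := by simp [hφ]
    exact Complex.ext this (by simp only [hz, this]; exact hwf 0)
  have e1 : z 1 = w 1 := by
    have : φ 1 = x1 := by simp [hφ]
    exact Complex.ext this (by simp only [hz, this]; exact hwf 1)
  refine ⟨fun s => (sign i : ℂ) * z s ^ 2, ?_, by simp only [e0, hw], by simp only [e1, hw],
    fun s => ⟨(hseg _ (hφm s)).2, ?_⟩⟩
  · rw [contDiff_one_iff_deriv]; refine ⟨fun s => (hγd s).differentiableAt, ?_⟩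
    rw [show deriv (fun s => (sign i : ℂ) * z s ^ 2) = _ from funext fun s => (hγd s).deriv]
    have c1 : Continuous κ := (hφ1.continuous_deriv le_rfl).div (Complex.continuous_re.comp hVc)
      fun s => (hVp s).ne'
    have c2 := (h.twist i).contDiff_fst.continuous; have c3 := (h.twist i).contDiff_snd.continuous
    exact (Complex.continuous_ofReal.comp ((continuous_const.mul c1).mul (hzc.norm.pow 2))).mul
      (((c2.comp (hzc.pow 2)).mul hzc).add ((c3.comp (hzc.pow 2)).mul
        (Complex.continuous_conj.comp hzc)))
  · rw [(hγd s).deriv]; exact (mem_coneLine_iff (hz0 s)).mpr ⟨_, rfl⟩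

/-- The leaf of a point consists of the points that can be reached by a continuous path. -/
lemma mem_planeLeaf_iff (h : CoeffPair a c b ε) {W : Set ℂ} (hW : ∀ z ∈ W, z ≠ 0) {z z' : ℂ} :
    z' ∈ planeLeaf (coneLine a c i) W z ↔ ∃ σ : ℝ → ℂ, Continuous σ ∧ σ 0 = z ∧ σ 1 = z' ∧
      ∀ t, σ t ∈ W ∧ SameConeLeaf a c i z (σ t) := by
  constructor
  · rintro ⟨γ, hγ, rfl, rfl, ht⟩
    exact ⟨γ, hγ.continuous, rfl, rfl, fun t => ⟨(ht t).1, sameConeLeaf_of_tangent h hγ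
      (fun t => hW _ (ht t).1) (fun t => (ht t).2) 0 t⟩⟩
  · rintro ⟨σ, hσ, rfl, rfl, ht⟩
    exact mem_planeLeaf_of_path h hW hσ (fun t => (ht t).1) fun t => (ht t).2

end Leaves

lemma sign_rev (i : Fin 2) : sign i.rev = -sign i := by fin_cases i <;> simp [sign]

lemma twist_rev (i : Fin 2) (a : ℂ → ℂ) : (fun z => twist i a (-z)) = twist i.rev a := by
  funext z; simp [twist, sign_rev]

/-- The slope field of the `i`-th foliation on its double cover `w ↦ sign i * w ^ 2`. -/
def coneSlope (a c : ℂ → ℂ) (i : Fin 2) : ℝ → ℝ → ℝ := slopeOf (twist i a) (twist i c)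

/-- The labels of the leaves through a point of the cover, that of the `i`-th foliation first. -/
def coneLabels (a c : ℂ → ℂ) (i : Fin 2) (w : ℂ) : (ℝ × ℝ) × (ℝ × ℝ) :=
  leafLabels (coneSlope a c i) (coneSlope a c i.rev) w

/-- The leaf tending to the origin with position `p` in the fan. -/
def fanLeaf (a c : ℂ → ℂ) (i : Fin 2) (p : ℝ) : Set ℂ :=
  {z | ∃ w : ℂ, (sign i : ℂ) * w ^ 2 = z ∧ 0 < w.re ∧ ord (coneSlope a c i) w = 0 ∧
    funnelPos (coneSlope a c i) w.re w.im = p}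

lemma CoeffPair.conePair {a c : ℂ → ℂ} {b : ℂ} {ε : ℝ} (h : CoeffPair a c b ε) (i : Fin 2) :
    SlopePair (coneSlope a c i) (coneSlope a c i.rev) ((‖b‖ + 2 * ε) / (1 - ‖b‖ - 2 * ε)) := by
  have := (h.twist i).slopePair; rwa [twist_rev, twist_rev] at this

lemma coneLabels_neg (a c : ℂ → ℂ) (i : Fin 2) (w : ℂ) :
    coneLabels a c i (-w) = -coneLabels a c i w := leafLabels_neg _ _ _

lemma isOpenMap_sq : IsOpenMap fun w : ℂ => w ^ 2 := by
  refine (AnalyticOnNhd.is_constant_or_isOpenMap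
    (g := fun w : ℂ => w ^ 2) fun z _ => by fun_prop).resolve_left ?_
  rintro ⟨w, hw⟩; have h0 := hw 0; have h1 := hw 1; rw [← h1] at h0; norm_num at h0

/-- An odd local homeomorphism induces one of the quotient by `w ↦ -w`. -/
lemma exists_sq_descent (e : OpenPartialHomeomorph ℂ ℂ)
    (ho : ∀ w ∈ e.source, -w ∈ e.source ∧ e (-w) = -e w) :
    ∃ ψ : OpenPartialHomeomorph ℂ ℂ, ψ.source = (fun w => w ^ 2) '' e.source ∧
      ψ.target = (fun w => w ^ 2) '' e.target ∧ ∀ w ∈ e.source, ψ (w ^ 2) = e w ^ 2 := by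
  have ho' : ∀ w ∈ e.target, -w ∈ e.target ∧ e.symm (-w) = -e.symm w := by
    intro w hw; obtain ⟨h1, h2⟩ := ho _ (e.map_target hw); rw [e.right_inv hw] at h2; rw [← h2]
    exact ⟨e.map_source h1, e.left_inv h1⟩
  set q : ℂ → ℂ := fun z => z ^ (((2 : ℕ) : ℂ)⁻¹)
  have hq : ∀ z, q z ^ 2 = z := fun z => cpow_nat_inv_pow _ two_ne_zero
  have key : ∀ (f : OpenPartialHomeomorph ℂ ℂ),
      (∀ w ∈ f.source, -w ∈ f.source ∧ f (-w) = -f w) → ∀ w ∈ f.source,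
      q (w ^ 2) ∈ f.source ∧ f (q (w ^ 2)) ^ 2 = f w ^ 2 := by
    intro f hf w hw; rcases sq_eq_sq_iff_eq_or_eq_neg.mp (hq (w ^ 2)) with h | h <;> rw [h]
    · exact ⟨hw, rfl⟩
    · exact ⟨(hf w hw).1, by rw [(hf w hw).2, neg_sq]⟩
  have cont : ∀ (f : OpenPartialHomeomorph ℂ ℂ),
      (∀ w ∈ f.source, -w ∈ f.source ∧ f (-w) = -f w) →
      ContinuousOn (fun z => f (q z) ^ 2) ((fun w => w ^ 2) '' f.source) := by
    rintro f hf _ ⟨w, hw, rfl⟩; refine ContinuousAt.continuousWithinAt ?_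
    have h1 : Tendsto (fun w => f (q (w ^ 2)) ^ 2) (𝓝 w) (𝓝 (f (q (w ^ 2)) ^ 2)) := by
      rw [(key f hf w hw).2]; refine Tendsto.congr' ?_ ((f.continuousAt hw).pow 2)
      filter_upwards [f.open_source.mem_nhds hw] with v hv using (key f hf v hv).2.symm
    exact (tendsto_map'_iff.mpr h1).mono_left (isOpenMap_sq.nhds_le w)
  refine ⟨⟨⟨⟨fun z => e (q z) ^ 2, fun z => e.symm (q z) ^ 2, (fun w => w ^ 2) '' e.source, (fun w
    => w ^ 2) '' e.target, ?_, ?_, ?_, ?_⟩, cont e ho, cont e.symm ho'⟩, isOpenMap_sq _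
    e.open_source, isOpenMap_sq _ e.open_target⟩, rfl, rfl, fun w hw => (key e ho w hw).2⟩
  · rintro _ ⟨w, hw, rfl⟩; exact ⟨e w, e.map_source hw, (key e ho w hw).2.symm⟩
  · rintro _ ⟨w, hw, rfl⟩; exact ⟨e.symm w, e.map_target hw, (key e.symm ho' w hw).2.symm⟩
  · rintro _ ⟨w, hw, rfl⟩; simp only
    rw [(key e ho w hw).2, (key e.symm ho' _ (e.map_source hw)).2, e.left_inv hw]
  · rintro _ ⟨w, hw, rfl⟩; simp only
    rw [(key e.symm ho' w hw).2, (key e ho _ (e.map_target hw)).2, e.right_inv hw]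

/-- A local homeomorphism preserving the labels of the leaves. -/
structure LabelConj (a c a1 c1 : ℂ → ℂ) (ψ : OpenPartialHomeomorph ℂ ℂ) : Prop where
  zero_mem : 0 ∈ ψ.source
  map_zero : ψ 0 = 0
  labels : ∀ i w, (sign i : ℂ) * w ^ 2 ∈ ψ.source → ∃ w', (sign i : ℂ) * w' ^ 2 =
    ψ ((sign i : ℂ) * w ^ 2) ∧ coneLabels a1 c1 i w' = coneLabels a c i w

namespace LabelConj

variable {a c a1 c1 : ℂ → ℂ} {b b1 : ℂ} {ε ε1 : ℝ} {ψ : OpenPartialHomeomorph ℂ ℂ} {i : Fin 2}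

lemma symm (h : LabelConj a c a1 c1 ψ) : LabelConj a1 c1 a c ψ.symm where
  zero_mem := by rw [← h.map_zero]; exact ψ.map_source h.zero_mem
  map_zero := by have := ψ.left_inv h.zero_mem; rwa [h.map_zero] at this
  labels i v hv := by
    obtain ⟨w, hw⟩ := exists_sign_mul_sq i (ψ.symm ((sign i : ℂ) * v ^ 2))
    obtain ⟨w', h1, h2⟩ := h.labels i w (by rw [hw]; exact ψ.map_target hv)
    rw [hw, ψ.right_inv hv] at h1
    rcases sq_eq_sq_iff_eq_or_eq_neg.mp (mul_left_cancel₀ (sign_ne_zero i) h1) with rfl | rfl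
    · exact ⟨w, hw, h2.symm⟩
    · refine ⟨-w, by rw [neg_sq, hw], ?_⟩; rw [coneLabels_neg, ← h2, coneLabels_neg, neg_neg]

lemma ne_zero (h : LabelConj a c a1 c1 ψ) {z : ℂ} (hz : z ∈ ψ.source) (h0 : z ≠ 0) : ψ z ≠ 0 :=
  fun h1 => h0 (ψ.injOn hz h.zero_mem (h1.trans h.map_zero.symm))

lemma sameConeLeaf (h : LabelConj a c a1 c1 ψ) (ha : CoeffPair a c b ε)
    (ha1 : CoeffPair a1 c1 b1 ε1) {z z' : ℂ} (hz : z ∈ ψ.source) (hz' : z' ∈ ψ.source)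
    (h0 : z ≠ 0) (h0' : z' ≠ 0) (hs : SameConeLeaf a c i z z') :
    SameConeLeaf a1 c1 i (ψ z) (ψ z') := by
  obtain ⟨w, w', rfl, rfl, hl⟩ := hs; obtain ⟨v, hv, hv1⟩ := h.labels i w hz
  obtain ⟨v', hv', hv1'⟩ := h.labels i w' hz'; refine ⟨v, v', hv, hv', ?_⟩
  have n1 : ∀ {u : ℂ}, (sign i : ℂ) * u ^ 2 ≠ 0 → u ≠ 0 := fun h1 h2 => h1 (by simp [h2])
  refine (ha1.conePair i).sameLeaf_of_sameLabel (n1 (hv ▸ h.ne_zero hz h0))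
    (n1 (hv' ▸ h.ne_zero hz' h0')) ?_
  change SameLabel (coneLabels a1 c1 i v) (coneLabels a1 c1 i v'); rw [hv1, hv1']
  exact (ha.conePair i).sameLabel_of_sameLeaf (n1 h0) (n1 h0') hl

lemma image_planeLeaf (h : LabelConj a c a1 c1 ψ) (ha : CoeffPair a c b ε)
    (ha1 : CoeffPair a1 c1 b1 ε1) {W : Set ℂ} (hW : W ⊆ ψ.source \ {0}) {z : ℂ} (hz : z ∈ W) :
    ψ '' planeLeaf (coneLine a c i) W z = planeLeaf (coneLine a1 c1 i) (ψ '' W) (ψ z) := by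
  have key : ∀ {a c a1 c1 : ℂ → ℂ} {b b1 : ℂ} {ε ε1 : ℝ} {ψ : OpenPartialHomeomorph ℂ ℂ},
      LabelConj a c a1 c1 ψ → CoeffPair a c b ε → CoeffPair a1 c1 b1 ε1 → ∀ {W : Set ℂ},
      W ⊆ ψ.source \ {0} → ∀ {z z' : ℂ}, z ∈ W → z' ∈ planeLeaf (coneLine a c i) W z →
      ψ z' ∈ planeLeaf (coneLine a1 c1 i) (ψ '' W) (ψ z) := by
    intro a c a1 c1 b b1 ε ε1 ψ h ha ha1 W hW z z' hz hz'
    rw [mem_planeLeaf_iff ha fun z hz => (hW hz).2] at hz'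
    rw [mem_planeLeaf_iff ha1 (by rintro _ ⟨z, hz, rfl⟩; exact h.ne_zero (hW hz).1 (hW hz).2)]
    obtain ⟨σ, hσ, rfl, rfl, ht⟩ := hz'
    exact ⟨fun t => ψ (σ t), ψ.continuousOn.comp_continuous hσ fun t => (hW (ht t).1).1, rfl, rfl,
      fun t => ⟨mem_image_of_mem _ (ht t).1, h.sameConeLeaf ha ha1 (hW hz).1 (hW (ht t).1).1
        (hW hz).2 (hW (ht t).1).2 (ht t).2⟩⟩
  have hW1 : W ⊆ ψ.source := fun z hz => (hW hz).1
  refine Subset.antisymm (by rintro _ ⟨z', hz', rfl⟩; exact key h ha ha1 hW hz hz') fun y hy => ?_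
  have h1 := key h.symm ha1 ha (W := ψ '' W) (by
    rintro _ ⟨z, hz, rfl⟩
    exact ⟨ψ.map_source (hW hz).1, h.ne_zero (hW hz).1 (hW hz).2⟩) (mem_image_of_mem _ hz) hy
  rw [ψ.left_inv (hW1 hz), show ψ.symm '' (ψ '' W) = W from
    ψ.toPartialEquiv.symm_image_image_of_subset_source hW1] at h1
  obtain ⟨γ, -, -, h2, h3⟩ := hy; obtain ⟨x, hx, hxe⟩ := (h3 1).1; rw [h2] at hxe
  refine ⟨_, h1, ψ.right_inv ?_⟩; rw [← hxe]; exact ψ.map_source (hW1 hx)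

lemma mem_fanLeaf (h : LabelConj a c a1 c1 ψ) (ha : CoeffPair a c b ε)
    (ha1 : CoeffPair a1 c1 b1 ε1) {p : ℝ} {z : ℂ} (hz : z ∈ ψ.source) :
    z ∈ fanLeaf a c i p ↔ ψ z ∈ fanLeaf a1 c1 i p := by
  have key : ∀ {a c a1 c1 : ℂ → ℂ} {b b1 : ℂ} {ε ε1 : ℝ} {ψ : OpenPartialHomeomorph ℂ ℂ},
      LabelConj a c a1 c1 ψ → CoeffPair a c b ε → CoeffPair a1 c1 b1 ε1 → ∀ {z : ℂ},
      z ∈ ψ.source → z ∈ fanLeaf a c i p → ψ z ∈ fanLeaf a1 c1 i p := by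
    rintro a c a1 c1 b b1 ε ε1 ψ h ha ha1 _ hz ⟨w, rfl, hw, h0, hp⟩
    obtain ⟨v, hv, hl⟩ := h.labels i w hz; have hw0 : w ≠ 0 := by rintro rfl; simp at hw
    have hv0 : v ≠ 0 := by
      rintro rfl; refine h.ne_zero hz (mul_ne_zero (sign_ne_zero i) (pow_ne_zero 2 hw0)) ?_
      rw [← hv]; simp
    have e1 : ord (coneSlope a1 c1 i) v = ord (coneSlope a c i) w :=
      congrArg (fun p => p.1.1) hl
    have e2 : ord (coneSlope a1 c1 i.rev) (-I * v) =
        ord (coneSlope a c i.rev) (-I * w) := congrArg (fun p => p.2.1) hl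
    have e3 : fan (coneSlope a1 c1 i) (coneSlope a1 c1 i.rev) v =
        fan (coneSlope a c i) (coneSlope a c i.rev) w := congrArg (fun p => p.1.2) hl
    have hu := (ha.conePair i).ord_neg_of_ord_eq_zero hw h0
    have hv1 := (ha1.conePair i).re_mul_ord_neg hv0 (e1.trans h0); rw [e2] at hv1
    have hvre : 0 < v.re := by by_contra hn; push Not at hn; nlinarith
    refine ⟨v, hv, hvre, e1.trans h0, ?_⟩; unfold fan at e3; rw [if_pos hvre, if_pos hw, e2] at e3
    rw [← hp]; exact mul_right_cancel₀ (abs_pos.mpr hu.ne).ne' e3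
  refine ⟨key h ha ha1 hz, fun h1 => ?_⟩; have := key h.symm ha1 ha (ψ.map_source hz) h1
  rwa [ψ.left_inv hz] at this

end LabelConj

lemma labelConj_of_labels {a c a1 c1 : ℂ → ℂ} {b : ℂ} {ε : ℝ} (ha1 : CoeffPair a1 c1 b ε)
    {ψ : OpenPartialHomeomorph ℂ ℂ} (h0 : 0 ∈ ψ.source)
    (hl : ∀ w, w ^ 2 ∈ ψ.source → ∃ w', w' ^ 2 = ψ (w ^ 2) ∧
      coneLabels a1 c1 1 w' = coneLabels a c 1 w) : LabelConj a c a1 c1 ψ where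
  zero_mem := h0
  map_zero := by
    obtain ⟨w', h1, h2⟩ := hl 0 (by simpa using h0)
    rw [coneLabels, coneLabels, SlopePair.leafLabels_zero] at h2
    rw [(ha1.conePair 1).leafLabels_eq_zero h2] at h1; simpa using h1.symm
  labels i w hw := by
    fin_cases i
    · have hs : ((sign 0 : ℝ) : ℂ) = -1 := by simp [sign]
      have e : ∀ v : ℂ, ((sign 0 : ℝ) : ℂ) * v ^ 2 = (I * v) ^ 2 := fun v => by
        rw [hs, mul_pow, I_sq]
      simp only [Fin.zero_eta, Fin.isValue, e] at hw ⊢; obtain ⟨w', h1, h2⟩ := hl _ hw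
      refine ⟨-I * w', ?_, ?_⟩
      · rw [← h1, ← mul_assoc, mul_neg, I_mul_I, neg_neg, one_mul]
      · have e2 : w = -I * (I * w) := by rw [← mul_assoc, neg_mul, I_mul_I, neg_neg, one_mul]
        conv_rhs => rw [e2]
        have h3 : ∀ a c : ℂ → ℂ, ∀ v, coneLabels a c 0 (-I * v) =
          ((coneLabels a c 1 v).2, -(coneLabels a c 1 v).1) := fun a c v => SlopePair.leafLabels_swap _ _ _
        rw [h3, h3, h2]
    · have hs : ((sign 1 : ℝ) : ℂ) = 1 := by simp [sign]
      simp only [Fin.mk_one, Fin.isValue, hs, one_mul] at hw ⊢; exact hl _ hw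

/-- Foliations whose fans are of the same kind are locally conjugate. -/
lemma exists_labelConj {a c a1 c1 : ℂ → ℂ} {b b1 : ℂ} {ε ε1 : ℝ} (ha : CoeffPair a c b ε)
    (ha1 : CoeffPair a1 c1 b1 ε1)
    (hf : ∀ i, fanFlag (coneSlope a c i) = fanFlag (coneSlope a1 c1 i)) {r : ℝ} (hr : 0 < r) :
    ∃ ψ, LabelConj a c a1 c1 ψ ∧ ψ.source ⊆ closedBall 0 r := by
  have hp := ha.conePair 1; have hp1 := ha1.conePair 1
  obtain ⟨η, e, hη, hs, ht, hsb, -, hl⟩ := hp.exists_conj hp1 (hf 1) (hf _)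
    (r := min r 1) (lt_min hr one_pos)
  have hneg : ∀ w ∈ e.source, -w ∈ e.source := by
    rw [hs]; rintro w ⟨h1, h2⟩; refine ⟨by rwa [ord_neg, abs_neg], ?_⟩
    rwa [mul_neg, ord_neg, abs_neg]
  obtain ⟨ψ, hψs, -, hψ⟩ := exists_sq_descent e fun w hw => by
    refine ⟨hneg w hw, hp1.leafLabels_injective ?_⟩
    rw [hl _ (hs ▸ hneg w hw), leafLabels_neg, leafLabels_neg, hl _ (hs ▸ hw)]
  refine ⟨ψ, labelConj_of_labels ha1 ?_ fun w hw => ?_, ?_⟩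
  · rw [hψs]; exact ⟨0, by rw [hs]; exact SlopePair.zero_mem_labelBox _ _ hη, by simp⟩
  · rw [hψs] at hw; obtain ⟨v, hv, he⟩ := hw
    have hw : w ∈ e.source := by
      rcases sq_eq_sq_iff_eq_or_eq_neg.mp he with rfl | rfl
      · exact hv
      · simpa using hneg _ hv
    exact ⟨e w, (hψ w hw).symm, hl w (hs ▸ hw)⟩
  · rw [hψs, hs]; rintro _ ⟨w, hw, rfl⟩; have h1 := hsb hw; rw [mem_closedBall_zero_iff] at h1 ⊢
    rw [norm_pow]; have h2 := h1.trans (min_le_left _ _); have h3 := h1.trans (min_le_right _ _)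
    nlinarith [norm_nonneg w]

section Tangents

variable {a c : ℂ → ℂ} {b : ℂ} {ε : ℝ} {i : Fin 2}

/-- A leaf of the fan of slope `s` on the cover has a tangent ray at the origin. -/
lemma tendsto_fanLeaf (h : CoeffPair a c b ε) {p s : ℝ}
    (hs : ∀ f, IsSol (coneSlope a c i) f → axisValue (coneSlope a c i) 1 (f 1) = 0 →
      funnelPos (coneSlope a c i) 1 (f 1) = p → Tendsto (fun x => f x / x) (𝓝[>] 0) (𝓝 s)) :
    Tendsto (fun z : ℂ => (‖z‖⁻¹ : ℝ) • z) (𝓝[fanLeaf a c i p] 0)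
      (𝓝 (((sign i / (1 + s ^ 2) : ℝ) : ℂ) * Complex.mk 1 s ^ 2)) := by
  have hp := h.conePair i; set g := coneSlope a c i
  by_cases hne : ∃ f, IsSol g f ∧ axisValue g 1 (f 1) = 0 ∧ funnelPos g 1 (f 1) = p
  · obtain ⟨f, hf, hf0, hfp⟩ := hne; have hlim := hs f hf hf0 hfp
    set G : ℝ → ℂ := fun s => ((sign i / (1 + s ^ 2) : ℝ) : ℂ) * Complex.mk 1 s ^ 2 with hG
    have hGc : Continuous G := by
      have h1 : Continuous fun s : ℝ => sign i / (1 + s ^ 2) :=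
        continuous_const.div (by fun_prop) fun s => by positivity
      have h2 : Continuous fun s : ℝ => Complex.mk 1 s :=
        Complex.equivRealProdCLM.symm.continuous.comp (continuous_const.prodMk continuous_id)
      exact (Complex.continuous_ofReal.comp h1).mul (h2.pow 2)
    have h1 := (hGc.tendsto s).comp hlim; intro N hN
    obtain ⟨δ, hδ0, hδ⟩ := mem_nhdsGT_iff_exists_Ioo_subset.mp (h1 hN); have hδ0 : 0 < δ := hδ0
    have hball : Metric.ball (0 : ℂ) (δ ^ 2) ∈ 𝓝 (0 : ℂ) := Metric.ball_mem_nhds _ (by positivity)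
    rw [mem_map]
    filter_upwards [mem_nhdsWithin_of_mem_nhds hball, self_mem_nhdsWithin] with z hz hzl
    obtain ⟨w, rfl, hw, h0, hpos⟩ := hzl
    have hwf : w.im = f w.re := by
      have e1 := hp.fst.sol_one_of_axisValue hw h0
      have e2 := hp.fst.sol_one_of_axisValue one_pos hf0; rw [hpos, ← hfp, ← e2] at e1
      rw [hp.fst.sol_eq hf one_pos one_pos] at e1
      have := hp.fst.sol_unique (hp.fst.isSol hw w.im) hf one_pos (by linarith) hw
      rwa [hp.fst.sol_self hw] at this
    have hlt : w.re < δ := by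
      rw [mem_ball_zero_iff, norm_mul, norm_sign, one_mul, norm_pow] at hz
      exact (Complex.re_le_norm w).trans_lt (lt_of_pow_lt_pow_left₀ 2 hδ0.le hz)
    have h3 := hδ ⟨hw, hlt⟩
    have h4 : (‖(sign i : ℂ) * w ^ 2‖⁻¹ : ℝ) • ((sign i : ℂ) * w ^ 2) = G (f w.re / w.re) := by
      have e : w = (w.re : ℂ) * Complex.mk 1 (f w.re / w.re) := by
        apply Complex.ext
        · simp
        · simp only [Complex.im_ofReal_mul]; rw [mul_div_cancel₀ _ hw.ne', hwf]
      have hn : ‖(sign i : ℂ) * w ^ 2‖ = w.re ^ 2 * (1 + (f w.re / w.re) ^ 2) := by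
        rw [norm_mul, norm_sign, one_mul, norm_pow, ← Complex.normSq_eq_norm_sq,
          Complex.normSq_apply, hwf]
        field_simp
      rw [hn, hG, Complex.real_smul]; have hw' : (w.re : ℂ) ≠ 0 := by exact_mod_cast hw.ne'
      generalize w.re = x at e hw' ⊢
      have hx : ((1 + (f x / x) ^ 2 : ℝ) : ℂ) ≠ 0 := by
        exact_mod_cast (by positivity : (1 + (f x / x) ^ 2 : ℝ) ≠ 0)
      rw [e]
      simp only [Complex.ofReal_inv, Complex.ofReal_mul, Complex.ofReal_pow, Complex.ofReal_div]
      generalize Complex.mk 1 (f x / x) = v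
      generalize ((1 + (f x / x) ^ 2 : ℝ) : ℂ) = u at hx
      field_simp
    simp only [mem_preimage]; rw [h4]; exact h3
  · have : fanLeaf a c i p = ∅ := by
      refine eq_empty_iff_forall_notMem.mpr ?_; rintro _ ⟨w, rfl, hw, h0, hpos⟩
      have hf := hp.fst.isSol hw w.im; have h1 := hp.fst.sol_self hw w.im
      refine hne ⟨_, hf, ?_, ?_⟩
      · rw [hp.fst.axisValue_sol_one hw]; exact h0
      · rw [hp.fst.funnelPos_eq_of_isSol hf one_pos hw, h1, hpos]
    rw [this, nhdsWithin_empty]; exact tendsto_bot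

/-- Leaves which accumulate at the origin tend to it. -/
lemma planeLeaf_subset_fanLeaf (h : CoeffPair a c b ε) {W : Set ℂ} (hW : ∀ z ∈ W, z ≠ 0) {z : ℂ}
    (hz : z ∈ W) (hcl : 0 ∈ closure (planeLeaf (coneLine a c i) W z)) :
    ∃ p, z ∈ fanLeaf a c i p ∧ planeLeaf (coneLine a c i) W z ⊆ fanLeaf a c i p := by
  have hp := h.conePair i; set g := coneSlope a c i with hg
  have hsame : ∀ z' ∈ planeLeaf (coneLine a c i) W z, SameConeLeaf a c i z z' := by
    rintro z' ⟨γ, hγ, rfl, rfl, ht⟩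
    exact sameConeLeaf_of_tangent h hγ (fun t => hW _ (ht t).1) (fun t => (ht t).2) 0 1
  obtain ⟨w, hw, hwre⟩ : ∃ w : ℂ, (sign i : ℂ) * w ^ 2 = z ∧ 0 ≤ w.re := by
    obtain ⟨w, hw⟩ := exists_sign_mul_sq i z; rcases le_total 0 w.re with h1 | h1
    · exact ⟨w, hw, h1⟩
    · exact ⟨-w, by rw [neg_sq, hw], by simpa using h1⟩
  have hw0 : w ≠ 0 := by rintro rfl; exact hW z hz (by rw [← hw]; simp)
  have hsame' : ∀ z' ∈ planeLeaf (coneLine a c i) W z, ∃ w', (sign i : ℂ) * w' ^ 2 = z' ∧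
      SameLeaf g w w' := by
    intro z' hz'; obtain ⟨v, v', hv, hv', hl⟩ := hsame z' hz'
    rcases sq_eq_sq_iff_eq_or_eq_neg.mp
      (mul_left_cancel₀ (sign_ne_zero i) (hw.trans hv.symm)) with rfl | rfl
    · exact ⟨v', hv', hl⟩
    · exact ⟨-v', by rw [neg_sq, hv'], hl.neg hp.fst⟩
  have hord : ∀ {w' : ℂ}, SameLeaf g w w' → ord g w' = ord g w := by
    rintro w' ⟨k, f, hf, h1, h2, -⟩; rw [ord, ord, ← h1, ← h2, hf.axisValue, hf.axisValue]
  have h0 : ord g w = 0 := by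
    by_contra hne; have hc : ContinuousAt (ord g) 0 := hp.fst.continuous_ord.continuousAt
    rw [ContinuousAt, ord_zero] at hc
    obtain ⟨δ, hδ, hδ'⟩ := Metric.eventually_nhds_iff.mp
      ((Metric.tendsto_nhds.mp hc) |ord g w| (abs_pos.mpr hne))
    obtain ⟨z', hz', hd⟩ := Metric.mem_closure_iff.mp hcl (δ ^ 2) (by positivity)
    obtain ⟨w', rfl, hl⟩ := hsame' z' hz'
    rw [dist_comm, dist_zero_right, norm_mul, norm_sign, one_mul, norm_pow] at hd
    have := hδ' (y := w') (by rw [dist_zero_right]; exact lt_of_pow_lt_pow_left₀ 2 hδ.le hd)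
    rw [hord hl, dist_zero_right, Real.norm_eq_abs] at this; exact lt_irrefl _ this
  have hwre : 0 < w.re := lt_of_le_of_ne hwre (re_ne_zero hw0 h0).symm
  refine ⟨_, ⟨w, hw, hwre, h0, rfl⟩, fun z' hz' => ?_⟩; obtain ⟨w', hw', hl⟩ := hsame' z' hz'
  have h0' := (hord hl).trans h0; obtain ⟨k, f, hf, h1, h2, h3⟩ := hl
  have hk : k = 0 := by rw [← h0, ord, ← h1, hf.axisValue]
  have hre : 0 < w'.re := (pos_iff_pos_of_mul_pos (h3.resolve_left (by simpa using hk))).mp hwre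
  refine ⟨w', hw', hre, h0', ?_⟩; rw [← h1, ← h2]
  exact hp.fst.funnelPos_eq_of_isSol hf.isSol hre hwre

end Tangents

section Transport

variable {N : Type*} [TopologicalSpace N] [ChartedSpace E2 N]

/-- A diffeomorphism which matches two line fields matches their leaves. -/
lemma image_leaf (φ : OpenPartialHomeomorph N ℂ)
    (hφ : ContMDiffOn (𝓡 2) 𝓘(ℝ, ℂ) 1 φ φ.source)
    (hφ' : ContMDiffOn 𝓘(ℝ, ℂ) (𝓡 2) 1 φ.symm φ.target)
    {l : (x : N) → Set (TangentSpace (𝓡 2) x)} {l' : ℂ → Set ℂ} {W : Set N} (hW : W ⊆ φ.source)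
    (hl : ∀ x ∈ W, ∀ v : E2, v ∈ l x ↔ (mfderiv (𝓡 2) 𝓘(ℝ, ℂ) φ x v : ℂ) ∈ l' (φ x)) {x : N} :
    φ '' leaf l W x = planeLeaf l' (φ '' W) (φ x) ∩ φ '' {y | x ∈ W ∧ y ∈ W} := by
  have hd : ∀ δ : ℝ → N, ContMDiff 𝓘(ℝ, ℝ) (𝓡 2) 1 δ → (∀ t, δ t ∈ W) → ∀ t,
      deriv (fun t => φ (δ t)) t =
        (mfderiv (𝓡 2) 𝓘(ℝ, ℂ) φ (δ t) (mfderiv 𝓘(ℝ, ℝ) (𝓡 2) δ t (1 : ℝ)) : ℂ) := by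
    intro δ hδ hm t
    have h1 : MDifferentiableAt (𝓡 2) 𝓘(ℝ, ℂ) φ (δ t) :=
      ((hφ.contMDiffAt (φ.open_source.mem_nhds (hW (hm t)))).mdifferentiableAt one_ne_zero)
    have h2 := mfderiv_comp t h1 ((hδ t).mdifferentiableAt one_ne_zero)
    rw [mfderiv_eq_fderiv] at h2; have h3 := congrArg (fun A => A (1 : ℝ)) h2; exact h3
  ext y; constructor
  · rintro ⟨_, ⟨γ, hγ, rfl, rfl, ht⟩, rfl⟩
    refine ⟨⟨fun t => φ (γ t), ?_, rfl, rfl, fun t => ⟨mem_image_of_mem _ (ht t).1, ?_⟩⟩,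
      mem_image_of_mem _ ⟨(ht 0).1, (ht 1).1⟩⟩
    · exact contMDiff_iff_contDiff.mp (hφ.comp_contMDiff hγ fun t => hW (ht t).1)
    · rw [hd γ hγ fun t => (ht t).1]; exact (hl _ (ht t).1 _).mp (ht t).2
  · rintro ⟨⟨γ, hγ, h0, h1, ht⟩, y, ⟨hx, hy⟩, rfl⟩
    have hm : ∀ t, φ.symm (γ t) ∈ W ∧ φ (φ.symm (γ t)) = γ t := fun t => by
      obtain ⟨z, hz, he⟩ := (ht t).1; rw [← he, φ.left_inv (hW hz)]; exact ⟨hz, rfl⟩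
    have hγt : ∀ t, γ t ∈ φ.target := fun t => by rw [← (hm t).2]; exact φ.map_source (hW (hm t).1)
    have hδ : ContMDiff 𝓘(ℝ, ℝ) (𝓡 2) 1 fun t => φ.symm (γ t) :=
      hφ'.comp_contMDiff (contMDiff_iff_contDiff.mpr hγ) hγt
    refine ⟨y, ⟨fun t => φ.symm (γ t), hδ, ?_, ?_, fun t => ⟨(hm t).1, ?_⟩⟩, rfl⟩
    · simp only [h0, φ.left_inv (hW hx)]
    · simp only [h1, φ.left_inv (hW hy)]
    · refine (hl _ (hm t).1 _).mpr ?_; rw [← hd _ hδ fun t => (hm t).1, (hm t).2]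
      simp only [(hm _).2]; exact (ht t).2

end Transport

/-- The linear coordinate in which the model with parameters `k`, `l` becomes a field of
cones. -/
def modelEquiv {k l ρ : ℝ} (hk : 0 < k) (hl : 0 < l) (hρ : 0 < ρ) : E2 ≃L[ℝ] ℂ :=
  (EuclideanSpace.equiv (Fin 2) ℝ).trans <| ContinuousLinearEquiv.equivOfInverse
    (Complex.equivRealProdCLM.symm.toContinuousLinearMap ∘L ((ρ * k) • ContinuousLinearMap.proj (R
    := ℝ) (φ := fun _ : Fin 2 => ℝ) 0).prod ((ρ * l) • ContinuousLinearMap.proj (R := ℝ) (φ := fun _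
    : Fin 2 => ℝ) 1)) (ContinuousLinearMap.pi ![(ρ * k)⁻¹ • Complex.reCLM, (ρ * l)⁻¹ •
    Complex.imCLM]) (fun x => by
      funext j
      fin_cases j <;> simp <;> field_simp)
    (fun x => by apply Complex.ext <;> simp <;> field_simp)

lemma modelEquiv_apply {k l ρ : ℝ} (hk : 0 < k) (hl : 0 < l) (hρ : 0 < ρ) (x : E2) :
    modelEquiv hk hl hρ x = Complex.mk (ρ * k * x 0) (ρ * l * x 1) := by
  apply Complex.ext <;> simp [modelEquiv]

lemma mem_modelLine_iff {k l ρ : ℝ} (hk : 0 < k) (hl : 0 < l) (hρ : 0 < ρ) {b : ℂ}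
    (hb : b = ((k - l) / (k + l) : ℝ)) (i : Fin 2) (x v : E2) :
    v ∈ modelLine k l i x ↔ modelEquiv hk hl hρ v ∈
      coneLine (fun _ => 1) (fun _ => b) i (modelEquiv hk hl hρ x) := by
  have hs : 0 < k + l := by positivity
  have key : ∀ v : E2, v ∈ modelLine k l i x ↔ modelEquiv hk hl hρ x * conj (Complex.mk (v 0) (v 1)) =
      (sign i * ‖modelEquiv hk hl hρ x‖ : ℝ) * Complex.mk (v 0) (v 1) := by
    intro v
    have hn : ‖modelEquiv hk hl hρ x‖ = ρ * √((k * x 0) ^ 2 + (l * x 1) ^ 2) := by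
      rw [modelEquiv_apply, Complex.norm_def, Complex.normSq_mk, show ρ * k * x 0 * (ρ * k * x 0) +
        ρ * l * x 1 * (ρ * l * x 1) = ρ ^ 2 * ((k * x 0) ^ 2 + (l * x 1) ^ 2) by ring, Real.sqrt_mul
        (by positivity), Real.sqrt_sq hρ.le]
    rw [hn, modelEquiv_apply, Complex.ext_iff]
    simp only [Complex.mul_re, Complex.mul_im, Complex.conj_re, Complex.conj_im,
      Complex.ofReal_re, Complex.ofReal_im, modelLine]
    set S := √((k * x 0) ^ 2 + (l * x 1) ^ 2); constructor
    · rintro ⟨h1, h2⟩; exact ⟨by linear_combination ρ * h1, by linear_combination ρ * h2⟩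
    · rintro ⟨h1, h2⟩
      exact ⟨mul_left_cancel₀ hρ.ne' (by linear_combination h1),
        mul_left_cancel₀ hρ.ne' (by linear_combination h2)⟩
  rw [key]; set ζ := modelEquiv hk hl hρ x
  have e : ∀ η : ℂ, (1 : ℂ) * η + b * conj η = Complex.mk (2 * k / (k + l) * η.re)
      (2 * l / (k + l) * η.im) := by
    intro η; rw [hb]; apply Complex.ext
    · simp only [Complex.add_re, one_mul, Complex.re_ofReal_mul, Complex.conj_re]; field_simp; ring
    · simp only [Complex.add_im, one_mul, Complex.im_ofReal_mul, Complex.conj_im]; field_simp; ring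
  constructor
  · intro h; refine ⟨((ρ * (k + l) / 2 : ℝ) : ℂ) * Complex.mk (v 0) (v 1), ?_, ?_⟩
    · rw [e, modelEquiv_apply]; apply Complex.ext
      · simp only [Complex.re_ofReal_mul]; field_simp
      · simp only [Complex.im_ofReal_mul]; field_simp
    · rw [map_mul, Complex.conj_ofReal]
      linear_combination ((ρ * (k + l) / 2 : ℝ) : ℂ) * h
  · rintro ⟨η, h1, h2⟩; rw [e, modelEquiv_apply] at h1; have h3 := congrArg Complex.re h1
    have h4 := congrArg Complex.im h1; simp only at h3 h4
    have e2 : Complex.mk (v 0) (v 1) = ((2 / (ρ * (k + l)) : ℝ) : ℂ) * η := by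
      apply Complex.ext
      · simp only [Complex.re_ofReal_mul]; field_simp at h3 ⊢; linarith
      · simp only [Complex.im_ofReal_mul]; field_simp at h4 ⊢; linarith
    rw [e2, map_mul, Complex.conj_ofReal]
    linear_combination ((2 / (ρ * (k + l)) : ℝ) : ℂ) * h2

lemma coeffPair_const {b : ℂ} (hb : ‖b‖ < 1) : CoeffPair (fun _ => 1) (fun _ => b) b 0 where
  contDiff_fst := contDiff_const
  contDiff_snd := contDiff_const
  norm_fst_sub z := by simp
  norm_snd_sub z := by simp
  norm_lt := by simpa
  fst_zero := rfl
  snd_zero := rfl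

variable {M : Type*} [TopologicalSpace M] [ChartedSpace E2 M]

/-- A coordinate `φ` near an umbilic point `q` and a frame `F` at `q`, in which the principal line
fields become a field of cones. -/
structure ConeChart (β : M → E3) (q : M) (a c : ℂ → ℂ) (b : ℂ) (φ : OpenPartialHomeomorph M ℂ)
    (F : ℂ →ₗ[ℝ] E2) : Prop where
  mem_source : q ∈ φ.source
  map_self : φ q = 0
  contMDiffOn : ContMDiffOn (𝓡 2) 𝓘(ℝ, ℂ) 1 φ φ.source
  contMDiffOn_symm : ContMDiffOn 𝓘(ℝ, ℂ) (𝓡 2) 1 φ.symm φ.target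
  umbilic_iff : ∀ x ∈ φ.source, IsUmbilic β x ↔ φ x = 0
  mem_line : ∀ i, ∀ x ∈ φ.source, x ≠ q → ∀ v : E2, v ∈ principalLine β i x ↔
    (mfderiv (𝓡 2) 𝓘(ℝ, ℂ) φ x v : ℂ) ∈ coneLine a c i (φ x)
  deriv : ∃ L : ℂ →L[ℝ] E2, HasFDerivAt (fun z => ch q (φ.symm z)) L 0 ∧
    ∀ z, L (z + b * conj z) = F z
  inner_frame : ∃ κ : ℝ, 0 < κ ∧ ∀ z z',
    inner ℝ (differential β q (F z)) (differential β q (F z')) = κ * (z * conj z').re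

namespace ConeChart

variable {β : M → E3} {q : M} {a c : ℂ → ℂ} {b : ℂ} {ε : ℝ} {φ : OpenPartialHomeomorph M ℂ}
  {F : ℂ →ₗ[ℝ] E2}

lemma frame_ne_zero (h : ConeChart β q a c b φ F) {z : ℂ} (hz : z ≠ 0) : F z ≠ 0 := by
  obtain ⟨κ, hκ, hi⟩ := h.inner_frame; intro h0; have := hi z z
  rw [h0, map_zero, inner_zero_left, mul_conj, ofReal_re] at this
  exact (mul_pos hκ (normSq_pos.mpr hz)).ne this

lemma exists_isModelChart (h : ConeChart β q a c b φ F) (ha : CoeffPair a c b ε) {k l : ℝ}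
    (hk : 0 < k) (hl : 0 < l) {b1 : ℂ} (hb1 : b1 = ((k - l) / (k + l) : ℝ)) (hb : ‖b1‖ < 1)
    (hf : ∀ i, fanFlag (coneSlope a c i) = fanFlag (coneSlope (fun _ => 1) (fun _ => b1) i))
    {V : Set M} (hV : V ∈ 𝓝 q) :
    ∃ (e : OpenPartialHomeomorph M E2) (ψ : OpenPartialHomeomorph ℂ ℂ) (ρ : ℝ) (hρ : 0 < ρ),
      e.source ⊆ V ∧ IsModelChart β q k l e ∧ LabelConj a c (fun _ => 1) (fun _ => b1) ψ ∧
      ∀ x ∈ e.source, x ∈ φ.source ∧ φ x ∈ ψ.source ∧ ψ (φ x) = modelEquiv hk hl hρ (e x) := by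
  have ha1 := coeffPair_const hb; obtain ⟨ψ, hψ, -⟩ := exists_labelConj ha ha1 hf one_pos
  obtain ⟨V', hV'V, hV'o, hqV'⟩ := mem_nhds_iff.mp hV
  set e0 : OpenPartialHomeomorph M ℂ := (φ.trans ψ).restrOpen V' hV'o with he0
  have hs0 : e0.source = (φ.source ∩ φ ⁻¹' ψ.source) ∩ V' := by
    rw [he0, OpenPartialHomeomorph.restrOpen_source, OpenPartialHomeomorph.trans_source]
  have hq0 : q ∈ e0.source := by
    rw [hs0]; exact ⟨⟨h.mem_source, by rw [mem_preimage, h.map_self]; exact hψ.zero_mem⟩, hqV'⟩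
  have he₀a : ∀ x, e0 x = ψ (φ x) := fun x => rfl
  have he₀q : e0 q = 0 := by rw [he₀a, h.map_self, hψ.map_zero]
  have h0t : (0 : ℂ) ∈ e0.target := he₀q ▸ e0.map_source hq0
  obtain ⟨r, hr, hrt⟩ := isOpen_iff.mp e0.open_target 0 h0t; set ρ : ℝ := r / (k + l + 1) with hρdef
  have hρ : 0 < ρ := by positivity
  set m := modelEquiv hk hl hρ with hm
  have hmball : ∀ x ∈ ball (0 : E2) 1, m x ∈ e0.target := by
    intro x hx; refine hrt ?_; rw [mem_ball_zero_iff] at hx ⊢; rw [hm, modelEquiv_apply]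
    refine (norm_le_abs_re_add_abs_im _).trans_lt ?_
    have h1 : ∀ j, |x j| ≤ 1 := fun j => ((PiLp.norm_apply_le x j).trans hx.le)
    simp only [abs_mul, abs_of_pos hρ, abs_of_pos hk, abs_of_pos hl]
    have e1 : ρ * (k + l + 1) = r := by rw [hρdef]; field_simp
    nlinarith [mul_le_mul_of_nonneg_left (h1 0) (mul_pos hρ hk).le,
      mul_le_mul_of_nonneg_left (h1 1) (mul_pos hρ hl).le]
  set g : OpenPartialHomeomorph E2 ℂ :=
    m.toHomeomorph.toOpenPartialHomeomorph.restrOpen (ball 0 1) isOpen_ball with hg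
  have hgs : g.source = ball 0 1 := by rw [hg, OpenPartialHomeomorph.restrOpen_source]; simp
  have hga : ∀ x, g x = m x := fun x => rfl; have hgsymm : ∀ z, g.symm z = m.symm z := fun z => rfl
  have hgt : g.target = m.symm ⁻¹' ball 0 1 := by
    rw [← g.image_source_eq_target, hgs]; ext z; constructor
    · rintro ⟨x, hx, rfl⟩; rwa [mem_preimage, hga, m.symm_apply_apply]
    · intro hz; exact ⟨m.symm z, hz, by rw [hga, m.apply_symm_apply]⟩
  set e := e0.trans g.symm with he
  have hes : ∀ x, x ∈ e.source ↔ x ∈ e0.source ∧ m.symm (e0 x) ∈ ball (0 : E2) 1 := by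
    intro x
    rw [he, OpenPartialHomeomorph.trans_source, OpenPartialHomeomorph.symm_source, hgt]; rfl
  have het : e.target = ball 0 1 := by
    rw [he, OpenPartialHomeomorph.trans_target, OpenPartialHomeomorph.symm_target, hgs]
    refine inter_eq_left.mpr fun x hx => ?_; rw [mem_preimage, OpenPartialHomeomorph.symm_symm]
    exact hmball x hx
  have hme : ∀ x, m (e x) = ψ (φ x) := fun x => by
    rw [he, OpenPartialHomeomorph.trans_apply, hgsymm, m.apply_symm_apply, he₀a]
  have heq : e q = 0 := by refine m.injective ?_; rw [hme, h.map_self, hψ.map_zero, map_zero]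
  have hqs : q ∈ e.source := (hes q).mpr ⟨hq0, by rw [he₀q, map_zero]; simp⟩
  have hsφ : ∀ x ∈ e.source, x ∈ φ.source ∧ φ x ∈ ψ.source := fun x hx => by
    have := ((hes x).mp hx).1; rw [hs0] at this; exact this.1
  refine ⟨e, ψ, ρ, hρ, fun x hx => ?_, ⟨hqs, het, heq, fun x hx => ?_, fun i x hx => ?_⟩, hψ,
    fun x hx => ⟨(hsφ x hx).1, (hsφ x hx).2, (hme x).symm⟩⟩
  · have := ((hes x).mp hx).1; rw [hs0] at this; exact hV'V this.2
  · rw [h.umbilic_iff x (hsφ x hx).1]; constructor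
    · intro h0; exact φ.injOn (hsφ x hx).1 h.mem_source (h0.trans h.map_self.symm)
    · rintro rfl; exact h.map_self
  · set W := e.source \ {q} with hW; have hWφ : W ⊆ φ.source := fun y hy => (hsφ y hy.1).1
    have l1 := image_leaf φ h.contMDiffOn h.contMDiffOn_symm hWφ (l := principalLine β i) (l' :=
      coneLine a c i) (fun y hy => h.mem_line i y (hWφ hy) hy.2) (x := x)
    have hφ0 : ∀ y ∈ W, φ y ≠ 0 := fun y hy h0 =>
      hy.2 (φ.injOn (hWφ hy) h.mem_source (h0.trans h.map_self.symm))
    have hW2 : φ '' W ⊆ ψ.source \ {0} := by rintro _ ⟨y, hy, rfl⟩; exact ⟨(hsφ y hy.1).2, hφ0 y hy⟩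
    have sub : ∀ {l' : ℂ → Set ℂ} {W : Set ℂ} {z : ℂ}, planeLeaf l' W z ⊆ W := by
      rintro l' W z _ ⟨γ, -, -, rfl, ht⟩; exact (ht 1).1
    have hx' : {y | x ∈ W ∧ y ∈ W} = W := by ext y; simp [hx]
    rw [hx', inter_eq_left.mpr sub] at l1
    have l2 := hψ.image_planeLeaf (i := i) ha ha1 hW2 (mem_image_of_mem φ hx)
    have himg : e '' W = ball 0 1 \ {0} := by
      rw [hW, e.injOn.image_sdiff_subset (singleton_subset_iff.mpr hqs), e.image_source_eq_target,
        het, image_singleton, heq]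
    have l3 := image_leaf m.toHomeomorph.toOpenPartialHomeomorph (contMDiffOn_iff_contDiffOn.mpr
      m.contDiff.contDiffOn) (contMDiffOn_iff_contDiffOn.mpr m.symm.contDiff.contDiffOn) (l :=
      modelLine k l i) (l' := coneLine (fun _ => 1) (fun _ => b1) i) (W := ball 0 1 \ {0}) (x := e
      x) (subset_univ _) (fun y _ v => by
        rw [mem_modelLine_iff hk hl hρ hb1 i y v, mfderiv_eq_fderiv]
        have : fderiv ℝ (m.toHomeomorph.toOpenPartialHomeomorph : E2 → ℂ) y = m := m.fderiv
        rw [this]; rfl)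
    have hex : e x ∈ ball (0 : E2) 1 \ {0} := himg ▸ mem_image_of_mem e hx
    have hx'' : {y | e x ∈ ball (0 : E2) 1 \ {0} ∧ y ∈ ball (0 : E2) 1 \ {0}} =
        ball (0 : E2) 1 \ {0} := by ext y; simp only [hex, true_and, ofPred_mem_eq]
    rw [hx'', inter_eq_left.mpr sub] at l3; change m '' _ = planeLeaf _ (m '' _) (m (e x)) at l3
    have hcomp : ∀ S : Set M, m '' (e '' S) = ψ '' (φ '' S) := fun S => by
      rw [image_image, image_image]; exact image_congr fun y _ => hme y
    refine m.injective.image_injective ?_; rw [hcomp, l1, l2, l3, ← himg, hcomp, hme]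

lemma isTangentRay (h : ConeChart β q a c b φ F) (ha : CoeffPair a c b ε) {i : Fin 2} {p s : ℝ}
    (hroot : slopeCubic b s = 0)
    (hs : ∀ f, IsSol (coneSlope a c i) f → axisValue (coneSlope a c i) 1 (f 1) = 0 →
      funnelPos (coneSlope a c i) 1 (f 1) = p → Tendsto (fun x => f x / x) (𝓝[>] 0) (𝓝 s))
    {S : Set M} (hS : S ⊆ φ.source) (hSp : φ '' S ⊆ fanLeaf a c i p) :
    IsTangentRay S q ((sign i * ‖F (Complex.mk 1 s)‖⁻¹) • F (Complex.mk 1 s)) := by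
  obtain ⟨L, hL, hLF⟩ := h.deriv; have hlim := tendsto_fanLeaf ha hs
  set d := ((sign i / (1 + s ^ 2) : ℝ) : ℂ) * Complex.mk 1 s ^ 2 with hd
  have h1s : (0 : ℝ) < 1 + s ^ 2 := by positivity
  have hR := slopeDenom_pos ha.norm_lt_one s
  set R := 1 + s ^ 2 + b.re * (1 - s ^ 2) + 2 * b.im * s with hRdef
  have hT : Complex.mk 1 s + b * conj (Complex.mk 1 s) =
      ((R / (1 + s ^ 2) : ℝ) : ℂ) * Complex.mk 1 s ^ 2 := by
    simp only [slopeCubic] at hroot; have hc : conj (Complex.mk 1 s) = Complex.mk 1 (-s) := rfl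
    rw [hc]; apply Complex.ext
    · simp only [Complex.add_re, Complex.mul_re, Complex.ofReal_re, Complex.ofReal_im, zero_mul,
        sub_zero, pow_two (Complex.mk 1 s)]
      rw [div_mul_eq_mul_div, eq_div_iff h1s.ne', hRdef]
      linear_combination -s * hroot
    · simp only [Complex.add_im, Complex.mul_im, Complex.ofReal_re, Complex.ofReal_im, zero_mul,
        add_zero, pow_two (Complex.mk 1 s)]
      rw [div_mul_eq_mul_div, eq_div_iff h1s.ne', hRdef]
      linear_combination hroot
  have hLd : L d = (sign i / R) • F (Complex.mk 1 s) := by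
    rw [← hLF, hT, hd, ← Complex.real_smul, ← Complex.real_smul, map_smul, map_smul, smul_smul]
    congr 1; field_simp
  have hFs : F (Complex.mk 1 s) ≠ 0 := h.frame_ne_zero fun h0 => by
    have := congrArg Complex.re h0; simp at this
  have hsn : |sign i| = 1 := by unfold sign; split_ifs <;> simp
  have hsne : sign i ≠ 0 := fun h0 => by rw [h0] at hsn; simp at hsn
  have hLd0 : L d ≠ 0 := by rw [hLd]; exact smul_ne_zero (div_ne_zero hsne hR.ne') hFs
  have hφq : φ.symm 0 = q := by rw [← h.map_self, φ.left_inv h.mem_source]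
  have hstep : Tendsto (fun z : ℂ => ‖z‖⁻¹ • (ch q (φ.symm z) - ch q q))
      (𝓝[fanLeaf a c i p] 0) (𝓝 (L d)) := by
    have h2 : Tendsto (fun z : ℂ => L ((‖z‖⁻¹ : ℝ) • z)) (𝓝[fanLeaf a c i p] 0) (𝓝 (L d)) :=
      (L.continuous.tendsto d).comp hlim
    have h3 : Tendsto (fun z : ℂ => ‖z‖⁻¹ • (ch q (φ.symm z) - ch q q - L z))
        (𝓝[fanLeaf a c i p] 0) (𝓝 0) := by
      have h4 := hL.isLittleO; rw [hφq] at h4; simp only [sub_zero] at h4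
      refine Tendsto.mono_left ?_ nhdsWithin_le_nhds; rw [tendsto_zero_iff_norm_tendsto_zero]
      refine (h4.norm_norm.tendsto_div_nhds_zero).congr fun z => ?_
      rw [norm_smul, norm_inv, norm_norm, div_eq_inv_mul]
    refine ((h2.add h3).congr fun z => ?_).mono_right (by rw [add_zero])
    rw [map_smul, ← smul_add, add_sub_cancel]
  have hnorm : Tendsto (fun z : ℂ => ‖ch q (φ.symm z) - ch q q‖⁻¹ •
      (ch q (φ.symm z) - ch q q)) (𝓝[fanLeaf a c i p \ {0}] 0)
      (𝓝 (‖L d‖⁻¹ • L d)) := by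
    have h5 := ((hstep.norm.inv₀ (norm_ne_zero_iff.mpr hLd0)).smul hstep).mono_left
      (nhdsWithin_mono 0 (sdiff_subset (s := fanLeaf a c i p) (t := {0})))
    refine h5.congr' ?_; filter_upwards [self_mem_nhdsWithin] with z hz
    have hz0 : ‖z‖ ≠ 0 := norm_ne_zero_iff.mpr hz.2
    rw [norm_smul, norm_inv, norm_norm, smul_smul, mul_inv, inv_inv]; congr 1; field_simp
  have hdir : ‖L d‖⁻¹ • L d = (sign i * ‖F (Complex.mk 1 s)‖⁻¹) • F (Complex.mk 1 s) := by
    rw [hLd, norm_smul, Real.norm_eq_abs, abs_div, hsn, abs_of_pos hR, smul_smul]; congr 1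
    have := norm_ne_zero_iff.mpr hFs; field_simp
  rw [← hdir, IsTangentRay]
  have hφt : Tendsto φ (𝓝[S \ {q}] q) (𝓝[fanLeaf a c i p \ {0}] 0) := by
    refine tendsto_nhdsWithin_iff.mpr ⟨?_, ?_⟩
    · have := (φ.continuousAt h.mem_source).tendsto; rw [h.map_self] at this
      exact this.mono_left nhdsWithin_le_nhds
    · filter_upwards [self_mem_nhdsWithin] with y hy
      refine ⟨hSp (mem_image_of_mem _ hy.1), fun h0 => hy.2 ?_⟩
      exact φ.injOn (hS hy.1) h.mem_source (Eq.trans h0 h.map_self.symm)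
  refine (hnorm.comp hφt).congr' ?_; filter_upwards [self_mem_nhdsWithin] with y hy
  simp only [Function.comp, φ.left_inv (hS hy.1)]

end ConeChart

section Fans

variable {a c : ℂ → ℂ} {b : ℂ} {ε : ℝ} {i : Fin 2}

lemma HasFan.tendsto (h : CoeffPair a c b ε) {σt σb σm : ℝ}
    (hF : HasFan (coneSlope a c i) σt σb σm) {p : ℝ} {f : ℝ → ℝ} (hf : IsSol (coneSlope a c i) f)
    (h0 : axisValue (coneSlope a c i) 1 (f 1) = 0) (hp : funnelPos (coneSlope a c i) 1 (f 1) = p) :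
    Tendsto (fun x => f x / x) (𝓝[>] 0) (𝓝 (if p = 1 then σt else if p = -1 then σb else σm)) := by
  have hg := (h.conePair i).fst; have e1 := hg.sol_one_of_axisValue one_pos h0
  rw [hg.sol_eq hf one_pos one_pos, hp] at e1
  have hne : funnelTop (coneSlope a c i) - funnelBot (coneSlope a c i) ≠ 0 := fun h1 => by
    have := hF.flag; rw [fanFlag, if_pos (sub_eq_zero.mp h1)] at this; norm_num at this
  split_ifs with h1 h2
  · exact hF.top f hf (by rw [h1] at e1; linarith)
  · exact hF.bot f hf (by rw [h2] at e1; linarith)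
  · refine hF.mid f hf h0 (fun h3 => h1 ?_) fun h3 => h2 ?_
    · refine mul_right_cancel₀ hne ?_; rw [h3] at e1; linarith
    · refine mul_right_cancel₀ hne ?_; rw [h3] at e1; linarith

lemma norm_model : ‖((-5 / 11 : ℝ) : ℂ)‖ < 1 := by
  rw [norm_real, Real.norm_eq_abs, abs_lt]; norm_num

lemma hasFan_model (i : Fin 2) :
    HasFan (coneSlope (fun _ => 1) (fun _ => ((-5 / 11 : ℝ) : ℂ)) i) (1 / 2) (-1 / 2) 0 :=
  ((coeffPair_const norm_model).twist i).hasFan_node (by norm_num) (by norm_num) fun s => by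
    simp only [slopeCubic, ofReal_re, ofReal_im]; ring

lemma mem_fanLeaf_const {b0 : ℂ} (hb0 : ‖b0‖ < 1) {i : Fin 2}
    (hF : HasFan (coneSlope (fun _ => 1) (fun _ => b0) i) (1 / 2) (-1 / 2) 0) {s : ℝ}
    (hs : s = 1 ∨ s = -1) (hroot : slopeCubic b0 (s / 2) = 0) {z : ℂ} :
    z ∈ fanLeaf (fun _ => 1) (fun _ => b0) i s ↔
      ∃ t : ℝ, 0 < t ∧ z = (sign i : ℂ) * (t * Complex.mk 2 s ^ 2) := by
  have hc := coeffPair_const hb0; have hp := hc.conePair i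
  set g := coneSlope (fun _ => 1) (fun _ => b0) i with hg
  have hsol : IsSol g fun x => x * (s / 2) := by
    intro x hx; have h1 := (hc.twist i).isBlowup.eq x (s / 2) hx
    have h2 : CoeffPair.blowup (twist i fun _ => 1) (twist i fun _ => b0) x (s / 2) =
        CoeffPair.blowup (twist i fun _ => 1) (twist i fun _ => b0) 0 (s / 2) := by
      simp only [CoeffPair.blowup, blowupVec, twist]
    rw [h2, (hc.twist i).blowup_zero_eq_zero.mpr hroot, zero_add] at h1
    have h3 : g x (x * (s / 2)) = s / 2 := h1; rw [h3]
    simpa using (hasDerivAt_id x).mul_const (s / 2)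
  have hdiv : ∀ x : ℝ, 0 < x → x * (s / 2) / x = s / 2 := fun x hx => by field_simp
  have hlim : Tendsto (fun x : ℝ => x * (s / 2) / x) (𝓝[>] 0) (𝓝 (s / 2)) := by
    refine tendsto_const_nhds.congr' ?_
    filter_upwards [self_mem_nhdsWithin] with x hx using (hdiv x hx).symm
  have hbd : ∀ᶠ x : ℝ in 𝓝[>] 0, |x * (s / 2) / x| ≤ |s / 2| := by
    filter_upwards [self_mem_nhdsWithin] with x hx using by rw [hdiv x hx]
  have hax := IsBlowup.axisValue_eq_zero hp.fst hsol hbd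
  beta_reduce at hax
  have hpos : funnelPos g 1 (1 * (s / 2)) = s := by
    have h2 := tendsto_nhds_unique hlim (hF.tendsto hc hsol hax rfl); by_contra hne
    change funnelPos g 1 (1 * (s / 2)) ≠ s at hne; split_ifs at h2 with h3 h4
    · exact hne (by rw [h3]; linarith)
    · exact hne (by rw [h4]; linarith)
    · rcases hs with rfl | rfl <;> norm_num at h2
  constructor
  · rintro ⟨w, rfl, hw, h0, hwp⟩; have e1 := hp.fst.sol_one_of_axisValue hw h0
    have e2 := hp.fst.sol_one_of_axisValue one_pos hax; rw [hwp, ← hpos, ← e2] at e1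
    have hq : sol g 1 (1 * (s / 2)) 1 = 1 * (s / 2) := hp.fst.sol_self one_pos _; rw [hq] at e1
    have h3 := hp.fst.sol_unique (hp.fst.isSol hw w.im) hsol one_pos (by linarith) hw
    rw [hp.fst.sol_self hw] at h3; refine ⟨w.re ^ 2 / 4, by positivity, ?_⟩
    have : w = ((w.re / 2 : ℝ) : ℂ) * Complex.mk 2 s := by
      apply Complex.ext
      · simp only [Complex.re_ofReal_mul]; ring
      · simp only [Complex.im_ofReal_mul]; rw [h3]; ring
    conv_lhs => rw [this]
    push_cast; ring
  · rintro ⟨t, ht, rfl⟩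
    have hre : (((√t : ℝ) : ℂ) * Complex.mk 2 s).re = √t * 2 := Complex.re_ofReal_mul _ _
    have him : (((√t : ℝ) : ℂ) * Complex.mk 2 s).im = √t * 2 * (s / 2) := by
      rw [Complex.im_ofReal_mul]; ring
    have h2 : 0 < √t * 2 := by positivity
    refine ⟨((√t : ℝ) : ℂ) * Complex.mk 2 s, ?_, ?_, ?_, ?_⟩
    · rw [mul_pow, ← Complex.ofReal_pow, Real.sq_sqrt ht.le]
    · rw [hre]; exact h2
    · rw [ord, hre, him]; exact (hp.fst.axisValue_eq hsol h2 one_pos).trans hax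
    · rw [hre, him]; exact (hp.fst.funnelPos_eq_of_isSol hsol h2 one_pos).trans hpos

end Fans

namespace ConeChart

variable {β : M → E3} {q : M} {a c : ℂ → ℂ} {b : ℂ} {ε : ℝ} {φ : OpenPartialHomeomorph M ℂ}
  {F : ℂ →ₗ[ℝ] E2}

/-- The leaves tending to the umbilic point belong to the fan. -/
lemma localLeaf_subset (h : ConeChart β q a c b φ F) (ha : CoeffPair a c b ε) {i : Fin 2}
    {e : OpenPartialHomeomorph M E2} (he : e.source ⊆ φ.source) {x : M}
    (hx : x ∈ e.source \ {q}) (hcl : q ∈ closure (localLeaf β q e i x)) :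
    localLeaf β q e i x ⊆ φ.source ∧ ∃ p, φ x ∈ fanLeaf a c i p ∧
      φ '' localLeaf β q e i x ⊆ fanLeaf a c i p := by
  set W := e.source \ {q} with hW; have hWφ : W ⊆ φ.source := fun y hy => he hy.1
  have hsub : localLeaf β q e i x ⊆ W := by rintro _ ⟨γ, -, -, rfl, ht⟩; exact (ht 1).1
  have l1 := image_leaf φ h.contMDiffOn h.contMDiffOn_symm hWφ (l := principalLine β i) (l' :=
    coneLine a c i) (fun y hy => h.mem_line i y (hWφ hy) hy.2) (x := x)
  have hφ0 : ∀ z ∈ φ '' W, z ≠ 0 := by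
    rintro _ ⟨y, hy, rfl⟩ h0; exact hy.2 (φ.injOn (hWφ hy) h.mem_source (h0.trans h.map_self.symm))
  have hsub2 : φ '' localLeaf β q e i x ⊆ planeLeaf (coneLine a c i) (φ '' W) (φ x) := by
    change φ '' leaf (principalLine β i) W x ⊆ _; rw [l1]; exact inter_subset_left
  have hcl2 : (0 : ℂ) ∈ closure (planeLeaf (coneLine a c i) (φ '' W) (φ x)) := by
    refine closure_mono hsub2 ?_; rw [← h.map_self]
    exact mem_closure_image (φ.continuousAt h.mem_source) hcl
  obtain ⟨p, h1, h2⟩ := planeLeaf_subset_fanLeaf ha hφ0 (mem_image_of_mem φ hx) hcl2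
  exact ⟨hsub.trans hWφ, p, h1, hsub2.trans h2⟩

/-- If the cubic has one root, a saddle, then the configuration is of type `D_1`. -/
lemma hasConfigD1 (h : ConeChart β q a c b φ F) (ha : CoeffPair a c b ε) {s0 : ℝ}
    (h0 : slopeCubic b s0 = 0) (hu : ∀ s, slopeCubic b s = 0 → s = s0)
    (hd : 3 * (b.re - 1) * s0 ^ 2 - 6 * b.im * s0 - (1 + 3 * b.re) < 0) : HasConfigD1 β q := by
  intro V hV
  obtain ⟨e, ψ, ρ, hρ, heV, hmodel, hψ, hcoord⟩ := h.exists_isModelChart ha one_pos one_pos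
    (b1 := 0) (by norm_num) (by simp) (fun i => by
      rw [show fanFlag (coneSlope a c i) = 0 from (ha.twist i).fanFlag_eq_zero hu h0 hd]
      exact (((coeffPair_const (b := 0) (by simp)).twist i).fanFlag_eq_zero (s0 := 0)
        (fun s hs => by
          simp only [slopeCubic, Complex.zero_re, Complex.zero_im] at hs
          have : s * (s ^ 2 + 1) = 0 := by linarith
          rcases mul_eq_zero.mp this with h1 | h1
          · exact h1
          · nlinarith [sq_nonneg s]) (by simp [slopeCubic]) (by simp)).symm) hV
  refine ⟨e, heV, hmodel, fun i => ⟨(sign i * ‖F (Complex.mk 1 s0)‖⁻¹) • F (Complex.mk 1 s0), fun x hx hcl => ?_⟩⟩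
  obtain ⟨h1, p, -, h2⟩ := h.localLeaf_subset ha (fun y hy => (hcoord y hy).1) hx hcl
  refine h.isTangentRay ha h0 (fun f hf hf0 _ => ?_) h1 h2
  obtain ⟨l, hl, ht⟩ := (ha.twist i).exists_tendsto hf hf0; rwa [hu l hl] at ht

lemma exists_fanChart (h : ConeChart β q a c b φ F) (ha : CoeffPair a c b ε) {σt σb σm : ℝ}
    (hF : ∀ i, HasFan (coneSlope a c i) σt σb σm) (ht : slopeCubic b σt = 0)
    (hb : slopeCubic b σb = 0) (hm : slopeCubic b σm = 0) {V : Set M} (hV : V ∈ 𝓝 q) :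
    ∃ e : OpenPartialHomeomorph M E2, e.source ⊆ V ∧ IsModelChart β q 3 8 e ∧ ∀ i, IsTangentRay
      (separatrix e i 1) q ((sign i * ‖F (Complex.mk 1 σt)‖⁻¹) • F (Complex.mk 1 σt)) ∧ IsTangentRay
      (separatrix e i (-1)) q ((sign i * ‖F (Complex.mk 1 σb)‖⁻¹) • F (Complex.mk 1 σb)) ∧ ∀ x ∈
      e.source \ {q}, q ∈ closure (localLeaf β q e i x) → x ∉ separatrix e i 1 → (x ∈ separatrix e i
      (-1) → IsTangentRay (localLeaf β q e i x) q ((sign i * ‖F (Complex.mk 1 σb)‖⁻¹) • F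
      (Complex.mk 1 σb))) ∧ (x ∉ separatrix e i (-1) → IsTangentRay (localLeaf β q e i x) q ((sign i
      * ‖F (Complex.mk 1 σm)‖⁻¹) • F (Complex.mk 1 σm))) := by
  have h3 : (0 : ℝ) < 3 := by norm_num
  have h8 : (0 : ℝ) < 8 := by norm_num
  obtain ⟨e, ψ, ρ, hρ, heV, hmodel, hψ, hcoord⟩ := h.exists_isModelChart ha h3 h8 (b1 := ((-5 / 11 :
    ℝ) : ℂ)) (by norm_num) norm_model (fun i => by rw [(hF i).flag, (hasFan_model i).flag]) hV
  have hmc := coeffPair_const norm_model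
  have hsep : ∀ i, ∀ s : ℝ, (s = 1 ∨ s = -1) → ∀ x ∈ e.source,
      (x ∈ separatrix e i s ↔ φ x ∈ fanLeaf a c i s) := by
    intro i s hs x hx; obtain ⟨hx1, hx2, hx3⟩ := hcoord x hx
    have hs2 : s ^ 2 = 1 := by rcases hs with rfl | rfl <;> norm_num
    rw [hψ.mem_fanLeaf ha hmc hx2, mem_fanLeaf_const norm_model (hasFan_model i) hs (by
      simp only [slopeCubic, Complex.ofReal_re, Complex.ofReal_im]
      rcases hs with rfl | rfl <;> norm_num), hx3, modelEquiv_apply]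
    have hsq : ∀ t : ℝ, (sign i : ℂ) * ((t : ℂ) * Complex.mk 2 s ^ 2) =
        Complex.mk (t * sign i * 3) (t * sign i * (4 * s)) := fun t => by
      rw [← mul_assoc, ← Complex.ofReal_mul]; apply Complex.ext
      · rw [Complex.re_ofReal_mul, pow_two, Complex.mul_re]
        simp only; linear_combination (-sign i * t) * hs2
      · rw [Complex.im_ofReal_mul, pow_two, Complex.mul_im]; simp only; ring
    simp only [hsq, Complex.mk.injEq]; constructor
    · rintro ⟨-, t, ht, h1, h2⟩
      exact ⟨2 * ρ * t, by positivity, by rw [h1]; ring, by rw [h2]; ring⟩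
    · rintro ⟨t, ht, h1, h2⟩; refine ⟨hx, t / (2 * ρ), by positivity, ?_, ?_⟩
      · field_simp; linarith
      · field_simp; linarith
  have heφ : e.source ⊆ φ.source := fun y hy => (hcoord y hy).1
  have key : ∀ i, ∀ s : ℝ, (s = 1 ∨ s = -1) → separatrix e i s ⊆ φ.source ∧
      φ '' separatrix e i s ⊆ fanLeaf a c i s := fun i s hs => by
    refine ⟨fun y hy => heφ hy.1, ?_⟩; rintro _ ⟨y, hy, rfl⟩; exact (hsep i s hs y hy.1).mp hy
  have hlim : ∀ i p f, IsSol (coneSlope a c i) f → axisValue (coneSlope a c i) 1 (f 1) = 0 →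
      funnelPos (coneSlope a c i) 1 (f 1) = p → Tendsto (fun x => f x / x) (𝓝[>] 0)
        (𝓝 (if p = 1 then σt else if p = -1 then σb else σm)) :=
    fun i p f hf h0 hp => (hF i).tendsto ha hf h0 hp
  refine ⟨e, heV, hmodel, fun i => ⟨?_, ?_, fun x hx hcl hx1 => ?_⟩⟩
  · refine h.isTangentRay ha ht (fun f hf h0 hp => ?_) (key i 1 (.inl rfl)).1 (key i 1 (.inl rfl)).2
    simpa using hlim i 1 f hf h0 hp
  · refine h.isTangentRay ha hb (fun f hf h0 hp => ?_) (key i _ (.inr rfl)).1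
      (key i _ (.inr rfl)).2
    have := hlim i (-1) f hf h0 hp; rwa [if_neg (by norm_num), if_pos rfl] at this
  · obtain ⟨l1, p, hp, l2⟩ := h.localLeaf_subset ha heφ hx hcl
    have hp1 : p ≠ 1 := by rintro rfl; exact hx1 ((hsep i 1 (.inl rfl) x hx.1).mpr hp)
    have hpu : ∀ p', φ x ∈ fanLeaf a c i p' → p' = p := by
      rintro p' ⟨w', hw', hr', -, hp'⟩; obtain ⟨w, hw, hr, -, hp⟩ := hp
      rcases sq_eq_sq_iff_eq_or_eq_neg.mp
        (mul_left_cancel₀ (sign_ne_zero i) (hw.trans hw'.symm)) with rfl | rfl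
      · exact hp'.symm.trans hp
      · rw [Complex.neg_re] at hr; linarith
    refine ⟨fun h2 => ?_, fun h2 => ?_⟩
    · have : -1 = p := hpu _ ((hsep i (-1) (.inr rfl) x hx.1).mp h2)
      refine h.isTangentRay ha hb (fun f hf h0 hfp => ?_) l1 l2; have h4 := hlim i p f hf h0 hfp
      rwa [if_neg hp1, if_pos this.symm] at h4
    · refine h.isTangentRay ha hm (fun f hf h0 hfp => ?_) l1 l2; have h4 := hlim i p f hf h0 hfp
      rwa [if_neg hp1, if_neg] at h4; rintro rfl; exact h2 ((hsep i (-1) (.inr rfl) x hx.1).mpr hp)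

lemma acuteAt (h : ConeChart β q a c b φ F) (ha : CoeffPair a c b ε) {s s' : ℝ} (hne : s ≠ s')
    (hs : slopeCubic b s = 0) (hs' : slopeCubic b s' = 0) (i : Fin 2) :
    AcuteAt β q ((sign i * ‖F (Complex.mk 1 s)‖⁻¹) • F (Complex.mk 1 s))
      ((sign i * ‖F (Complex.mk 1 s')‖⁻¹) • F (Complex.mk 1 s')) := by
  have hF0 : ∀ s : ℝ, 0 < ‖F (Complex.mk 1 s)‖⁻¹ := fun s =>
    inv_pos.mpr (norm_pos_iff.mpr (h.frame_ne_zero fun h0 => by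
      have := congrArg Complex.re h0; simp at this))
  have hi0 : sign i ≠ 0 := fun h0 => by have := sign_sq i; rw [h0] at this; norm_num at this
  obtain ⟨κ, hκ, hin⟩ := h.inner_frame; constructor
  · rw [LinearIndependent.pair_iff]; intro x y hxy
    rw [smul_smul, smul_smul, ← map_smul, ← map_smul, ← map_add] at hxy
    have h1 : (x * (sign i * ‖F (Complex.mk 1 s)‖⁻¹)) • Complex.mk 1 s +
        (y * (sign i * ‖F (Complex.mk 1 s')‖⁻¹)) • Complex.mk 1 s' = 0 := by
      by_contra h2; exact h.frame_ne_zero h2 hxy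
    set A := x * (sign i * ‖F (Complex.mk 1 s)‖⁻¹) with hA
    set B := y * (sign i * ‖F (Complex.mk 1 s')‖⁻¹) with hB; have e1 := congrArg Complex.re h1
    have e2 := congrArg Complex.im h1
    simp only [Complex.real_smul, Complex.add_re, Complex.add_im, Complex.re_ofReal_mul,
      Complex.im_ofReal_mul, Complex.zero_re, Complex.zero_im, mul_one] at e1 e2
    have e3 : B = 0 := by
      refine (mul_eq_zero.mp (?_ : B * (s' - s) = 0)).resolve_right (sub_ne_zero.mpr hne.symm)
      linear_combination e2 - s * e1
    have e4 : A = 0 := by linarith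
    exact ⟨(mul_eq_zero.mp e4).resolve_right (mul_ne_zero hi0 (hF0 s).ne'),
      (mul_eq_zero.mp e3).resolve_right (mul_ne_zero hi0 (hF0 s').ne')⟩
  · rw [map_smul, map_smul, real_inner_smul_left, real_inner_smul_right, hin]
    have h1 : (Complex.mk 1 s * conj (Complex.mk 1 s')).re = 1 + s * s' := by simp
    have h2 := one_add_mul_pos ha.norm_lt_one hs hs'
    rw [h1, show sign i * ‖F (Complex.mk 1 s)‖⁻¹ * (sign i * ‖F (Complex.mk 1 s')‖⁻¹ *
      (κ * (1 + s * s'))) = sign i ^ 2 * (‖F (Complex.mk 1 s)‖⁻¹ * ‖F (Complex.mk 1 s')‖⁻¹ *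
      (κ * (1 + s * s'))) by ring, sign_sq, one_mul]
    exact mul_pos (mul_pos (hF0 s) (hF0 s')) (mul_pos hκ h2)

/-- If the cubic has three roots, then the configuration is of type `D_2`. -/
lemma hasConfigD2 (h : ConeChart β q a c b φ F) (ha : CoeffPair a c b ε) {s1 s2 s3 : ℝ}
    (h12 : s1 < s2) (h23 : s2 < s3)
    (hfac : ∀ s, slopeCubic b s = (b.re - 1) * ((s - s1) * (s - s2) * (s - s3))) :
    HasConfigD2 β q := by
  intro V hV; have z1 : slopeCubic b s1 = 0 := by rw [hfac]; ring
  have z2 : slopeCubic b s2 = 0 := by rw [hfac]; ring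
  have z3 : slopeCubic b s3 = 0 := by rw [hfac]; ring
  obtain ⟨e, heV, hmodel, H⟩ := h.exists_fanChart ha
    (fun i => (ha.twist i).hasFan_node h12 h23 hfac) z3 z1 z2 hV
  refine ⟨e, heV, hmodel, fun i => ⟨_, _, _, h.acuteAt ha (h12.trans h23).ne' z3 z1 i, ?_,
    (H i).1, (H i).2.1, fun x hx hcl h1 h2 => ((H i).2.2 x hx hcl h1).2 h2⟩⟩
  have hF0 : ∀ s : ℝ, 0 < ‖F (Complex.mk 1 s)‖ := fun s =>
    norm_pos_iff.mpr (h.frame_ne_zero fun h0 => by have := congrArg Complex.re h0; simp at this)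
  have d1 := sub_pos.mpr h12; have d2 := sub_pos.mpr h23; have d3 := sub_pos.mpr (h12.trans h23)
  have e1 : Complex.mk 1 s2 = ((s2 - s1) / (s3 - s1)) • Complex.mk 1 s3 +
      ((s3 - s2) / (s3 - s1)) • Complex.mk 1 s1 := by
    apply Complex.ext <;>
    simp only [Complex.real_smul, Complex.add_re, Complex.add_im, Complex.re_ofReal_mul,
      Complex.im_ofReal_mul] <;> field_simp <;> ring
  have p1 := hF0 s1; have p2 := hF0 s2; have p3 := hF0 s3
  refine ⟨‖F (Complex.mk 1 s2)‖⁻¹ * ((s2 - s1) / (s3 - s1)) * ‖F (Complex.mk 1 s3)‖, ‖F (Complex.mk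
    1 s2)‖⁻¹ * ((s3 - s2) / (s3 - s1)) * ‖F (Complex.mk 1 s1)‖, by positivity, by positivity, ?_⟩
  conv_lhs => enter [2]; rw [e1, map_add, map_smul, map_smul]
  rw [smul_add, smul_smul, smul_smul, smul_smul, smul_smul]; congr 2 <;> field_simp

/-- If the cubic has a double and a greater simple root, then the configuration is of type
`D^1_2`. -/
lemma hasConfigD12 (h : ConeChart β q a c b φ F) (ha : CoeffPair a c b ε) {s1 s2 : ℝ}
    (h12 : s1 < s2) (hfac : ∀ s, slopeCubic b s = (b.re - 1) * ((s - s1) ^ 2 * (s - s2))) :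
    HasConfigD12 β q := by
  intro V hV; have z1 : slopeCubic b s1 = 0 := by rw [hfac]; ring
  have z2 : slopeCubic b s2 = 0 := by rw [hfac]; ring
  obtain ⟨e, heV, hmodel, H⟩ := h.exists_fanChart ha
    (fun i => (ha.twist i).hasFan_saddleNode h12 hfac) z2 z1 z1 hV
  refine ⟨e, heV, hmodel, fun i => ⟨_, _, h.acuteAt ha h12.ne z1 z2 i, (H i).1, (H i).2.1,
    fun x hx hcl h1 => ?_⟩⟩
  by_cases h2 : x ∈ separatrix e i (-1)
  · exact ((H i).2.2 x hx hcl h1).1 h2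
  · exact ((H i).2.2 x hx hcl h1).2 h2

end ConeChart

/-! ### The shape operator in coordinates -/

lemma inner_eq_three (a b : E3) : inner ℝ a b = a 0 * b 0 + a 1 * b 1 + a 2 * b 2 := by
  simp [PiLp.inner_apply, Fin.sum_univ_three, mul_comm]

lemma cross_zero' (a b : E3) : cross a b 0 = a 1 * b 2 - a 2 * b 1 := by simp [cross, cross_apply]

lemma cross_one' (a b : E3) : cross a b 1 = a 2 * b 0 - a 0 * b 2 := by simp [cross, cross_apply]

lemma cross_two' (a b : E3) : cross a b 2 = a 0 * b 1 - a 1 * b 0 := by simp [cross, cross_apply]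

lemma inner_cross_left (a b : E3) : inner ℝ (cross a b) a = 0 := by
  rw [inner_eq_three, cross_zero', cross_one', cross_two']; ring

lemma inner_cross_right (a b : E3) : inner ℝ (cross a b) b = 0 := by
  rw [inner_eq_three, cross_zero', cross_one', cross_two']; ring

lemma inner_cross_cross (a b c d : E3) : inner ℝ (cross a b) (cross c d) =
    inner ℝ a c * inner ℝ b d - inner ℝ a d * inner ℝ b c := by
  simp only [inner_eq_three, cross_zero', cross_one', cross_two']; ring

lemma norm_cross_sq (a b : E3) :
    ‖cross a b‖ ^ 2 = inner ℝ a a * inner ℝ b b - inner ℝ a b ^ 2 := by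
  rw [← real_inner_self_eq_norm_sq, inner_cross_cross, real_inner_comm b a, pow_two]

lemma cross_comb (a b : E3) (s t u v : ℝ) :
    cross (s • a + t • b) (u • a + v • b) = (s * v - t * u) • cross a b := by
  ext i
  fin_cases i <;> simp [cross_zero', cross_one', cross_two'] <;> ring

lemma eq_zero_of_inner_frame {a b v : E3} (h : cross a b ≠ 0) (ha : inner ℝ v a = 0)
    (hb : inner ℝ v b = 0) (hc : inner ℝ v (cross a b) = 0) : v = 0 := by
  have key : ‖cross a b‖ ^ 2 • v =
      inner ℝ v a • (inner ℝ b b • a - inner ℝ a b • b) +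
      inner ℝ v b • (inner ℝ a a • b - inner ℝ a b • a) +
      inner ℝ v (cross a b) • cross a b := by
    rw [← real_inner_self_eq_norm_sq]; simp only [inner_eq_three]; ext i
    fin_cases i <;> simp [cross_zero', cross_one', cross_two'] <;> ring
  rw [ha, hb, hc] at key; simpa [h] using key

lemma eq_comb (w : E2) : w = w 0 • e₁ + w 1 • e₂ := by
  ext i
  fin_cases i <;> simp [e₁, e₂]

/-- The normal field of Gauss' formulas, before normalization. -/
def rawNormal (f : E2 → E3) (x : E2) : E3 := cross (du f x) (dv f x)

/-- The coefficient of `du ^ 2` in the equation of principal lines, up to a positive factor. -/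
def formM (f : E2 → E3) (x : E2) : ℝ :=
  coeffE f x * inner ℝ (rawNormal f x) (dv (du f) x) -
    coeffF f x * inner ℝ (rawNormal f x) (du (du f) x)

/-- The coefficient of `du dv` in the equation of principal lines, up to a positive factor. -/
def formN (f : E2 → E3) (x : E2) : ℝ :=
  coeffE f x * inner ℝ (rawNormal f x) (dv (dv f) x) -
    coeffG f x * inner ℝ (rawNormal f x) (du (du f) x)

section Plane

variable {f : E2 → E3} {x : E2}

lemma fderiv_eq_comb (f : E2 → E3) (x w : E2) :
    fderiv ℝ f x w = w 0 • du f x + w 1 • dv f x := by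
  conv_lhs => rw [eq_comb w]
  simp [du, dv]

lemma contDiffAt_du {n : WithTop ℕ∞} (h : ContDiffAt ℝ (n + 1) f x) : ContDiffAt ℝ n (du f) x :=
  (h.fderiv_right le_rfl).clm_apply contDiffAt_const

lemma contDiffAt_dv {n : WithTop ℕ∞} (h : ContDiffAt ℝ (n + 1) f x) : ContDiffAt ℝ n (dv f) x :=
  (h.fderiv_right le_rfl).clm_apply contDiffAt_const

lemma contDiffAt_cross {X : Type*} [NormedAddCommGroup X] [NormedSpace ℝ X] {n : WithTop ℕ∞}
    {g h : X → E3} {x : X} (hg : ContDiffAt ℝ n g x) (hh : ContDiffAt ℝ n h x) :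
    ContDiffAt ℝ n (fun y => cross (g y) (h y)) x := by
  rw [contDiffAt_euclidean] at *; intro i
  fin_cases i
  · simpa [cross_zero'] using ((hg 1).mul (hh 2)).sub ((hg 2).mul (hh 1))
  · simpa [cross_one'] using ((hg 2).mul (hh 0)).sub ((hg 0).mul (hh 2))
  · simpa [cross_two'] using ((hg 0).mul (hh 1)).sub ((hg 1).mul (hh 0))

lemma contDiffAt_rawNormal {n : WithTop ℕ∞} (h : ContDiffAt ℝ (n + 1) f x) :
    ContDiffAt ℝ n (rawNormal f) x :=
  contDiffAt_cross (contDiffAt_du h) (contDiffAt_dv h)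

lemma contDiffAt_normal {n : WithTop ℕ∞} (h : ContDiffAt ℝ (n + 1) f x)
    (h0 : rawNormal f x ≠ 0) : ContDiffAt ℝ n (normal f) x :=
  (((contDiffAt_rawNormal h).norm ℝ h0).inv (norm_ne_zero_iff.mpr h0)).smul (contDiffAt_rawNormal h)

lemma norm_rawNormal_sq (f : E2 → E3) (x : E2) :
    ‖rawNormal f x‖ ^ 2 = coeffE f x * coeffG f x - coeffF f x ^ 2 := norm_cross_sq _ _

lemma coeffE_pos (h0 : rawNormal f x ≠ 0) : 0 < coeffE f x := by
  have h1 := norm_rawNormal_sq f x; have h2 : 0 < ‖rawNormal f x‖ := norm_pos_iff.mpr h0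
  have h3 : 0 ≤ coeffE f x := real_inner_self_nonneg; rcases h3.lt_or_eq with h | h
  · exact h
  · rw [← h] at h1; nlinarith

lemma normal_eq (f : E2 → E3) (x : E2) : normal f x = ‖rawNormal f x‖⁻¹ • rawNormal f x := rfl

lemma inner_normal_fderiv (f : E2 → E3) (x w : E2) : inner ℝ (normal f x) (fderiv ℝ f x w) = 0 := by
  rw [fderiv_eq_comb, normal_eq, inner_smul_left, inner_add_right, inner_smul_right,
    inner_smul_right, rawNormal, inner_cross_left, inner_cross_right]
  simp

lemma eventually_rawNormal_ne (hf : ContDiffAt ℝ 1 f x) (h0 : rawNormal f x ≠ 0) :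
    ∀ᶠ y in 𝓝 x, rawNormal f y ≠ 0 :=
  (contDiffAt_rawNormal (n := 0) (by simpa using hf)).continuousAt.eventually_ne h0

lemma fderiv_fderiv_apply (hf : ContDiffAt ℝ 2 f x) (v w : E2) :
    fderiv ℝ (fun y => fderiv ℝ f y w) x v = fderiv ℝ (fderiv ℝ f) x v w := by
  have hD : DifferentiableAt ℝ (fderiv ℝ f) x :=
    (hf.fderiv_right (m := 1) (by simp [one_add_one_eq_two])).differentiableAt one_ne_zero
  rw [fderiv_clm_apply hD (differentiableAt_const w)]; simp

lemma inner_fderiv_normal (hf : ContDiffAt ℝ 2 f x) (h0 : rawNormal f x ≠ 0) (v w : E2) :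
    inner ℝ (fderiv ℝ (normal f) x v) (fderiv ℝ f x w) =
      -inner ℝ (normal f x) (fderiv ℝ (fderiv ℝ f) x v w) := by
  have hN : DifferentiableAt ℝ (normal f) x :=
    (contDiffAt_normal (n := 1) (by simpa [one_add_one_eq_two] using hf) h0).differentiableAt
      one_ne_zero
  have hD : DifferentiableAt ℝ (fderiv ℝ f) x :=
    (hf.fderiv_right (m := 1) (by simp [one_add_one_eq_two])).differentiableAt one_ne_zero
  have h1 := fderiv_inner_apply ℝ hN (hD.clm_apply (differentiableAt_const w)) v
  rw [show (fun t => inner ℝ (normal f t) (fderiv ℝ f t w)) = fun _ => (0 : ℝ) from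
    funext fun t => inner_normal_fderiv f t w] at h1
  rw [fderiv_fderiv_apply hf] at h1; simp at h1; linarith

lemma inner_fderiv_normal_normal (hf : ContDiffAt ℝ 2 f x) (h0 : rawNormal f x ≠ 0) (v : E2) :
    inner ℝ (fderiv ℝ (normal f) x v) (rawNormal f x) = 0 := by
  have hN : DifferentiableAt ℝ (normal f) x :=
    (contDiffAt_normal (n := 1) (by simpa [one_add_one_eq_two] using hf) h0).differentiableAt
      one_ne_zero
  have h1 := fderiv_inner_apply ℝ hN hN v
  have h2 : (fun t => inner ℝ (normal f t) (normal f t)) =ᶠ[𝓝 x] fun _ => (1 : ℝ) := by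
    filter_upwards [eventually_rawNormal_ne (hf.of_le (by norm_num)) h0] with y hy
    rw [real_inner_self_eq_norm_sq, normal_eq, norm_smul, norm_inv, norm_norm,
      inv_mul_cancel₀ (norm_ne_zero_iff.mpr hy), one_pow]
  rw [h2.fderiv_eq] at h1; rw [real_inner_comm] at h1
  simp only [fderiv_fun_const, Pi.zero_apply, _root_.zero_apply, normal_eq f x,
    inner_smul_right] at h1
  have h3 : ‖rawNormal f x‖ ≠ 0 := norm_ne_zero_iff.mpr h0; field_simp at h1; linarith

/-- The equations of Weingarten: `S` is the shape operator of `f` at `x`, up to sign. -/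
lemma inner_shape (hf : ContDiffAt ℝ 2 f x) (h0 : rawNormal f x ≠ 0) (w : E2) :
    inner ℝ (fderiv ℝ (normal f) x w) (du f x) = -(w 0 * coeffe f x + w 1 * coefff f x) ∧
    inner ℝ (fderiv ℝ (normal f) x w) (dv f x) = -(w 0 * coefff f x + w 1 * coeffg f x) := by
  have hs : fderiv ℝ (fderiv ℝ f) x e₁ e₂ = fderiv ℝ (fderiv ℝ f) x e₂ e₁ :=
    hf.isSymmSndFDerivAt (by simp) e₁ e₂
  have h1 := inner_fderiv_normal hf h0 w e₁; have h2 := inner_fderiv_normal hf h0 w e₂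
  have h3 : ∀ v u, fderiv ℝ (fun y => fderiv ℝ f y u) x v = fderiv ℝ (fderiv ℝ f) x v u :=
    fderiv_fderiv_apply hf
  have h4 : ∀ u, fderiv ℝ (fderiv ℝ f) x w u =
      w 0 • fderiv ℝ (fderiv ℝ f) x e₁ u + w 1 • fderiv ℝ (fderiv ℝ f) x e₂ u := by
    intro u
    conv_lhs => rw [eq_comb w]
    simp
  rw [h4, inner_add_right, inner_smul_right, inner_smul_right] at h1 h2; refine ⟨?_, ?_⟩
  · change inner ℝ _ (fderiv ℝ f x e₁) = -(w 0 * inner ℝ _ (fderiv ℝ (fun y => fderiv ℝ f y e₁) x e₁) +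
      w 1 * inner ℝ _ (fderiv ℝ (fun y => fderiv ℝ f y e₁) x e₂))
    rw [h1, h3, h3]
  · change inner ℝ _ (fderiv ℝ f x e₂) = -(w 0 * inner ℝ _ (fderiv ℝ (fun y => fderiv ℝ f y e₁) x e₂) +
      w 1 * inner ℝ _ (fderiv ℝ (fun y => fderiv ℝ f y e₂) x e₂))
    rw [h2, h3, h3, hs]

end Plane

/-- A conformal frame of the first fundamental form, positive for `σ = 1`. -/
def frame (f : E2 → E3) (σ : ℝ) (y : E2) : ℂ →ₗ[ℝ] E2 where
  toFun z := (z.re * ‖rawNormal f y‖) • e₁ + (σ * z.im) • (coeffE f y • e₂ - coeffF f y • e₁)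
  map_add' z w := by simp only [add_re, add_im]; module
  map_smul' t z := by simp only [smul_re, smul_im, smul_eq_mul, RingHom.id_apply]; module

/-- The trace-free part of the second fundamental form in the conformal frame. -/
def theta (f : E2 → E3) (σ : ℝ) (y : E2) : ℂ :=
  ⟨2 * coeffF f y * formM f y - coeffE f y * formN f y, 2 * σ * ‖rawNormal f y‖ * formM f y⟩

/-- The partial derivatives of order at most two of a map. -/
def jetTwo (f : E2 → E3) (y : E2) : E3 × E3 × E3 × E3 × E3 :=
  (du f y, dv f y, du (du f) y, dv (du f) y, dv (dv f) y)

/-- The trace-free part of the second fundamental form as a function of the partial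
derivatives. -/
def thetaOf (σ : ℝ) (J : E3 × E3 × E3 × E3 × E3) : ℂ :=
  ofRealCLM (2 * inner ℝ J.1 J.2.1 *
      (inner ℝ J.1 J.1 * inner ℝ (cross J.1 J.2.1) J.2.2.2.1 -
        inner ℝ J.1 J.2.1 * inner ℝ (cross J.1 J.2.1) J.2.2.1) -
    inner ℝ J.1 J.1 * (inner ℝ J.1 J.1 * inner ℝ (cross J.1 J.2.1) J.2.2.2.2 -
      inner ℝ J.2.1 J.2.1 * inner ℝ (cross J.1 J.2.1) J.2.2.1)) +
  ofRealCLM (2 * σ * ‖cross J.1 J.2.1‖ * (inner ℝ J.1 J.1 * inner ℝ (cross J.1 J.2.1) J.2.2.2.1 -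
      inner ℝ J.1 J.2.1 * inner ℝ (cross J.1 J.2.1) J.2.2.1)) * I

section Plane

variable {f : E2 → E3} {x : E2} {σ : ℝ}

lemma frame_zero (f : E2 → E3) (σ : ℝ) (y : E2) (z : ℂ) :
    frame f σ y z 0 = z.re * ‖rawNormal f y‖ - σ * z.im * coeffF f y := by
  simp [frame, e₁, e₂]; ring

lemma frame_one (f : E2 → E3) (σ : ℝ) (y : E2) (z : ℂ) :
    frame f σ y z 1 = σ * z.im * coeffE f y := by simp [frame, e₁, e₂]

variable (h0 : rawNormal f x ≠ 0)
include h0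

lemma inner_rawNormal (v : E3) :
    inner ℝ (rawNormal f x) v = ‖rawNormal f x‖ * inner ℝ (normal f x) v := by
  rw [normal_eq, inner_smul_left]; simp [h0]

lemma formM_eq : formM f x =
    ‖rawNormal f x‖ * (coeffE f x * coefff f x - coeffF f x * coeffe f x) := by
  rw [formM, inner_rawNormal h0, inner_rawNormal h0, coefff, coeffe]; ring

lemma formN_eq : formN f x =
    ‖rawNormal f x‖ * (coeffE f x * coeffg f x - coeffG f x * coeffe f x) := by
  rw [formN, inner_rawNormal h0, inner_rawNormal h0, coeffg, coeffe]; ring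

omit h0 in
lemma inner_fderiv_du (f : E2 → E3) (x w : E2) :
    inner ℝ (fderiv ℝ f x w) (du f x) = w 0 * coeffE f x + w 1 * coeffF f x := by
  rw [fderiv_eq_comb, inner_add_left, inner_smul_left, inner_smul_left, real_inner_comm (du f x) (dv f x)]
  rfl

omit h0 in
lemma inner_fderiv_dv (f : E2 → E3) (x w : E2) :
    inner ℝ (fderiv ℝ f x w) (dv f x) = w 0 * coeffF f x + w 1 * coeffG f x := by
  rw [fderiv_eq_comb, inner_add_left, inner_smul_left, inner_smul_left]; rfl

omit h0 in
lemma inner_frame (hσ : σ ^ 2 = 1) (z z' : ℂ) :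
    inner ℝ (fderiv ℝ f x (frame f σ x z)) (fderiv ℝ f x (frame f σ x z')) =
      coeffE f x * ‖rawNormal f x‖ ^ 2 * (z * conj z').re := by
  rw [fderiv_eq_comb f x (frame f σ x z'), inner_add_right, inner_smul_right, inner_smul_right,
    inner_fderiv_du, inner_fderiv_dv]
  simp only [frame_zero, frame_one]; have hD := norm_rawNormal_sq f x
  simp only [mul_re, conj_re, conj_im]
  linear_combination (coeffE f x * z.im * z'.im * (coeffE f x * coeffG f x - coeffF f x ^ 2)) * hσ -
    coeffE f x * z.im * z'.im * hD

omit h0 in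
lemma fderiv_normal_frame (hf : ContDiffAt ℝ 2 f x) (h0 : rawNormal f x ≠ 0) (hσ : σ ^ 2 = 1) :
    ∃ H c : ℝ, 0 < c ∧ ∀ z, fderiv ℝ (normal f) x (frame f σ x z) =
      -fderiv ℝ f x (frame f σ x (H * z + c * (theta f σ x * conj z))) := by
  have hE := coeffE_pos h0; have hD0 : 0 < ‖rawNormal f x‖ := norm_pos_iff.mpr h0
  have hD := norm_rawNormal_sq f x
  refine ⟨(coeffE f x * coeffg f x - 2 * coeffF f x * coefff f x + coeffG f x * coeffe f x) / (2 *
    ‖rawNormal f x‖ ^ 2), 1 / (2 * coeffE f x * ‖rawNormal f x‖ ^ 3), by positivity, fun z => ?_⟩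
  rw [← sub_eq_zero, sub_neg_eq_add]; obtain ⟨h1, h2⟩ := inner_shape hf h0 (frame f σ x z)
  refine eq_zero_of_inner_frame h0 ?_ ?_ ?_
  pick_goal 3
  · rw [← rawNormal, inner_add_left, inner_fderiv_normal_normal hf h0, zero_add, real_inner_comm,
      inner_rawNormal h0, inner_normal_fderiv, mul_zero]
  all_goals
    rw [inner_add_left]
    first | rw [h1, inner_fderiv_du] | rw [h2, inner_fderiv_dv]
    clear h1 h2
    simp only [theta, frame_zero, frame_one, formM_eq h0, formN_eq h0, add_re, add_im, mul_re,
      mul_im, ofReal_re, ofReal_im, conj_re, conj_im]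
    generalize ‖rawNormal f x‖ = d at *
    generalize coeffE f x = E at *
    generalize coeffF f x = F at *
    generalize coeffG f x = G at *
    obtain rfl : G = (d ^ 2 + F ^ 2) / E := by field_simp; linarith
    rcases sq_eq_sq_iff_eq_or_eq_neg.mp (hσ.trans (one_pow 2).symm) with rfl | rfl <;>
      (field_simp; ring)

omit h0 in
lemma principalForm_eq_inner (hf : ContDiffAt ℝ 2 f x) (h0 : rawNormal f x ≠ 0) (w : E2) :
    principalForm f x w = -inner ℝ (rawNormal f x) (cross (fderiv ℝ f x w)
      (fderiv ℝ (normal f) x w)) := by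
  obtain ⟨h1, h2⟩ := inner_shape hf h0 w
  rw [real_inner_comm, rawNormal, inner_cross_cross, inner_fderiv_du, h2, inner_fderiv_dv, h1,
    principalForm]
  ring

lemma frame_injective (hσ : σ ≠ 0) :
    Function.Injective (frame f σ x) := by
  rw [injective_iff_map_eq_zero]; intro z hz; have h1 : frame f σ x z 1 = 0 := by rw [hz]; rfl
  have h2 : frame f σ x z 0 = 0 := by rw [hz]; rfl
  rw [frame_one] at h1; have hi : z.im = 0 := by simpa [hσ, (coeffE_pos h0).ne'] using h1
  rw [frame_zero, hi] at h2; exact ext (by simpa [h0] using h2) hi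

lemma principalForm_frame (z : ℂ) :
    principalForm f x (frame f 1 x z) = (theta f 1 x * conj z ^ 2).im / 2 := by
  have hE := (coeffE_pos h0).ne'; have hD0 : ‖rawNormal f x‖ ≠ 0 := norm_ne_zero_iff.mpr h0
  have hD := norm_rawNormal_sq f x
  simp only [principalForm, theta, formM_eq h0, formN_eq h0, frame_zero, frame_one,
    pow_two (conj z), mul_re, mul_im, conj_re, conj_im]
  linear_combination z.im ^ 2 * (coefff f x * coeffE f x - coeffF f x * coeffe f x) * hD

/-- The conjugate of the coordinate of a vector in the conformal frame. -/
def coframe (f : E2 → E3) (x w : E2) : ℂ :=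
  (‖rawNormal f x‖⁻¹ * (w 0 + (coeffE f x)⁻¹ * coeffF f x * w 1)) • 1 - ((coeffE f x)⁻¹ * w 1) • I

lemma frame_coframe (w : E2) :
    frame f 1 x (conj (coframe f x w)) = w := by
  have hE := (coeffE_pos h0).ne'; have hD0 : ‖rawNormal f x‖ ≠ 0 := norm_ne_zero_iff.mpr h0; ext i
  fin_cases i
  · refine (frame_zero f 1 x _).trans ?_; simp [coframe]; field_simp; ring
  · refine (frame_one f 1 x _).trans ?_; simp [coframe]; field_simp

lemma coframe_frame (z : ℂ) :
    coframe f x (frame f 1 x z) = conj z :=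
  (starRingEnd ℂ).injective ((frame_injective h0 one_ne_zero (frame_coframe h0 _)).trans (conj_conj z).symm)

lemma principalForm_eq (w : E2) :
    principalForm f x w = (theta f 1 x * coframe f x w ^ 2).im / 2 := by
  conv_lhs => rw [← frame_coframe h0 w]
  rw [principalForm_frame h0, conj_conj]

section Smooth

variable {n : WithTop ℕ∞}

omit h0 in
lemma contDiffAt_coeffE (h : ContDiffAt ℝ (n + 1) f x) : ContDiffAt ℝ n (coeffE f) x :=
  (contDiffAt_du h).inner ℝ (contDiffAt_du h)

omit h0 in
lemma contDiffAt_coeffF (h : ContDiffAt ℝ (n + 1) f x) : ContDiffAt ℝ n (coeffF f) x :=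
  (contDiffAt_du h).inner ℝ (contDiffAt_dv h)

omit h0 in
lemma theta_eq_thetaOf (f : E2 → E3) (σ : ℝ) : theta f σ = fun y => thetaOf σ (jetTwo f y) := by
  ext y; exact (re_add_im (theta f σ y)).symm

omit h0 in
lemma contDiffAt_thetaOf {J : E3 × E3 × E3 × E3 × E3}
    (h : cross J.1 J.2.1 ≠ 0) : ContDiffAt ℝ n (thetaOf σ) J := by
  have h1 : ContDiffAt ℝ n (fun J : E3 × E3 × E3 × E3 × E3 => cross J.1 J.2.1) J :=
    contDiffAt_cross (by fun_prop) (by fun_prop)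
  have hD := h1.norm ℝ h
  have hA : ContDiffAt ℝ n (fun J : E3 × E3 × E3 × E3 × E3 => J.1) J := contDiffAt_fst
  have hB : ContDiffAt ℝ n (fun J : E3 × E3 × E3 × E3 × E3 => J.2.1) J := by fun_prop
  have hU := h1.inner ℝ (g := fun J : E3 × E3 × E3 × E3 × E3 => J.2.2.1) (by fun_prop)
  have hW := h1.inner ℝ (g := fun J : E3 × E3 × E3 × E3 × E3 => J.2.2.2.1) (by fun_prop)
  have hY := h1.inner ℝ (g := fun J : E3 × E3 × E3 × E3 × E3 => J.2.2.2.2) (by fun_prop)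
  have hE := hA.inner ℝ hA; have hF := hA.inner ℝ hB; have hG := hB.inner ℝ hB
  have hm := (hE.mul hW).sub (hF.mul hU); have hn := (hE.mul hY).sub (hG.mul hU)
  exact (ofRealCLM.contDiff.contDiffAt.comp J (((contDiffAt_const.mul hF).mul hm).sub (hE.mul
    hn))).add ((ofRealCLM.contDiff.contDiffAt.comp J ((contDiffAt_const.mul hD).mul hm)).mul
    contDiffAt_const)

omit h0 in
lemma contDiffAt_jetTwo (h : ContDiffAt ℝ (n + 1 + 1) f x) : ContDiffAt ℝ n (jetTwo f) x := by
  have h1 := contDiffAt_du h; have h2 := contDiffAt_dv h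
  exact (h1.of_le le_self_add).prodMk ((h2.of_le le_self_add).prodMk ((contDiffAt_du h1).prodMk
    ((contDiffAt_dv h1).prodMk (contDiffAt_dv h2))))

omit h0 in
lemma contDiffAt_theta (h : ContDiffAt ℝ (n + 1 + 1) f x) (h0 : rawNormal f x ≠ 0) :
    ContDiffAt ℝ n (theta f σ) x := by
  rw [theta_eq_thetaOf]
  exact (contDiffAt_thetaOf (J := jetTwo f x) h0).comp x (contDiffAt_jetTwo h)

omit h0 in
lemma contDiffAt_frame (h : ContDiffAt ℝ (n + 1) f x) (h0 : rawNormal f x ≠ 0) (z : ℂ) :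
    ContDiffAt ℝ n (fun y => frame f σ y z) x := by
  have h1 := contDiffAt_coeffE h; have h2 := contDiffAt_coeffF h
  have h3 := (contDiffAt_rawNormal h).norm ℝ h0
  change ContDiffAt ℝ n (fun y => (z.re * ‖rawNormal f y‖) • e₁ +
    (σ * z.im) • (coeffE f y • e₂ - coeffF f y • e₁)) x
  fun_prop

omit h0 in
lemma contDiffAt_coframe {ψ c : E2 → E2} {y : E2} (hf : ContDiffAt ℝ (n + 1) f (ψ y))
    (h0 : rawNormal f (ψ y) ≠ 0) (hψ : ContDiffAt ℝ n ψ y) (hc : ContDiffAt ℝ n c y) :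
    ContDiffAt ℝ n (fun x => coframe f (ψ x) (c x)) y := by
  have h1 := ((contDiffAt_coeffE hf).comp y hψ).inv (coeffE_pos h0).ne'
  have h2 := (contDiffAt_coeffF hf).comp y hψ
  have h3 := (((contDiffAt_rawNormal hf).norm ℝ h0).comp y hψ).inv (norm_ne_zero_iff.mpr h0)
  have h4 := contDiffAt_euclidean.mp hc
  exact ((h3.mul ((h4 0).add ((h1.mul h2).mul (h4 1)))).smul contDiffAt_const).sub
    ((h1.mul (h4 1)).smul contDiffAt_const)

omit h0 in
lemma contDiffAt_principalForm (hf : ContDiffAt ℝ (n + 1 + 1) f x) (h0 : rawNormal f x ≠ 0)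
    (w : E2) : ContDiffAt ℝ n (fun y => principalForm f y w) x := by
  have h' := hf.of_le le_self_add
  refine ((imCLM.contDiff.contDiffAt.comp x ((contDiffAt_theta (σ := 1) hf h0).mul
    ((contDiffAt_coframe (c := fun _ => w) h' h0 contDiffAt_id contDiffAt_const).pow 2))).div_const
    2).congr_of_eventuallyEq ?_
  filter_upwards [eventually_rawNormal_ne (h'.of_le le_add_self) h0] with y hy
  exact principalForm_eq hy w

end Smooth

/-- The derivative of the equation of principal lines at a point, in the direction `v`. -/
def slopeForm (f : E2 → E3) (x v w : E2) : ℝ := fderiv ℝ (fun y => principalForm f y w) x v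

omit h0 in
lemma fderiv_principalForm {ψ c : E2 → E2} {ρ : E2 → ℝ} {y : E2} (hf : ContDiffAt ℝ 3 f (ψ y))
    (h0 : rawNormal f (ψ y) ≠ 0) (hT : theta f 1 (ψ y) = 0) (hψ : ContDiffAt ℝ 1 ψ y)
    (hc : ContDiffAt ℝ 1 c y) (hρ : DifferentiableAt ℝ ρ y) {z : ℂ} (hz : c y = frame f 1 (ψ y) z)
    (v : E2) : fderiv ℝ (fun x => ρ x * principalForm f (ψ x) (c x)) y v =
      ρ y * ((fderiv ℝ (theta f 1) (ψ y) (fderiv ℝ ψ y v) * conj z ^ 2).im / 2) := by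
  have hψ1 := hψ.differentiableAt one_ne_zero
  have h1 := ((contDiffAt_theta (σ := 1) (n := 1) (by convert! hf using 1) h0).differentiableAt
    one_ne_zero).hasFDerivAt.comp y hψ1.hasFDerivAt
  have h2 := ((contDiffAt_coframe (n := 1) (hf.of_le (by norm_num)) h0 hψ hc).differentiableAt
    one_ne_zero).hasFDerivAt
  have h3 := (hρ.hasFDerivAt.mul ((imCLM.hasFDerivAt.comp y (h1.mul (h2.pow 2))).mul_const
    (1 / 2 : ℝ))).congr_of_eventuallyEq (f₁ := fun x => ρ x * principalForm f (ψ x) (c x)) (by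
      filter_upwards [hψ.continuousAt.eventually (eventually_rawNormal_ne (hf.of_le (by norm_num)) h0)]
        with x hx
      rw [principalForm_eq hx, div_eq_mul_one_div]; rfl)
  refine (congrArg (fun L => L v) h3.fderiv).trans ?_
  simp [hT, hz, coframe_frame h0, mul_comm, div_eq_mul_inv]

omit h0 in
lemma slopeForm_frame (hf : ContDiffAt ℝ 3 f x) (h0 : rawNormal f x ≠ 0) (hT : theta f 1 x = 0)
    (v : E2) (z : ℂ) : slopeForm f x v (frame f 1 x z) =
      1 / 2 * (fderiv ℝ (theta f 1) x v * conj z ^ 2).im := by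
  have := fderiv_principalForm (ψ := id) (ρ := 1) hf h0 hT contDiffAt_id contDiffAt_const
    (differentiableAt_const 1) (z := z) rfl v
  simpa [slopeForm, div_eq_inv_mul] using this

omit h0 in
lemma eq_mul_add_mul_conj (L : ℂ →ₗ[ℝ] ℂ) (z : ℂ) :
    L z = (L 1 - Complex.I * L Complex.I) / 2 * z + (L 1 + Complex.I * L Complex.I) / 2 * conj z := by
  have h : L z = z.re • L 1 + z.im • L Complex.I := by
    rw [← map_smul, ← map_smul, ← map_add]; congr 1; apply Complex.ext <;> simp
  rw [h]; apply Complex.ext <;> simp <;> ring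

end Plane

section Chart

/-- The derivative at `x` of the preferred chart at `p`, in terms of the preferred chart at `x`. -/
def chartJac (p x : M) : E2 →L[ℝ] E2 := mfderiv (𝓡 2) 𝓘(ℝ, E2) (ch p) x

variable {β : M → E3} {p x : M}

lemma eventually_inChart (β : M → E3) (hx : x ∈ (ch p).source) :
    β =ᶠ[𝓝 x] inChart β p ∘ ch p := by
  filter_upwards [(ch p).open_source.mem_nhds hx] with y hy; simp [inChart, (ch p).left_inv hy]

variable [IsManifold (𝓡 2) ∞ M]

lemma hasMFDerivAt_chart (hx : x ∈ (ch p).source) :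
    HasMFDerivAt (𝓡 2) 𝓘(ℝ, E2) (ch p) x (chartJac p x) :=
  ((mdifferentiable_chart (I := 𝓡 2) p).mdifferentiableAt hx).hasMFDerivAt

lemma chartJac_eq (hx : x ∈ (ch p).source) : chartJac p x =
    fderiv ℝ ((ch x).symm.trans (ch p)) (ch x x) := by
  rw [chartJac, (hasMFDerivAt_chart hx).mdifferentiableAt.mfderiv]; simp [writtenInExtChartAt]; rfl

lemma chartJac_det_pos (ho : OrientedAtlas M) (hx : x ∈ (ch p).source) :
    0 < (chartJac p x).det := by
  rw [chartJac_eq hx]; refine ho _ (chart_mem_atlas _ _) _ (chart_mem_atlas _ _) _ ?_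
  simp [(ch x).left_inv (mem_chart_source E2 x), hx]

lemma contDiffAt_inChart {n : ℕ} (hβ : CM n β) {y : E2}
    (hy : y ∈ (ch p).target) : ContDiffAt ℝ n (inChart β p) y := by
  have h := hβ.comp_contMDiffOn (contMDiffOn_chart_symm (I := 𝓡 2) (n := n) (x := p))
  exact (contMDiffOn_iff_contDiffOn.mp h).contDiffAt ((ch p).open_target.mem_nhds hy)

lemma mfderiv_comp_chart {G : Type*} [NormedAddCommGroup G] [NormedSpace ℝ G] {g : E2 → G}
    {h : M → G} (hx : x ∈ (ch p).source) (hg : DifferentiableAt ℝ g (ch p x))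
    (he : h =ᶠ[𝓝 x] g ∘ ch p) (v : E2) :
    mfderiv (𝓡 2) 𝓘(ℝ, G) h x v = fderiv ℝ g (ch p x) (chartJac p x v) :=
  congrArg (fun L => L v) ((hg.hasFDerivAt.hasMFDerivAt.comp x
    (hasMFDerivAt_chart hx)).congr_of_eventuallyEq he).mfderiv

lemma differential_eq (hβ : CM 1 β) (hx : x ∈ (ch p).source)
    (v : E2) :
    differential β x v = fderiv ℝ (inChart β p) (ch p x) (chartJac p x v) :=
  mfderiv_comp_chart hx ((contDiffAt_inChart (n := 1) (by exact_mod_cast hβ)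
    ((ch p).map_source hx)).differentiableAt (by simp)) (eventually_inChart β hx) v

lemma rawNormal_ne_zero_iff {f : E2 → E3} {y : E2} :
    rawNormal f y ≠ 0 ↔ Function.Injective (fderiv ℝ f y) := by
  have hn := norm_rawNormal_sq f y; rw [injective_iff_map_eq_zero]; constructor
  · intro h0 w hw; have h1 := inner_fderiv_du f y w; have h2 := inner_fderiv_dv f y w
    rw [hw, inner_zero_left] at h1 h2
    have hD : coeffE f y * coeffG f y - coeffF f y ^ 2 ≠ 0 := by rw [← hn]; simpa using h0
    have h3 : w 0 = 0 := by
      have : (coeffE f y * coeffG f y - coeffF f y ^ 2) * w 0 = 0 := by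
        linear_combination coeffF f y * h2 - coeffG f y * h1
      simpa [hD] using this
    have h4 : w 1 = 0 := by
      have : (coeffE f y * coeffG f y - coeffF f y ^ 2) * w 1 = 0 := by
        linear_combination coeffF f y * h1 - coeffE f y * h2
      simpa [hD] using this
    rw [eq_comb w, h3, h4]; simp
  · intro hi h0
    have hE : coeffE f y ≠ 0 := by
      intro h; have h1 : du f y = 0 := inner_self_eq_zero.mp h
      have h2 := congrArg (fun v : E2 => v 0) (hi e₁ h1); simp [e₁] at h2
    have h1 : fderiv ℝ f y (coeffE f y • e₂ - coeffF f y • e₁) = 0 := by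
      rw [← inner_self_eq_zero (𝕜 := ℝ)]
      conv_lhs => rw [fderiv_eq_comb, inner_add_right, inner_smul_right, inner_smul_right]
      rw [← fderiv_eq_comb, inner_fderiv_du, inner_fderiv_dv]; rw [h0, norm_zero] at hn
      simp [e₁, e₂]
      linear_combination -coeffE f y * hn
    have h2 := congrArg (fun v : E2 => v 1) (hi _ h1); exact hE (by simpa [e₁, e₂] using h2)

lemma det_eq (J : E2 →L[ℝ] E2) :
    J.det = J e₁ 0 * J e₂ 1 - J e₁ 1 * J e₂ 0 := by
  have hd : J.det = LinearMap.det (J : E2 →ₗ[ℝ] E2) := rfl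
  rw [hd, ← LinearMap.det_toMatrix (EuclideanSpace.basisFun (Fin 2) ℝ).toBasis, Matrix.det_fin_two]
  simp [LinearMap.toMatrix_apply, e₁, e₂]; ring

lemma cross_map (L : E2 →L[ℝ] E3) (J : E2 →L[ℝ] E2) :
    cross (L (J e₁)) (L (J e₂)) = J.det • cross (L e₁) (L e₂) := by
  have h : ∀ w, L w = w 0 • L e₁ + w 1 • L e₂ := fun w => by
    conv_lhs => rw [eq_comb w]
    simp
  rw [h (J e₁), h (J e₂), cross_comb, det_eq]

lemma gaussMap_eq (ho : OrientedAtlas M) (hβ : CM 1 β)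
    (hx : x ∈ (ch p).source) :
    gaussMap β x = normal (inChart β p) (ch p x) := by
  have hd := chartJac_det_pos ho hx; simp only [gaussMap, differential_eq hβ hx, cross_map]
  rw [normal, norm_smul, Real.norm_of_nonneg hd.le, mul_inv, smul_smul, mul_right_comm,
    inv_mul_cancel₀ hd.ne', one_mul]
  rfl

lemma exists_chartJac_equiv (ho : OrientedAtlas M) (hx : x ∈ (ch p).source) :
    ∃ J : E2 ≃ₗ[ℝ] E2, ⇑J = chartJac p x :=
  ⟨(chartJac p x : E2 →ₗ[ℝ] E2).equivOfDetNeZero (chartJac_det_pos ho hx).ne', rfl⟩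

lemma rawNormal_inChart_ne_zero_iff (hβ : CM 1 β) (ho : OrientedAtlas M)
    (hx : x ∈ (ch p).source) :
    rawNormal (inChart β p) (ch p x) ≠ 0 ↔ Function.Injective (differential β x) := by
  obtain ⟨J, hJ⟩ := exists_chartJac_equiv ho hx
  rw [rawNormal_ne_zero_iff, ← Function.Injective.of_comp_iff' _ J.bijective, hJ]
  exact Eq.to_iff (congrArg _ (funext fun v => (differential_eq hβ hx v).symm))

lemma rawNormal_ne_zero (hβ : CM 1 β) (hi : IsImmersion β)
    (ho : OrientedAtlas M) (hx : x ∈ (ch p).source) :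
    rawNormal (inChart β p) (ch p x) ≠ 0 :=
  (rawNormal_inChart_ne_zero_iff hβ ho hx).mpr (hi x)

end Chart

lemma exists_equiv_of_injective {L : ℂ →ₗ[ℝ] E2} (h : Function.Injective L) :
    ∃ e : ℂ ≃ₗ[ℝ] E2, ∀ z, e z = L z :=
  ⟨L.linearEquivOfInjective h (by simp [finrank_real_complex]), fun _ => rfl⟩

/-- The invariants of an operator with scalar part `H` and trace-free part `Θ`. -/
lemma trace_det_of_conj {A : E2 →ₗ[ℝ] E2} (e : ℂ ≃ₗ[ℝ] E2) {H : ℝ} {Θ : ℂ}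
    (h : ∀ z, -A (e z) = e (H * z + Θ * conj z)) :
    LinearMap.trace ℝ E2 (-A) = 2 * H ∧ LinearMap.det (-A) = H ^ 2 - ‖Θ‖ ^ 2 := by
  have hA : -A = e.conj (e.symm.conj (-A)) := by ext1 v; simp [LinearEquiv.conj_apply]
  have hv : ∀ z, e.symm.conj (-A) z = H * z + Θ * conj z := fun z => by
    rw [LinearEquiv.conj_apply_apply]; simp only [LinearEquiv.symm_symm, LinearMap.neg_apply]
    rw [h, e.symm_apply_apply]
  constructor
  · rw [hA, LinearMap.trace_conj', LinearMap.trace_eq_matrix_trace ℝ basisOneI,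
      Matrix.trace_fin_two]
    simp only [LinearMap.toMatrix_apply, hv]; simp [coe_basisOneI_repr]; ring
  · rw [← LinearMap.det_conj (-A) e.symm]
    rw [show (e.symm : E2 →ₗ[ℝ] ℂ) ∘ₗ (-A) ∘ₗ (e.symm.symm : ℂ →ₗ[ℝ] E2) = e.symm.conj (-A) from rfl,
      ← LinearMap.det_toMatrix basisOneI, Matrix.det_fin_two]
    simp only [LinearMap.toMatrix_apply, hv]; rw [← normSq_eq_norm_sq, normSq_apply]
    simp [coe_basisOneI_repr]; ring

section Weingarten

variable {β : M → E3} {p x : M} {σ : ℝ}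

variable [IsManifold (𝓡 2) ∞ M]

lemma exists_pullback_frame (ho : OrientedAtlas M) (hβ : CM 1 β)
    (hi : IsImmersion β) (hσ : σ ≠ 0) (hx : x ∈ (ch p).source) :
    ∃ e : ℂ ≃ₗ[ℝ] E2, ∀ z, chartJac p x (e z) = frame (inChart β p) σ (ch p x) z := by
  obtain ⟨e, he⟩ := exists_equiv_of_injective
    (frame_injective (f := inChart β p) (rawNormal_ne_zero hβ hi ho hx) hσ)
  obtain ⟨J, hJ⟩ := exists_chartJac_equiv ho hx; refine ⟨e.trans J.symm, fun z => ?_⟩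
  rw [← he, ← hJ]; exact J.apply_symm_apply (e z)

lemma differential_gaussMap (ho : OrientedAtlas M) (hβ : CM 2 β)
    (hi : IsImmersion β) (hx : x ∈ (ch p).source) (v : E2) :
    differential (gaussMap β) x v = fderiv ℝ (normal (inChart β p)) (ch p x) (chartJac p x v) := by
  have hβ1 : CM 1 β := hβ.of_le one_le_two
  have hf : ContDiffAt ℝ 2 (inChart β p) (ch p x) :=
    contDiffAt_inChart (n := 2) (by exact_mod_cast hβ) ((ch p).map_source hx)
  refine mfderiv_comp_chart hx ((contDiffAt_normal (n := 1) (by simpa [one_add_one_eq_two] using hf)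
    (rawNormal_ne_zero hβ1 hi ho hx)).differentiableAt one_ne_zero) ?_ v
  filter_upwards [(ch p).open_source.mem_nhds hx] with y hy; exact gaussMap_eq ho hβ1 hy

/-- The equation of principal lines in terms of the Gauss map. -/
lemma principalForm_inChart (ho : OrientedAtlas M) (hβ : CM 2 β)
    (hi : IsImmersion β) (hx : x ∈ (ch p).source) (v : E2) :
    principalForm (inChart β p) (ch p x) (chartJac p x v) = ‖rawNormal (inChart β p) (ch p x)‖ *
      -inner ℝ (gaussMap β x) (cross (differential β x v) (differential (gaussMap β) x v)) := by
  have hβ1 : CM 1 β := hβ.of_le one_le_two; have h0 := rawNormal_ne_zero hβ1 hi ho hx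
  rw [principalForm_eq_inner (contDiffAt_inChart (n := 2) (by exact_mod_cast hβ)
    ((ch p).map_source hx)) h0, ← differential_eq hβ1 hx,
    ← differential_gaussMap ho hβ hi hx, inner_rawNormal h0, gaussMap_eq ho hβ1 hx, mul_neg]

lemma weingarten_frame (ho : OrientedAtlas M) (hβ : CM 2 β)
    (hi : IsImmersion β) (hσ : σ ^ 2 = 1) (hx : x ∈ (ch p).source) {e : ℂ ≃ₗ[ℝ] E2}
    (he : ∀ z, chartJac p x (e z) = frame (inChart β p) σ (ch p x) z) :
    ∃ H c : ℝ, 0 < c ∧ ∀ z, -weingarten β x (e z) =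
      e (H * z + (c * theta (inChart β p) σ (ch p x)) * conj z) := by
  have hβ1 : CM 1 β := hβ.of_le one_le_two; have h0 := rawNormal_ne_zero hβ1 hi ho hx
  have hf : ContDiffAt ℝ 2 (inChart β p) (ch p x) :=
    contDiffAt_inChart (n := 2) (by exact_mod_cast hβ) ((ch p).map_source hx)
  obtain ⟨H, c, hc, hS⟩ := fderiv_normal_frame hf h0 hσ; refine ⟨H, c, hc, ?_⟩
  have hN := differential_gaussMap ho hβ hi hx
  let A : E2 →ₗ[ℝ] E2 := e.conj (-((H : ℝ) • LinearMap.id + (LinearMap.mulLeft ℝ ((c : ℂ) * theta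
    (inChart β p) σ (ch p x))) ∘ₗ (conjAe.toLinearMap)))
  have hA : ∀ z, A (e z) =
      -e (H * z + (c * theta (inChart β p) σ (ch p x)) * conj z) := fun z => by
    simp only [A, LinearEquiv.conj_apply_apply, e.symm_apply_apply]; rw [← map_neg]
    simp [mul_assoc]
  have hex : ∃ A : E2 →ₗ[ℝ] E2,
      ∀ v, differential β x (A v) = differential (gaussMap β) x v := by
    refine ⟨A, fun v => ?_⟩; obtain ⟨z, rfl⟩ := e.surjective v
    rw [hA, map_neg, hN, differential_eq hβ1 hx, he, he, hS, mul_assoc]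
  intro z; have h1 := Classical.epsilon_spec hex (e z)
  have h2 : differential β x (A (e z)) = differential (gaussMap β) x (e z) := by
    rw [hA, map_neg, hN, differential_eq hβ1 hx, he, he, hS, mul_assoc]
  have h3 : weingarten β x (e z) = A (e z) := hi x (h1.trans h2.symm); rw [h3, hA, neg_neg]

lemma isUmbilic_iff_theta (ho : OrientedAtlas M) (hβ : CM 2 β)
    (hi : IsImmersion β) (hσ : σ ^ 2 = 1) (hx : x ∈ (ch p).source) :
    IsUmbilic β x ↔ theta (inChart β p) σ (ch p x) = 0 := by
  obtain ⟨e, he⟩ := exists_pullback_frame ho (hβ.of_le one_le_two) hi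
    (σ := σ) (by rintro rfl; norm_num at hσ) hx
  obtain ⟨H, c, hc, hw⟩ := weingarten_frame ho hβ hi hσ hx he
  obtain ⟨h1, h2⟩ := trace_det_of_conj e hw; rw [IsUmbilic, meanCurvature, gaussCurvature, h1, h2]
  simp [hc.ne']

lemma mem_principalLine_iff (ho : OrientedAtlas M) (hβ : CM 2 β)
    (hi : IsImmersion β) (hσ : σ ^ 2 = 1) (hx : x ∈ (ch p).source) {e : ℂ ≃ₗ[ℝ] E2}
    (he : ∀ z, chartJac p x (e z) = frame (inChart β p) σ (ch p x) z) (i : Fin 2) (z : ℂ) :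
    e z ∈ principalLine β i x ↔ theta (inChart β p) σ (ch p x) * conj z =
      (sign i * ‖theta (inChart β p) σ (ch p x)‖ : ℝ) * z := by
  obtain ⟨H, c, hc, hw⟩ := weingarten_frame ho hβ hi hσ hx he
  obtain ⟨h1, h2⟩ := trace_det_of_conj e hw
  generalize theta (inChart β p) σ (ch p x) = Θ at *
  have hk : principalCurvature β i x = H + sign i * (c * ‖Θ‖) := by
    have hs : (1 / 2 * (2 * H)) ^ 2 - (H ^ 2 - ‖(c : ℂ) * Θ‖ ^ 2) = (c * ‖Θ‖) ^ 2 := by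
      rw [norm_mul, norm_real, Real.norm_of_nonneg hc.le]; ring
    rw [principalCurvature, meanCurvature, gaussCurvature, h1, h2, hs, Real.sqrt_sq (by positivity)]
    ring
  change weingarten β x (e z) + principalCurvature β i x • e z = 0 ↔ _
  rw [show weingarten β x (e z) = -e (H * z + c * Θ * conj z) from by rw [← hw, neg_neg], hk,
    ← map_smul, ← map_neg, ← map_add, LinearEquiv.map_eq_zero_iff]
  have hc' : (c : ℂ) ≠ 0 := by exact_mod_cast hc.ne'
  rw [← sub_eq_zero (a := Θ * conj z), ← mul_right_inj' (b := Θ * conj z - _) hc', mul_zero,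
    ← neg_eq_zero (a := (c : ℂ) * _)]
  refine Eq.congr_left ?_; rw [real_smul]; push_cast; ring

end Weingarten

lemma mul_add_mul_conj_injective {A B : ℂ} (h : ‖B‖ < ‖A‖) :
    Function.Injective fun z => A * z + B * conj z := by
  intro z w hzw
  have h1 : A * (z - w) = -(B * conj (z - w)) := by rw [map_sub]; linear_combination hzw
  have h2 := congrArg norm h1; rw [norm_neg, norm_mul, norm_mul, RCLike.norm_conj] at h2
  by_contra hne; have h3 : 0 < ‖z - w‖ := norm_pos_iff.mpr (sub_ne_zero.mpr hne); nlinarith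

lemma norm_mul_conj_div_sq_lt {A B : ℂ} (h : ‖B‖ < ‖A‖) : ‖B * conj A / A ^ 2‖ < 1 := by
  have : 0 < ‖A‖ := (norm_nonneg B).trans_lt h
  rw [norm_div, norm_mul, norm_pow, RCLike.norm_conj, div_lt_one (by positivity), pow_two]
  exact mul_lt_mul_of_pos_right h this

variable {β : M → E3} {p q x : M} {σ : ℝ}

variable [IsManifold (𝓡 2) ∞ M]

lemma chartJac_self (q : M) (v : E2) : chartJac q q v = v := by
  have hq := mem_chart_source E2 q; rw [chartJac_eq hq]
  have h : ⇑((ch q).symm.trans (ch q)) =ᶠ[𝓝 (ch q q)] id := by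
    filter_upwards [(ch q).open_target.mem_nhds (mem_chart_target E2 q)] with y hy
    simp [(ch q).right_inv hy]
  rw [h.fderiv_eq]; simp

lemma exists_equiv_fderiv {g : E2 → ℂ} {y : E2} {F : ℂ →ₗ[ℝ] E2} {A B : ℂ}
    (h : ∀ z, fderiv ℝ g y (F z) = A * z + B * conj z) (hAB : ‖B‖ < ‖A‖) :
    ∃ L : E2 ≃L[ℝ] ℂ, (L : E2 →L[ℝ] ℂ) = fderiv ℝ g y := by
  have hF : Function.Injective F := fun z w hzw => mul_add_mul_conj_injective hAB
    (by beta_reduce; rw [← h, ← h, hzw])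
  obtain ⟨e, he⟩ := exists_equiv_of_injective hF
  have hi : Function.Injective (fderiv ℝ g y : E2 →ₗ[ℝ] ℂ) := by
    intro v w hvw; obtain ⟨z, rfl⟩ := e.surjective v; obtain ⟨z', rfl⟩ := e.surjective w
    rw [he, he, ContinuousLinearMap.coe_coe, h, h] at hvw; rw [mul_add_mul_conj_injective hAB hvw]
  refine ⟨(LinearMap.linearEquivOfInjective _ hi (by
    simp [Complex.finrank_real_complex])).toContinuousLinearEquiv, ?_⟩
  ext v; rfl

/-- Near an umbilic point of index `1 / 2`, the trace-free part of the second fundamental form is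
a chart in which the principal lines are given by a pair of coefficients. -/
lemma exists_coneChart (ho : OrientedAtlas M) (hβ : CM 4 β)
    (hi : IsImmersion β) (hσ : σ ^ 2 = 1) (hq : q ∈ (ch p).source)
    (hθ : theta (inChart β p) σ (ch p q) = 0) {A B : ℂ} (hlt : ‖B‖ < ‖A‖)
    (hAB : ∀ z, fderiv ℝ (theta (inChart β p) σ) (ch p q)
      (frame (inChart β p) σ (ch p q) z) = A * z + B * conj z) {T : ℂ →ₗ[ℝ] E2}
    (hT : ∀ z, chartJac p q (T z) = frame (inChart β p) σ (ch p q) (A * z)) :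
    ∃ a c ε φ, CoeffPair a c (B * conj A / A ^ 2) ε ∧
      ConeChart β q a c (B * conj A / A ^ 2) φ T := by
  have hβ2 : CM 2 β := hβ.of_le (by norm_num); have hβ1 : CM 1 β := hβ.of_le (by norm_num)
  have hσ0 : σ ≠ 0 := by rintro rfl; norm_num at hσ
  set f := inChart β p with hf; set y0 := ch p q with hy0
  have hA : A ≠ 0 := norm_pos_iff.mp ((norm_nonneg B).trans_lt hlt)
  have htgt : y0 ∈ (ch p).target := (ch p).map_source hq
  have hraw : ∀ y ∈ (ch p).target, rawNormal f y ≠ 0 := fun y hy => by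
    have := rawNormal_ne_zero hβ1 hi ho ((ch p).map_target hy); rwa [(ch p).right_inv hy] at this
  have hsm : ∀ y ∈ (ch p).target, ContDiffAt ℝ (2 + 1 + 1) f y := fun y hy => by
    have := contDiffAt_inChart (n := 4) (by exact_mod_cast hβ) hy
    convert! this using 1
  let g : E2 → ℂ := fun y => (A ^ 2)⁻¹ * theta f σ y
  have hg : ∀ y ∈ (ch p).target, ContDiffAt ℝ 2 g y := fun y hy =>
    contDiffAt_const.mul (contDiffAt_theta (hsm y hy) (hraw y hy))
  have hg0 : g y0 = 0 := by simp [g, hθ]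
  have hgd : ∀ y ∈ (ch p).target, ∀ v, fderiv ℝ g y v =
      (A ^ 2)⁻¹ * fderiv ℝ (theta f σ) y v := fun y hy v => by
    have h1 := ((contDiffAt_theta (σ := σ) (hsm y hy) (hraw y hy)).differentiableAt two_ne_zero)
    have h2 := fderiv_const_mul h1 ((A ^ 2)⁻¹); exact congrArg (fun L => L v) h2
  have hFT : ∀ z, fderiv ℝ g y0 (frame f σ y0 (A * z)) = z + B * conj A / A ^ 2 * conj z := by
    intro z; rw [hgd _ htgt, hAB, map_mul]; field_simp
  have hFT' : ∀ z, fderiv ℝ g y0 (frame f σ y0 z) = A⁻¹ * z + B / A ^ 2 * conj z := by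
    intro z; rw [hgd _ htgt, hAB]; field_simp
  obtain ⟨L, hL⟩ := exists_equiv_fderiv hFT' (by
    rw [norm_div, norm_inv, norm_pow, inv_eq_one_div, div_lt_div_iff₀ (by positivity)
      (by positivity)]
    nlinarith [norm_nonneg B, norm_pos_iff.mpr hA])
  have hg' : HasFDerivAt g (L : E2 →L[ℝ] ℂ) y0 := by
    rw [hL]; exact ((hg _ htgt).differentiableAt two_ne_zero).hasFDerivAt
  let e := (hg _ htgt).toOpenPartialHomeomorph g hg' two_ne_zero
  have hecoe : ∀ y, e y = g y := fun y => rfl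
  have hes : y0 ∈ e.source := (hg _ htgt).mem_toOpenPartialHomeomorph_source hg' two_ne_zero
  have hesymm : e.symm 0 = y0 := by rw [← hg0, ← hecoe, e.left_inv hes]
  have he0 : (0 : ℂ) ∈ e.target := by rw [← hg0, ← hecoe]; exact e.map_source hes
  have hei : ContDiffAt ℝ 2 e.symm 0 := by
    have := (hg _ htgt).to_localInverse hg' two_ne_zero; rw [hg0] at this; exact this
  have hcoef : ∀ z, ContDiffAt ℝ 1 (fun y => fderiv ℝ g y (frame f σ y z)) y0 := fun z =>
    ((hg _ htgt).fderiv_right (m := 1) (by simp [one_add_one_eq_two])).clm_apply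
      (contDiffAt_frame ((hsm _ htgt).of_le (by norm_num)) (hraw _ htgt) z)
  let a1 : E2 → ℂ := fun y => (fderiv ℝ g y (frame f σ y (A * 1)) -
    Complex.I * fderiv ℝ g y (frame f σ y (A * Complex.I))) / 2
  let c1 : E2 → ℂ := fun y => (fderiv ℝ g y (frame f σ y (A * 1)) +
    Complex.I * fderiv ℝ g y (frame f σ y (A * Complex.I))) / 2
  have hac : ∀ y z, fderiv ℝ g y (frame f σ y (A * z)) = a1 y * z + c1 y * conj z := fun y z =>
    eq_mul_add_mul_conj ((fderiv ℝ g y : E2 →ₗ[ℝ] ℂ) ∘ₗ frame f σ y ∘ₗ LinearMap.mulLeft ℝ A) z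
  have ha1 : a1 y0 = 1 := by
    simp only [a1, hFT]; simp
    linear_combination (-(1 : ℂ) / 2 + B * conj A / A ^ 2 / 2) * Complex.I_sq
  have hc1 : c1 y0 = B * conj A / A ^ 2 := by
    simp only [c1, hFT]; simp
    linear_combination ((1 : ℂ) / 2 - B * conj A / A ^ 2 / 2) * Complex.I_sq
  have hsymm1 : ContDiffAt ℝ 1 e.symm 0 := hei.of_le one_le_two
  have ha2 : ContDiffAt ℝ 1 (fun ζ => a1 (e.symm ζ)) 0 := by
    refine ContDiffAt.comp (g := a1) 0 ?_ hsymm1; rw [hesymm]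
    exact ((hcoef _).sub (contDiffAt_const.mul (hcoef _))).div_const 2
  have hc2 : ContDiffAt ℝ 1 (fun ζ => c1 (e.symm ζ)) 0 := by
    refine ContDiffAt.comp (g := c1) 0 ?_ hsymm1; rw [hesymm]
    exact ((hcoef _).add (contDiffAt_const.mul (hcoef _))).div_const 2
  obtain ⟨a, c, ε, hpair, hev⟩ := exists_coeffPair ha2 hc2 (by rw [hesymm, ha1])
    (by rw [hesymm, hc1]; exact norm_mul_conj_div_sq_lt hlt)
  rw [hesymm, hc1] at hpair
  obtain ⟨O, hO, hOo, h0O⟩ := _root_.eventually_nhds_iff.mp (hev.and (hsymm1.eventually (by simp)))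
  let e' := (e.symm.restrOpen O hOo).symm
  let φ := (ch p).trans e'
  have hφ : ∀ x, φ x = g (ch p x) := fun x => rfl
  have hmemφ : ∀ x, x ∈ φ.source ↔ x ∈ (ch p).source ∧ ch p x ∈ e.source ∧
      g (ch p x) ∈ O := fun x => Iff.rfl
  have hsrc := fun x => (hmemφ x).mp
  have hqs : q ∈ φ.source := (hmemφ q).mpr ⟨hq, hes, by rw [hg0]; exact h0O⟩
  have hDφ : ∀ x ∈ φ.source, ∀ v, mfderiv (𝓡 2) 𝓘(ℝ, ℂ) φ x v =
      fderiv ℝ g (ch p x) (chartJac p x v) := fun x hx =>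
    mfderiv_comp_chart (hsrc x hx).1 ((hg _ ((ch p).map_source
      (hsrc x hx).1)).differentiableAt two_ne_zero) (Eventually.of_forall fun _ => rfl)
  have hsmooth : ContMDiffOn (𝓡 2) 𝓘(ℝ, ℂ) 1 φ φ.source := by
    intro x hx
    have h1 : ContMDiffAt 𝓘(ℝ, E2) 𝓘(ℝ, ℂ) 1 g (ch p x) :=
      ((hg _ ((ch p).map_source (hsrc x hx).1)).of_le one_le_two).contMDiffAt
    exact (h1.comp x ((contMDiffOn_chart (I := 𝓡 2) (n := 1)).contMDiffAt
      ((ch p).open_source.mem_nhds (hsrc x hx).1))).contMDiffWithinAt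
  have hsymm : ContMDiffOn 𝓘(ℝ, ℂ) (𝓡 2) 1 φ.symm φ.target := by
    intro z hz; have hz' := hsrc _ (φ.map_target hz); have hφz : φ (φ.symm z) = z := φ.right_inv hz
    rw [hφ] at hφz; have hzO : z ∈ O := by rw [← hφz]; exact hz'.2.2
    have hmem : e.symm z ∈ (ch p).target := by
      have : e.symm z = ch p (φ.symm z) := by rw [← e.left_inv hz'.2.1, hecoe, hφz]
      rw [this]; exact (ch p).map_source hz'.1
    have h1 : ContMDiffAt 𝓘(ℝ, ℂ) 𝓘(ℝ, E2) 1 e.symm z := ((hO z hzO).2).contMDiffAt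
    have h2 : ContMDiffAt 𝓘(ℝ, E2) (𝓡 2) 1 (ch p).symm (e.symm z) :=
      (contMDiffOn_chart_symm (I := 𝓡 2) (n := 1)).contMDiffAt
      ((ch p).open_target.mem_nhds hmem)
    exact (h2.comp z h1).contMDiffWithinAt
  have h0φ : φ q = 0 := hg0; refine ⟨a, c, ε, φ, hpair, hqs, h0φ, hsmooth, hsymm, ?_, ?_, ?_, ?_⟩
  · intro x hx; rw [isUmbilic_iff_theta ho hβ2 hi hσ (hsrc x hx).1, hφ]; simp [g, hA, hf]
  · intro i x hx _ v; obtain ⟨u, hu⟩ := exists_pullback_frame ho hβ1 hi hσ0 (hsrc x hx).1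
    obtain ⟨z', rfl⟩ := u.surjective v
    obtain ⟨z, rfl⟩ : ∃ z, z' = A * z := ⟨A⁻¹ * z', by field_simp⟩
    rw [mem_principalLine_iff ho hβ2 hi hσ (hsrc x hx).1 hu]
    have hder : fderiv ℝ g (ch p x) (chartJac p x (u (A * z))) =
        a (φ x) * z + c (φ x) * conj z := by
      have h3 := (hO _ (hsrc x hx).2.2).1; rw [← hecoe, e.left_inv (hsrc x hx).2.1] at h3
      rw [hu, hac, hφ, ← hecoe, h3.1, h3.2]
    have hd := (hDφ x hx (u (A * z))).trans hder
    have hiff : theta f σ (ch p x) * conj (A * z) =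
        (sign i * ‖theta f σ (ch p x)‖ : ℝ) * (A * z) ↔
        φ x * conj z = (sign i * ‖φ x‖ : ℝ) * z := by
      have hth : theta f σ (ch p x) = A ^ 2 * φ x := by rw [hφ]; simp only [g]; field_simp
      rw [hth, map_mul, norm_mul, norm_pow]
      have hn : ((sign i * (‖A‖ ^ 2 * ‖φ x‖) : ℝ) : ℂ) =
          A * conj A * (sign i * ‖φ x‖ : ℝ) := by
        rw [Complex.mul_conj, Complex.normSq_eq_norm_sq]; push_cast; ring
      rw [hn, show A ^ 2 * φ x * (conj A * conj z) = A ^ 2 * conj A * (φ x * conj z) from by ring,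
        show A * conj A * ((sign i * ‖φ x‖ : ℝ) : ℂ) * (A * z) =
          A ^ 2 * conj A * ((sign i * ‖φ x‖ : ℝ) * z) from by ring]
      exact mul_right_inj' (mul_ne_zero (pow_ne_zero 2 hA) ((map_ne_zero _).mpr hA))
    rw [hiff]; constructor
    · intro h; exact ⟨z, hd, h⟩
    · rintro ⟨η, h1, h2⟩
      rwa [mul_add_mul_conj_injective (hpair.norm_lt_norm (φ x)) (hd.symm.trans h1)]
  · have h0t : (0 : ℂ) ∈ φ.target := by rw [← h0φ]; exact φ.map_source hqs
    have hq' : φ.symm 0 = q := by rw [← h0φ, φ.left_inv hqs]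
    have h1 : ContMDiffAt 𝓘(ℝ, ℂ) 𝓘(ℝ, E2) 1 (fun z => ch q (φ.symm z)) 0 := by
      refine ContMDiffAt.comp (g := ch q) 0 ?_ (hsymm.contMDiffAt (φ.open_target.mem_nhds h0t))
      rw [hq']
      exact (contMDiffOn_chart (I := 𝓡 2) (n := 1)).contMDiffAt
        ((ch q).open_source.mem_nhds (mem_chart_source E2 q))
    have h2 := (contMDiffAt_iff_contDiffAt.mp h1).differentiableAt one_ne_zero
    refine ⟨_, h2.hasFDerivAt, fun z => ?_⟩
    have h3 : ch q =ᶠ[𝓝 q] (fun z => ch q (φ.symm z)) ∘ φ := by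
      filter_upwards [φ.open_source.mem_nhds hqs] with x hx; simp [φ.left_inv hx]
    have h4 : HasMFDerivAt 𝓘(ℝ, ℂ) 𝓘(ℝ, E2) (fun z => ch q (φ.symm z)) (φ q)
        (fderiv ℝ (fun z => ch q (φ.symm z)) 0) := by rw [h0φ]; exact h2.hasFDerivAt.hasMFDerivAt
    have h5 := (hsmooth.contMDiffAt (φ.open_source.mem_nhds hqs)).mdifferentiableAt one_ne_zero
    have h6 := ((h4.comp q h5.hasMFDerivAt).congr_of_eventuallyEq h3).mfderiv
    have h7 : chartJac q q (T z) = fderiv ℝ (fun z => ch q (φ.symm z)) 0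
      (mfderiv (𝓡 2) 𝓘(ℝ, ℂ) φ q (T z)) := congrArg (fun L => L (T z)) h6
    have h8 := (hDφ q hqs (T z)).trans ((congrArg (fderiv ℝ g y0) (hT z)).trans (hFT z))
    exact (congrArg (fderiv ℝ (fun z => ch q (φ.symm z)) 0) h8).symm.trans
      (h7.symm.trans (chartJac_self q _))
  · refine ⟨coeffE f y0 * ‖rawNormal f y0‖ ^ 2 * ‖A‖ ^ 2, ?_, fun z z' => ?_⟩
    · have := coeffE_pos (hraw _ htgt); have := norm_pos_iff.mpr (hraw _ htgt)
      have := norm_pos_iff.mpr hA; positivity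
    · rw [differential_eq hβ1 hq, differential_eq hβ1 hq, hT, hT, inner_frame hσ, map_mul,
        show A * z * (conj A * conj z') = A * conj A * (z * conj z') from by ring,
        Complex.mul_conj, Complex.re_ofReal_mul, Complex.normSq_eq_norm_sq]
      ring

variable {β : M → E3} {p q : M}

lemma contDiffAt_transition {x : M} (hx : x ∈ (ch q).source)
    (hx' : x ∈ (ch p).source) :
    ContDiffAt ℝ 2 ((ch q).symm.trans (ch p)) (ch q x) := by
  rw [← contMDiffAt_iff_contDiffAt]
  refine ContMDiffAt.comp (g := ch p) (f := (ch q).symm) (I' := 𝓡 2) _ ?_ ((contMDiffOn_chart_symm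
    (I := 𝓡 2) (n := 2)).contMDiffAt ((ch q).open_target.mem_nhds ((ch q).map_source hx)))
  rw [(ch q).left_inv hx]
  exact (contMDiffOn_chart (I := 𝓡 2) (n := 2)).contMDiffAt ((ch p).open_source.mem_nhds hx')

lemma chartJac_trans {x : M} (hx : x ∈ (ch q).source)
    (hx' : x ∈ (ch p).source) (v : E2) : chartJac p x v =
      fderiv ℝ ((ch q).symm.trans (ch p)) (ch q x) (chartJac q x v) := by
  refine mfderiv_comp_chart hx ((contDiffAt_transition hx hx').differentiableAt two_ne_zero) ?_ v
  filter_upwards [(ch q).open_source.mem_nhds hx] with y hy; simp [(ch q).left_inv hy]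

/-- The linear part of the equation of principal lines in the preferred chart at an umbilic
point, in terms of another chart. -/
lemma exists_slopeForm_chart (ho : OrientedAtlas M) (hβ : CM 3 β)
    (hi : IsImmersion β) (hq : q ∈ (ch p).source)
    (hθ : theta (inChart β p) 1 (ch p q) = 0) : ∃ ρ : ℝ, ρ ≠ 0 ∧ ∀ {w z}, chartJac p q w = frame
      (inChart β p) 1 (ch p q) z → ∀ v, slopeForm (inChart β q) (ch q q) v w = ρ * ((fderiv ℝ (theta
      (inChart β p) 1) (ch p q) (chartJac p q v) * conj z ^ 2).im / 2) := by
  have hβ2 : CM 2 β := hβ.of_le (by norm_num); have hβ1 : CM 1 β := hβ.of_le (by norm_num)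
  have hqq := mem_chart_source E2 q; have hn := rawNormal_ne_zero hβ1 hi ho hqq
  have hn' := rawNormal_ne_zero hβ1 hi ho hq
  have hf : ∀ {p : M}, q ∈ (ch p).source →
      ContDiffAt ℝ 3 (inChart β p) (ch p q) := fun {p} hq =>
    contDiffAt_inChart (n := 3) (by exact_mod_cast hβ) ((ch p).map_source hq)
  set ψ := (ch q).symm.trans (ch p) with hψ
  have hψq : ψ (ch q q) = ch p q := by simp [ψ, (ch q).left_inv hqq]
  have hJ : chartJac p q = fderiv ℝ ψ (ch q q) := chartJac_eq hq
  have dψ : ContDiffAt ℝ 2 ψ (ch q q) := contDiffAt_transition hqq hq; rw [hJ, ← hψq]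
  rw [← hψq] at hθ hn'
  refine ⟨‖rawNormal (inChart β q) (ch q q)‖ * ‖rawNormal (inChart β p) (ψ (ch q q))‖⁻¹, mul_ne_zero
    (norm_ne_zero_iff.mpr hn) (inv_ne_zero (norm_ne_zero_iff.mpr hn')), fun {w z} hz v => ?_⟩
  rw [slopeForm, ← fderiv_principalForm (ψ := ψ) (c := fun x => fderiv ℝ ψ x w) (ρ := fun y =>
    ‖rawNormal (inChart β q) y‖ * ‖rawNormal (inChart β p) (ψ y)‖⁻¹) (by rw [hψq]; exact hf hq) hn'
    hθ (dψ.of_le one_le_two) ((dψ.fderiv_right (m := 1) (by simp [one_add_one_eq_two])).clm_apply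
    contDiffAt_const) ?_ hz v]
  · refine congrArg (fun L : E2 →L[ℝ] ℝ => L v) (EventuallyEq.fderiv_eq ?_)
    filter_upwards [ψ.open_source.mem_nhds (x := ch q q)
      (by simp [ψ, (ch q).left_inv hqq, hq])] with y hy
    obtain ⟨hy1, hy2⟩ : y ∈ (ch q).target ∧ (ch q).symm y ∈ (ch p).source := by simpa [ψ] using hy
    have hx := (ch q).map_target hy1; obtain ⟨J, hJ⟩ := exists_chartJac_equiv ho hx
    obtain ⟨u, rfl⟩ := J.surjective w; have k1 := principalForm_inChart ho hβ2 hi hx u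
    have k2 := principalForm_inChart ho hβ2 hi hy2 u
    have h0 := norm_ne_zero_iff.mpr (rawNormal_ne_zero hβ1 hi ho hy2)
    rw [chartJac_trans hx hy2, ← hψ] at k2; have e : ch p ((ch q).symm y) = ψ y := rfl
    rw [(ch q).right_inv hy1] at k1 k2; rw [hJ, k1, ← e, k2, e]; rw [e] at h0; field_simp
  · have h1 := (contDiffAt_rawNormal (n := 1) ((hf hqq).of_le (by norm_num))).norm ℝ hn
    have h2 := (contDiffAt_rawNormal (n := 1) ((hψq ▸ hf hq : ContDiffAt ℝ 3 (inChart β p)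
      (ψ (ch q q))).of_le (by norm_num))).norm ℝ hn'
    exact (h1.differentiableAt one_ne_zero).mul (((h2.differentiableAt one_ne_zero).comp _
      (dψ.differentiableAt two_ne_zero)).inv (norm_ne_zero_iff.mpr hn'))

/-- The form `Λ` is `κ Im ((z + b conj z) conj (η) ^ 2)` in the frame `T`. -/
structure NormalForm (Λ : E2 → E2 → ℝ) (T : ℂ →ₗ[ℝ] E2) (κ : ℝ) (b : ℂ) : Prop where
  injective : Function.Injective T
  ne_zero : κ ≠ 0
  norm_lt : ‖b‖ < 1
  eq : ∀ z η, Λ (T z) (T η) = κ * ((z + b * conj z) * conj η ^ 2).im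

lemma theta_neg (f : E2 → E3) (σ : ℝ) (y : E2) : theta f (-σ) y = conj (theta f σ y) := by
  apply Complex.ext <;> simp [theta]

lemma frame_neg (f : E2 → E3) (σ : ℝ) (y : E2) (z : ℂ) :
    frame f (-σ) y z = frame f σ y (conj z) := by simp [frame]

/-- The derivative of the trace-free part in the conformal frame. -/
def thetaDeriv (f : E2 → E3) (y : E2) : ℂ →ₗ[ℝ] ℂ :=
  (fderiv ℝ (theta f 1) y : E2 →ₗ[ℝ] ℂ) ∘ₗ frame f 1 y

/-- Its complex linear part. -/
def coeffA (f : E2 → E3) (y : E2) : ℂ :=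
  (thetaDeriv f y 1 - I * thetaDeriv f y I) / 2

/-- Its antilinear part. -/
def coeffB (f : E2 → E3) (y : E2) : ℂ :=
  (thetaDeriv f y 1 + I * thetaDeriv f y I) / 2

/-- The modulus of an umbilic point. -/
def modulus (f : E2 → E3) (y : E2) : ℂ := coeffB f y * conj (coeffA f y) / coeffA f y ^ 2

/-- The normal form of an umbilic point of index `1 / 2`, in the preferred chart at this point,
together with the charts by the trace-free part of the second fundamental
form and by its conjugate. -/
lemma exists_normalForm (ho : OrientedAtlas M) (hβ : CM 4 β)
    (hi : IsImmersion β) (hq : q ∈ (ch p).source)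
    (hθ : theta (inChart β p) 1 (ch p q) = 0)
    (hlt : ‖coeffB (inChart β p) (ch p q)‖ < ‖coeffA (inChart β p) (ch p q)‖) :
    ∃ (T : ℂ →ₗ[ℝ] E2) (κ : ℝ), NormalForm (slopeForm (inChart β q) (ch q q)) T κ (modulus (inChart
      β p) (ch p q)) ∧ (∃ a c ε φ, CoeffPair a c (modulus (inChart β p) (ch p q)) ε ∧ ConeChart β q
      a c (modulus (inChart β p) (ch p q)) φ T) ∧ ∃ a c ε φ F, CoeffPair a c (conj (modulus (inChart
      β p) (ch p q))) ε ∧ ConeChart β q a c (conj (modulus (inChart β p) (ch p q))) φ F := by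
  have hβ3 : CM 3 β := hβ.of_le (by norm_num); have hβ1 : CM 1 β := hβ.of_le (by norm_num)
  have hf : ContDiffAt ℝ 3 (inChart β p) (ch p q) :=
    contDiffAt_inChart (n := 3) (by exact_mod_cast hβ3) ((ch p).map_source hq)
  have h0 := rawNormal_ne_zero hβ1 hi ho hq
  obtain ⟨ρ, hρ, hs⟩ := exists_slopeForm_chart ho hβ3 hi hq hθ; set f := inChart β p
  set y := ch p q
  have hAB : ∀ z, fderiv ℝ (theta f 1) y (frame f 1 y z) = coeffA f y * z + coeffB f y * conj z :=
    eq_mul_add_mul_conj (thetaDeriv f y)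
  unfold modulus; set A := coeffA f y; set B := coeffB f y
  have hA : A ≠ 0 := norm_pos_iff.mp ((norm_nonneg B).trans_lt hlt)
  obtain ⟨u, hu⟩ := exists_pullback_frame ho hβ1 hi one_ne_zero hq
  have hcj : (fun z => theta f (-1) z) = fun z => conjCLE (theta f 1 z) :=
    funext fun z => theta_neg f 1 z
  have hAB' : ∀ z, fderiv ℝ (theta f (-1)) y (frame f (-1) y z) =
      conj A * z + conj B * conj z := by
    intro z
    have hd1 : DifferentiableAt ℝ (theta f 1) y :=
      (contDiffAt_theta (n := 1) (by convert! hf using 1) h0).differentiableAt one_ne_zero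
    have h1 : fderiv ℝ (theta f (-1)) y (frame f (-1) y z) =
        conj (fderiv ℝ (theta f 1) y (frame f (-1) y z)) := by
      change fderiv ℝ (fun z => theta f (-1) z) y _ = _; rw [hcj]
      have := (conjCLE.toContinuousLinearMap.hasFDerivAt.comp y hd1.hasFDerivAt).fderiv
      exact congrArg (fun L => L (frame f (-1) y z)) this
    rw [h1, frame_neg, hAB]; simp
  refine ⟨(u : ℂ →ₗ[ℝ] E2) ∘ₗ LinearMap.mulLeft ℝ A, ρ * (‖A‖ ^ 4 / 2), ⟨u.injective.comp
    (mul_right_injective₀ hA), by positivity, norm_mul_conj_div_sq_lt hlt, fun z η => ?_⟩, ?_, ?_⟩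
  · have h4 : ((‖A‖ ^ 4 : ℝ) : ℂ) = (A * conj A) ^ 2 := by
      rw [mul_conj, normSq_eq_norm_sq]; push_cast; ring
    simp only [LinearMap.comp_apply, LinearMap.mulLeft_apply, LinearEquiv.coe_coe]
    rw [hs (hu _), hu, hAB, map_mul, map_mul, show (A * (A * z) + B * (conj A * conj z)) * (conj A *
      conj η) ^ 2 = ((‖A‖ ^ 4 : ℝ) : ℂ) * ((z + B * conj A / A ^ 2 * conj z) * conj η ^ 2) from by
        rw [h4]; field_simp, im_ofReal_mul]
    ring
  · exact exists_coneChart ho hβ hi (one_pow 2) hq hθ hlt hAB fun z => hu _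
  · obtain ⟨u', hu'⟩ := exists_pullback_frame (σ := -1) ho hβ1 hi (by norm_num) hq
    obtain ⟨a, c, ε, φ, h1, h2⟩ := exists_coneChart ho hβ hi (σ := -1) (by norm_num) hq
      (by rw [theta_neg, hθ, map_zero]) (A := conj A) (B := conj B) (by simpa using hlt) hAB'
      (T := (u' : ℂ →ₗ[ℝ] E2) ∘ₗ LinearMap.mulLeft ℝ (conj A)) fun z => hu' _
    have hb : conj (B * conj A / A ^ 2) = conj B * conj (conj A) / conj A ^ 2 := by simp
    rw [← hb] at h1 h2; exact ⟨a, c, ε, φ, _, h1, h2⟩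

/-- The linear part of the Lie-Cartan field at the points over an umbilic point. -/
lemma lieCartan_at {f : E2 → E3} {x : E2} (hf : ContDiffAt ℝ 4 f x) (h0 : rawNormal f x ≠ 0)
    (hθ : theta f 1 x = 0) (a b : E2) : ∃ LA LB LC : E2 →L[ℝ] ℝ,
    (∀ v t, slopeForm f x v (a + t • b) = LA v + t * LB v + t ^ 2 * LC v) ∧
    ∀ s, (∀ v τ, fderiv ℝ (surfaceFun f a b) (x, s) (v, τ) = LA v + s * LB v + s ^ 2 * LC v) ∧
      lieCartan f a b (x, s) = (0, -(LA (a + s • b) + s * LB (a + s • b) + s ^ 2 * LC (a + s • b)))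
      ∧ ∃ Q : E2 →L[ℝ] ℝ, ∀ v τ, fderiv ℝ (lieCartan f a b) (x, s) (v, τ) = ((LB v + 2 * s * LC v) •
      (a + s • b), -(Q v + (LB (a + s • b) + 2 * s * LC (a + s • b) + (LA b + s * LB b + s ^ 2 * LC
      b)) * τ)) := by
  have hf' : ContDiffAt ℝ (2 + 1 + 1) f x := by convert! hf using 1
  have cp := contDiffAt_principalForm hf' h0
  have zp : ∀ u, principalForm f x u = 0 := fun u => by simp [principalForm_eq h0, hθ]
  let A : E2 → ℝ := fun y => principalForm f y a
  let C : E2 → ℝ := fun y => principalForm f y b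
  let B : E2 → ℝ := fun y => principalForm f y (a + b) - principalForm f y a - principalForm f y b
  have cA : ContDiffAt ℝ 2 A x := cp a
  have cB : ContDiffAt ℝ 2 B x := ((cp (a + b)).sub (cp a)).sub (cp b)
  have cC : ContDiffAt ℝ 2 C x := cp b; have zA : A x = 0 := zp a
  have zB : B x = 0 := by simp [B, zp]
  have zC : C x = 0 := zp b
  have hT : ∀ y t, principalForm f y (a + t • b) = A y + t * B y + t ^ 2 * C y := fun y t => by
    simp only [principalForm, A, B, C, PiLp.add_apply, PiLp.smul_apply, smul_eq_mul]; ring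
  have dd : ∀ {m : E2 → ℝ} {y : E2}, ContDiffAt ℝ 2 m y → HasFDerivAt m (fderiv ℝ m y) y :=
    fun h => (h.differentiableAt two_ne_zero).hasFDerivAt
  have d2 : ∀ {m : E2 → ℝ}, ContDiffAt ℝ 2 m x →
      HasFDerivAt (fderiv ℝ m) (fderiv ℝ (fderiv ℝ m) x) x :=
    fun h => ((h.fderiv_right (m := 1) (by simp [one_add_one_eq_two])).differentiableAt
      one_ne_zero).hasFDerivAt
  have hS : surfaceFun f a b = fun z => A z.1 + z.2 * B z.1 + z.2 ^ 2 * C z.1 :=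
    funext fun z => hT z.1 z.2
  have hDT : ∀ y, ContDiffAt ℝ 2 A y → ContDiffAt ℝ 2 B y → ContDiffAt ℝ 2 C y → ∀ s v τ,
      fderiv ℝ (surfaceFun f a b) (y, s) (v, τ) = fderiv ℝ A y v + s * fderiv ℝ B y v +
        s ^ 2 * fderiv ℝ C y v + (B y + 2 * s * C y) * τ := by
    intro y h1 h2 h3 s v τ
    have e1 : HasFDerivAt (fun z : E2 × ℝ => z.2) (ContinuousLinearMap.snd ℝ E2 ℝ) (y, s) :=
      hasFDerivAt_snd
    have e2 : HasFDerivAt (fun z : E2 × ℝ => z.1) (ContinuousLinearMap.fst ℝ E2 ℝ) (y, s) :=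
      hasFDerivAt_fst
    have := (((dd h1).comp (y, s) e2).add (e1.mul ((dd h2).comp (y, s) e2))).add
      ((e1.mul e1).mul ((dd h3).comp (y, s) e2))
    rw [hS, show (fun z : E2 × ℝ => A z.1 + z.2 * B z.1 + z.2 ^ 2 * C z.1) =
      fun z => A z.1 + z.2 * B z.1 + z.2 * z.2 * C z.1 from funext fun z => by ring]
    refine (congrArg (fun L => L (v, τ)) this.fderiv).trans ?_; simp; ring
  refine ⟨fderiv ℝ A x, fderiv ℝ B x, fderiv ℝ C x, fun v t => ?_, fun s => ⟨fun v τ => ?_, ?_, ?_⟩⟩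
  · rw [slopeForm, show (fun y => principalForm f y (a + t • b)) = fun y =>
      A y + t * B y + t ^ 2 * C y from funext fun y => hT y t]
    have := ((dd cA).add ((dd cB).const_mul t)).add ((dd cC).const_mul (t ^ 2))
    exact congrArg (fun L => L v) this.fderiv
  · rw [hDT x cA cB cC, zB, zC]; ring
  · simp only [lieCartan, hDT x cA cB cC, zB, zC]; simp
  · have hX : lieCartan f a b =ᶠ[𝓝 (x, s)] fun z => ((B z.1 + 2 * z.2 * C z.1) • (a + z.2 • b),
        -(fderiv ℝ A z.1 (a + z.2 • b) + z.2 * fderiv ℝ B z.1 (a + z.2 • b) +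
          z.2 * z.2 * fderiv ℝ C z.1 (a + z.2 • b))) := by
      have hc : Tendsto (fun z : E2 × ℝ => z.1) (𝓝 (x, s)) (𝓝 x) := continuous_fst.tendsto _
      filter_upwards [hc.eventually (cA.eventually (by simp)), hc.eventually (cB.eventually (by
        simp)), hc.eventually (cC.eventually (by simp))] with z h1 h2 h3
      obtain ⟨y, t⟩ := z; simp only [lieCartan, hDT y h1 h2 h3]; simp [pow_two]
    have e1 : HasFDerivAt (fun z : E2 × ℝ => z.2) (ContinuousLinearMap.snd ℝ E2 ℝ) (x, s) :=
      hasFDerivAt_snd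
    have e2 : HasFDerivAt (fun z : E2 × ℝ => z.1) (ContinuousLinearMap.fst ℝ E2 ℝ) (x, s) :=
      hasFDerivAt_fst
    have ew := (e1.smul_const b).const_add a
    have k : ∀ {m : E2 → ℝ}, ContDiffAt ℝ 2 m x → _ := fun {m} h =>
      (((d2 h).comp (x, s) e2).clm_apply ew)
    have hd := ((((dd cB).comp (x, s) e2).add ((e1.const_mul 2).mul ((dd cC).comp (x, s) e2))).smul
      ew).prodMk (((k cA).add (e1.mul (k cB))).add ((e1.mul e1).mul (k cC))).neg
    let w := a + s • b
    refine ⟨(fderiv ℝ (fderiv ℝ A) x).flip w + s • (fderiv ℝ (fderiv ℝ B) x).flip w +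
      s ^ 2 • (fderiv ℝ (fderiv ℝ C) x).flip w, fun v τ => ?_⟩
    rw [hX.fderiv_eq]; refine (congrArg (fun L => L (v, τ)) hd.fderiv).trans ?_
    ext1
    · simp [zB, zC]
    · simp [w]; ring

section Types

variable {T : E2 × ℝ → ℝ} {X : E2 × ℝ → E2 × ℝ} {z : E2 × ℝ} {l m Q : E2 →L[ℝ] ℝ} {w : E2} {k : ℝ}

lemma mul_eq_of_hasEigenvaluesOn (hT : ∀ v τ, fderiv ℝ T z (v, τ) = l v)
    (hX : ∀ v τ, fderiv ℝ X z (v, τ) = (m v • w, -(Q v + k * τ))) (hw : w ≠ 0)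
    (hker : ∀ v, l v = 0 → ∃ t : ℝ, v = t • w) {u : E2 × ℝ} {p q : ℝ}
    (h : HasEigenvaluesOn T X z u p q) : p * q = -(k * m w) := by
  obtain ⟨⟨u', τ'⟩, c, hli, h1, h2, h3, h4⟩ := h; obtain ⟨u, τ⟩ := u; rw [hT] at h1 h2
  obtain ⟨t, rfl⟩ := hker u h1; obtain ⟨t', rfl⟩ := hker u' h2; rw [hX, Prod.mk.injEq] at h3 h4
  obtain ⟨h3, h5⟩ := h3; obtain ⟨h4, h6⟩ := h4
  simp only [map_smul, smul_eq_mul, Prod.smul_mk, Prod.mk_add_mk, smul_smul, ← add_smul] at h3 h4 h5 h6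
  have g3 : t * m w = p * t := smul_left_injective ℝ hw h3
  have g4 : t' * m w = c * t + q * t' := smul_left_injective ℝ hw h4
  have hD : t * τ' - t' * τ ≠ 0 := by
    intro hD; rw [LinearIndependent.pair_iff] at hli
    by_cases ht : t = 0 ∧ τ = 0
    · have := hli 1 0 (by simp [ht.1, ht.2]); simp at this
    · have h7 := hli t' (-t) (by
        ext1
        · simp [smul_smul, mul_comm]
        · simp; linear_combination -hD)
      have h8 := hli τ' (-τ) (by
        ext1
        · simp only [Prod.fst_add, Prod.smul_mk, smul_smul, ← add_smul, Prod.fst_zero]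
          rw [show τ' * t + -τ * t' = 0 from by linear_combination hD, zero_smul]
        · simp; ring)
      exact ht ⟨by simpa using h7.2, by simpa using h8.2⟩
  have key : (p * q + k * m w) * (t * τ' - t' * τ) = 0 := by
    by_cases ht : t = 0
    · subst ht
      have hq : q = m w := by
        have : t' ≠ 0 := by rintro rfl; simp at hD
        exact mul_right_cancel₀ this (by linear_combination -g4)
      have hp : p = -k := by
        have : τ ≠ 0 := by rintro rfl; simp at hD
        exact mul_right_cancel₀ this (by linear_combination -h5)
      rw [hp, hq]; ring
    · have hp : p = m w := mul_right_cancel₀ ht (by linear_combination -g3); subst hp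
      linear_combination m w * (-t * h6 + τ * g4 + t' * h5)
  have := (mul_eq_zero.mp key).resolve_right hD; linarith

lemma isSaddleOn_iff (hT : ∀ v τ, fderiv ℝ T z (v, τ) = l v)
    (hX : ∀ v τ, fderiv ℝ X z (v, τ) = (m v • w, -(Q v + k * τ))) (hw : w ≠ 0)
    (hker : ∀ v, l v = 0 → ∃ t : ℝ, v = t • w) (hlw : l w = 0) (h0 : X z = 0) :
    (IsSaddleOn T X z ↔ 0 < k * m w) ∧ (IsNodeOn T X z ↔ k * m w < 0) ∧
      ((∃ r, r ≠ 0 ∧ HasEigenvaluesOn T X z (0, 1) 0 r) ↔ k = 0 ∧ m w ≠ 0) := by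
  have E : HasEigenvaluesOn T X z (0, 1) (-k) (m w) := by
    refine ⟨(w, 0), -Q w, ?_, by simp [hT], by simp [hT, hlw], by simp [hX], by simp [hX]⟩
    rw [LinearIndependent.pair_iff]; intro s t hst
    simp only [Prod.smul_mk, Prod.mk_add_mk, Prod.mk_eq_zero] at hst; simpa [hw, and_comm] using hst
  have mul := fun {u p q} => mul_eq_of_hasEigenvaluesOn (u := u) (p := p) (q := q) hT hX hw hker
  refine ⟨⟨?_, fun h => ⟨h0, ?_⟩⟩, ⟨?_, fun h => ⟨h0, _, _, _, by linarith, E⟩⟩,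
    ⟨?_, fun h => ⟨m w, h.2, by simpa [h.1] using E⟩⟩⟩
  · rintro ⟨-, u, p, q, hp, hq, h⟩; have := mul h; nlinarith
  · rcases pos_and_pos_or_neg_and_neg_of_mul_pos h with ⟨h1, h2⟩ | ⟨h1, h2⟩
    · exact ⟨_, _, _, by linarith, h2, E⟩
    · refine ⟨(w, -Q w / (m w + k)), m w, -k, h2, by linarith, (0, 1), 0, ?_, by simp [hT, hlw],
        by simp [hT], ?_, by simp [hX]⟩
      · rw [LinearIndependent.pair_iff]; intro s t hst
        simp only [Prod.smul_mk, Prod.mk_add_mk, Prod.mk_eq_zero] at hst; obtain ⟨h3, h4⟩ := hst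
        have hs : s = 0 := by simpa [hw] using h3
        exact ⟨hs, by simpa [hs] using h4⟩
      · rw [hX]; have : m w + k ≠ 0 := by linarith
        ext1
        · rfl
        · simp; field_simp; ring
  · rintro ⟨-, u, p, q, hp, h⟩; have := mul h; linarith
  · rintro ⟨r, hr, h⟩
    have hk : k = 0 := by obtain ⟨-, -, -, -, -, h3, -⟩ := h; rw [hX] at h3; simpa using h3
    have h' := h; obtain ⟨⟨u', τ'⟩, c, hli, -, h2, -, h4⟩ := h; refine ⟨hk, ?_⟩; rw [hT] at h2
    obtain ⟨t', rfl⟩ := hker u' h2; rw [hX, Prod.mk.injEq] at h4; have h5 := h4.1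
    simp only [map_smul, smul_eq_mul, smul_smul, Prod.fst_add, Prod.smul_fst, smul_zero,
      zero_add] at h5
    have g : t' * m w = r * t' := smul_left_injective ℝ hw h5; intro h6
    have ht : t' = 0 := by simpa [h6, hr] using g.symm
    rw [LinearIndependent.pair_iff] at hli; have := hli τ' (-1) (by simp [ht]); simp at this

end Types

/-- The vector of slope `ξ`. -/
def slopeVec (ξ : OnePoint ℝ) : E2 := (slopeChart ξ).1 + (slopeChart ξ).2.2 • (slopeChart ξ).2.1

lemma slopeVec_infty : slopeVec OnePoint.infty = e₂ := by change e₂ + (0 : ℝ) • e₁ = e₂; simp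

lemma slopeVec_coe (p : ℝ) : slopeVec p = e₁ + p • e₂ := rfl

lemma slopeVec_ne_zero (ξ : OnePoint ℝ) : slopeVec ξ ≠ 0 := by
  intro h
  induction ξ using OnePoint.rec with
  | infty => simpa [slopeVec_infty, e₂] using congrArg (fun v : E2 => v 1) h
  | coe p => simpa [slopeVec_coe, e₁, e₂] using congrArg (fun v : E2 => v 0) h

lemma exists_slopeVec {w : E2} (hw : w ≠ 0) : ∃ (ξ : OnePoint ℝ) (t : ℝ), t ≠ 0 ∧ slopeVec ξ = t • w := by
  by_cases h : w 0 = 0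
  · have h1 : w 1 ≠ 0 := fun h1 => hw (by rw [eq_comb w, h, h1]; simp)
    refine ⟨OnePoint.infty, (w 1)⁻¹, inv_ne_zero h1, ?_⟩; rw [slopeVec_infty]; ext i
    fin_cases i <;> simp [e₂, h, h1]
  · refine ⟨((w 1 / w 0 : ℝ) : OnePoint ℝ), (w 0)⁻¹, inv_ne_zero h, ?_⟩; rw [slopeVec_coe]; ext i
    fin_cases i <;> simp [e₁, e₂, h, div_eq_inv_mul]

lemma slopeVec_injective {ξ ξ' : OnePoint ℝ} {t : ℝ} (ht : t ≠ 0)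
    (h : slopeVec ξ = t • slopeVec ξ') : ξ = ξ' := by
  have h0 := congrArg (fun v : E2 => v 0) h; have h1 := congrArg (fun v : E2 => v 1) h
  induction ξ using OnePoint.rec with
  | infty =>
    induction ξ' using OnePoint.rec with
    | infty => rfl
    | coe p =>
      simp [slopeVec_infty, slopeVec_coe, e₁, e₂] at h0; exact absurd h0.symm ht
  | coe p =>
    induction ξ' using OnePoint.rec with
    | infty => simp [slopeVec_infty, slopeVec_coe, e₁, e₂] at h0
    | coe p' =>
      simp [slopeVec_coe, e₁, e₂] at h0 h1; rw [h1, ← h0, one_mul]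

lemma exists_comb_slopeVec (ξ : OnePoint ℝ) (v : E2) :
    ∃ s t : ℝ, v = s • slopeVec ξ + t • (slopeChart ξ).2.1 := by
  induction ξ using OnePoint.rec with
  | infty =>
    refine ⟨v 1, v 0, ?_⟩
    conv_lhs => rw [eq_comb v]
    rw [slopeVec_infty, add_comm]; rfl
  | coe p =>
    refine ⟨v 0, v 1 - v 0 * p, ?_⟩
    conv_lhs => rw [eq_comb v]
    change _ = v 0 • (e₁ + p • e₂) + (v 1 - v 0 * p) • e₂
    module

lemma iteratedDeriv_two_cubic (c0 c1 c2 c3 s : ℝ) :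
    iteratedDeriv 2 (fun t : ℝ => c0 + c1 * t + c2 * t ^ 2 + c3 * t ^ 3) s =
      2 * c2 + 6 * c3 * s := by
  have h1 : deriv (fun t : ℝ => c0 + c1 * t + c2 * t ^ 2 + c3 * t ^ 3) =
      fun t => c1 + c2 * (2 * t) + c3 * (3 * t ^ 2) := by
    ext t
    have := ((((hasDerivAt_id t).const_mul c1).const_add c0).add
      ((hasDerivAt_pow 2 t).const_mul c2)).add ((hasDerivAt_pow 3 t).const_mul c3)
    refine this.deriv.trans ?_; simp
  rw [iteratedDeriv_succ, iteratedDeriv_one, h1]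
  have := ((((hasDerivAt_id s).const_mul 2).const_mul c2).const_add c1).add
    (((hasDerivAt_pow 2 s).const_mul 3).const_mul c3)
  refine this.deriv.trans ?_; simp; ring

omit [IsManifold (𝓡 2) ∞ M] in
/-- The singularities over an umbilic point, in a frame of the tangent plane. -/
lemma types_of_frame {α : M → E3} {q : M}
    (hf : ContDiffAt ℝ 4 (inChart α q) (ch q q))
    (h0 : rawNormal (inChart α q) (ch q q) ≠ 0)
    (hθ : theta (inChart α q) 1 (ch q q) = 0)
    {T : ℂ →ₗ[ℝ] E2} {κ : ℝ} {A B : ℂ}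
    (hform : ∀ z η, slopeForm (inChart α q) (ch q q) (T z) (T η) =
      κ * ((A * z + B * conj z) * conj η ^ 2).im) (ξ : OnePoint ℝ) {η δ : ℂ}
    (hη : T η = slopeVec ξ) (hδ : T δ = (slopeChart ξ).2.1) {μ k c : ℝ}
    (hμ : μ = 2 * κ * ((A * η + B * conj η) * (conj η * conj δ)).im)
    (hk : k = μ + κ * ((A * δ + B * conj δ) * conj η ^ 2).im)
    (hc : c = 2 * κ * ((A * δ + B * conj δ) * (conj η * conj δ)).im +
      κ * ((A * η + B * conj η) * conj δ ^ 2).im) :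
    (IsSing α q ξ ↔ κ * ((A * η + B * conj η) * conj η ^ 2).im = 0) ∧
    (fderiv ℝ (surfaceAt α q ξ) (pointAt q ξ) ≠ 0 ↔
      ∃ z, κ * ((A * z + B * conj z) * conj η ^ 2).im ≠ 0) ∧
    (fderiv ℝ (surfaceAt α q ξ) (pointAt q ξ) ≠ 0 → IsSing α q ξ → (IsSaddle α q ξ ↔ 0 < k * μ) ∧
      (IsNode α q ξ ↔ k * μ < 0) ∧ (IsFibreSaddleNode α q ξ ↔ (k = 0 ∧ μ ≠ 0) ∧ c ≠ 0)) := by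
  obtain ⟨LA, LB, LC, hL, hs⟩ := lieCartan_at hf h0 hθ (slopeChart ξ).1 (slopeChart ξ).2.1
  have hX0 := fun t => (hs t).2.1; obtain ⟨hDT, hX, Q, hDX⟩ := hs (slopeChart ξ).2.2
  have hcomb := exists_comb_slopeVec ξ; have hw := slopeVec_ne_zero ξ; unfold slopeVec at *
  set a := (slopeChart ξ).1; set b := (slopeChart ξ).2.1; set s := (slopeChart ξ).2.2
  have hw' : a + s • b = T η := hη.symm
  have hval : ∀ (z : ℂ) (t : ℝ), LA (T z) + (s + t) * LB (T z) + (s + t) ^ 2 * LC (T z) =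
      κ * ((A * z + B * conj z) * conj (η + t * δ) ^ 2).im := by
    intro z t; rw [← hL, ← hform]; congr 1; rw [map_add, ← real_smul, map_smul, hη, hδ]
    module
  have v0 : ∀ z, LA (T z) + s * LB (T z) + s ^ 2 * LC (T z) =
      κ * ((A * z + B * conj z) * conj η ^ 2).im := fun z => by simpa using hval z 0
  have e1 : ∀ z, κ * ((A * z + B * conj z) * conj (η + (1 : ℝ) * δ) ^ 2).im =
      κ * ((A * z + B * conj z) * conj η ^ 2).im +
      2 * κ * ((A * z + B * conj z) * (conj η * conj δ)).im +
      κ * ((A * z + B * conj z) * conj δ ^ 2).im := fun z => by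
    rw [mul_comm 2 κ, mul_assoc κ 2, ← mul_add, ← mul_add, ← im_ofReal_mul 2, ← add_im, ← add_im]
    congr 2; simp; ring
  have e2 : ∀ z, κ * ((A * z + B * conj z) * conj (η + (-1 : ℝ) * δ) ^ 2).im =
      κ * ((A * z + B * conj z) * conj η ^ 2).im -
      2 * κ * ((A * z + B * conj z) * (conj η * conj δ)).im +
      κ * ((A * z + B * conj z) * conj δ ^ 2).im := fun z => by
    rw [mul_comm 2 κ, mul_assoc κ 2, ← mul_sub, ← mul_add, ← im_ofReal_mul 2, ← sub_im, ← add_im]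
    congr 2; simp; ring
  have v1 : ∀ z, LB (T z) + 2 * s * LC (T z) =
      2 * κ * ((A * z + B * conj z) * (conj η * conj δ)).im := fun z => by
    linear_combination (hval z 1 - hval z (-1) + e1 z - e2 z) / 2
  have v2 : ∀ z, LC (T z) = κ * ((A * z + B * conj z) * conj δ ^ 2).im := fun z => by
    linear_combination (hval z 1 + hval z (-1) + e1 z + e2 z) / 2 - v0 z
  have hsing : IsSing α q ξ ↔ κ * ((A * η + B * conj η) * conj η ^ 2).im = 0 := by
    change lieCartan _ a b (_, s) = 0 ↔ _; rw [hX, hw', v0]; simp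
  have hder : fderiv ℝ (surfaceAt α q ξ) (pointAt q ξ) ≠ 0 ↔
      ∃ z, κ * ((A * z + B * conj z) * conj η ^ 2).im ≠ 0 := by
    change fderiv ℝ (surfaceFun _ a b) (_, s) ≠ 0 ↔ _; constructor
    · intro h; by_contra! h'; apply h; refine ContinuousLinearMap.ext fun ⟨v, τ⟩ => ?_
      obtain ⟨x, y, rfl⟩ := hcomb v; rw [hDT, ← hη, ← hδ, ← map_smul, ← map_smul, ← map_add, v0, h']
      rfl
    · rintro ⟨z, hz⟩ h; have := hDT (T z) 0; rw [h, v0] at this; exact hz this.symm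
  refine ⟨hsing, hder, fun hne hsg => ?_⟩; obtain ⟨z1, hz1⟩ := hder.mp hne; have hlw := hsing.mp hsg
  have hk' : k = LB (a + s • b) + 2 * s * LC (a + s • b) + (LA b + s * LB b + s ^ 2 * LC b) := by
    rw [hk, hμ, hw', v1, ← hδ, v0]
  have hμ' : μ = LB (a + s • b) + 2 * s * LC (a + s • b) := by rw [hμ, hw', v1]
  have key := isSaddleOn_iff (T := surfaceFun (inChart α q) a b) (X := lieCartan (inChart α q) a b)
    (z := (ch q q, s)) (l := LA + s • LB + s ^ 2 • LC) (m := LB + (2 * s) • LC) (Q := Q)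
    (w := a + s • b) (k := k) (fun v τ => (hDT v τ).trans (by simp))
    (fun v τ => (hDX v τ).trans (by simp [hk'])) hw (fun v hv => by
      obtain ⟨x, y, rfl⟩ := hcomb v
      have h1 : LA (T η) + s * LB (T η) + s ^ 2 * LC (T η) = 0 := by rw [v0, hlw]
      have hy : y = 0 := by
        by_contra hy; apply hz1; obtain ⟨x', y', hxy⟩ := hcomb (T z1); rw [← v0, hxy, hw']
        rw [hw'] at hv; simp at hv ⊢
        have h2 : LA b + s * LB b + s ^ 2 * LC b = 0 :=
          mul_left_cancel₀ hy (by linear_combination hv - x * h1)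
        linear_combination x' * h1 + y' * h2
      exact ⟨x, by rw [hy]; simp⟩)
    (by rw [hw']; simpa using (v0 η).trans hlw) hsg
  have hmw : (LB + (2 * s) • LC) (a + s • b) = μ := by rw [hμ']; simp
  rw [hmw] at key; refine ⟨key.1, key.2.1, ?_⟩; change (_ ∧ _ ∧ _) ↔ _
  refine (and_iff_right hsg).trans (and_congr key.2.2 (not_congr ?_))
  have hp : (fun t => (fieldAt α q ξ ((pointAt q ξ).1, t)).2) = fun t : ℝ => -LA a +
      -(LA b + LB a) * t + -(LB b + LC a) * t ^ 2 + -LC b * t ^ 3 := by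
    funext t; change (lieCartan (inChart α q) a b (ch q q, t)).2 = _; rw [hX0]; simp; ring
  rw [hp, iteratedDeriv_two_cubic]
  have hcc : c = LB b + 2 * s * LC b + LC (a + s • b) := by rw [hc, hw', ← hδ, v1, v2]
  change _ + 6 * -LC b * s = 0 ↔ _; rw [hcc, map_add, map_smul, smul_eq_mul]
  constructor <;> intro h <;> linarith

lemma slopeDir_ne (ξ : OnePoint ℝ) (t : ℝ) : (slopeChart ξ).2.1 ≠ t • slopeVec ξ := by
  intro h
  induction ξ using OnePoint.rec with
  | infty => simpa [slopeVec_infty, slopeChart, e₁, e₂] using congrArg (fun v : E2 => v 0) h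
  | coe p =>
    change e₂ = t • (e₁ + p • e₂) at h; have h0 := congrArg (fun v : E2 => v 0) h
    have h1 := congrArg (fun v : E2 => v 1) h; simp [e₁, e₂] at h0 h1; simp [← h0] at h1

namespace NormalForm

variable {α : M → E3} {q : M} {T : ℂ →ₗ[ℝ] E2} {κ : ℝ} {b : ℂ} {Λ : E2 → E2 → ℝ}

lemma exists_preimage (h : NormalForm Λ T κ b) (v : E2) : ∃ z, T z = v := by
  obtain ⟨e, he⟩ := exists_equiv_of_injective h.injective
  exact ⟨e.symm v, by rw [← he, e.apply_symm_apply]⟩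

lemma reTerm_pos (h : NormalForm Λ T κ b) (s : ℝ) :
    0 < 1 + s ^ 2 + (b.re * (1 - s ^ 2) + 2 * b.im * s) := by
  have hb : b.re ^ 2 + b.im ^ 2 < 1 := by
    have := h.norm_lt
    rw [← sq_lt_one_iff₀ (norm_nonneg b), ← normSq_eq_norm_sq, normSq_apply] at this; linarith
  have hs : 0 < 1 + s ^ 2 := by positivity
  have h1 : (b.re * (1 - s ^ 2) + 2 * b.im * s) ^ 2 < (1 + s ^ 2) ^ 2 := by
    nlinarith [sq_nonneg (b.im * (1 - s ^ 2) - 2 * b.re * s), mul_pos hs hs]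
  have := (abs_lt_of_sq_lt_sq' h1 hs.le).1; linarith

/-- The derivative of `slopeCubic`. -/
def _root_.Umbilic.slopeCubicDeriv (b : ℂ) (s : ℝ) : ℝ :=
  3 * (b.re - 1) * s ^ 2 - 6 * b.im * s - (1 + 3 * b.re)

omit [IsManifold (𝓡 2) ∞ M] in
lemma types (hn : NormalForm (slopeForm (inChart α q) (ch q q)) T κ b)
    (hf : ContDiffAt ℝ 4 (inChart α q) (ch q q))
    (h0 : rawNormal (inChart α q) (ch q q) ≠ 0)
    (hθ : theta (inChart α q) 1 (ch q q) = 0) : CondT α q ∧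
    (∀ ξ, IsSing α q ξ → ∃ s t : ℝ, t ≠ 0 ∧ slopeVec ξ = t • T ⟨1, s⟩) ∧
    ∀ ξ (s t : ℝ), t ≠ 0 → slopeVec ξ = t • T ⟨1, s⟩ → (IsSing α q ξ ↔ slopeCubic b s = 0) ∧
      (slopeCubic b s = 0 → (IsSaddle α q ξ ↔ slopeCubicDeriv b s < 0) ∧
        (IsNode α q ξ ↔ 0 < slopeCubicDeriv b s) ∧
        (IsFibreSaddleNode α q ξ ↔ slopeCubicDeriv b s = 0 ∧ (b.re - 1) * s - b.im ≠ 0)) := by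
  have hform : ∀ z η, slopeForm (inChart α q) (ch q q) (T z) (T η) =
      κ * ((1 * z + b * conj z) * conj η ^ 2).im := fun z η => by rw [one_mul]; exact hn.eq z η
  have hb1 : 1 - (‖b‖ ^ 2 : ℝ) ≠ 0 := by nlinarith [hn.norm_lt, norm_nonneg b]
  have hbb : b * conj b = (‖b‖ ^ 2 : ℝ) := by rw [Complex.mul_conj, Complex.normSq_eq_norm_sq]
  choose pre hpre using hn.exists_preimage
  have gen := fun ξ => types_of_frame hf h0 hθ hform ξ (hpre (slopeVec ξ)) (hpre _) rfl rfl rfl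
  have hT : CondT α q := by
    intro ξ; have hη := hpre (slopeVec ξ); have hδ := hpre (slopeChart ξ).2.1
    obtain ⟨h1, h2, h3⟩ := gen ξ
    generalize pre (slopeVec ξ) = η at *
    generalize pre (slopeChart ξ).2.1 = δ at *
    refine h2.mpr ?_
    have hη0 : η ≠ 0 := by rintro rfl; exact slopeVec_ne_zero ξ (by rw [← hη, map_zero])
    set u := Complex.I * η ^ 2 with hu
    refine ⟨(u - b * conj u) / (1 - (‖b‖ ^ 2 : ℝ)), mul_ne_zero hn.ne_zero ?_⟩
    have hb2 : (1 : ℂ) - (‖b‖ ^ 2 : ℝ) ≠ 0 := by exact_mod_cast hb1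
    have h3 : 1 * ((u - b * conj u) / (1 - (‖b‖ ^ 2 : ℝ))) +
        b * conj ((u - b * conj u) / (1 - (‖b‖ ^ 2 : ℝ))) = u := by
      clear_value u
      rw [map_div₀, map_sub, map_sub, map_mul, Complex.conj_conj, Complex.conj_ofReal, map_one]
      field_simp
      linear_combination -u * hbb
    rw [h3, hu, show Complex.I * η ^ 2 * conj η ^ 2 = ((Complex.normSq η ^ 2 : ℝ) : ℂ) * Complex.I
      from by rw [Complex.ofReal_pow, ← Complex.mul_conj]; ring, Complex.im_ofReal_mul]
    simpa using hη0
  refine ⟨hT, fun ξ hs => ?_, fun ξ s t ht hξ => ?_⟩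
  · have hη := hpre (slopeVec ξ); have hδ := hpre (slopeChart ξ).2.1; obtain ⟨h1, h2, h3⟩ := gen ξ
    generalize pre (slopeVec ξ) = η at *
    generalize pre (slopeChart ξ).2.1 = δ at *
    have hre : η.re ≠ 0 := by
      intro hre
      have him : η.im ≠ 0 := fun him => slopeVec_ne_zero ξ (by
        rw [← hη, show η = 0 from Complex.ext hre him, map_zero])
      have h2 := (mul_eq_zero.mp (h1.mp hs)).resolve_left hn.ne_zero
      have h3 : η.im ^ 3 * (b.re - 1) = 0 := by
        simp only [pow_two, Complex.mul_im, Complex.mul_re, Complex.add_re, Complex.add_im,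
          Complex.conj_re, Complex.conj_im, Complex.one_re, Complex.one_im, hre] at h2
        linear_combination h2
      have h4 : b.re < 1 := (Complex.re_le_norm b).trans_lt hn.norm_lt
      rcases mul_eq_zero.mp h3 with h | h
      · exact him (pow_eq_zero_iff (by norm_num) |>.mp h)
      · linarith
    refine ⟨η.im / η.re, η.re, hre, ?_⟩; rw [← hη, ← map_smul]; congr 1; apply Complex.ext <;> simp
    field_simp
  · have hη := hpre (slopeVec ξ); have hδ := hpre (slopeChart ξ).2.1; obtain ⟨h1, h2, h3⟩ := gen ξ
    generalize pre (slopeVec ξ) = η at *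
    generalize pre (slopeChart ξ).2.1 = δ at *
    have h2' := h3 (hT ξ); clear h3 h2
    have hη' : η = ⟨t, t * s⟩ := hn.injective (by
      rw [hη, hξ, ← map_smul]; congr 1; apply Complex.ext <;> simp)
    obtain ⟨ρ, τ, hδ'⟩ : ∃ ρ τ : ℝ, δ = ⟨ρ, ρ * s + τ⟩ :=
      ⟨δ.re, δ.im - δ.re * s, Complex.ext rfl (by simp)⟩
    have hτ : τ ≠ 0 := by
      rintro rfl; refine slopeDir_ne ξ (ρ / t) ?_; rw [← hδ, ← hη, ← map_smul, hδ', hη']; congr 1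
      apply Complex.ext <;> simp <;> field_simp
    subst hη' hδ'
    have hsing : IsSing α q ξ ↔ slopeCubic b s = 0 := by
      have e0 : κ * ((1 * (⟨t, t * s⟩ : ℂ) + b * conj (⟨t, t * s⟩ : ℂ)) *
          conj (⟨t, t * s⟩ : ℂ) ^ 2).im = κ * t ^ 3 * slopeCubic b s := by
        simp [slopeCubic, pow_two]; ring
      rw [h1, e0]; simp [hn.ne_zero, ht]
    refine ⟨hsing, fun hC => ?_⟩; obtain ⟨g1, g2, g3⟩ := h2' (hsing.mpr hC); have hC' := hC
    unfold slopeCubic at hC'; have hR := hn.reTerm_pos s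
    set R := 1 + s ^ 2 + (b.re * (1 - s ^ 2) + 2 * b.im * s) with hRdef
    have eμ : 2 * κ * ((1 * (⟨t, t * s⟩ : ℂ) + b * conj (⟨t, t * s⟩ : ℂ)) *
        (conj (⟨t, t * s⟩ : ℂ) * conj (⟨ρ, ρ * s + τ⟩ : ℂ))).im = -(2 * κ * t ^ 2 * τ * R) := by
      simp [hRdef]
      linear_combination (2 * κ * t ^ 2 * ρ) * hC'
    have ek : 2 * κ * ((1 * (⟨t, t * s⟩ : ℂ) + b * conj (⟨t, t * s⟩ : ℂ)) *
        (conj (⟨t, t * s⟩ : ℂ) * conj (⟨ρ, ρ * s + τ⟩ : ℂ))).im + κ *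
        ((1 * (⟨ρ, ρ * s + τ⟩ : ℂ) + b * conj (⟨ρ, ρ * s + τ⟩ : ℂ)) *
          conj (⟨t, t * s⟩ : ℂ) ^ 2).im = κ * t ^ 2 * τ * slopeCubicDeriv b s := by
      simp [slopeCubicDeriv, pow_two]
      linear_combination (3 * κ * t ^ 2 * ρ) * hC'
    rw [ek, eμ] at g1 g2 g3
    have hpos : 0 < 2 * (κ * t ^ 2 * τ) ^ 2 * R := by have := hn.ne_zero; positivity
    have e : κ * t ^ 2 * τ * slopeCubicDeriv b s * -(2 * κ * t ^ 2 * τ * R) =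
        -(2 * (κ * t ^ 2 * τ) ^ 2 * R) * slopeCubicDeriv b s := by ring
    rw [e] at g1 g2; refine ⟨g1.trans ?_, g2.trans ?_, g3.trans ?_⟩
    · constructor <;> intro h <;> nlinarith
    · constructor <;> intro h <;> nlinarith
    · have hk : κ * t ^ 2 * τ * slopeCubicDeriv b s = 0 ↔ slopeCubicDeriv b s = 0 := by
        simp [hn.ne_zero, ht, hτ]
      rw [hk, and_assoc]; refine and_congr_right fun hd => ?_; unfold slopeCubicDeriv at hd
      rw [and_iff_right (neg_ne_zero.mpr (mul_ne_zero (mul_ne_zero (mul_ne_zero (mul_ne_zero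
        two_ne_zero hn.ne_zero) (pow_ne_zero 2 ht)) hτ) hR.ne'))]
      refine not_congr ?_
      have e2 : 2 * κ * ((1 * (⟨ρ, ρ * s + τ⟩ : ℂ) + b * conj (⟨ρ, ρ * s + τ⟩ : ℂ)) *
          (conj (⟨t, t * s⟩ : ℂ) * conj (⟨ρ, ρ * s + τ⟩ : ℂ))).im + κ *
          ((1 * (⟨t, t * s⟩ : ℂ) + b * conj (⟨t, t * s⟩ : ℂ)) *
          conj (⟨ρ, ρ * s + τ⟩ : ℂ) ^ 2).im = 3 * κ * t * τ ^ 2 * ((b.re - 1) * s - b.im) := by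
        simp [pow_two]
        linear_combination (3 * κ * t * ρ ^ 2) * hC' + (2 * κ * t * ρ * τ) * hd
      rw [e2]; simp [hn.ne_zero, ht, hτ]

end NormalForm

/-- The opposite of the discriminant of `slopeCubic b`, divided by `4`. -/
def typeFun (b : ℂ) : ℝ := 1 + 8 * b.re + 18 * normSq b - 27 * normSq b ^ 2

lemma exists_cubic_root {k : ℝ} (hk : k < 0) (c2 c1 c0 : ℝ) :
    ∃ s : ℝ, k * s ^ 3 + c2 * s ^ 2 + c1 * s + c0 = 0 := by
  set m := |c2| + |c1| + |c0| with hm; have hm0 : 0 ≤ m := by positivity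
  set R := 1 + m / -k with hR; have hd : 0 ≤ m / -k := div_nonneg hm0 (by linarith)
  have hR1 : 1 ≤ R := by linarith
  have hk0 := hk.ne; have hkR : k * R + m = k := by rw [hR]; field_simp; ring
  have b2 := abs_le.mp (le_refl |c2|); have b1 := abs_le.mp (le_refl |c1|)
  have b0 := abs_le.mp (le_refl |c0|); have hR2 : R ≤ R ^ 2 := by nlinarith
  have hbound : |c2| * R ^ 2 + |c1| * R + |c0| ≤ m * R ^ 2 := by
    rw [hm]
    nlinarith [mul_le_mul_of_nonneg_left hR2 (abs_nonneg c1),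
      mul_le_mul_of_nonneg_left (hR1.trans hR2) (abs_nonneg c0)]
  have hneg : k * R ^ 3 + m * R ^ 2 < 0 := by
    rw [show k * R ^ 3 + m * R ^ 2 = R ^ 2 * (k * R + m) from by ring, hkR]
    exact mul_neg_of_pos_of_neg (by positivity) hk
  have h1 : k * R ^ 3 + c2 * R ^ 2 + c1 * R + c0 ≤ 0 := by
    nlinarith [mul_le_mul_of_nonneg_right b2.2 (sq_nonneg R),
      mul_le_mul_of_nonneg_right b1.2 (by linarith : (0 : ℝ) ≤ R)]
  have h2 : 0 ≤ k * (-R) ^ 3 + c2 * (-R) ^ 2 + c1 * (-R) + c0 := by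
    nlinarith [mul_le_mul_of_nonneg_right b2.1 (sq_nonneg R),
      mul_le_mul_of_nonneg_right b1.2 (by linarith : (0 : ℝ) ≤ R)]
  obtain ⟨s, -, hs⟩ := intermediate_value_Icc' (f := fun s : ℝ => k * s ^ 3 + c2 * s ^ 2 + c1 * s + c0)
    (by linarith : -R ≤ R) (by fun_prop) ⟨h1, h2⟩
  exact ⟨s, hs⟩

lemma slopeCubic_cases {b : ℂ} (hb : ‖b‖ < 1) (h3 : b ≠ -1 / 3) :
    (0 < typeFun b → ∃ s0, slopeCubic b s0 = 0 ∧ (∀ s, slopeCubic b s = 0 → s = s0) ∧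
      slopeCubicDeriv b s0 < 0) ∧
    (typeFun b < 0 → ∃ s1 s2 s3, s1 < s2 ∧ s2 < s3 ∧
      ∀ s, slopeCubic b s = (b.re - 1) * ((s - s1) * (s - s2) * (s - s3))) ∧
    (typeFun b = 0 → ∃ s1 s2, s1 ≠ s2 ∧
      ∀ s, slopeCubic b s = (b.re - 1) * ((s - s1) ^ 2 * (s - s2))) := by
  have hk : b.re - 1 < 0 := by have := Complex.re_le_norm b; linarith
  have hk0 := hk.ne; obtain ⟨s0, hs0⟩ := exists_cubic_root hk (-3 * b.im) (-(1 + 3 * b.re)) b.im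
  obtain ⟨u, hu⟩ : ∃ u, (b.re - 1) * (u - s0) = -3 * b.im :=
    ⟨s0 + -3 * b.im / (b.re - 1), by field_simp; ring⟩
  obtain ⟨v, hv⟩ : ∃ v, (b.re - 1) * (v - u * s0) = -(1 + 3 * b.re) :=
    ⟨u * s0 + -(1 + 3 * b.re) / (b.re - 1), by field_simp; ring⟩
  have hw : -(b.re - 1) * v * s0 = b.im := by linear_combination -hs0 - s0 ^ 2 * hu - s0 * hv
  have hC : ∀ s, slopeCubic b s = (b.re - 1) * ((s - s0) * (s ^ 2 + u * s + v)) := fun s => by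
    unfold slopeCubic
    linear_combination -s ^ 2 * hu - s * hv - hw
  have hdisc : (b.re - 1) ^ 4 * (u ^ 2 - 4 * v) * (s0 ^ 2 + u * s0 + v) ^ 2 = -4 * typeFun b := by
    have e1 : (b.re - 1) ^ 4 * (u ^ 2 - 4 * v) * (s0 ^ 2 + u * s0 + v) ^ 2 = ((b.re - 1) * (v - u *
        s0)) ^ 2 * ((b.re - 1) * (u - s0)) ^ 2 - 4 * (-(b.re - 1) * v * s0) * ((b.re - 1) * (u -
        s0)) ^ 3 - 4 * ((b.re - 1) * (v - u * s0)) ^ 3 * (b.re - 1) + 18 * (-(b.re - 1) * v * s0) *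
        ((b.re - 1) * (v - u * s0)) * ((b.re - 1) * (u - s0)) * (b.re - 1) - 27 * (-(b.re - 1) * v *
        s0) ^ 2 * (b.re - 1) ^ 2 := by ring
    rw [e1, hu, hv, hw, typeFun, Complex.normSq_apply]; ring
  have hk4 : 0 < (b.re - 1) ^ 4 := Even.pow_pos (by decide) hk0
  have hder : slopeCubicDeriv b s0 = (b.re - 1) * (s0 ^ 2 + u * s0 + v) := by
    unfold slopeCubicDeriv
    linear_combination -2 * s0 * hu - hv
  have htriple : ∀ r, ¬ ∀ s, slopeCubic b s = (b.re - 1) * (s - r) ^ 3 := by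
    intro r h; have g0 := h 0; have g1 := h 1; have g2 := h (-1); unfold slopeCubic at g0 g1 g2
    have a0 : b.im = -(b.re - 1) * r ^ 3 := by linear_combination g0
    have a2 : b.im = (b.re - 1) * r := by linear_combination (-g1 - g2 + 2 * g0) / 6
    have a1 : -(1 + 3 * b.re) = 3 * (b.re - 1) * r ^ 2 := by linear_combination (g1 - g2) / 2
    have hr : r = 0 := by
      have : (b.re - 1) * r * (1 + r ^ 2) = 0 := by linear_combination a0 - a2
      simpa [hk.ne, (by positivity : 1 + r ^ 2 ≠ 0)] using this
    rw [hr] at a1 a2; apply h3; apply Complex.ext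
    · simp; linarith
    · simp [a2]
  refine ⟨fun h => ?_, fun h => ?_, fun h => ?_⟩
  · have hΔ : u ^ 2 - 4 * v < 0 := by
      by_contra hcon
      have : 0 ≤ (b.re - 1) ^ 4 * (u ^ 2 - 4 * v) * (s0 ^ 2 + u * s0 + v) ^ 2 :=
        mul_nonneg (mul_nonneg hk4.le (not_lt.mp hcon)) (sq_nonneg _)
      linarith
    have hq : ∀ s, 0 < s ^ 2 + u * s + v := fun s => by nlinarith [sq_nonneg (2 * s + u)]
    refine ⟨s0, by rw [hC]; ring, fun s hs => ?_, ?_⟩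
    · rw [hC] at hs; simpa [hk.ne, (hq s).ne', sub_eq_zero] using hs
    · rw [hder]; exact mul_neg_of_neg_of_pos hk (hq _)
  · have hΔ : 0 < u ^ 2 - 4 * v := by
      by_contra hcon
      have := mul_nonneg (mul_nonneg hk4.le (neg_nonneg.mpr (not_lt.mp hcon)))
        (sq_nonneg (s0 ^ 2 + u * s0 + v))
      linarith
    set d := √(u ^ 2 - 4 * v); have hd : d ^ 2 = u ^ 2 - 4 * v := Real.sq_sqrt hΔ.le
    have hd0 : 0 < d := Real.sqrt_pos.mpr hΔ
    have hq : ∀ s, s ^ 2 + u * s + v = (s - (-u - d) / 2) * (s - (-u + d) / 2) := fun s => by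
      linear_combination hd / 4
    have hR : s0 ^ 2 + u * s0 + v ≠ 0 := by intro h0; rw [h0] at hdisc; linarith
    rw [hq] at hR; have n1 : s0 ≠ (-u - d) / 2 := fun h => hR (by rw [← h]; ring)
    have n2 : s0 ≠ (-u + d) / 2 := fun h => hR (by rw [← h]; ring)
    have h12 : (-u - d) / 2 < (-u + d) / 2 := by linarith
    rcases n1.lt_or_gt with l1 | l1
    · exact ⟨_, _, _, l1, h12, fun s => by rw [hC, hq]; ring⟩
    · rcases n2.lt_or_gt with l2 | l2
      · exact ⟨_, _, _, l1, l2, fun s => by rw [hC, hq]; ring⟩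
      · exact ⟨_, _, _, h12, l2, fun s => by rw [hC, hq]; ring⟩
  · rw [h, mul_zero] at hdisc; rcases mul_eq_zero.mp hdisc with h | h
    · have hΔ := (mul_eq_zero.mp h).resolve_left hk4.ne'
      have hf : ∀ s, slopeCubic b s = (b.re - 1) * ((s - -u / 2) ^ 2 * (s - s0)) := fun s => by
        rw [hC]; linear_combination -(b.re - 1) * (s - s0) / 4 * hΔ
      exact ⟨-u / 2, s0, fun he => htriple s0 fun s => by rw [hf, he]; ring, hf⟩
    · have hR := pow_eq_zero_iff (two_ne_zero) |>.mp h
      have hf : ∀ s, slopeCubic b s = (b.re - 1) * ((s - s0) ^ 2 * (s - (-u - s0))) := fun s => by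
        rw [hC]; linear_combination (b.re - 1) * (s - s0) * hR
      exact ⟨s0, -u - s0, fun he => htriple s0 fun s => by rw [hf, ← he]; ring, hf⟩

lemma slopeCubicDeriv_of_factor {b : ℂ} {s1 s2 s3 : ℝ}
    (h : ∀ s, slopeCubic b s = (b.re - 1) * ((s - s1) * (s - s2) * (s - s3))) (s : ℝ) :
    slopeCubicDeriv b s = (b.re - 1) *
      ((s - s2) * (s - s3) + (s - s1) * (s - s3) + (s - s1) * (s - s2)) ∧
    (b.re - 1) * (s1 + s2 + s3) = 3 * b.im := by
  have g0 := h 0; have g1 := h 1; have g2 := h (-1); unfold slopeCubic at g0 g1 g2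
  unfold slopeCubicDeriv; constructor
  · linear_combination s * (g1 + g2 - 2 * g0) + (g1 - g2) / 2
  · linear_combination (g1 + g2 - 2 * g0) / 2

variable {β : M → E3} {p q : M}

/-- The type and the local principal configuration of an umbilic point, in terms of its
modulus. -/
lemma types_of_modulus (ho : OrientedAtlas M) (hβ : CM 4 β)
    (hi : IsImmersion β) (hq : q ∈ (ch p).source) (hU : IsUmbilic β q) {b : ℂ}
    (hlt : ‖coeffB (inChart β p) (ch p q)‖ < ‖coeffA (inChart β p) (ch p q)‖)
    (hb : modulus (inChart β p) (ch p q) = b) (h3 : b ≠ -1 / 3) :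
    (0 < typeFun b ↔ IsD1 β q) ∧ (typeFun b < 0 ↔ IsD2 β q) ∧ (typeFun b = 0 ↔ IsD12 β q) ∧
    (0 < typeFun b → HasConfigD1 β q) ∧ (typeFun b < 0 → HasConfigD2 β q) ∧
    (typeFun b = 0 → HasConfigD12 β q) := by
  have hβ2 : CM 2 β := hβ.of_le (by norm_num); have hβ1 : CM 1 β := hβ.of_le (by norm_num)
  have hqq := mem_chart_source E2 q
  have hθ := fun {p : M} hq => (isUmbilic_iff_theta (p := p) ho hβ2 hi (one_pow 2) hq).mp hU
  obtain ⟨T, κ, hn, ⟨a, c, ε, φ, hac, hφ⟩, a', c', ε', φ', F, hac', hφ'⟩ :=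
    exists_normalForm ho hβ hi hq (hθ hq) hlt
  rw [hb] at hn hac hφ hac' hφ'
  obtain ⟨hT, hcov, hty⟩ := hn.types (contDiffAt_inChart (n := 4) (by exact_mod_cast hβ)
    ((ch q).map_source hqq)) (rawNormal_ne_zero hβ1 hi ho hqq) (hθ hqq)
  have hk : b.re - 1 < 0 := by have := re_le_norm b; have := hn.norm_lt; linarith
  have hTne : ∀ s : ℝ, T ⟨1, s⟩ ≠ 0 := fun s h => by
    have := hn.injective (h.trans (map_zero T).symm); simpa using congrArg re this
  have hex : ∀ s : ℝ, ∃ (ξ : OnePoint ℝ) (t : ℝ), t ≠ 0 ∧ slopeVec ξ = t • T ⟨1, s⟩ := fun s =>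
    exists_slopeVec (hTne s)
  have huniq : ∀ {ξ ξ' : OnePoint ℝ} {t t' s : ℝ}, t ≠ 0 → t' ≠ 0 → slopeVec ξ = t • T ⟨1, s⟩ →
      slopeVec ξ' = t' • T ⟨1, s⟩ → ξ = ξ' := fun {ξ ξ' t t' s} ht ht' h h' =>
    slopeVec_injective (t := t / t') (div_ne_zero ht ht') (by
      rw [h, h', smul_smul, div_mul_cancel₀ _ ht'])
  have hroot : ∀ {ξ}, IsSing β q ξ → ∃ s t : ℝ, t ≠ 0 ∧ slopeVec ξ = t • T ⟨1, s⟩ ∧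
      slopeCubic b s = 0 := fun {ξ} h => by
    obtain ⟨s, t, ht, hs⟩ := hcov ξ h; exact ⟨s, t, ht, hs, (hty ξ s t ht hs).1.mp h⟩
  have hSN : ∀ {ξ}, IsSaddle β q ξ → ¬ IsNode β q ξ ∧ ¬ IsFibreSaddleNode β q ξ := by
    intro ξ h; obtain ⟨s, t, ht, hs, h0⟩ := hroot h.1; obtain ⟨h1, h2, h3⟩ := (hty ξ s t ht hs).2 h0
    have := h1.mp h; exact ⟨fun h' => by linarith [h2.mp h'], fun h' => by linarith [(h3.mp h').1]⟩
  have hNF : ∀ {ξ}, IsNode β q ξ → ¬ IsFibreSaddleNode β q ξ := by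
    intro ξ h h'; obtain ⟨s, t, ht, hs, h0⟩ := hroot h.1
    obtain ⟨h1, h2, h3⟩ := (hty ξ s t ht hs).2 h0; linarith [h2.mp h, (h3.mp h').1]
  have x12 : IsD1 β q → ¬ IsD2 β q := by
    rintro ⟨-, -, ξ, hξ, hall⟩ ⟨-, -, ξ0, ξ1, ξ2, -, hn0, hs1, -⟩; rw [← hall ξ0 hn0.1] at hξ
    exact (hSN hξ).1 hn0
  have x13 : IsD1 β q → ¬ IsD12 β q := by
    rintro ⟨-, -, ξ, hξ, hall⟩ ⟨-, -, ξ0, ξ1, hn0, -⟩; rw [← hall ξ0 hn0.1] at hξ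
    exact (hSN hξ).2 hn0
  have x23 : IsD2 β q → ¬ IsD12 β q := by
    rintro ⟨-, -, ξ0, ξ1, ξ2, -, hn0, -⟩ ⟨-, -, η0, η1, hf0, hs1, hall⟩
    rcases hall ξ0 hn0.1 with h | h
    · rw [h] at hn0; exact hNF hn0 hf0
    · rw [h] at hn0; exact (hSN hs1).1 hn0
  obtain ⟨c1, c2, c3⟩ := slopeCubic_cases hn.norm_lt h3
  have d1 : 0 < typeFun b → IsD1 β q ∧ HasConfigD1 β q := by
    intro h; obtain ⟨s, h0, hall, hd⟩ := c1 h; refine ⟨⟨hU, hT, ?_⟩, hφ.hasConfigD1 hac h0 hall hd⟩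
    obtain ⟨ξ, t, ht, hξ⟩ := hex s; refine ⟨ξ, (((hty ξ s t ht hξ).2 h0).1).mpr hd, fun η hη => ?_⟩
    obtain ⟨s', t', ht', hη', h0'⟩ := hroot hη; rw [hall s' h0'] at hη'; exact huniq ht' ht hη' hξ
  have d2 : typeFun b < 0 → IsD2 β q ∧ HasConfigD2 β q := by
    intro h; obtain ⟨s1, s2, s3, h12, h23, hf⟩ := c2 h
    refine ⟨⟨hU, hT, ?_⟩, hφ.hasConfigD2 hac h12 h23 hf⟩; obtain ⟨ξ1, t1, ht1, hξ1⟩ := hex s1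
    obtain ⟨ξ2, t2, ht2, hξ2⟩ := hex s2; obtain ⟨ξ3, t3, ht3, hξ3⟩ := hex s3
    have hd := fun s => (slopeCubicDeriv_of_factor hf s).1
    refine ⟨ξ2, ξ1, ξ3, ?_, ?_, ?_, ?_, fun η hη => ?_⟩
    · rintro rfl
      have h1 := hn.injective (a₁ := t1 • ⟨1, s1⟩) (a₂ := t3 • ⟨1, s3⟩)
        (by rw [map_smul, map_smul, ← hξ1, ← hξ3])
      have h2 : t1 = t3 := by simpa using congrArg re h1
      have h4 : t1 * s1 = t3 * s3 := by simpa using congrArg im h1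
      rw [h2] at h4; linarith [mul_left_cancel₀ ht3 h4]
    · refine (((hty ξ2 s2 t2 ht2 hξ2).2 (by rw [hf]; ring)).2.1).mpr ?_; rw [hd]
      nlinarith [mul_pos (sub_pos.mpr h12) (sub_pos.mpr h23)]
    · refine (((hty ξ1 s1 t1 ht1 hξ1).2 (by rw [hf]; ring)).1).mpr ?_; rw [hd]
      nlinarith [mul_pos (sub_pos.mpr h12) (sub_pos.mpr (h12.trans h23))]
    · refine (((hty ξ3 s3 t3 ht3 hξ3).2 (by rw [hf]; ring)).1).mpr ?_; rw [hd]
      nlinarith [mul_pos (sub_pos.mpr h23) (sub_pos.mpr (h12.trans h23))]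
    · obtain ⟨s, t, ht, hs, h0⟩ := hroot hη; rw [hf] at h0
      simp only [mul_eq_zero, hk.ne, false_or, sub_eq_zero] at h0; rcases h0 with (rfl | rfl) | rfl
      · exact Or.inr (Or.inl (huniq ht ht1 hs hξ1))
      · exact Or.inl (huniq ht ht2 hs hξ2)
      · exact Or.inr (Or.inr (huniq ht ht3 hs hξ3))
  have d3 : typeFun b = 0 → IsD12 β q ∧ HasConfigD12 β q := by
    intro h; obtain ⟨s1, s2, h12, hf⟩ := c3 h; refine ⟨⟨hU, hT, ?_⟩, ?_⟩
    · obtain ⟨ξ1, t1, ht1, hξ1⟩ := hex s1; obtain ⟨ξ2, t2, ht2, hξ2⟩ := hex s2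
      have hf' : ∀ s, slopeCubic b s = (b.re - 1) * ((s - s1) * (s - s1) * (s - s2)) := fun s => by
        rw [hf]; ring
      have hd := slopeCubicDeriv_of_factor hf'; refine ⟨ξ1, ξ2, ?_, ?_, fun η hη => ?_⟩
      · refine (((hty ξ1 s1 t1 ht1 hξ1).2 (by rw [hf]; ring)).2.2).mpr ⟨?_, fun h => ?_⟩
        · rw [(hd s1).1]; ring
        · have : (b.re - 1) * (s1 - s2) = 0 := by linear_combination 3 * h - (hd s1).2
          exact mul_ne_zero hk.ne (sub_ne_zero.mpr h12) this
      · refine (((hty ξ2 s2 t2 ht2 hξ2).2 (by rw [hf]; ring)).1).mpr ?_; rw [(hd s2).1]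
        nlinarith [sq_pos_of_ne_zero (sub_ne_zero.mpr h12)]
      · obtain ⟨s, t, ht, hs, h0⟩ := hroot hη; rw [hf'] at h0
        simp only [mul_eq_zero, hk.ne, false_or, sub_eq_zero, or_self] at h0
        rcases h0 with rfl | rfl
        · exact Or.inl (huniq ht ht1 hs hξ1)
        · exact Or.inr (huniq ht ht2 hs hξ2)
    · rcases h12.lt_or_gt with h | h
      · exact hφ.hasConfigD12 hac h hf
      · refine hφ'.hasConfigD12 hac' (neg_lt_neg h) fun s => ?_; have := hf (-s)
        unfold slopeCubic at this ⊢; simp only [conj_re, conj_im]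
        linear_combination -this
  refine ⟨⟨fun h => (d1 h).1, fun h => ?_⟩, ⟨fun h => (d2 h).1, fun h => ?_⟩,
    ⟨fun h => (d3 h).1, fun h => ?_⟩, fun h => (d1 h).2, fun h => (d2 h).2, fun h => (d3 h).2⟩
  · rcases lt_trichotomy (typeFun b) 0 with h' | h' | h'
    · exact absurd (d2 h').1 (x12 h)
    · exact absurd (d3 h').1 (x13 h)
    · exact h'
  · rcases lt_trichotomy (typeFun b) 0 with h' | h' | h'
    · exact h'
    · exact absurd (d3 h').1 (x23 h)
    · exact absurd h (x12 (d1 h').1)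
  · rcases lt_trichotomy (typeFun b) 0 with h' | h' | h'
    · exact absurd h (x23 (d2 h').1)
    · exact h'
    · exact absurd h (x13 (d1 h').1)

/-- An antilinear part is small if one root of the cubic form has a saddle-node. -/
lemma norm_lt_of_saddleNode {A B η δ : ℂ} (h1 : ((A * η + B * conj η) * conj η ^ 2).im = 0)
    (h2 : ((A * η + B * conj η) * (conj η * conj δ)).im ≠ 0)
    (h3 : ((A * η + B * conj η) * (conj η * conj δ)).im +
      1 / 2 * ((A * δ + B * conj δ) * conj η ^ 2).im = 0) : ‖B‖ < ‖A‖ := by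
  have hη : η ≠ 0 := by rintro rfl; simp at h2
  obtain ⟨u, rfl⟩ : ∃ u, δ = u * η := ⟨δ / η, by field_simp⟩
  obtain ⟨a, ha⟩ : ∃ a, a = A * η * conj η ^ 2 := ⟨_, rfl⟩
  obtain ⟨b, hb⟩ : ∃ b, b = B * conj η ^ 3 := ⟨_, rfl⟩
  have g1 : (A * η + B * conj η) * conj η ^ 2 = a + b := by rw [ha, hb]; ring
  have g2 : (A * η + B * conj η) * (conj η * conj (u * η)) = (a + b) * conj u := by
    rw [ha, hb, map_mul]; ring
  have g3 : (A * (u * η) + B * conj (u * η)) * conj η ^ 2 = a * u + b * conj u := by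
    rw [ha, hb, map_mul]; ring
  rw [g1] at h1; rw [g2] at h2 h3; rw [g3] at h3
  simp only [add_im, add_re, mul_im, conj_re, conj_im] at h1 h2 h3
  have hu : u.im ≠ 0 := fun h => h2 (by rw [h, h1]; ring)
  have hl : a.re + b.re ≠ 0 := fun h => h2 (by rw [h, h1]; ring)
  have hk : a.re - b.re = 2 * (a.re + b.re) := by
    refine mul_left_cancel₀ hu ?_
    linear_combination 2 * h3 - 3 * u.re * h1
  have hab : ‖b‖ < ‖a‖ := by
    refine lt_of_pow_lt_pow_left₀ 2 (norm_nonneg _) ?_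
    rw [← normSq_eq_norm_sq, ← normSq_eq_norm_sq, normSq_apply, normSq_apply]
    have := sq_pos_of_ne_zero hl
    have e : a.re * a.re + a.im * a.im - (b.re * b.re + b.im * b.im) = 2 * (a.re + b.re) ^ 2 := by
      linear_combination (a.re + b.re) * hk + (a.im - b.im) * h1
    linarith
  rw [ha, hb, norm_mul, norm_mul, norm_mul, norm_pow, norm_pow, RCLike.norm_conj, mul_assoc,
    ← pow_succ'] at hab
  exact lt_of_mul_lt_mul_right hab (by positivity)

variable {β : M → E3} {p : M}

lemma modulus_of_isD12 (ho : OrientedAtlas M) (hβ : CM 4 β)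
    (hi : IsImmersion β) (h12 : IsD12 β p) :
    ‖coeffB (inChart β p) (ch p p)‖ < ‖coeffA (inChart β p) (ch p p)‖ ∧
    modulus (inChart β p) (ch p p) ≠ -1 / 3 := by
  have hβ2 : CM 2 β := hβ.of_le (by norm_num); have hβ1 : CM 1 β := hβ.of_le (by norm_num)
  have hp := mem_chart_source E2 p; obtain ⟨hU, hT, ξ, -, hξ, -⟩ := h12
  have h0 := rawNormal_ne_zero hβ1 hi ho hp
  have hθ := (isUmbilic_iff_theta ho hβ2 hi (one_pow 2) hp).mp hU
  have hf : ContDiffAt ℝ 4 (inChart β p) (ch p p) :=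
    contDiffAt_inChart (n := 4) (by exact_mod_cast hβ) ((ch p).map_source hp)
  have hlt : ‖coeffB (inChart β p) (ch p p)‖ < ‖coeffA (inChart β p) (ch p p)‖ := by
    have hsurj : Function.Surjective (frame (inChart β p) 1 (ch p p)) :=
      (LinearMap.injective_iff_surjective_of_finrank_eq_finrank (by simp)).mp
        (frame_injective h0 one_ne_zero)
    obtain ⟨η, hη⟩ := hsurj (slopeVec ξ); obtain ⟨δ, hδ⟩ := hsurj (slopeChart ξ).2.1
    have hAB : ∀ z, fderiv ℝ (theta (inChart β p) 1) (ch p p)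
        (frame (inChart β p) 1 (ch p p) z) =
        coeffA (inChart β p) (ch p p) * z + coeffB (inChart β p) (ch p p) * conj z :=
      eq_mul_add_mul_conj (thetaDeriv (inChart β p) (ch p p))
    obtain ⟨t1, -, t3⟩ := types_of_frame hf h0 hθ (κ := 1 / 2) (fun z η => by
      rw [slopeForm_frame (hf.of_le (by norm_num)) h0 hθ, hAB]) ξ hη hδ rfl rfl rfl
    obtain ⟨⟨k0, m0⟩, -⟩ := ((t3 (hT ξ) hξ.1).2.2).mp hξ; have s0 := t1.mp hξ.1
    refine norm_lt_of_saddleNode (η := η) (δ := δ) (by linarith) ?_ (by linarith); intro h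
    exact m0 (by rw [h]; ring)
  refine ⟨hlt, fun hb => ?_⟩; obtain ⟨T, κ, hn, -⟩ := exists_normalForm ho hβ hi hp hθ hlt
  obtain ⟨-, hcov, hty⟩ := hn.types hf h0 hθ; obtain ⟨s, t, ht, hs⟩ := hcov ξ hξ.1
  obtain ⟨w1, w2⟩ := hty ξ s t ht hs; have c0 := w1.mp hξ.1; obtain ⟨-, hne⟩ := (w2 c0).2.2.mp hξ
  rw [hb] at c0 hne; have hre : (-1 / 3 : ℂ).re = -1 / 3 := by simp
  have him : (-1 / 3 : ℂ).im = 0 := by simp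
  rw [slopeCubic, hre, him] at c0; rw [hre, him] at hne
  have : s ^ 3 = 0 := by linear_combination -3 / 4 * c0
  rw [pow_eq_zero_iff (by decide)] at this; rw [this] at hne; norm_num at hne

section Implicit

variable {X E F : Type*} [NormedAddCommGroup X] [NormedSpace ℝ X] [NormedAddCommGroup E]
  [NormedSpace ℝ E] [NormedAddCommGroup F] [NormedSpace ℝ F] {g : X × E → F} {y : X → E} {x1 : X}

lemma hasFDerivAt_of_implicit {G : X × E →L[ℝ] F} {L : E ≃L[ℝ] F} {K : ℝ}
    (hK : ∀ᶠ x in 𝓝 x1, ‖y x - y x1‖ ≤ K * ‖x - x1‖) (hg : HasFDerivAt g G (x1, y x1))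
    (h0 : g (x1, y x1) = 0) (h : ∀ᶠ x in 𝓝 x1, g (x, y x) = 0)
    (hL : ∀ v, G (0, v) = L v) :
    HasFDerivAt y (-((L.symm : F →L[ℝ] E) ∘L G ∘L .inl ℝ X E)) x1 := by
  have hO : (fun x => (x, y x) - (x1, y x1)) =O[𝓝 x1] fun x => x - x1 := by
    refine Asymptotics.IsBigO.of_bound (max 1 K) ?_; filter_upwards [hK] with x hx
    rw [Prod.mk_sub_mk, Prod.norm_def]
    refine max_le (le_mul_of_one_le_left (norm_nonneg _) (le_max_left _ _)) (hx.trans ?_)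
    exact mul_le_mul_of_nonneg_right (le_max_right _ _) (norm_nonneg _)
  have hcont : Tendsto (fun x => (x, y x)) (𝓝 x1) (𝓝 (x1, y x1)) := by
    have hz : Tendsto (fun x => (x, y x) - (x1, y x1)) (𝓝 x1) (𝓝 0) :=
      hO.trans_tendsto (by
        simpa using (tendsto_id (α := X) (x := 𝓝 x1)).sub_const x1)
    simpa using hz.add_const (x1, y x1)
  have h1 := ((hasFDerivAt_iff_isLittleO.mp hg).comp_tendsto hcont).trans_isBigO hO
  have h2 := ((L.symm : F →L[ℝ] E).isBigO_comp _ (𝓝 x1)).trans_isLittleO h1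
  refine hasFDerivAt_iff_isLittleO.mpr (h2.neg_left.congr' ?_ EventuallyEq.rfl)
  filter_upwards [h] with x hx
  have e : G ((x, y x) - (x1, y x1)) = L (y x - y x1) + G (x - x1, 0) := by
    rw [← hL, ← map_add]; simp
  rw [Function.comp_apply, hx, h0, e]
  simp only [ContinuousLinearEquiv.coe_coe, sub_zero, zero_sub, map_neg, map_add,
    ContinuousLinearEquiv.symm_apply_apply, neg_apply,
    ContinuousLinearMap.comp_apply, ContinuousLinearMap.inl_apply]
  abel

/-- The implicit function theorem, with parameters in a space which may be not complete. -/
lemma exists_implicit [CompleteSpace E] {x0 : X} {y0 : E} {n : ℕ} (hn : 1 ≤ n)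
    (hg : ContDiffAt ℝ n g (x0, y0)) (h0 : g (x0, y0) = 0) (L : E ≃L[ℝ] F)
    (hL : ∀ v, fderiv ℝ g (x0, y0) (0, v) = L v) :
    ∃ (y : X → E) (W : Set E), y x0 = y0 ∧ ContDiffAt ℝ n y x0 ∧ IsOpen W ∧ y0 ∈ W ∧
      ∀ᶠ x in 𝓝 x0, g (x, y x) = 0 ∧ ∀ v ∈ W, g (x, v) = 0 → v = y x := by
  have hn0 : (n : WithTop ℕ∞) ≠ 0 := by exact_mod_cast (by lia : n ≠ 0)
  set G := fderiv ℝ g (x0, y0) with hG; set N := ‖(L.symm : F →L[ℝ] E)‖ with hN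
  obtain ⟨c, hc0, hc⟩ : ∃ c : NNReal, 0 < c ∧ N * c ≤ 1 / 2 := by
    have hp : 0 < 1 / (2 * (N + 1)) := by positivity
    refine ⟨(1 / (2 * (N + 1))).toNNReal, Real.toNNReal_pos.mpr hp, ?_⟩
    rw [Real.coe_toNNReal _ hp.le]
    rw [mul_one_div, div_le_div_iff₀ (by positivity) (by positivity)]; linarith
  obtain ⟨S, hS, hap⟩ := (hg.hasStrictFDerivAt hn0).approximates_deriv_on_nhds (Or.inr hc0)
  obtain ⟨δ, hδ, hball⟩ := Metric.mem_nhds_iff.mp hS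
  have hmem : ∀ x ∈ Metric.ball x0 δ, ∀ v ∈ Metric.ball y0 δ, (x, v) ∈ S := fun x hx v hv =>
    hball (by rw [← ball_prod_same]; exact ⟨hx, hv⟩)
  have hest : ∀ x ∈ Metric.ball x0 δ, ∀ x' ∈ Metric.ball x0 δ, ∀ v ∈ Metric.ball y0 δ,
      ∀ v' ∈ Metric.ball y0 δ, g (x, v) = 0 → g (x', v') = 0 →
      ‖v - v'‖ ≤ (2 * N * ‖G‖ + 1) * ‖x - x'‖ := by
    intro x hx x' hx' v hv v' hv' h h'; have h1 := hap _ (hmem x hx v hv) _ (hmem x' hx' v' hv')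
    rw [h, h', sub_zero, zero_sub, norm_neg, Prod.mk_sub_mk] at h1
    have e : G (x - x', v - v') = L (v - v') + G (x - x', 0) := by rw [← hL, ← map_add]; simp
    have e2 : v - v' = L.symm (G (x - x', v - v') - G (x - x', 0)) := by
      rw [e, add_sub_cancel_right, L.symm_apply_apply]
    have h2 : ‖v - v'‖ ≤ N * ‖G (x - x', v - v') - G (x - x', 0)‖ := by
      conv_lhs => rw [e2]
      exact (L.symm : F →L[ℝ] E).le_opNorm _
    have h3 : ‖G (x - x', 0)‖ ≤ ‖G‖ * ‖x - x'‖ := by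
      simpa [Prod.norm_def] using G.le_opNorm (x - x', 0)
    have h4 : ‖(x - x', v - v')‖ ≤ ‖x - x'‖ + ‖v - v'‖ :=
      max_le (by simp) (by simp)
    have h5 := norm_sub_le (G (x - x', v - v')) (G (x - x', 0)); have hN0 : 0 ≤ N := norm_nonneg _
    have h6 : (c : ℝ) * ‖(x - x', v - v')‖ ≤ c * (‖x - x'‖ + ‖v - v'‖) :=
      mul_le_mul_of_nonneg_left h4 c.2
    have h7 := mul_le_mul_of_nonneg_left (h5.trans (add_le_add (h1.trans h6) h3)) hN0
    have h8 := mul_le_mul_of_nonneg_right hc (by positivity : 0 ≤ ‖x - x'‖ + ‖v - v'‖); nlinarith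
  have hsol : ∀ᶠ x in 𝓝 x0, ∃ v ∈ Metric.ball y0 δ, g (x, v) = 0 := by
    have hcx : ContinuousAt (fun x => g (x, y0)) x0 :=
      hg.continuousAt.comp (f := fun x => (x, y0)) (by fun_prop)
    rcases subsingleton_or_nontrivial E with hE | hE
    · have : Subsingleton F := L.symm.toEquiv.subsingleton
      exact Eventually.of_forall fun x => ⟨y0, Metric.mem_ball_self hδ, Subsingleton.elim _ _⟩
    have hNp : 0 < N := L.norm_symm_pos
    have hr : 0 < (N⁻¹ - c) * (δ / 2) := by
      have : (c : ℝ) < N⁻¹ := by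
        rw [lt_inv_comm₀ (by exact_mod_cast hc0) hNp, lt_inv_comm₀ hNp (by exact_mod_cast hc0)]
        rw [← one_div, lt_div_iff₀ hNp]; linarith
      exact mul_pos (by linarith) (by linarith)
    have hx0 := hcx.eventually (Metric.ball_mem_nhds _ hr)
    filter_upwards [hx0, Metric.ball_mem_nhds x0 hδ] with x hx hxδ
    have happ : ApproximatesLinearOn (fun v => g (x, v)) (L : E →L[ℝ] F)
        (Metric.closedBall y0 (δ / 2)) c := by
      intro v hv v' hv'
      have hsub := Metric.closedBall_subset_ball (x := y0) (by linarith : δ / 2 < δ)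
      have := hap _ (hmem x hxδ v (hsub hv)) _ (hmem x hxδ v' (hsub hv'))
      rw [Prod.mk_sub_mk, sub_self, ← hG, hL] at this; simpa [Prod.norm_def] using this
    obtain ⟨v, hv, hv0⟩ := happ.surjOn_closedBall_of_nonlinearRightInverse
      L.toNonlinearRightInverse (by linarith) subset_rfl (show (0 : F) ∈ Metric.closedBall (g (x, y0)) _ by
        rw [Metric.mem_closedBall, dist_comm]; rw [h0] at hx; exact (Metric.mem_ball.mp hx).le)
    exact ⟨v, Metric.closedBall_subset_ball (by linarith) hv, hv0⟩
  choose! y hyW hy using fun x (h : ∃ v ∈ Metric.ball y0 δ, g (x, v) = 0) => h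
  have hW : ∀ᶠ x in 𝓝 x0, x ∈ Metric.ball x0 δ ∧ y x ∈ Metric.ball y0 δ ∧ g (x, y x) = 0 := by
    filter_upwards [hsol, Metric.ball_mem_nhds x0 hδ] with x hx hx'; exact ⟨hx', hyW x hx, hy x hx⟩
  have huniq : ∀ᶠ x in 𝓝 x0, g (x, y x) = 0 ∧ ∀ v ∈ Metric.ball y0 δ, g (x, v) = 0 → v = y x := by
    filter_upwards [hW] with x ⟨hx, hxW, hx0⟩; refine ⟨hx0, fun v hv hv0 => ?_⟩
    have := hest x hx x hx v hv (y x) hxW hv0 hx0; rw [sub_self, norm_zero, mul_zero] at this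
    exact sub_eq_zero.mp (norm_le_zero_iff.mp this)
  have hy0 : y x0 = y0 := (huniq.self_of_nhds.2 y0 (Metric.mem_ball_self hδ) h0).symm
  have hlip : ∀ᶠ x in 𝓝 x0, ∀ᶠ x' in 𝓝 x, ‖y x' - y x‖ ≤ (2 * N * ‖G‖ + 1) * ‖x' - x‖ := by
    filter_upwards [hW.eventually_nhds] with x hx; filter_upwards [hx] with x' hx'
    exact hest _ hx'.1 _ hx.self_of_nhds.1 _ hx'.2.1 _ hx.self_of_nhds.2.1 hx'.2.2
      hx.self_of_nhds.2.2
  have hcont : ∀ᶠ x in 𝓝 x0, ContinuousAt y x := by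
    filter_upwards [hlip] with x hx
    have hz : Tendsto (fun x' => y x' - y x) (𝓝 x) (𝓝 0) := by
      refine squeeze_zero_norm' hx ?_
      have : Continuous fun x' => (2 * N * ‖G‖ + 1) * ‖x' - x‖ := by fun_prop
      simpa using this.tendsto x
    have := hz.add_const (y x); simpa [ContinuousAt] using this
  refine ⟨y, Metric.ball y0 δ, hy0, ?_, Metric.isOpen_ball, Metric.mem_ball_self hδ, huniq⟩
  have hpair : ContinuousAt (fun x => (x, y x)) x0 :=
    continuousAt_id.prodMk hcont.self_of_nhds
  have hdiff : ∀ᶠ x in 𝓝 x0, HasFDerivAt g (fderiv ℝ g (x, y x)) (x, y x) := by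
    have h1 := hg.eventually (by simp); rw [← hy0] at h1
    filter_upwards [hpair.eventually h1] with x hx; exact (hx.differentiableAt hn0).hasFDerivAt
  have hDg : ContDiffAt ℝ ((n - 1 : ℕ) : WithTop ℕ∞) (fderiv ℝ g) (x0, y x0) := by
    rw [hy0]; exact hg.fderiv_right (by exact_mod_cast (by lia : n - 1 + 1 ≤ n))
  have hinv : (fderiv ℝ g (x0, y x0)).comp (.inr ℝ X E) = (L : E →L[ℝ] F) := by
    rw [hy0]; ext v; simpa using hL v
  have hrange : ∀ᶠ x in 𝓝 x0, (fderiv ℝ g (x, y x)).comp (.inr ℝ X E) ∈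
      range ((↑) : (E ≃L[ℝ] F) → E →L[ℝ] F) := by
    have hc : ContinuousAt (fun x => (fderiv ℝ g (x, y x)).comp (.inr ℝ X E)) x0 :=
      (hDg.continuousAt.comp (f := fun x => (x, y x)) hpair).clm_comp continuousAt_const
    refine hc.eventually (?_ : range _ ∈ 𝓝 ((fderiv ℝ g (x0, y x0)).comp (.inr ℝ X E))); rw [hinv]
    exact ContinuousLinearEquiv.nhds L
  have hder : ∀ᶠ x in 𝓝 x0, HasFDerivAt y
      (-(((fderiv ℝ g (x, y x)).comp (.inr ℝ X E)).inverse ∘L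
        (fderiv ℝ g (x, y x)) ∘L .inl ℝ X E)) x := by
    filter_upwards [hdiff, hrange, hlip, hW.eventually_nhds] with x h1 ⟨L', hL'⟩ h3 h4
    rw [← hL', ContinuousLinearMap.inverse_equiv]
    refine hasFDerivAt_of_implicit h3 h1 h4.self_of_nhds.2.2 (h4.mono fun _ h => h.2.2) fun v => ?_
    have := congrArg (fun T => T v) hL'; simpa using this.symm
  have main : ∀ k : ℕ, k ≤ n → ContDiffAt ℝ k y x0 := by
    intro k
    induction k with
    | zero =>
      intro _; refine contDiffAt_zero.mpr ⟨_, hcont, fun x hx => ContinuousAt.continuousWithinAt hx⟩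
    | succ k ih =>
      intro hk; have hyk := ih (by lia)
      refine contDiffAt_succ_iff_hasFDerivAt.mpr ⟨_, ⟨_, hder, fun x hx => hx⟩, ?_⟩
      have hD : ContDiffAt ℝ k (fun x => fderiv ℝ g (x, y x)) x0 :=
        (hDg.of_le (by exact_mod_cast (by lia : k ≤ n - 1))).comp x0 (contDiffAt_id.prodMk hyk)
      have hI : ContDiffAt ℝ k
          (fun x => ((fderiv ℝ g (x, y x)).comp (.inr ℝ X E)).inverse) x0 := by
        refine ContDiffAt.comp (g := ContinuousLinearMap.inverse) x0 (?_ : ContDiffAt ℝ k _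
          ((fderiv ℝ g (x0, y x0)).comp (.inr ℝ X E))) (hD.clm_comp contDiffAt_const)
        rw [hinv]; exact contDiffAt_map_inverse L
      exact (hI.clm_comp (hD.clm_comp contDiffAt_const)).neg
  exact main n le_rfl

end Implicit

section Family

variable {X : Type*} [NormedAddCommGroup X] [NormedSpace ℝ X] {E G : Type} [NormedAddCommGroup E]
  [NormedSpace ℝ E] [NormedAddCommGroup G] [NormedSpace ℝ G] {V : Set E} {C : ℝ} {n : ℕ}

/-- A linear family of functions of class `C^n` on `V`, with uniformly bounded derivatives. -/
def IsBoundedFamily (V : Set E) (C : ℝ) (n : ℕ) (L : E → X →L[ℝ] G) : Prop :=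
  ∀ β, ContDiffOn ℝ n (fun y => L y β) V ∧
    ∀ j ≤ n, ∀ y ∈ V, ‖iteratedFDeriv ℝ j (fun y => L y β) y‖ ≤ C * ‖β‖

lemma IsBoundedFamily.exists_deriv {L : E → X →L[ℝ] G} (hV : IsOpen V)
    (h : IsBoundedFamily V C (n + 1) L) : ∃ L' : E → X →L[ℝ] E →L[ℝ] G,
      IsBoundedFamily V C n L' ∧ ∀ y ∈ V, ∀ β, HasFDerivAt (fun y => L y β) (L' y β) y := by
  classical
  have hd : ∀ y ∈ V, ∀ β, DifferentiableAt ℝ (fun y => L y β) y := fun y hy β =>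
    ((h β).1.contDiffAt (hV.mem_nhds hy)).differentiableAt (by simp)
  let L' : E → X →L[ℝ] E →L[ℝ] G := fun y => if hy : y ∈ V then
    LinearMap.mkContinuous
      { toFun := fun β => fderiv ℝ (fun y => L y β) y
        map_add' := fun β γ => by simp only [map_add]; exact fderiv_fun_add (hd y hy β) (hd y hy γ)
        map_smul' := fun t β => by
          simp only [map_smul]; exact fderiv_fun_const_smul (hd y hy β) t } C
      (fun β => by
        have := (h β).2 1 (by lia) y hy
        rwa [← norm_iteratedFDeriv_fderiv, norm_iteratedFDeriv_zero] at this) else 0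
  have hL' : ∀ y ∈ V, ∀ β, L' y β = fderiv ℝ (fun y => L y β) y := fun y hy β => by
    simp only [L', dif_pos hy]; rfl
  have hev : ∀ y ∈ V, ∀ β, (fun y => L' y β) =ᶠ[𝓝 y] fderiv ℝ (fun y => L y β) := fun y hy β => by
    filter_upwards [hV.mem_nhds hy] with z hz using hL' z hz β
  refine ⟨L', fun β => ⟨?_, fun j hj y hy => ?_⟩, fun y hy β => ?_⟩
  · exact ((h β).1.fderiv_of_isOpen hV (by norm_cast)).congr fun y hy => hL' y hy β
  · rw [((hev y hy β).iteratedFDeriv ℝ j).self_of_nhds, norm_iteratedFDeriv_fderiv]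
    exact (h β).2 (j + 1) (by lia) y hy
  · rw [hL' y hy]; exact (hd y hy β).hasFDerivAt

lemma IsBoundedFamily.contDiffOn_clm (hV : IsOpen V) (hc : Convex ℝ V) : ∀ {G : Type}
    [NormedAddCommGroup G] [NormedSpace ℝ G] {L : E → X →L[ℝ] G},
    IsBoundedFamily V C (n + 1) L → ContDiffOn ℝ n L V := by
  induction n with
  | zero =>
    intro G _ _ L h; obtain ⟨L', hL', hd⟩ := h.exists_deriv hV
    refine contDiffOn_zero.mpr (LipschitzOnWith.continuousOn (K := C.toNNReal)
      (LipschitzOnWith.of_dist_le_mul fun y hy z hz => ?_))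
    rw [dist_eq_norm, dist_eq_norm]
    refine ContinuousLinearMap.opNorm_le_bound _ (by positivity) fun β => ?_
    have := hc.norm_image_sub_le_of_norm_hasFDerivWithin_le (f := fun y => L y β)
      (C := C.toNNReal * ‖β‖) (fun w hw => (hd w hw β).hasFDerivWithinAt) (fun w hw => by
        have := (hL' β).2 0 le_rfl w hw; rw [norm_iteratedFDeriv_zero] at this
        exact this.trans (mul_le_mul_of_nonneg_right (Real.le_coe_toNNReal C) (norm_nonneg _)))
      hz hy
    rw [mul_right_comm]; exact this
  | succ n ih =>
    intro G _ _ L h; obtain ⟨L', hL', hd⟩ := h.exists_deriv hV; have h' := ih hL'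
    obtain ⟨L'', hL'', hd'⟩ := hL'.exists_deriv hV
    have hder : ∀ y ∈ V, HasFDerivAt L (L' y).flip y := by
      intro y hy; have hcy : ContinuousAt L' y := h'.continuousOn.continuousAt (hV.mem_nhds hy)
      refine hasFDerivAt_iff_isLittleO.mpr (Asymptotics.isLittleO_iff.mpr fun ε hε => ?_)
      obtain ⟨δ, hδ, hball⟩ := Metric.mem_nhds_iff.mp
        (inter_mem (hV.mem_nhds hy) (hcy.eventually (Metric.ball_mem_nhds (L' y) hε)))
      filter_upwards [Metric.ball_mem_nhds y hδ] with z hz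
      refine ContinuousLinearMap.opNorm_le_bound _ (by positivity) fun β => ?_
      have := (convex_ball y δ).norm_image_sub_le_of_norm_hasFDerivWithin_le'
        (f := fun y => L y β) (C := ε * ‖β‖) (φ := L' y β)
        (fun w hw => (hd w (hball hw).1 β).hasFDerivWithinAt) (fun w hw => by
          rw [← sub_apply]
          refine ((L' w - L' y).le_opNorm β).trans (mul_le_mul_of_nonneg_right ?_ (norm_nonneg _))
          rw [← dist_eq_norm]; exact (hball hw).2.le) (Metric.mem_ball_self hδ) hz
      rw [mul_right_comm]; exact this
    push_cast
    refine (contDiffOn_succ_iff_fderiv_of_isOpen hV).mpr ⟨fun y hy => (hder y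
      hy).differentiableAt.differentiableWithinAt, fun h => absurd h (WithTop.natCast_ne_top n), ?_⟩
    have hfl : ContDiff ℝ n fun A : X →L[ℝ] E →L[ℝ] G => A.flip :=
      LinearIsometryEquiv.contDiff (𝕜 := ℝ) (E := X →L[ℝ] E →L[ℝ] G) (F := E →L[ℝ] X →L[ℝ] G)
        (ContinuousLinearMap.flipₗᵢ ℝ X E G)
    refine (hfl.comp_contDiffOn h').congr fun y hy => (hder y hy).fderiv

lemma IsBoundedFamily.contDiffOn (hV : IsOpen V) (hc : Convex ℝ V) : ∀ {G : Type}
    [NormedAddCommGroup G] [NormedSpace ℝ G] {L : E → X →L[ℝ] G},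
    IsBoundedFamily V C n L → ContDiffOn ℝ n (fun q : X × E => L q.2 q.1) (univ ×ˢ V) := by
  have hVU : IsOpen ((univ : Set X) ×ˢ V) := isOpen_univ.prod hV
  induction n with
  | zero =>
    intro G _ _ L h; refine contDiffOn_zero.mpr fun q hq => ContinuousAt.continuousWithinAt ?_
    have h1 : ContinuousAt (fun z : X × E => L z.2 q.1) q :=
      ContinuousAt.comp (g := fun y => L y q.1) (f := Prod.snd)
        ((h q.1).1.continuousOn.continuousAt (hV.mem_nhds hq.2)) continuousAt_snd
    have h2 : Tendsto (fun z : X × E => L z.2 (z.1 - q.1)) (𝓝 q) (𝓝 0) := by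
      refine squeeze_zero_norm' (a := fun z => C * ‖z.1 - q.1‖) ?_ ?_
      · filter_upwards [hVU.mem_nhds hq] with z hz; have := (h (z.1 - q.1)).2 0 le_rfl z.2 hz.2
        rwa [norm_iteratedFDeriv_zero] at this
      · have : Continuous fun z : X × E => C * ‖z.1 - q.1‖ := by fun_prop
        simpa using this.tendsto q
    have h3 := h2.add h1; rw [zero_add] at h3; refine h3.congr fun z => ?_; simp
  | succ n ih =>
    intro G _ _ L h; have hL := h.contDiffOn_clm hV hc; obtain ⟨L', hL', hd⟩ := h.exists_deriv hV
    have h' := ih hL'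
    have hL1 : ContDiffOn ℝ n (fun q : X × E => L q.2) (univ ×ˢ V) :=
      hL.comp contDiff_snd.contDiffOn fun q hq => hq.2
    have hder : ∀ q ∈ (univ : Set X) ×ˢ V, HasFDerivAt (fun q : X × E => L q.2 q.1)
        ((L q.2).comp (.fst ℝ X E) + (L' q.2 q.1).comp (.snd ℝ X E)) q := by
      intro q hq
      have := hasStrictFDerivAt_uncurry_coprod (u := q) (f := fun β y => L y β)
        (f₁ := fun β y => L y) (f₂ := fun β y => L' y β)
        (Eventually.of_forall fun v => (L v.2).hasFDerivAt)
        (eventually_of_mem (hVU.mem_nhds hq) fun v hv => hd v.2 hv.2 v.1) ?_ ?_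
      · exact this.hasFDerivAt
      · exact hL1.continuousOn.continuousAt (hVU.mem_nhds hq)
      · exact h'.continuousOn.continuousAt (hVU.mem_nhds hq)
    push_cast
    refine (contDiffOn_succ_iff_fderiv_of_isOpen hVU).mpr ⟨fun q hq => (hder q
      hq).differentiableAt.differentiableWithinAt, fun h => absurd h (WithTop.natCast_ne_top n), ?_⟩
    refine ((hL1.clm_comp contDiffOn_const).add (h'.clm_comp contDiffOn_const)).congr
      fun q hq => (hder q hq).fderiv

end Family

section Evaluation

variable {D : ChartCover M} {r : ℕ}

lemma norm_iteratedFDeriv_piece_le (β : CrMap D r) (c : D.centers) {x : M} (hx : x ∈ D.piece c)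
    {j : ℕ} (hj : j ≤ r) :
    ‖iteratedFDeriv ℝ j (inChart β c) (ch (c : M) x)‖ ≤ ‖β‖ := by
  have h1 := norm_le_pi_norm (CrMap.jet D r β) c
  have h2 := norm_le_pi_norm (CrMap.jet D r β c) ⟨j, Nat.lt_succ_of_le hj⟩
  exact ((ContinuousMap.norm_coe_le_norm (CrMap.jet D r β c ⟨j, Nat.lt_succ_of_le hj⟩)
    ⟨x, hx⟩).trans h2).trans h1

lemma contDiffOn_chart_comp (p c : M) (r : ℕ) :
    ContDiffOn ℝ r (fun z => ch c ((ch p).symm z))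
      ((ch p).target ∩ (ch p).symm ⁻¹' (ch c).source) := by
  have h := (contMDiffOn_chart (I := 𝓡 2) (n := ∞) (x := c)).comp
    (contMDiffOn_chart_symm (I := 𝓡 2) (n := ∞) (x := p) |>.mono inter_subset_left)
    (fun z hz => hz.2 : ((ch p).target ∩ (ch p).symm ⁻¹' (ch c).source) ⊆ _)
  exact (contMDiffOn_iff_contDiffOn.mp h).of_le (by exact_mod_cast le_top)

lemma exists_bound_chart (p c : M) (hc : p ∈ (ch c).source) (r : ℕ) :
    ∃ C, 1 ≤ C ∧ ∀ᶠ y in 𝓝 (ch p p), ∀ j ≤ r,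
      ‖iteratedFDeriv ℝ j (fun z => ch c ((ch p).symm z)) y‖ ≤ C := by
  have hs := (contDiffOn_chart_comp p c r).contDiffAt (x := ch p p)
    ((ch p).symm.isOpen_inter_preimage (ch c).open_source |>.mem_nhds
      ⟨mem_chart_target E2 p, by simpa using hc⟩)
  have hb : ∀ j : Fin (r + 1), ∀ᶠ y in 𝓝 (ch p p),
      ‖iteratedFDeriv ℝ j (fun z => ch c ((ch p).symm z)) y‖ ≤
      ‖iteratedFDeriv ℝ j (fun z => ch c ((ch p).symm z)) (ch p p)‖ + 1 :=
    fun j => by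
      have := (hs.continuousAt_iteratedFDeriv (k := j)
        (by exact_mod_cast Nat.lt_succ_iff.mp j.2)).norm.eventually
        (gt_mem_nhds (lt_add_one _))
      exact this.mono fun _ => le_of_lt
  refine ⟨∑ j : Fin (r + 1), (‖iteratedFDeriv ℝ j
    (fun z => ch c ((ch p).symm z)) (ch p p)‖ + 1), ?_, ?_⟩
  · refine (le_add_of_nonneg_left (norm_nonneg _)).trans
      (Finset.single_le_sum (f := fun j : Fin (r + 1) => ‖iteratedFDeriv ℝ j (fun z => ch c ((ch
        p).symm z)) (ch p p)‖ + 1) (fun j _ => by positivity) (Finset.mem_univ 0))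
  · filter_upwards [eventually_all.mpr hb] with y hy j hj
    refine (hy ⟨j, Nat.lt_succ_of_le hj⟩).trans ?_
    exact Finset.single_le_sum (f := fun j : Fin (r + 1) => ‖iteratedFDeriv ℝ j (fun z => ch c ((ch
      p).symm z)) (ch p p)‖ + 1) (fun j _ => by positivity) (Finset.mem_univ _)

lemma exists_bound_inChart [T2Space M] (D : ChartCover M) (r : ℕ) (p : M) :
    ∃ C, ∀ᶠ y in 𝓝 (ch p p), ∀ β : CrMap D r, ∀ j ≤ r,
      ‖iteratedFDeriv ℝ j (inChart β p) y‖ ≤ C * ‖β‖ := by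
  have hsymm : Tendsto (ch p).symm (𝓝 (ch p p)) (𝓝 p) := by
    have := (ch p).continuousAt_symm (mem_chart_target E2 p)
    rwa [ContinuousAt, (ch p).left_inv (mem_chart_source E2 p)] at this
  have key : ∀ c : D.centers, ∃ C, 0 ≤ C ∧ ∀ᶠ y in 𝓝 (ch p p),
      (ch p).symm y ∈ D.piece c → ∀ β : CrMap D r, ∀ j ≤ r,
      ‖iteratedFDeriv ℝ j (inChart β p) y‖ ≤ C * ‖β‖ := by
    intro c
    by_cases hpc : p ∈ D.piece c
    · obtain ⟨K, hK1, hK⟩ := exists_bound_chart p c (D.piece_subset c hpc) r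
      refine ⟨r.factorial * K ^ r, by positivity, ?_⟩
      have hsrc := hsymm.eventually ((ch (c : M)).open_source.mem_nhds (D.piece_subset c hpc))
      have hO : IsOpen ((ch p).target ∩
          (ch p).symm ⁻¹' (ch (c : M)).source) :=
        (ch p).symm.isOpen_inter_preimage (ch (c : M)).open_source
      have htgt := (ch p).open_target.mem_nhds (mem_chart_target E2 p)
      filter_upwards [hK, hsrc.eventually_nhds, htgt] with y hKy hy hyt hyc β j hj
      have he : inChart β p =ᶠ[𝓝 y]
          inChart β c ∘ fun z => ch (c : M) ((ch p).symm z) := by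
        filter_upwards [hy] with z hz; simp only [Function.comp_apply, inChart]
        rw [(ch (c : M)).left_inv hz]
      have hyO : y ∈ (ch p).target ∩ (ch p).symm ⁻¹' (ch (c : M)).source :=
        ⟨hyt, hy.self_of_nhds⟩
      have htar := (ch (c : M)).map_source (D.piece_subset c hyc)
      rw [(he.iteratedFDeriv ℝ j).self_of_nhds, ← iteratedFDerivWithin_of_isOpen j hO hyO]
      have hb := norm_iteratedFDerivWithin_comp_le (C := ‖β‖) (D := K) (n := j)
        (β.contDiffOn_inChart c) (contDiffOn_chart_comp p (c : M) r) (by exact_mod_cast hj)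
        (ch (c : M)).open_target.uniqueDiffOn hO.uniqueDiffOn
        (fun z hz => (ch (c : M)).map_source hz.2) hyO (fun i hi => by
          rw [iteratedFDerivWithin_of_isOpen i (ch (c : M)).open_target htar]
          exact norm_iteratedFDeriv_piece_le β c hyc (hi.trans hj)) (fun i h1 hi => by
          rw [iteratedFDerivWithin_of_isOpen i hO hyO]
          exact (hKy i (hi.trans hj)).trans (le_self_pow₀ hK1 (by lia)))
      refine hb.trans ?_; rw [mul_right_comm]; refine mul_le_mul_of_nonneg_right ?_ (norm_nonneg _)
      have := Nat.factorial_le hj; gcongr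
    · refine ⟨0, le_rfl, ?_⟩
      filter_upwards [hsymm.eventually ((D.isCompact_piece c).isClosed.isOpen_compl.mem_nhds hpc)]
        with y hy hyc using absurd hyc hy
  choose C hC0 hC using key; refine ⟨∑ c, C c, ?_⟩
  filter_upwards [eventually_all.mpr hC] with y hy β j hj
  obtain ⟨c, hc⟩ := D.covers ((ch p).symm y)
  refine (hy c hc β j hj).trans (mul_le_mul_of_nonneg_right ?_ (norm_nonneg _))
  exact Finset.single_le_sum (fun c _ => hC0 c) (Finset.mem_univ c)

/-- The evaluation of a map of class `C^r` in a chart is of class `C^r` in both variables. -/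
lemma contDiffAt_eval [T2Space M] (β : CrMap D r) (p : M) :
    ContDiffAt ℝ r (fun q : CrMap D r × E2 => inChart q.1 p q.2) (β, ch p p) := by
  classical
  obtain ⟨C, hC⟩ := exists_bound_inChart D r p
  obtain ⟨ε, hε, hb⟩ := Metric.mem_nhds_iff.mp
    (inter_mem ((ch p).open_target.mem_nhds (mem_chart_target E2 p)) hC)
  let L : E2 → CrMap D r →L[ℝ] E3 := fun y => if hy : y ∈ Metric.ball (ch p p) ε then
    LinearMap.mkContinuous
      { toFun := fun β => inChart β p y
        map_add' := fun β γ => rfl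
        map_smul' := fun t β => rfl } C
      (fun β => by
        have := (hb hy).2 β 0 (Nat.zero_le r); rwa [norm_iteratedFDeriv_zero] at this) else 0
  have hL : ∀ y ∈ Metric.ball (ch p p) ε, ∀ β, L y β = inChart β p y := fun y hy β => by
    simp only [L, dif_pos hy]; rfl
  have hfam : IsBoundedFamily (Metric.ball (ch p p) ε) C r L := by
    refine fun β => ⟨((β.contDiffOn_inChart p).mono fun y hy => (hb hy).1).congr
      fun y hy => hL y hy β, fun j hj y hy => ?_⟩
    have he : (fun y => L y β) =ᶠ[𝓝 y] inChart β p := by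
      filter_upwards [Metric.isOpen_ball.mem_nhds hy] with z hz using hL z hz β
    rw [(he.iteratedFDeriv ℝ j).self_of_nhds]; exact (hb hy).2 β j hj
  have hmem : (univ : Set (CrMap D r)) ×ˢ Metric.ball (ch p p) ε ∈
      𝓝 (β, ch p p) :=
    (isOpen_univ.prod Metric.isOpen_ball).mem_nhds ⟨mem_univ _, Metric.mem_ball_self hε⟩
  refine ((hfam.contDiffOn Metric.isOpen_ball (convex_ball _ _)).contDiffAt hmem).congr_of_eventuallyEq ?_
  filter_upwards [hmem] with q hq using (hL _ hq.2 _).symm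

end Evaluation

section Parametric

variable {X : Type*} [NormedAddCommGroup X] [NormedSpace ℝ X] {F : X → E2 → E3} {q0 : X × E2}
  {n : WithTop ℕ∞}

lemma contDiffAt_fderiv_param {G : Type*} [NormedAddCommGroup G] [NormedSpace ℝ G]
    {F : X → E2 → G} (h : ContDiffAt ℝ (n + 1) (fun q : X × E2 => F q.1 q.2) q0) :
    ContDiffAt ℝ n (fun q : X × E2 => fderiv ℝ (F q.1) q.2) q0 := by
  refine ContDiffAt.fderiv (f := fun q : X × E2 => F q.1) (g := Prod.snd) (n := n + 1) ?_
    contDiffAt_snd le_rfl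
  exact ContDiffAt.comp (g := fun q : X × E2 => F q.1 q.2)
    (f := fun z : (X × E2) × E2 => (z.1.1, z.2)) (q0, q0.2) h (by fun_prop)

lemma contDiffAt_jetTwo_param
    (h : ContDiffAt ℝ (n + 1 + 1) (fun q : X × E2 => F q.1 q.2) q0) :
    ContDiffAt ℝ n (fun q : X × E2 => jetTwo (F q.1) q.2) q0 := by
  have h1 (w : E2) := (contDiffAt_fderiv_param h).clm_apply (contDiffAt_const (c := w))
  have h2 (v w : E2) := (contDiffAt_fderiv_param (F := fun x y => fderiv ℝ (F x) y w)
    (h1 w)).clm_apply (contDiffAt_const (c := v))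
  exact ((h1 e₁).of_le le_self_add).prodMk (((h1 e₂).of_le le_self_add).prodMk
    ((h2 e₁ e₁).prodMk ((h2 e₂ e₁).prodMk (h2 e₂ e₂))))

lemma contDiffAt_theta_param
    (h : ContDiffAt ℝ (n + 1 + 1) (fun q : X × E2 => F q.1 q.2) q0)
    (h0 : rawNormal (F q0.1) q0.2 ≠ 0) :
    ContDiffAt ℝ n (fun q : X × E2 => theta (F q.1) 1 q.2) q0 := by
  simp only [theta_eq_thetaOf]
  exact (contDiffAt_thetaOf (J := jetTwo (F q0.1) q0.2) h0).comp q0 (contDiffAt_jetTwo_param h)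

lemma contDiffAt_thetaDeriv_param
    (h : ContDiffAt ℝ (n + 1 + 1 + 1) (fun q : X × E2 => F q.1 q.2) q0)
    (h0 : rawNormal (F q0.1) q0.2 ≠ 0) (z : ℂ) :
    ContDiffAt ℝ n (fun q : X × E2 => thetaDeriv (F q.1) q.2 z) q0 := by
  have hj := contDiffAt_jetTwo_param (h.of_le le_self_add)
  have hc : ContDiffAt ℝ n (fun q : X × E2 => rawNormal (F q.1) q.2) q0 :=
    contDiffAt_cross hj.fst hj.snd.fst
  have hE : ContDiffAt ℝ n (fun q : X × E2 => coeffE (F q.1) q.2) q0 := hj.fst.inner ℝ hj.fst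
  have hF : ContDiffAt ℝ n (fun q : X × E2 => coeffF (F q.1) q.2) q0 := hj.fst.inner ℝ hj.snd.fst
  have hD := hc.norm ℝ h0
  refine (contDiffAt_fderiv_param (F := fun x y => theta (F x) 1 y)
    (contDiffAt_theta_param h h0)).clm_apply ?_
  change ContDiffAt ℝ n (fun q : X × E2 => (z.re * ‖rawNormal (F q.1) q.2‖) • e₁ +
    (1 * z.im) • (coeffE (F q.1) q.2 • e₂ - coeffF (F q.1) q.2 • e₁)) q0
  fun_prop

lemma contDiffAt_coeffAB_param
    (h : ContDiffAt ℝ (n + 1 + 1 + 1) (fun q : X × E2 => F q.1 q.2) q0)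
    (h0 : rawNormal (F q0.1) q0.2 ≠ 0) :
    ContDiffAt ℝ n (fun q : X × E2 => coeffA (F q.1) q.2) q0 ∧
    ContDiffAt ℝ n (fun q : X × E2 => coeffB (F q.1) q.2) q0 := by
  have h1 := contDiffAt_thetaDeriv_param h h0 1; have h2 := contDiffAt_thetaDeriv_param h h0 I
  exact ⟨(h1.sub (contDiffAt_const.mul h2)).mul contDiffAt_const,
    (h1.add (contDiffAt_const.mul h2)).mul contDiffAt_const⟩

lemma contDiffAt_modulus_param
    (h : ContDiffAt ℝ (n + 1 + 1 + 1) (fun q : X × E2 => F q.1 q.2) q0)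
    (h0 : rawNormal (F q0.1) q0.2 ≠ 0) (hA : coeffA (F q0.1) q0.2 ≠ 0) :
    ContDiffAt ℝ n (fun q : X × E2 => modulus (F q.1) q.2) q0 := by
  obtain ⟨h1, h2⟩ := contDiffAt_coeffAB_param h h0
  exact (h2.mul (conjCLE.contDiff.contDiffAt.comp q0 h1)).mul ((h1.pow 2).inv (pow_ne_zero 2 hA))

end Parametric

section Perturbation

variable {f g : E2 → E3} {y : E2}

lemma jetTwo_congr (h : f =ᶠ[𝓝 y] g) : jetTwo f =ᶠ[𝓝 y] jetTwo g := by
  have h1 (w : E2) {f g : E2 → E3} (h : f =ᶠ[𝓝 y] g) :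
      (fun z => fderiv ℝ f z w) =ᶠ[𝓝 y] fun z => fderiv ℝ g z w :=
    (h.fderiv).mono fun z hz => congrArg (fun L : E2 →L[ℝ] E3 => L w) hz
  filter_upwards [h1 e₁ h, h1 e₂ h, h1 e₁ (h1 e₁ h), h1 e₂ (h1 e₁ h), h1 e₂ (h1 e₂ h)]
    with z a b c d e
  exact Prod.ext a (Prod.ext b (Prod.ext c (Prod.ext d e)))

lemma jetTwo_add (hf : ContDiffAt ℝ 2 f y) (hg : ContDiffAt ℝ 2 g y) :
    jetTwo (fun z => f z + g z) =ᶠ[𝓝 y] fun z => jetTwo f z + jetTwo g z := by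
  have h1 (w : E2) {f g : E2 → E3} (hf : ContDiffAt ℝ 1 f y) (hg : ContDiffAt ℝ 1 g y) :
      (fun z => fderiv ℝ (fun z => f z + g z) z w) =ᶠ[𝓝 y]
        fun z => fderiv ℝ f z w + fderiv ℝ g z w := by
    filter_upwards [hf.eventually (by simp), hg.eventually (by simp)] with z h h'
    exact congrArg (fun L => L w)
      (fderiv_fun_add (h.differentiableAt one_ne_zero) (h'.differentiableAt one_ne_zero))
  have h2 (v w : E2) : (fun z => fderiv ℝ (fun z => fderiv ℝ (fun z => f z + g z) z w) z v) =ᶠ[𝓝 y]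
      fun z => fderiv ℝ (fun z => fderiv ℝ f z w) z v + fderiv ℝ (fun z => fderiv ℝ g z w) z v := by
    have a : (fun z => fderiv ℝ (fun z => fderiv ℝ (fun z => f z + g z) z w) z v) =ᶠ[𝓝 y]
        fun z => fderiv ℝ (fun z => fderiv ℝ f z w + fderiv ℝ g z w) z v :=
      ((h1 w (hf.of_le (by norm_num)) (hg.of_le (by norm_num))).fderiv).mono
        fun z hz => congrArg (fun L : E2 →L[ℝ] E3 => L v) hz
    refine a.trans (h1 v ?_ ?_)
    · exact (hf.fderiv_right (m := 1) (by norm_num)).clm_apply contDiffAt_const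
    · exact (hg.fderiv_right (m := 1) (by norm_num)).clm_apply contDiffAt_const
  have h3 (w : E2) := h1 w (hf.of_le (by norm_num)) (hg.of_le (by norm_num))
  filter_upwards [h3 e₁, h3 e₂, h2 e₁ e₁, h2 e₂ e₁, h2 e₂ e₂] with z a b c d e
  exact Prod.ext a (Prod.ext b (Prod.ext c (Prod.ext d e)))

lemma fderiv_theta_add (hf : ContDiffAt ℝ 3 f y) (hg : ContDiffAt ℝ 3 g y)
    (h0 : rawNormal f y ≠ 0) (hj : jetTwo g y = 0) {v : E2} {a b d : E3}
    (hv : fderiv ℝ (jetTwo g) y v = (0, 0, a, b, d)) :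
    fderiv ℝ (theta (fun z => f z + g z) 1) y v =
      fderiv ℝ (theta f 1) y v + thetaOf 1 (du f y, dv f y, a, b, d) := by
  have hJ := jetTwo_add (hf.of_le (by norm_num)) (hg.of_le (by norm_num))
  have dJ {f : E2 → E3} (hf : ContDiffAt ℝ 3 f y) : DifferentiableAt ℝ (jetTwo f) y :=
    (contDiffAt_jetTwo (n := 1) (by convert! hf using 1)).differentiableAt one_ne_zero
  have df := dJ hf; have dg := dJ hg
  have hθ : DifferentiableAt ℝ (thetaOf 1) (jetTwo f y) :=
    (contDiffAt_thetaOf (n := 1) (J := jetTwo f y) h0).differentiableAt one_ne_zero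
  have hJy : jetTwo (fun z => f z + g z) y = jetTwo f y := by
    rw [hJ.self_of_nhds]; change jetTwo f y + jetTwo g y = _; rw [hj, add_zero]
  have hJ' := (df.hasFDerivAt.add dg.hasFDerivAt).congr_of_eventuallyEq hJ
  have h1 := (HasFDerivAt.comp y (by rw [hJy]; exact hθ.hasFDerivAt) hJ').fderiv
  have h2 := (HasFDerivAt.comp y hθ.hasFDerivAt df.hasFDerivAt).fderiv
  have e1 := congrArg (fun L => L v) h1; have e2 := congrArg (fun L => L v) h2
  simp only [theta_eq_thetaOf]; refine e1.trans (Eq.trans ?_ (congrArg (· + _) e2.symm))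
  change fderiv ℝ (thetaOf 1) (jetTwo f y) (fderiv ℝ (jetTwo f) y v + fderiv ℝ (jetTwo g) y v) =
    fderiv ℝ (thetaOf 1) (jetTwo f y) (fderiv ℝ (jetTwo f) y v) + _
  rw [map_add, hv]; congr 1
  have l1 : HasDerivAt (fun s : ℝ => thetaOf 1 (jetTwo f y + s • (0, 0, a, b, d)))
      (fderiv ℝ (thetaOf 1) (jetTwo f y) (0, 0, a, b, d)) 0 := by
    have hl : HasDerivAt (fun s : ℝ => jetTwo f y + s • ((0, 0, a, b, d) : E3 × E3 × E3 × E3 × E3))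
        (0, 0, a, b, d) 0 := by
      simpa using ((hasDerivAt_id (0 : ℝ)).smul_const (0, 0, a, b, d)).const_add (jetTwo f y)
    exact HasFDerivAt.comp_hasDerivAt (0 : ℝ) (by simpa using hθ.hasFDerivAt) hl
  have l2 : HasDerivAt (fun s : ℝ => thetaOf 1 (jetTwo f y + s • (0, 0, a, b, d)))
      (thetaOf 1 (du f y, dv f y, a, b, d)) 0 := by
    have hl : HasDerivAt (fun s : ℝ => thetaOf 1 (jetTwo f y) + s • thetaOf 1 (du f y, dv f y, a, b, d))
        (thetaOf 1 (du f y, dv f y, a, b, d)) 0 := by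
      simpa using ((hasDerivAt_id (0 : ℝ)).smul_const
        (thetaOf 1 (du f y, dv f y, a, b, d))).const_add (thetaOf 1 (jetTwo f y))
    refine hl.congr_of_eventuallyEq (Eventually.of_forall fun s => ?_)
    simp only [thetaOf, jetTwo, Prod.mk_add_mk, Prod.smul_mk, smul_zero, add_zero, inner_add_right,
      inner_smul_right]
    apply Complex.ext <;> simp <;> ring
  exact l1.unique l2

lemma thetaOf_cubic (h0 : rawNormal f y ≠ 0) {Z : E2 →L[ℝ] ℂ} (hZ : ∀ z, Z (frame f 1 y z) = z)
    (k : ℂ) : thetaOf 1 (du f y, dv f y, (k * (Z e₁ * Z e₁)).re • rawNormal f y,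
      (k * (Z e₁ * Z e₂)).re • rawNormal f y, (k * (Z e₂ * Z e₂)).re • rawNormal f y) =
      (2 * ‖rawNormal f y‖ ^ 2 : ℝ) * conj k := by
  have hE := (coeffE_pos h0).ne'; have hD0 : ‖rawNormal f y‖ ≠ 0 := norm_ne_zero_iff.mpr h0
  have hD := norm_rawNormal_sq f y
  have h1 : ‖rawNormal f y‖ • Z e₁ = 1 := by rw [← map_smul, ← hZ 1]; simp [frame]
  have h2 : coeffE f y • Z e₂ - coeffF f y • Z e₁ = Complex.I := by
    rw [← map_smul, ← map_smul, ← map_sub, ← hZ Complex.I]; simp [frame]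
  have e1 : Z e₁ = ((‖rawNormal f y‖⁻¹ : ℝ) : ℂ) := by
    rw [Complex.real_smul] at h1; push_cast; exact eq_inv_of_mul_eq_one_right h1
  have e2 : Z e₂ = ⟨(coeffE f y)⁻¹ * coeffF f y * ‖rawNormal f y‖⁻¹, (coeffE f y)⁻¹⟩ := by
    rw [e1] at h2; have r := congrArg Complex.re h2; have i := congrArg Complex.im h2; simp at r i
    apply Complex.ext
    · field_simp; field_simp at r
      linear_combination r
    · field_simp
      linear_combination i
  have hi : inner ℝ (rawNormal f y) (rawNormal f y) = ‖rawNormal f y‖ ^ 2 :=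
    real_inner_self_eq_norm_sq _
  rw [e1, e2]; simp only [thetaOf, inner_smul_right]
  change Complex.ofRealCLM (2 * coeffF f y * (coeffE f y * (_ * inner ℝ (rawNormal f y) (rawNormal f
    y)) - coeffF f y * (_ * inner ℝ (rawNormal f y) (rawNormal f y))) - coeffE f y * (coeffE f y *
    (_ * inner ℝ (rawNormal f y) (rawNormal f y)) - coeffG f y * (_ * inner ℝ (rawNormal f y)
    (rawNormal f y)))) + Complex.ofRealCLM (2 * 1 * ‖rawNormal f y‖ * (coeffE f y * (_ * inner ℝ
    (rawNormal f y) (rawNormal f y)) - coeffF f y * (_ * inner ℝ (rawNormal f y) (rawNormal f y))))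
    * Complex.I = _
  rw [hi]; apply Complex.ext
  · rw [Complex.re_ofReal_mul]; simp [-Complex.ofReal_pow]; field_simp
    linear_combination -k.re * hD
  · rw [Complex.im_ofReal_mul]; simp [-Complex.ofReal_pow]; field_simp; ring

end Perturbation

/-- A cubic polynomial map with values in a line. -/
def cubicMap (c : ℂ) (Z : E2 →L[ℝ] ℂ) (N : E3) (y0 y : E2) : E3 :=
  (c * Z (y - y0) ^ 3).re • N

section Cubic

variable {c : ℂ} {Z : E2 →L[ℝ] ℂ} {N : E3} {y0 : E2}

lemma contDiff_cubicMap {n : WithTop ℕ∞} : ContDiff ℝ n (cubicMap c Z N y0) := by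
  have h : ContDiff ℝ n fun y => c * Z (y - y0) ^ 3 := by fun_prop
  exact (reCLM.contDiff.comp h).smul contDiff_const

lemma hasFDerivAt_pow_smul (a : ℂ) (k : ℕ) (y w : E2) :
    fderiv ℝ (fun y => (a * Z (y - y0) ^ (k + 1)).re • N) y w =
      (((k + 1 : ℕ) * a * Z w) * Z (y - y0) ^ k).re • N := by
  have h1 : HasFDerivAt (fun y => Z (y - y0)) Z y :=
    Z.hasFDerivAt.comp y ((hasFDerivAt_id y).sub_const y0)
  have h2 := (reCLM.hasFDerivAt.comp y ((h1.pow (k + 1)).const_mul a)).smul_const N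
  refine (congrArg (fun L : E2 →L[ℝ] E3 => L w) h2.fderiv).trans ?_
  simp only [ContinuousLinearMap.smulRight_apply, ContinuousLinearMap.comp_apply,
    reCLM_apply, smul_apply, smul_eq_mul, Nat.add_sub_cancel]
  congr 2; simp [nsmul_eq_mul]; ring

lemma jetTwo_cubicMap (c : ℂ) (Z : E2 →L[ℝ] ℂ) (N : E3) (y0 : E2) :
    jetTwo (cubicMap c Z N y0) = fun y => ((3 * c * Z e₁ * Z (y - y0) ^ 2).re • N, (3 * c * Z e₂ * Z
      (y - y0) ^ 2).re • N, (2 * (3 * c * Z e₁) * Z e₁ * Z (y - y0) ^ 1).re • N, (2 * (3 * c * Z e₁)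
      * Z e₂ * Z (y - y0) ^ 1).re • N, (2 * (3 * c * Z e₂) * Z e₂ * Z (y - y0) ^ 1).re • N) := by
  have h1 (w : E2) : (fun y => fderiv ℝ (cubicMap c Z N y0) y w) =
      fun y => (3 * c * Z w * Z (y - y0) ^ (1 + 1)).re • N :=
    funext fun y => hasFDerivAt_pow_smul c 2 y w
  have h2 (v w : E2) : (fun y => fderiv ℝ (fun y => fderiv ℝ (cubicMap c Z N y0) y w) y v) =
      fun y => (2 * (3 * c * Z w) * Z v * Z (y - y0) ^ 1).re • N := by
    rw [h1]; exact funext fun y => hasFDerivAt_pow_smul (3 * c * Z w) 1 y v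
  ext1 y
  exact Prod.ext (congrFun (h1 e₁) y) (Prod.ext (congrFun (h1 e₂) y) (Prod.ext
    (congrFun (h2 e₁ e₁) y) (Prod.ext (congrFun (h2 e₂ e₁) y) (congrFun (h2 e₂ e₂) y))))

lemma jetTwo_cubicMap_self : jetTwo (cubicMap c Z N y0) y0 = 0 := by simp [jetTwo_cubicMap]

lemma fderiv_jetTwo_cubicMap (v : E2) : fderiv ℝ (jetTwo (cubicMap c Z N y0)) y0 v =
    (0, 0, (6 * c * Z v * (Z e₁ * Z e₁)).re • N, (6 * c * Z v * (Z e₁ * Z e₂)).re • N,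
      (6 * c * Z v * (Z e₂ * Z e₂)).re • N) := by
  have h (a : ℂ) (k : ℕ) : HasFDerivAt (fun y => (a * Z (y - y0) ^ (k + 1)).re • N)
      (fderiv ℝ (fun y => (a * Z (y - y0) ^ (k + 1)).re • N) y0) y0 := by
    refine DifferentiableAt.hasFDerivAt ?_
    have h : Differentiable ℝ fun y => a * Z (y - y0) ^ (k + 1) := by fun_prop
    exact ((reCLM.differentiable.comp h) y0).smul_const N
  rw [jetTwo_cubicMap]
  refine (congrArg (fun L => L v) ((h (3 * c * Z e₁) 1).prodMk ((h (3 * c * Z e₂) 1).prodMk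
    ((h (2 * (3 * c * Z e₁) * Z e₁) 0).prodMk ((h (2 * (3 * c * Z e₁) * Z e₂) 0).prodMk
      (h (2 * (3 * c * Z e₂) * Z e₂) 0))))).fderiv).trans ?_
  simp only [ContinuousLinearMap.prod_apply, hasFDerivAt_pow_smul, sub_self, map_zero]
  refine Prod.ext (by simp) (Prod.ext (by simp) (Prod.ext ?_ (Prod.ext ?_ ?_))) <;>
  · simp only [pow_zero, mul_one]; congr 2; push_cast; ring

variable {f : E2 → E3}

lemma jetTwo_add_cubicMap (hf : ContDiffAt ℝ 2 f y0) :
    jetTwo (fun y => f y + cubicMap c Z N y0 y) y0 = jetTwo f y0 :=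
  (jetTwo_add hf contDiff_cubicMap.contDiffAt).self_of_nhds.trans
    ((congrArg (jetTwo f y0 + ·) jetTwo_cubicMap_self).trans (add_zero _))

lemma theta_add_cubicMap (hf : ContDiffAt ℝ 2 f y0) :
    theta (fun y => f y + cubicMap c Z N y0 y) 1 y0 = theta f 1 y0 := by
  rw [theta_eq_thetaOf, theta_eq_thetaOf]; exact congrArg (thetaOf 1) (jetTwo_add_cubicMap hf)

lemma modulus_add_cubicMap (hf : ContDiffAt ℝ 3 f y0) (h0 : rawNormal f y0 ≠ 0)
    (hZ : ∀ z, Z (frame f 1 y0 z) = z) :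
    modulus (fun y => f y + cubicMap c Z (rawNormal f y0) y0 y) y0 = (coeffB f y0 + (12 * ‖rawNormal
      f y0‖ ^ 2 : ℝ) * conj c) * conj (coeffA f y0) / coeffA f y0 ^ 2 := by
  have hj := jetTwo_add_cubicMap (c := c) (Z := Z) (N := rawNormal f y0)
    (hf.of_le (by norm_num) : ContDiffAt ℝ 2 f y0)
  have hu : du (fun y => f y + cubicMap c Z (rawNormal f y0) y0 y) y0 = du f y0 :=
    congrArg Prod.fst hj
  have hv : dv (fun y => f y + cubicMap c Z (rawNormal f y0) y0 y) y0 = dv f y0 :=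
    congrArg (fun J => J.2.1) hj
  have hfr : ∀ z, frame (fun y => f y + cubicMap c Z (rawNormal f y0) y0 y) 1 y0 z =
      frame f 1 y0 z := fun z => by
    change (z.re * ‖cross (du _ y0) (dv _ y0)‖) • e₁ + (1 * z.im) •
      ((inner ℝ (du _ y0) (du _ y0) : ℝ) • e₂ - (inner ℝ (du _ y0) (dv _ y0) : ℝ) • e₁) = _
    rw [hu, hv]; rfl
  have hd : ∀ z, thetaDeriv (fun y => f y + cubicMap c Z (rawNormal f y0) y0 y) y0 z =
      thetaDeriv f y0 z + (12 * ‖rawNormal f y0‖ ^ 2 : ℝ) * conj (c * z) := fun z => by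
    change fderiv ℝ (theta _ 1) y0 (frame _ 1 y0 z) = _
    rw [hfr, fderiv_theta_add hf contDiff_cubicMap.contDiffAt h0 jetTwo_cubicMap_self
      (fderiv_jetTwo_cubicMap _), hZ, thetaOf_cubic h0 hZ]
    congr 1; simp only [map_mul, conj_ofNat]; push_cast; ring
  have hA : coeffA (fun y => f y + cubicMap c Z (rawNormal f y0) y0 y) y0 = coeffA f y0 := by
    rw [coeffA, hd, hd, coeffA, map_mul, map_mul, conj_I, map_one (starRingEnd ℂ)]
    linear_combination (12 * ‖rawNormal f y0‖ ^ 2 : ℝ) * conj c / 2 * I_mul_I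
  have hB : coeffB (fun y => f y + cubicMap c Z (rawNormal f y0) y0 y) y0 =
      coeffB f y0 + (12 * ‖rawNormal f y0‖ ^ 2 : ℝ) * conj c := by
    rw [coeffB, hd, hd, coeffB, map_mul, map_mul, conj_I, map_one (starRingEnd ℂ)]
    linear_combination -(12 * ‖rawNormal f y0‖ ^ 2 : ℝ) * conj c / 2 * I_mul_I
  rw [modulus, hA, hB]

lemma theta_congr {f g : E2 → E3} {y : E2} (h : f =ᶠ[𝓝 y] g) :
    theta f 1 =ᶠ[𝓝 y] theta g 1 := by
  rw [theta_eq_thetaOf, theta_eq_thetaOf]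
  exact (jetTwo_congr h).mono fun z hz => congrArg (thetaOf 1) hz

lemma modulus_congr {f g : E2 → E3} {y : E2} (h : f =ᶠ[𝓝 y] g) : modulus f y = modulus g y := by
  have hj := (jetTwo_congr h).self_of_nhds; have hu : du f y = du g y := congrArg Prod.fst hj
  have hv : dv f y = dv g y := congrArg (fun J => J.2.1) hj
  have hfr : frame f 1 y = frame g 1 y := by
    ext1 z
    change (z.re * ‖cross (du f y) (dv f y)‖) • e₁ + (1 * z.im) •
      ((inner ℝ (du f y) (du f y) : ℝ) • e₂ - (inner ℝ (du f y) (dv f y) : ℝ) • e₁) = _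
    rw [hu, hv]; rfl
  have hd : thetaDeriv f y = thetaDeriv g y := by
    rw [thetaDeriv, thetaDeriv, hfr, (theta_congr h).fderiv_eq]
  rw [modulus, modulus, coeffA, coeffA, coeffB, coeffB, hd]

end Cubic

/-- The derivative of `typeFun` does not vanish at its zeros, but for the triple root. -/
lemma exists_typeFun_deriv_ne {b : ℂ} (hb : typeFun b = 0) (h3 : b ≠ -1 / 3) :
    ∃ (δ : ℂ) (d : ℝ), d ≠ 0 ∧ HasDerivAt (fun t : ℝ => typeFun (b + t * δ)) d 0 := by
  set w : ℂ := 8 + ((36 - 108 * Complex.normSq b : ℝ) : ℂ) * b with hw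
  have hw0 : w ≠ 0 := by
    intro h0; have hr := congrArg Complex.re h0; have hi := congrArg Complex.im h0
    rw [hw, Complex.add_re, Complex.re_ofReal_mul] at hr
    rw [hw, Complex.add_im, Complex.im_ofReal_mul] at hi
    simp only [Complex.re_ofNat, Complex.im_ofNat, Complex.zero_re, Complex.zero_im, zero_add]
      at hr hi
    rcases mul_eq_zero.mp hi with h | h
    · rw [h] at hr; norm_num at hr
    · rw [Complex.normSq_apply, h] at hr; rw [typeFun, Complex.normSq_apply, h] at hb
      have hne : 3 * b.re + 1 ≠ 0 := fun h' => h3 (by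
        apply Complex.ext
        · simp; linarith
        · simp [h])
      have e : (3 * b.re + 1) ^ 2 * (2 - 3 * b.re) = 0 := by linear_combination hr / 4
      have e2 : 2 - 3 * b.re = 0 := by simpa [hne] using e
      have : b.re = 2 / 3 := by linarith
      rw [this] at hb; norm_num at hb
  refine ⟨w, Complex.normSq w, by simpa using hw0, ?_⟩
  have hre : HasDerivAt (fun t : ℝ => (b + t * w).re) w.re 0 := by
    have := ((hasDerivAt_id (0 : ℝ)).mul_const w.re).const_add b.re; simpa using this
  have him : HasDerivAt (fun t : ℝ => (b + t * w).im) w.im 0 := by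
    have := ((hasDerivAt_id (0 : ℝ)).mul_const w.im).const_add b.im; simpa using this
  have hn : HasDerivAt (fun t : ℝ => Complex.normSq (b + t * w))
      (w.re * b.re + b.re * w.re + (w.im * b.im + b.im * w.im)) 0 := by
    have := (hre.mul hre).add (him.mul him)
    simp only [Complex.ofReal_zero, zero_mul, add_zero] at this
    exact this.congr_of_eventuallyEq (Eventually.of_forall fun t => Complex.normSq_apply _)
  have := (((hre.const_mul 8).const_add 1).add (hn.const_mul 18)).sub ((hn.pow 2).const_mul 27)
  refine (this.congr_deriv ?_).congr_of_eventuallyEq (Eventually.of_forall fun t => rfl)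
  rw [Complex.normSq_apply w]
  have wr : w.re = 8 + (36 - 108 * Complex.normSq b) * b.re := by
    rw [hw, Complex.add_re, Complex.re_ofReal_mul]; simp
  have wi : w.im = (36 - 108 * Complex.normSq b) * b.im := by
    rw [hw, Complex.add_im, Complex.im_ofReal_mul]; simp
  simp only [Complex.ofReal_zero, zero_mul, add_zero]
  linear_combination -w.re * wr - w.im * wi

section Manifold

/-- Every smooth germ at a point is the germ of an element of the space of maps. -/
lemma exists_crMap_germ [T2Space M] (D : ChartCover M) (r : ℕ) (p : M) {G : E2 → E3}
    (hG : ContDiff ℝ ∞ G) :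
    ∃ h : CrMap D r, inChart h p =ᶠ[𝓝 (ch p p)] G := by
  obtain ⟨ψ⟩ : Nonempty (SmoothBumpFunction (𝓡 2) p) := inferInstance
  have hs : CM ∞ fun x => ψ x • G (ch p x) :=
    ψ.contMDiff_smul (hG.contMDiff.comp_contMDiffOn (contMDiffOn_chart (x := p)))
  refine ⟨⟨_, hs.of_le (by exact_mod_cast le_top)⟩, ?_⟩
  have hsymm : Tendsto (ch p).symm (𝓝 (ch p p)) (𝓝 p) := by
    have := (ch p).continuousAt_symm (mem_chart_target E2 p)
    rwa [ContinuousAt, (ch p).left_inv (mem_chart_source E2 p)] at this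
  filter_upwards [hsymm.eventually ψ.eventuallyEq_one,
    (ch p).open_target.mem_nhds (mem_chart_target E2 p)] with y h1 h2
  change ψ ((ch p).symm y) • G (ch p ((ch p).symm y)) = G y; rw [h1, (ch p).right_inv h2]; simp

/-- Immersions form a neighbourhood of each of them. -/
lemma eventually_isImmersion [T2Space M] [CompactSpace M] (ho : OrientedAtlas M)
    {D : ChartCover M} {r : ℕ} (hr : 1 ≤ r) {α : CrMap D r} (hα : IsImmersion α) :
    ∀ᶠ β : CrMap D r in 𝓝 α, IsImmersion β := by
  have h1 (β : CrMap D r) : CM 1 β :=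
    β.contMDiff.of_le (by exact_mod_cast hr)
  have key : ∀ᶠ β : CrMap D r in 𝓝 α, ∀ x ∈ (univ : Set M),
      Function.Injective (differential β x) := by
    refine isCompact_univ.eventually_forall_of_forall_eventually fun m _ => ?_
    have hF := contDiffAt_fderiv_param (F := fun (β : CrMap D r) => inChart β m) (n := 0)
      ((contDiffAt_eval α m).of_le (by simpa using (by exact_mod_cast hr : (1 : WithTop ℕ∞) ≤ r)))
    have hN : ContinuousAt (fun q : CrMap D r × E2 => rawNormal (inChart q.1 m) q.2)
        (α, ch m m) :=
      (contDiffAt_cross (n := 0) (hF.clm_apply contDiffAt_const)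
        (hF.clm_apply contDiffAt_const)).continuousAt
    have hne := hN.eventually_ne (rawNormal_ne_zero (h1 α) hα ho (mem_chart_source E2 m))
    have hc : Tendsto (fun q : CrMap D r × M => (q.1, ch m q.2)) (𝓝 (α, m))
        (𝓝 (α, ch m m)) :=
      (continuousAt_fst.prodMk (ContinuousAt.comp (f := Prod.snd)
        ((ch m).continuousAt (mem_chart_source E2 m)) continuousAt_snd))
    filter_upwards [hc.eventually hne, continuousAt_snd.eventually
      ((ch m).open_source.mem_nhds (mem_chart_source E2 m))] with q hq hs
    exact (rawNormal_inChart_ne_zero_iff (h1 q.1) ho hs).mp hq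
  exact key.mono fun β h x => h x (mem_univ x)

end Manifold

lemma contDiff_typeFun {n : WithTop ℕ∞} : ContDiff ℝ n typeFun := by
  have hr : ContDiff ℝ n re := reCLM.contDiff; have hi : ContDiff ℝ n im := imCLM.contDiff
  have hn : ContDiff ℝ n fun b : ℂ => normSq b := by
    simpa only [normSq_apply] using (hr.mul hr).add (hi.mul hi)
  exact ((contDiff_const.add (contDiff_const.mul hr)).add (contDiff_const.mul hn)).sub
    (contDiff_const.mul (hn.pow 2))

lemma exists_frame_inverse {f : E2 → E3} {y : E2} (h0 : rawNormal f y ≠ 0) :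
    ∃ Z : E2 →L[ℝ] ℂ, ∀ z, Z (frame f 1 y z) = z := by
  have hb : Function.Bijective (frame f 1 y) := by
    have hi := frame_injective (f := f) (x := y) h0 one_ne_zero
    exact ⟨hi, (LinearMap.injective_iff_surjective_of_finrank_eq_finrank (by simp)).mp hi⟩
  exact ⟨LinearMap.toContinuousLinearMap ((LinearEquiv.ofBijective (frame f 1 y) hb).symm :
    E2 →ₗ[ℝ] ℂ), fun z => (LinearEquiv.ofBijective (frame f 1 y) hb).symm_apply_apply z⟩

variable {M : Type*} [TopologicalSpace M] [T2Space M] [ChartedSpace E2 M]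
  [IsManifold (𝓡 2) ∞ M] {D : ChartCover M} {r : ℕ}

/-- The modulus of an umbilic point can be moved in all directions without moving the point. -/
lemma exists_modulus_add {α : CrMap D r} (hr : 3 ≤ r) {p : M}
    (h0 : rawNormal (inChart α p) (ch p p) ≠ 0)
    (hA : coeffA (inChart α p) (ch p p) ≠ 0) (δ : ℂ) :
    ∃ h : CrMap D r, ∀ t : ℝ, theta (inChart (α + t • h : CrMap D r) p) 1 (ch p p) = theta
      (inChart α p) 1 (ch p p) ∧ modulus (inChart (α + t • h : CrMap D r) p) (ch p
      p) = modulus (inChart α p) (ch p p) + t * δ := by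
  obtain ⟨Z, hZ⟩ := exists_frame_inverse h0
  have hf : ContDiffAt ℝ 3 (inChart α p) (ch p p) :=
    α.contDiffAt_inChart p (mem_chart_target E2 p) (j := 3) hr
  set k : ℝ := 12 * ‖rawNormal (inChart α p) (ch p p)‖ ^ 2 with hk
  have hk0 : (k : ℂ) ≠ 0 := by have := norm_pos_iff.mpr h0; exact_mod_cast (by positivity : k ≠ 0)
  set A := coeffA (inChart α p) (ch p p) with hAd
  have hA' : conj A ≠ 0 := (map_ne_zero _).mpr hA; set c : ℂ := conj (δ * A ^ 2 / (k * conj A))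
  obtain ⟨h, hh⟩ := exists_crMap_germ D r p (G := cubicMap c Z
    (rawNormal (inChart α p) (ch p p)) (ch p p)) contDiff_cubicMap
  refine ⟨h, fun t => ?_⟩
  have he : inChart (α + t • h : CrMap D r) p =ᶠ[𝓝 (ch p p)] fun y => inChart α p y +
      cubicMap (t * c) Z (rawNormal (inChart α p) (ch p p)) (ch p p) y := by
    filter_upwards [hh] with y hy; change inChart α p y + t • inChart h p y = _
    rw [hy, cubicMap, cubicMap, smul_smul, mul_assoc, re_ofReal_mul]
  refine ⟨(theta_congr he).self_of_nhds.trans (theta_add_cubicMap (hf.of_le (by norm_num))), ?_⟩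
  rw [modulus_congr he, modulus_add_cubicMap hf h0 hZ, modulus, ← hk, ← hAd, map_mul, conj_ofReal,
    conj_conj]
  field_simp

end Umbilic
end

theorem mainTheorem4 {M : Type*} [TopologicalSpace M] [T2Space M] [CompactSpace M]
    [ConnectedSpace M] [ChartedSpace Umbilic.E2 M] [IsManifold (𝓡 2) ∞ M]
    (horient : Umbilic.OrientedAtlas M) (D : Umbilic.ChartCover M) (r : ℕ) (hr : 5 ≤ r)
    (α : Umbilic.CrMap D r) (hα : Umbilic.IsImmersion (α : M → Umbilic.E3)) (p : M)
    (hp : Umbilic.IsD12 (α : M → Umbilic.E3) p) :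
    ∃ (𝒱 : Set (Umbilic.CrMap D r)) (V : Set M) (B : Umbilic.CrMap D r → ℝ), IsOpen 𝒱 ∧ α ∈ 𝒱 ∧ (∀ β
      ∈ 𝒱, Umbilic.IsImmersion (β : M → Umbilic.E3)) ∧ IsOpen V ∧ p ∈ V ∧ ContDiffOn ℝ ((r - 3 : ℕ)
      : WithTop ℕ∞) B 𝒱 ∧ fderiv ℝ B α ≠ 0 ∧ ∀ β ∈ 𝒱, ∃ q ∈ V, Umbilic.IsUmbilic (β : M →
      Umbilic.E3) q ∧ (∀ q' ∈ V, Umbilic.IsUmbilic (β : M → Umbilic.E3) q' → q' = q) ∧ (0 < B β ↔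
      Umbilic.IsD1 (β : M → Umbilic.E3) q) ∧ (B β < 0 ↔ Umbilic.IsD2 (β : M → Umbilic.E3) q) ∧ (B β
      = 0 ↔ Umbilic.IsD12 (β : M → Umbilic.E3) q) ∧ (0 < B β → Umbilic.HasConfigD1 (β : M →
      Umbilic.E3) q) ∧ (B β < 0 → Umbilic.HasConfigD2 (β : M → Umbilic.E3) q) ∧ (B β = 0 →
      Umbilic.HasConfigD12 (β : M → Umbilic.E3) q) := by
  open Umbilic in
  obtain ⟨n, rfl⟩ : ∃ n, r = n + 3 := ⟨r - 3, by lia⟩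
  have h4 (β : CrMap D (n + 3)) : ContMDiff (𝓡 2) 𝓘(ℝ, E3) 4 β :=
    β.contMDiff.of_le (by exact_mod_cast (by lia : 4 ≤ n + 3))
  have h2 (β : CrMap D (n + 3)) : ContMDiff (𝓡 2) 𝓘(ℝ, E3) 2 β := (h4 β).of_le (by norm_num)
  have hpp := mem_chart_source E2 p
  have h0 := rawNormal_ne_zero ((h4 α).of_le (by norm_num)) hα horient hpp
  obtain ⟨hlt, h3⟩ := modulus_of_isD12 horient (h4 α) hα hp
  have hA : coeffA (inChart α p) (chartAt E2 p p) ≠ 0 :=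
    norm_pos_iff.mp ((norm_nonneg _).trans_lt hlt)
  have hb0 := (types_of_modulus horient (h4 α) hα hpp hp.1 hlt rfl h3).2.2.1.mpr hp
  have hz := (isUmbilic_iff_theta horient (h2 α) hα (one_pow 2) hpp).mp hp.1
  have hF : ContDiffAt ℝ ((n : WithTop ℕ∞) + 1 + 1 + 1)
      (fun q : CrMap D (n + 3) × E2 => inChart q.1 p q.2) (α, chartAt E2 p p) :=
    (contDiffAt_eval α p).of_le (by exact_mod_cast le_rfl)
  have hθ : ContDiffAt ℝ ((n + 1 : ℕ) : WithTop ℕ∞)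
      (fun q : CrMap D (n + 3) × E2 => theta (inChart q.1 p) 1 q.2) (α, chartAt E2 p p) :=
    contDiffAt_theta_param (F := fun β : CrMap D (n + 3) => inChart β p) (by exact_mod_cast hF) h0
  obtain ⟨L, hL⟩ := exists_equiv_fderiv (g := theta (inChart α p) 1)
    (eq_mul_add_mul_conj (thetaDeriv (inChart α p) (chartAt E2 p p))) hlt
  obtain ⟨y, W, hy0, hy, hWo, hyW, hev⟩ := exists_implicit (by lia) hθ hz L fun v => by
    have h1 : HasFDerivAt (fun z : E2 => (α, z))
        (ContinuousLinearMap.inr ℝ (CrMap D (n + 3)) E2) (chartAt E2 p p) :=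
      hasFDerivAt_prodMk_right α _
    have h2 := (HasFDerivAt.comp (chartAt E2 p p)
      (hθ.differentiableAt (by simp)).hasFDerivAt h1).fderiv
    have h3 := congrArg (fun T : E2 →L[ℝ] ℂ => T v) (hL.trans h2); simpa using h3.symm
  have hyn : ContDiffAt ℝ n y α := hy.of_le (by exact_mod_cast n.le_succ)
  have hpair : ContDiffAt ℝ n (fun β => (β, y β)) α := contDiffAt_id.prodMk hyn
  have hmod : ContDiffAt ℝ n (fun β : CrMap D (n + 3) => modulus (inChart β p) (y β)) α := by
    have h := contDiffAt_modulus_param (F := fun β : CrMap D (n + 3) => inChart β p) hF h0 hA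
    rw [← hy0] at h; exact ContDiffAt.comp (f := fun β => (β, y β)) α h hpair
  have hB : ContDiffAt ℝ n (fun β : CrMap D (n + 3) => typeFun (modulus (inChart β p) (y β))) α :=
    contDiff_typeFun.contDiffAt.comp α hmod
  have hAB : ∀ᶠ β : CrMap D (n + 3) in 𝓝 α,
      ‖coeffB (inChart β p) (y β)‖ < ‖coeffA (inChart β p) (y β)‖ := by
    obtain ⟨c1, c2⟩ := contDiffAt_coeffAB_param (F := fun β : CrMap D (n + 3) => inChart β p) hF h0
    rw [← hy0] at c1 c2
    have k1 := (ContDiffAt.comp (f := fun β => (β, y β)) α c1 hpair).continuousAt.norm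
    have k2 := (ContDiffAt.comp (f := fun β => (β, y β)) α c2 hpair).continuousAt.norm
    refine k2.eventually_lt k1 ?_; simp only [Function.comp_apply, hy0]; exact hlt
  have hne := hmod.continuousAt.eventually_ne (by rw [hy0]; exact h3)
  have hyWt := hyn.continuousAt.eventually ((hWo.inter (chartAt E2 p).open_target).mem_nhds
    (by rw [hy0]; exact ⟨hyW, mem_chart_target E2 p⟩))
  obtain ⟨𝒱, hsub, h𝒱o, hα𝒱⟩ := mem_nhds_iff.mp ((eventually_isImmersion horient (by lia) hα).and
    (hev.and (hAB.and (hne.and (hyWt.and (hB.eventually (by simp)))))))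
  refine ⟨𝒱, _, fun β => typeFun (modulus (inChart β p) (y β)), h𝒱o, hα𝒱,
    fun β hβ => (hsub hβ).1, (chartAt E2 p).isOpen_inter_preimage hWo, ⟨hpp, hyW⟩,
    fun β hβ => (hsub hβ).2.2.2.2.2.contDiffWithinAt, ?_, fun β hβ => ?_⟩
  · obtain ⟨δ, d, hd, hder⟩ := exists_typeFun_deriv_ne hb0 h3
    obtain ⟨h, hh⟩ := exists_modulus_add (by lia) h0 hA δ
    have hline : HasDerivAt (fun t : ℝ => α + t • h) h 0 := by
      simpa using ((hasDerivAt_id (0 : ℝ)).smul_const h).const_add α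
    have h1 := HasFDerivAt.comp_hasDerivAt (0 : ℝ) (f := fun t : ℝ => α + t • h)
      (by simpa using (hB.differentiableAt (by exact_mod_cast (by lia : n ≠ 0))).hasFDerivAt) hline
    have hcl : Tendsto (fun t : ℝ => α + t • h) (𝓝 0) (𝓝 α) := by
      simpa using hline.continuousAt.tendsto
    have he : ((fun β : CrMap D (n + 3) => typeFun (modulus (inChart β p) (y β))) ∘
        fun t : ℝ => α + t • h) =ᶠ[𝓝 0]
        fun t : ℝ => typeFun (modulus (inChart α p) (chartAt E2 p p) + t * δ) := by
      filter_upwards [hcl.eventually hev] with t ht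
      rw [Function.comp_apply, ← ht.2 _ hyW ((hh t).1.trans hz), (hh t).2]
    intro hzero; have h5 := (hder.congr_of_eventuallyEq he).unique h1; rw [hzero] at h5; exact hd h5
  · obtain ⟨hi, ⟨hzβ, huniq⟩, hltβ, hneβ, hyβ, -⟩ := hsub hβ
    have hq := (chartAt E2 p).map_target hyβ.2; have hcq := (chartAt E2 p).right_inv hyβ.2
    have hU : IsUmbilic (β : M → E3) ((chartAt E2 p).symm (y β)) := by
      rw [isUmbilic_iff_theta horient (h2 β) hi (one_pow 2) hq, hcq]; exact hzβ
    refine ⟨_, ⟨hq, by rw [mem_preimage, hcq]; exact hyβ.1⟩, hU, fun q' hq' hU' => ?_,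
      types_of_modulus horient (h4 β) hi hq hU (by rw [hcq]; exact hltβ) (by rw [hcq]) hneβ⟩
    rw [← huniq _ hq'.2 ((isUmbilic_iff_theta horient (h2 β) hi (one_pow 2) hq'.1).mp hU'),
      (chartAt E2 p).left_inv hq'.1]
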